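/- Let $M$ be an oriented smooth manifold of even dimension $2m$ (without boundary, not necessarily compact) with a smooth action of the circle group $S^1$, and suppose that the universal covering of $M$ is spin, i.e. orientable with $w_2=0$, equivalently admits a spin structure (if $M$ is not connected, the universal covering is formed over each component). Let $H\subset S^1$ be a subgroup and let $F$ be a connected component of the fixed point set $M^H$ which contains an $S^1$-fixed point. Then: 1. $F$ is a smoothly embedded submanifold of $M$, and $F$ is orientable. 2. The orientation of $F$ can be chosen in the following way (as in Bott--Taubes, Lemma 9.3). Let first $H=\mathbb{Z}_n$ be finite. Then $TM|_F=\bigoplus_{0\le r\le n/2}V_r$, where $V_0=TF$, where for $0<r<n/2$ the bundle $V_r$ is complex and $z\in\mathbb{Z}_n\subset S^1\subset\mathbb{C}$ acts on it as multiplication by $z^r$, and where, for $n\geq 2$ even, $V_{n/2}$ is the real bundle on which a generator of $\mathbb{Z}_n$ acts as $-1$. There are an orientation of $F$ and, at every $x\in F^{S^1}$, an orientation of $V_{n/2}|_x$ (if $n$ is even) such that $T_xM=\bigoplus_r V_r|_x$ as oriented vector spaces for the complex orientations of the $V_r$, $0<r<n/2$, and such that the following holds. For $x\in F^{S^1}$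 write $T_xM$ as a direct sum of oriented $S^1$-invariant real planes $L_1,\dots,L_m$, each contained in some $V_{r_j}|_x$, inducing the given orientations of all the nonzero $V_r|_x$ and complex linearly embedded for $0<r_j<n/2$. Such decompositions exist. If $S^1$ rotates $L_j$ with weight $a_j$ (so that $a_j\equiv r_j \bmod n$) and $a_j=n\,l_j+r_j$, then the class of $\sum_{j=1}^m l_j$ in $\mathbb{Z}/2$ depends neither on the decomposition nor on the point $x\in F^{S^1}$. (An orientation of a zero-dimensional vector space is a sign; if $V_{n/2}|_x=0$, its sign is taken to be $+$.) If $H$ is infinite, then $S^1$ acts trivially on $F$, and the orientation of $F$ can be chosen so that, at every point $x\in F=F^{S^1}$, $T_xM$ is the oriented direct sum of $T_xF$ and the normal space of $F$, the latter oriented as the complex $S^1$-representation with only positive weights. -/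

import Mathlib

open scoped Manifold ContDiff Topology

universe u

/-- The frame bundle of a smooth `d`-manifold `N`: pairs of a point `x` and a basis of `T_x N`. -/
def FrameBundle (d : ℕ) (N : Type*) [TopologicalSpace N]
    [ChartedSpace (EuclideanSpace ℝ (Fin d)) N] : Type _ :=
  Σ x : N, Module.Basis (Fin d) ℝ (TangentSpace (𝓡 d) x)

/-- A frame is recorded by its base point and the tuple of its vectors in the tangent bundle;
the frame bundle carries the topology induced from `N × (TN)^d`. -/
noncomputable def FrameBundle.toTangent (d : ℕ) (N : Type*) [TopologicalSpace N]
    [ChartedSpace (EuclideanSpace ℝ (Fin d)) N]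
    (f : FrameBundle d N) : N × (Fin d → TangentBundle (𝓡 d) N) :=
  (f.1, fun i => ⟨f.1, f.2 i⟩)

noncomputable instance FrameBundle.instTopologicalSpace (d : ℕ) (N : Type*) [TopologicalSpace N]
    [ChartedSpace (EuclideanSpace ℝ (Fin d)) N] [IsManifold (𝓡 d) ∞ N] :
    TopologicalSpace (FrameBundle d N) :=
  TopologicalSpace.induced (FrameBundle.toTangent d N) inferInstance

/-- An orientation of a smooth `d`-manifold `N`: an orientation of every tangent space, depending
continuously on the point, i.e. being positively oriented is a locally constant property
of frames. (In dimension `0` this is an arbitrary sign at every point.) -/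
structure ManifoldOrientation (d : ℕ) (N : Type*) [TopologicalSpace N]
    [ChartedSpace (EuclideanSpace ℝ (Fin d)) N] [IsManifold (𝓡 d) ∞ N] where
  /-- the orientation of `T_x N` -/
  at' : ∀ x : N, Orientation ℝ (TangentSpace (𝓡 d) x) (Fin d)
  continuous' : IsClopen {f : FrameBundle d N | f.2.orientation = at' f.1}

/-- The bundle of positively oriented frames, with the subspace topology. -/
abbrev OrientedFrameBundle {d : ℕ} {N : Type*} [TopologicalSpace N]
    [ChartedSpace (EuclideanSpace ℝ (Fin d)) N] [IsManifold (𝓡 d) ∞ N]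
    (o : ManifoldOrientation d N) : Type _ :=
  {f : FrameBundle d N // f.2.orientation = o.at' f.1}

/-- `N` is spin: it is orientable and admits a spin structure, i.e. a two-sheeted covering of its
oriented frame bundle that is nontrivial (connected) over the frames at each point of `N`. In
dimensions `0` and `1` there is no condition on the fibres, since there the identity component of
the general linear group is contractible. -/
def IsSpinManifold (d : ℕ) (N : Type u) [TopologicalSpace N]
    [ChartedSpace (EuclideanSpace ℝ (Fin d)) N] [IsManifold (𝓡 d) ∞ N] : Prop :=
  ∃ (o : ManifoldOrientation d N) (P : Type u) (_ : TopologicalSpace P)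
    (π : P → OrientedFrameBundle o),
    IsCoveringMap π ∧
    (∀ f, Nat.card (π ⁻¹' {f}) = 2) ∧
    (2 ≤ d → ∀ x : N, IsConnected {q : P | (π q).1.1 = x})

/-- `p : N → M` is the universal covering of the smooth manifold `M`: a smooth covering whose
restriction to each connected component of `M` has simply connected total space. -/
structure IsUniversalCovering (d : ℕ) {N M : Type*}
    [TopologicalSpace N] [ChartedSpace (EuclideanSpace ℝ (Fin d)) N]
    [TopologicalSpace M] [ChartedSpace (EuclideanSpace ℝ (Fin d)) M]
    (p : N → M) : Prop where
  covering : IsCoveringMap p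
  localDiffeo : IsLocalDiffeomorph (𝓡 d) (𝓡 d) ∞ p
  simplyConnected : ∀ x : M, SimplyConnectedSpace (p ⁻¹' connectedComponent x)

/-- A weight frame at an `S¹`-fixed point `x` lying on a submanifold `F ⊆ M`, where `F` is a
component of the fixed set of a subgroup of order `n` of the circle (`n = 0` if the subgroup is
infinite), and `F`, `M` are oriented.

The circle rotates the `j`-th plane, spanned by `b (2j), b (2j+1)`, of `T_x M` with weight `a j`,
and `a j = n * l j + r j` with `0 ≤ r j ≤ n / 2`. The planes with `2j < k` form `T_x F`.
For `0 < r < n / 2` the planes with `r j = r` carry the orientation of the complex vector space on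
which `z` in the subgroup of order `n` acts as multiplication by `z ^ r`.
The condition `orientation_iff` says that the planes with `r j = n / 2` are positively oriented for
the orientation on the `-1`-part of the normal space for which `T_x M` is the oriented direct sum
of `T_x F`, this part, and the complex parts.
If `n = 0`, then all `l j` are `0` and `a j = r j ≥ 0`: the normal space of `F` then has no `-1`-part
and carries the orientation of the complex vector space in which all weights are positive. -/
structure WeightFrame (n : ℕ) {m k : ℕ} {M : Type*} [TopologicalSpace M]
    [ChartedSpace (EuclideanSpace ℝ (Fin (2 * m))) M] [IsManifold (𝓡 (2 * m)) ∞ M]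
    [MulAction Circle M] (oM : ManifoldOrientation (2 * m) M)
    (F : Set M) [ChartedSpace (EuclideanSpace ℝ (Fin k)) F] [IsManifold (𝓡 k) ∞ F]
    (oF : ManifoldOrientation k F) (x : F) where
  b : Module.Basis (Fin (2 * m)) ℝ (TangentSpace (𝓡 (2 * m)) (x : M))
  f : Module.Basis (Fin k) ℝ (TangentSpace (𝓡 k) x)
  a : Fin m → ℤ
  l : Fin m → ℤ
  r : Fin m → ℤ
  rotate_fst : ∀ (z : Circle) (j : Fin m),
    tangentMap (𝓡 (2 * m)) (𝓡 (2 * m)) (fun y : M => z • y) ⟨x, b ⟨2 * j, by omega⟩⟩ =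
      ⟨x, ((z ^ a j : Circle) : ℂ).re • b ⟨2 * j, by omega⟩ +
        ((z ^ a j : Circle) : ℂ).im • b ⟨2 * j + 1, by omega⟩⟩
  rotate_snd : ∀ (z : Circle) (j : Fin m),
    tangentMap (𝓡 (2 * m)) (𝓡 (2 * m)) (fun y : M => z • y) ⟨x, b ⟨2 * j + 1, by omega⟩⟩ =
      ⟨x, -((z ^ a j : Circle) : ℂ).im • b ⟨2 * j, by omega⟩ +
        ((z ^ a j : Circle) : ℂ).re • b ⟨2 * j + 1, by omega⟩⟩
  weight_eq : ∀ j, a j = n * l j + r j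
  r_nonneg : ∀ j, 0 ≤ r j
  two_r_le : n ≠ 0 → ∀ j, 2 * r j ≤ n
  l_eq_zero : n = 0 → ∀ j, l j = 0
  dim_le : k ≤ 2 * m
  tangent : ∀ i : Fin k,
    mfderiv (𝓡 k) (𝓡 (2 * m)) (Subtype.val : F → M) x (f i) = b (Fin.castLE dim_le i)
  orientation_iff : b.orientation = oM.at' (x : M) ↔ f.orientation = oF.at' x

/-!
Why the theorem holds. Let `g = exp (2π i / n)` generate the group of order `n`.

The submanifold. Averaging a linear coordinate over the group linearises the action of `g` near a fixed
point (`exists_linearisation`, `exists_linearising_chart`), so that the fixed set is locally a linear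
slice, and the conjugacy class of the differential of `g` is constant along the component `F`. Fix a
normal form of it: the rotation by the angles `θ j = 2π r j / n` between `0` and `π` in the coordinate
planes. The frames of `M` over `F` on which `g` acts by this rotation are the *adapted frames*.

The invariant. An adapted frame `f` gives a loop of frames (`frameLoop`): move `f` by `exp (2π i t / n)`,
and rotate it back by the angles `t θ`, for `0 ≤ t ≤ 1`. This loop lifts to the frame bundle of the
universal covering. There the spin structure assigns a monodromy in `ZMod 2` to it, the invariant `e f`
(`HasMon`, `SpinCover.mon`). It has three properties, collected in `WeightInvariant`:

* `e` is constant along paths of adapted frames (`HasMon.of_path`);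
* at a point fixed by the circle, if the circle rotates the planes of `f` with weights
  `a j = n * l j + r j`, the loop is a loop of rotations with winding numbers `l j`, and
  `e f` is the parity of `∑ l j` (`hasMon_iff_of_fixed`);
* replacing `f` by `op h • f`, for a matrix `h` commuting with the rotation, multiplies the loop by the
  loop of commutators of `h` and the rotations by `t θ`. Its monodromy is nontrivial if and only if `h`
  reverses the orientation of the part rotated by `π` (`SpinCover.mon_twistLoop`). The part with angles
  strictly between `0` and `π` is complex linear and contributes no sign, so that this is also the
  product of the signs of `h` on `T M` and on `T F` (`sign_det_of_commute`).

The last two rest on the fact that a full turn of one plane has nontrivial monodromy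
(`SpinCover.mon_lastRotLoop`). Otherwise the orbit map of the group of matrices of positive determinant
would lift to the double covering (`hasLiftsOn_posDet`, an induction on the size which replaces the
computation of the fundamental group), and the covering would have a section over the frames at a point,
where it is connected.

The orientation. By these properties the orientation of `F` can be defined by comparing, for an adapted
frame, the orientations of `M` and `F` with the invariant (`FrameInvariant.exists_orientation`). In a
weight frame the two orientations are compatible, so that its invariant `∑ l j` is the same at all points
(`WeightInvariant.sum_eq`); the frame need not be ordered as the adapted frames are, but conjugate
rotations differ by a permutation of the planes (`exists_perm_of_mul_rotGL_of_fixed`). Weight frames exist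
by the splitting of representations of the circle into planes (`exists_rotated_frame`), after reflecting a
plane with `2 * r j = n` if the invariant is the wrong one (`WeightInvariant.nonempty_weightFrame`). If
there is no such plane, `e` is constant on the component (`WeightInvariant.eq_of_forall_ne`).

Infinite groups. These are dense, so that `F` is a component of the fixed set of the circle. It is also a
component of the fixed set of a finite group of odd order, large compared to the weights. For this group
all `l j` vanish and there is no part rotated by `π`, so that `e = 0` is a weight invariant and the above
applies (`exists_orientation_weightFrame_zero`).
-/

section

open scoped unitInterval
open Matrix MulOpposite

/-! ### Householder reflections -/

/-- The real square matrices of positive determinant. -/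
def posDet (d : ℕ) : Set (Matrix (Fin d) (Fin d) ℝ) := {A | 0 < A.det}

lemma isOpen_posDet (d : ℕ) : IsOpen (posDet d) :=
  isOpen_lt continuous_const (Continuous.matrix_det continuous_id)

lemma det_ne_zero_of_mem {d : ℕ} {A : Matrix (Fin d) (Fin d) ℝ} (hA : A ∈ posDet d) :
    A.det ≠ 0 :=
  ne_of_gt (show 0 < A.det from hA)

lemma one_mem_posDet (d : ℕ) : (1 : Matrix (Fin d) (Fin d) ℝ) ∈ posDet d := by
  simp [posDet]

lemma mul_mem_posDet {d : ℕ} {A B : Matrix (Fin d) (Fin d) ℝ} (hA : A ∈ posDet d)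
    (hB : B ∈ posDet d) : A * B ∈ posDet d := by
  simp only [posDet, Set.mem_ofPred, det_mul] at *
  positivity

section Householder

variable {n : ℕ}

/-- The Euclidean norm of a tuple of real numbers. -/
noncomputable def euclNorm (v : Fin (n + 1) → ℝ) : ℝ := ‖WithLp.toLp 2 v‖

lemma continuous_euclNorm : Continuous (euclNorm (n := n)) := by
  unfold euclNorm; fun_prop

lemma euclNorm_nonneg (v : Fin (n + 1) → ℝ) : 0 ≤ euclNorm v := norm_nonneg _

lemma euclNorm_mul_self (v : Fin (n + 1) → ℝ) : euclNorm v * euclNorm v = v ⬝ᵥ v := by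
  rw [euclNorm, ← sq, EuclideanSpace.norm_sq_eq]
  simp [dotProduct, sq]

/-- The vectors outside the closed ray spanned by minus the first unit vector. -/
def slitSet (n : ℕ) : Set (Fin (n + 1) → ℝ) := {v | 0 < euclNorm v + v 0}

lemma slitSet_euclNorm_pos {v : Fin (n + 1) → ℝ} (hv : v ∈ slitSet n) : 0 < euclNorm v := by
  rcases (euclNorm_nonneg v).lt_or_eq with h | h
  · exact h
  · exfalso
    have h0 : v = 0 := by
      have := norm_eq_zero.1 h.symm
      simpa using this
    subst h0
    simp [slitSet, euclNorm] at hv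

lemma isOpen_slitSet : IsOpen (slitSet n) :=
  isOpen_lt continuous_const (continuous_euclNorm.add (continuous_apply 0))

/-- The segment from a vector outside the ray to the first unit vector avoids the ray, by the
triangle inequality. -/
lemma starConvex_slitSet : StarConvex ℝ (Pi.single 0 1 : Fin (n + 1) → ℝ) (slitSet n) := by
  intro v hv a b ha hb hab
  simp only [slitSet, Set.mem_ofPred] at hv ⊢
  have h1 : b * euclNorm v - a ≤ euclNorm (a • (Pi.single 0 1 : Fin (n + 1) → ℝ) + b • v) := by
    have h := norm_sub_norm_le (WithLp.toLp 2 (b • v))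
      (WithLp.toLp 2 (-(a • (Pi.single 0 1 : Fin (n + 1) → ℝ))))
    have e1 : ‖(WithLp.toLp 2 (b • v) : EuclideanSpace ℝ (Fin (n + 1)))‖ = b * euclNorm v := by
      rw [WithLp.toLp_smul, norm_smul, Real.norm_of_nonneg hb, euclNorm]
    have e2 : ‖(WithLp.toLp 2 (-(a • (Pi.single 0 1 : Fin (n + 1) → ℝ))) :
        EuclideanSpace ℝ (Fin (n + 1)))‖ = a := by
      rw [WithLp.toLp_neg, norm_neg, WithLp.toLp_smul, norm_smul, Real.norm_of_nonneg ha]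
      have : (WithLp.toLp 2 (Pi.single 0 1 : Fin (n + 1) → ℝ) : EuclideanSpace ℝ (Fin (n + 1)))
        = EuclideanSpace.single 0 1 := rfl
      rw [this]; simp
    rw [e1, e2, ← WithLp.toLp_sub, sub_neg_eq_add, add_comm (b • v)] at h
    exact h
  simp only [Pi.add_apply, Pi.smul_apply, Pi.single_eq_same, smul_eq_mul, mul_one]
  rcases hb.lt_or_eq with hb' | hb'
  · nlinarith
  · have ha1 : a = 1 := by linarith
    subst hb'; subst ha1
    have : (0:ℝ) ≤ euclNorm ((1:ℝ) • (Pi.single 0 1 : Fin (n + 1) → ℝ) + (0:ℝ) • v) :=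
      euclNorm_nonneg _
    linarith

lemma isPreconnected_slitSet : IsPreconnected (slitSet n) := by
  have h : (Pi.single 0 1 : Fin (n + 1) → ℝ) ∈ slitSet n := by
    simp only [slitSet, Set.mem_ofPred, Pi.single_eq_same]
    linarith [euclNorm_nonneg (Pi.single 0 1 : Fin (n + 1) → ℝ)]
  exact (starConvex_slitSet.isPathConnected h).isConnected.isPreconnected

/-- The sum of a vector and its norm times the first unit vector. -/
noncomputable def bisector (v : Fin (n + 1) → ℝ) : Fin (n + 1) → ℝ :=
  v + euclNorm v • Pi.single 0 1

/-- The reflection exchanging `v` and minus its norm times the first unit vector. -/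
noncomputable def householder (v : Fin (n + 1) → ℝ) : Matrix (Fin (n + 1)) (Fin (n + 1)) ℝ :=
  1 - (euclNorm v * (euclNorm v + v 0))⁻¹ • vecMulVec (bisector v) (bisector v)

lemma bisector_dotProduct_self (v : Fin (n + 1) → ℝ) :
    bisector v ⬝ᵥ bisector v = 2 * (euclNorm v * (euclNorm v + v 0)) := by
  simp only [bisector, add_dotProduct, dotProduct_add, smul_dotProduct, dotProduct_smul,
    ← euclNorm_mul_self, dotProduct_single, single_dotProduct, smul_eq_mul]
  simp; ring

lemma bisector_dotProduct (v : Fin (n + 1) → ℝ) :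
    bisector v ⬝ᵥ v = euclNorm v * (euclNorm v + v 0) := by
  simp only [bisector, add_dotProduct, smul_dotProduct,
    ← euclNorm_mul_self, single_dotProduct, smul_eq_mul]
  ring

lemma householder_mul_self {v : Fin (n + 1) → ℝ} (hv : v ∈ slitSet n) :
    householder v * householder v = 1 := by
  have h1 := slitSet_euclNorm_pos hv
  have h2 : 0 < euclNorm v + v 0 := hv
  have h3 : euclNorm v * (euclNorm v + v 0) ≠ 0 := by positivity
  rw [householder, sub_mul, mul_sub, mul_sub, one_mul, mul_one, one_mul, smul_mul_smul_comm,
    vecMulVec_mul_vecMulVec, bisector_dotProduct_self]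
  ext i k
  simp [Matrix.sub_apply, Matrix.smul_apply, vecMulVec_apply]
  field_simp
  ring

lemma householder_mulVec {v : Fin (n + 1) → ℝ} (hv : v ∈ slitSet n) :
    householder v *ᵥ v = -(euclNorm v • Pi.single 0 1) := by
  have h1 := slitSet_euclNorm_pos hv
  have h2 : 0 < euclNorm v + v 0 := hv
  have h3 : euclNorm v * (euclNorm v + v 0) ≠ 0 := by positivity
  rw [householder, sub_mulVec, one_mulVec, smul_mulVec, vecMulVec_mulVec, bisector_dotProduct]
  ext i
  simp [bisector]
  field_simp
  ring

lemma det_householder {v : Fin (n + 1) → ℝ} (hv : v ∈ slitSet n) : (householder v).det = -1 := by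
  have h1 := slitSet_euclNorm_pos hv
  have h2 : 0 < euclNorm v + v 0 := hv
  have h3 : euclNorm v * (euclNorm v + v 0) ≠ 0 := by positivity
  have : householder v = 1 + replicateCol Unit (-((euclNorm v * (euclNorm v + v 0))⁻¹ • bisector v))
      * replicateRow Unit (bisector v) := by
    ext i k
    simp [householder, vecMulVec_apply, Matrix.mul_apply]
    ring
  rw [this, det_one_add_replicateCol_mul_replicateRow, dotProduct_neg, dotProduct_smul,
    bisector_dotProduct_self]
  simp only [smul_eq_mul]
  field_simp
  norm_num

lemma continuousOn_householder : ContinuousOn (householder (n := n)) (slitSet n) := by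
  have hc : Continuous (bisector (n := n)) := by
    unfold bisector
    exact continuous_id.add (continuous_euclNorm.smul continuous_const)
  refine ContinuousOn.sub continuousOn_const
    (ContinuousOn.smul (f := fun v => (euclNorm v * (euclNorm v + v 0))⁻¹)
      (ContinuousOn.inv₀ ?_ ?_) ?_)
  · exact (continuous_euclNorm.mul (continuous_euclNorm.add (continuous_apply 0))).continuousOn
  · intro v hv
    have h1 := slitSet_euclNorm_pos hv
    have h2 : 0 < euclNorm v + v 0 := hv
    positivity
  · exact (hc.matrix_vecMulVec hc).continuousOn

/-- The diagonal matrix reflecting the first coordinate. -/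
noncomputable def reflZero (n : ℕ) : Matrix (Fin (n + 1)) (Fin (n + 1)) ℝ :=
  diagonal (Function.update 1 0 (-1))

lemma reflZero_mul_self : reflZero n * reflZero n = 1 := by
  rw [reflZero, diagonal_mul_diagonal, ← diagonal_one]
  congr 1
  ext i
  by_cases h : i = 0
  · subst h; simp
  · simp [h]

lemma det_reflZero : (reflZero n).det = -1 := by
  simp [reflZero, det_diagonal, Finset.prod_update_of_mem]

/-- A positive multiple of a rotation, taking the first unit vector to a positive multiple of `v`.
-/
noncomputable def rotTo (v : Fin (n + 1) → ℝ) : Matrix (Fin (n + 1)) (Fin (n + 1)) ℝ :=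
  householder v * reflZero n

/-- The inverse of `rotTo`. -/
noncomputable def rotFrom (v : Fin (n + 1) → ℝ) : Matrix (Fin (n + 1)) (Fin (n + 1)) ℝ :=
  reflZero n * householder v

lemma rotTo_mul_rotFrom {v : Fin (n + 1) → ℝ} (hv : v ∈ slitSet n) : rotTo v * rotFrom v = 1 := by
  rw [rotTo, rotFrom, mul_assoc, ← mul_assoc (reflZero n), reflZero_mul_self, one_mul,
    householder_mul_self hv]

lemma det_rotTo {v : Fin (n + 1) → ℝ} (hv : v ∈ slitSet n) : (rotTo v).det = 1 := by
  rw [rotTo, det_mul, det_householder hv, det_reflZero]; norm_num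

lemma det_rotFrom {v : Fin (n + 1) → ℝ} (hv : v ∈ slitSet n) : (rotFrom v).det = 1 := by
  rw [rotFrom, det_mul, det_householder hv, det_reflZero]; norm_num

lemma rotFrom_mulVec {v : Fin (n + 1) → ℝ} (hv : v ∈ slitSet n) :
    rotFrom v *ᵥ v = euclNorm v • Pi.single 0 1 := by
  rw [rotFrom, ← mulVec_mulVec, householder_mulVec hv, reflZero]
  ext i
  rw [mulVec_diagonal]
  by_cases h : i = 0
  · subst h; simp
  · simp [h]

lemma rotTo_mulVec {v : Fin (n + 1) → ℝ} (hv : v ∈ slitSet n) :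
    rotTo v *ᵥ (euclNorm v • Pi.single 0 1) = v := by
  rw [← rotFrom_mulVec hv, mulVec_mulVec, rotTo_mul_rotFrom hv, one_mulVec]

lemma rotTo_single : rotTo (Pi.single 0 1 : Fin (n + 1) → ℝ) = 1 := by
  have hn : euclNorm (Pi.single 0 1 : Fin (n + 1) → ℝ) = 1 := by
    have : (WithLp.toLp 2 (Pi.single 0 1 : Fin (n + 1) → ℝ) : EuclideanSpace ℝ (Fin (n + 1)))
        = EuclideanSpace.single 0 1 := rfl
    rw [euclNorm, this]; simp
  have : householder (Pi.single 0 1 : Fin (n + 1) → ℝ) = reflZero n := by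
    ext i k
    by_cases hi : i = 0 <;> by_cases hk : k = 0 <;>
    simp [householder, reflZero, bisector, hn, vecMulVec_apply, hi, hk, one_apply, diagonal_apply]
    simp [Ne.symm hk]
  rw [rotTo, this, reflZero_mul_self]

lemma continuousOn_rotTo : ContinuousOn (rotTo (n := n)) (slitSet n) :=
  continuousOn_householder.mul continuousOn_const

lemma continuousOn_rotFrom : ContinuousOn (rotFrom (n := n)) (slitSet n) :=
  continuousOn_const.mul continuousOn_householder

end Householder

/-! ### Connectedness of the matrices of positive determinant -/

section Columns

variable {n : ℕ}

/-- The block diagonal matrix with blocks `1` and `B`. -/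
def oneBlock (B : Matrix (Fin n) (Fin n) ℝ) : Matrix (Fin (n + 1)) (Fin (n + 1)) ℝ :=
  of (Fin.cons (Fin.cons 1 0) fun i => Fin.cons 0 (B i))

@[simp] lemma oneBlock_zero_zero (B : Matrix (Fin n) (Fin n) ℝ) : oneBlock B 0 0 = 1 := rfl
@[simp] lemma oneBlock_zero_succ (B : Matrix (Fin n) (Fin n) ℝ) (k : Fin n) :
    oneBlock B 0 k.succ = 0 := rfl
@[simp] lemma oneBlock_succ_zero (B : Matrix (Fin n) (Fin n) ℝ) (i : Fin n) :
    oneBlock B i.succ 0 = 0 := rfl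
@[simp] lemma oneBlock_succ_succ (B : Matrix (Fin n) (Fin n) ℝ) (i k : Fin n) :
    oneBlock B i.succ k.succ = B i k := rfl

/-- The determinant of a matrix whose first column is a multiple of the first unit vector. -/
lemma det_of_col_zero (T : Matrix (Fin (n + 1)) (Fin (n + 1)) ℝ) (hT : ∀ i : Fin n, T i.succ 0 = 0) :
    T.det = T 0 0 * (T.submatrix Fin.succ Fin.succ).det := by
  rw [det_succ_column_zero, Fin.sum_univ_succ]
  simp [hT]

lemma det_oneBlock (B : Matrix (Fin n) (Fin n) ℝ) : (oneBlock B).det = B.det := by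
  rw [det_of_col_zero _ (by simp)]
  simp
  rfl

lemma oneBlock_mul (B C : Matrix (Fin n) (Fin n) ℝ) :
    oneBlock (B * C) = oneBlock B * oneBlock C := by
  ext i k
  refine Fin.cases ?_ (fun i => ?_) i <;> refine Fin.cases ?_ (fun k => ?_) k <;>
    simp [Matrix.mul_apply, Fin.sum_univ_succ]

lemma oneBlock_mem_posDet {B : Matrix (Fin n) (Fin n) ℝ} (hB : B ∈ posDet n) :
    oneBlock B ∈ posDet (n + 1) := by
  simpa [posDet, det_oneBlock] using hB

lemma continuous_oneBlock : Continuous (oneBlock (n := n)) := by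
  refine continuous_matrix fun i k => ?_
  refine Fin.cases ?_ (fun i => ?_) i <;> refine Fin.cases ?_ (fun k => ?_) k <;>
    simp <;> fun_prop

/-- The matrices of positive determinant whose first column lies in `V`. -/
def posDetCol (n : ℕ) (V : Set (Fin (n + 1) → ℝ)) : Set (Matrix (Fin (n + 1)) (Fin (n + 1)) ℝ) :=
  {A | A ∈ posDet (n + 1) ∧ A.col 0 ∈ V}

lemma isOpen_posDetCol {V : Set (Fin (n + 1) → ℝ)} (hV : IsOpen V) : IsOpen (posDetCol n V) :=
  (isOpen_posDet _).inter (hV.preimage (by unfold Matrix.col; fun_prop))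

/-- Rotate the first column into the direction of the first unit vector. -/
noncomputable def straighten (A : Matrix (Fin (n + 1)) (Fin (n + 1)) ℝ) :
    Matrix (Fin (n + 1)) (Fin (n + 1)) ℝ :=
  rotFrom (A.col 0) * A

variable {A : Matrix (Fin (n + 1)) (Fin (n + 1)) ℝ}

lemma straighten_col (hA : A.col 0 ∈ slitSet n) :
    (straighten A).col 0 = euclNorm (A.col 0) • Pi.single 0 1 := by
  rw [← rotFrom_mulVec hA]
  ext i
  simp [straighten, Matrix.col, Matrix.mul_apply, mulVec, dotProduct]

lemma straighten_zero_zero (hA : A.col 0 ∈ slitSet n) :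
    straighten A 0 0 = euclNorm (A.col 0) := by
  have := congrFun (straighten_col hA) 0
  simpa using this

lemma straighten_succ_zero (hA : A.col 0 ∈ slitSet n) (i : Fin n) :
    straighten A i.succ 0 = 0 := by
  have := congrFun (straighten_col hA) i.succ
  simpa using this

lemma rotTo_mul_straighten (hA : A.col 0 ∈ slitSet n) :
    rotTo (A.col 0) * straighten A = A := by
  rw [straighten, ← mul_assoc, rotTo_mul_rotFrom hA, one_mul]

lemma det_straighten (hA : A.col 0 ∈ slitSet n) : (straighten A).det = A.det := by
  rw [straighten, det_mul, det_rotFrom hA, one_mul]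

/-- The lower right block of the straightened matrix. -/
noncomputable def lowerBlock (A : Matrix (Fin (n + 1)) (Fin (n + 1)) ℝ) :
    Matrix (Fin n) (Fin n) ℝ :=
  (straighten A).submatrix Fin.succ Fin.succ

lemma lowerBlock_mem (hA : A ∈ posDetCol n (slitSet n)) : lowerBlock A ∈ posDet n := by
  have h := det_of_col_zero _ (straighten_succ_zero hA.2)
  rw [det_straighten hA.2, straighten_zero_zero hA.2] at h
  have h1 : 0 < A.det := hA.1
  have h2 := slitSet_euclNorm_pos hA.2
  rw [h] at h1
  exact (pos_iff_pos_of_mul_pos h1).1 h2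

lemma continuousOn_straighten : ContinuousOn (straighten (n := n)) (posDetCol n (slitSet n)) := by
  have hcol : Continuous fun A : Matrix (Fin (n + 1)) (Fin (n + 1)) ℝ => A.col 0 := by
    unfold Matrix.col; fun_prop
  exact (continuousOn_rotFrom.comp hcol.continuousOn fun A hA => hA.2).mul continuousOn_id

lemma continuousOn_lowerBlock : ContinuousOn (lowerBlock (n := n)) (posDetCol n (slitSet n)) :=
  (continuous_id.matrix_submatrix _ _).comp_continuousOn continuousOn_straighten

/-- A deformation of the matrices with first column outside a closed ray onto the block diagonal
matrices with upper left block `1`. -/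
noncomputable def deform (s : ℝ) (A : Matrix (Fin (n + 1)) (Fin (n + 1)) ℝ) :
    Matrix (Fin (n + 1)) (Fin (n + 1)) ℝ :=
  rotTo ((1 - s) • Pi.single 0 1 + s • A.col 0) *
    updateRow (straighten A) 0 ((1 - s) • Pi.single 0 1 + s • straighten A 0)

lemma updateRow_straighten (hA : A.col 0 ∈ slitSet n) :
    updateRow (straighten A) 0 (Pi.single 0 1) = oneBlock (lowerBlock A) := by
  ext i k
  refine Fin.cases ?_ (fun i => ?_) i <;> refine Fin.cases ?_ (fun k => ?_) k <;>
    simp [updateRow_apply, straighten_succ_zero hA, lowerBlock]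

lemma deform_zero (hA : A.col 0 ∈ slitSet n) : deform 0 A = oneBlock (lowerBlock A) := by
  simp [deform, rotTo_single, updateRow_straighten hA]

lemma deform_one (hA : A.col 0 ∈ slitSet n) : deform 1 A = A := by
  simp [deform, rotTo_mul_straighten hA]

lemma segment_mem_slitSet {v : Fin (n + 1) → ℝ} (hv : v ∈ slitSet n) {s : ℝ} (hs : s ∈ Set.Icc (0:ℝ) 1) :
    (1 - s) • Pi.single 0 1 + s • v ∈ slitSet n :=
  starConvex_slitSet hv (by linarith [hs.2]) hs.1 (by ring)

lemma deform_mem_posDet (hA : A ∈ posDetCol n (slitSet n)) {s : ℝ} (hs : s ∈ Set.Icc (0:ℝ) 1) :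
    deform s A ∈ posDet (n + 1) := by
  have h1 : 0 < A.det := hA.1
  have h2 : 0 < (lowerBlock A).det := lowerBlock_mem hA
  simp only [posDet, Set.mem_ofPred, deform, det_mul, det_rotTo (segment_mem_slitSet hA.2 hs), one_mul]
  rw [det_updateRow_add, det_updateRow_smul, det_updateRow_smul, updateRow_straighten hA.2,
    updateRow_eq_self, det_oneBlock, det_straighten hA.2]
  rcases hs.1.lt_or_eq with h | h
  · have : 0 ≤ 1 - s := by linarith [hs.2]
    positivity
  · rw [← h]; simpa using h2

lemma continuousOn_deform : ContinuousOn
    (fun p : ℝ × Matrix (Fin (n + 1)) (Fin (n + 1)) ℝ => deform p.1 p.2)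
    (Set.Icc 0 1 ×ˢ posDetCol n (slitSet n)) := by
  have hcol : Continuous fun A : Matrix (Fin (n + 1)) (Fin (n + 1)) ℝ => A.col 0 := by
    unfold Matrix.col; fun_prop
  have hst : ContinuousOn (fun p : ℝ × Matrix (Fin (n + 1)) (Fin (n + 1)) ℝ => straighten p.2)
      (Set.Icc 0 1 ×ˢ posDetCol n (slitSet n)) :=
    continuousOn_straighten.comp continuousOn_snd fun p hp => hp.2
  refine ContinuousOn.mul (continuousOn_rotTo.comp (Continuous.continuousOn ?_) ?_) ?_
  · have := hcol.comp (continuous_snd (X := ℝ))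
    fun_prop
  · exact fun p hp => segment_mem_slitSet hp.2.2 hp.1
  · have hu : Continuous fun q : Matrix (Fin (n + 1)) (Fin (n + 1)) ℝ × (Fin (n + 1) → ℝ) =>
        updateRow q.1 0 q.2 := continuous_fst.matrix_updateRow 0 continuous_snd
    refine hu.comp_continuousOn (hst.prodMk (ContinuousOn.add (f := fun p => (1 - p.1) •
      (Pi.single 0 1 : Fin (n + 1) → ℝ)) (Continuous.continuousOn (by fun_prop)) ?_))
    exact continuousOn_fst.smul ((continuous_apply 0).comp_continuousOn hst)

/-- The matrices of positive determinant with first column in `V` are the products of a rotation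
and a block triangular matrix. -/
lemma isPreconnected_posDetCol {V : Set (Fin (n + 1) → ℝ)} (hV : V ⊆ slitSet n)
    (hVc : IsPreconnected V) (hn : IsPreconnected (posDet n)) : IsPreconnected (posDetCol n V) := by
  let Φ : (Fin (n + 1) → ℝ) × (Fin n → ℝ) × Matrix (Fin n) (Fin n) ℝ →
      Matrix (Fin (n + 1)) (Fin (n + 1)) ℝ :=
    fun p => rotTo p.1 * updateRow (oneBlock p.2.2) 0 (Fin.cons (euclNorm p.1) p.2.1)
  have hΦ : ContinuousOn Φ (V ×ˢ Set.univ ×ˢ posDet n) := by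
    refine ((continuousOn_rotTo.mono hV).comp continuousOn_fst fun p hp => hp.1).mul
      (Continuous.continuousOn (Continuous.matrix_updateRow _ ?_ ?_))
    · exact continuous_oneBlock.comp (continuous_snd.comp continuous_snd)
    · exact (continuous_euclNorm.comp continuous_fst).finCons
        (continuous_fst.comp continuous_snd)
  have himg : posDetCol n V = Φ '' (V ×ˢ Set.univ ×ˢ posDet n) := by
    ext A
    constructor
    · intro hA
      have hA' : A ∈ posDetCol n (slitSet n) := ⟨hA.1, hV hA.2⟩
      refine ⟨(A.col 0, fun k => straighten A 0 k.succ, lowerBlock A),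
        ⟨hA.2, trivial, lowerBlock_mem hA'⟩, ?_⟩
      have : updateRow (oneBlock (lowerBlock A)) 0
          (Fin.cons (euclNorm (A.col 0)) fun k => straighten A 0 k.succ) = straighten A := by
        ext i k
        refine Fin.cases ?_ (fun i => ?_) i <;> refine Fin.cases ?_ (fun k => ?_) k <;>
          simp [updateRow_apply, straighten_succ_zero hA'.2, lowerBlock,
            straighten_zero_zero hA'.2]
      simp only [Φ, this]
      exact rotTo_mul_straighten hA'.2
    · rintro ⟨⟨v, w, B⟩, ⟨hv, -, hB⟩, rfl⟩
      simp only at hv hB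
      have hv' := hV hv
      refine ⟨?_, ?_⟩
      · simp only [Φ, posDet, Set.mem_ofPred, det_mul, det_rotTo hv', one_mul]
        rw [det_of_col_zero _ (by simp [updateRow_apply])]
        have e : ((oneBlock B).updateRow 0 (Fin.cons (euclNorm v) w)).submatrix Fin.succ Fin.succ
            = B := by
          ext i k; simp [updateRow_apply]
        rw [e]
        simpa using mul_pos (slitSet_euclNorm_pos hv') hB
      · have : (Φ (v, w, B)).col 0 = v := by
          conv_rhs => rw [← rotTo_mulVec hv']
          ext i
          simp [Φ, Matrix.col, Matrix.mul_apply, mulVec, dotProduct, Fin.sum_univ_succ,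
            updateRow_apply]
        rw [this]; exact hv
  rw [himg]
  exact (hVc.prod (isPreconnected_univ.prod hn)).image Φ hΦ

/-- The diagonal matrix reflecting the first two coordinates. -/
noncomputable def reflTwo (n : ℕ) : Matrix (Fin (n + 2)) (Fin (n + 2)) ℝ :=
  diagonal (Fin.cons (-1) (Fin.cons (-1) 1))

lemma det_reflTwo : (reflTwo n).det = 1 := by
  simp [reflTwo, det_diagonal, Fin.prod_univ_succ]

lemma reflTwo_mul_self : reflTwo n * reflTwo n = 1 := by
  rw [reflTwo, diagonal_mul_diagonal, ← diagonal_one]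
  congr 1
  ext i
  refine Fin.cases ?_ (fun i => ?_) i
  · simp
  · refine Fin.cases ?_ (fun i => ?_) i <;> simp

lemma reflTwo_mul_mem {A : Matrix (Fin (n + 2)) (Fin (n + 2)) ℝ} (hA : A ∈ posDet (n + 2)) :
    reflTwo n * A ∈ posDet (n + 2) := by
  simpa [posDet, det_mul, det_reflTwo] using hA

/-- The vectors outside the closed ray spanned by the first unit vector. -/
def slitSetNeg (n : ℕ) : Set (Fin (n + 1) → ℝ) := {v | 0 < euclNorm v - v 0}

lemma isOpen_slitSetNeg : IsOpen (slitSetNeg n) :=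
  isOpen_lt continuous_const (continuous_euclNorm.sub (continuous_apply 0))

lemma euclNorm_reflTwo_mul (A : Matrix (Fin (n + 2)) (Fin (n + 2)) ℝ) :
    euclNorm ((reflTwo n * A).col 0) = euclNorm (A.col 0) := by
  rw [euclNorm, euclNorm, EuclideanSpace.norm_eq, EuclideanSpace.norm_eq]
  congr 1
  refine Finset.sum_congr rfl fun i _ => ?_
  have : |(Fin.cons (-1) (Fin.cons (-1) 1) : Fin (n + 2) → ℝ) i| = 1 := by
    refine Fin.cases ?_ (fun i => ?_) i
    · simp
    · refine Fin.cases ?_ (fun i => ?_) i <;> simp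
  simp only [reflTwo, Matrix.col, transpose_apply, diagonal_mul, Real.norm_eq_abs, abs_mul, this,
    one_mul]

lemma reflTwo_mul_zero_zero (A : Matrix (Fin (n + 2)) (Fin (n + 2)) ℝ) :
    (reflTwo n * A) 0 0 = - A 0 0 := by
  simp [reflTwo, diagonal_mul]

lemma reflTwo_mem_slitSet {A : Matrix (Fin (n + 2)) (Fin (n + 2)) ℝ} :
    (reflTwo n * A).col 0 ∈ slitSet (n + 1) ↔ A.col 0 ∈ slitSetNeg (n + 1) := by
  simp only [slitSet, slitSetNeg, Set.mem_ofPred, euclNorm_reflTwo_mul]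
  simp [Matrix.col, reflTwo_mul_zero_zero, sub_eq_add_neg]

lemma euclNorm_pos {v : Fin (n + 1) → ℝ} (hv : v ≠ 0) : 0 < euclNorm v :=
  norm_pos_iff.2 (by simpa using hv)

lemma col_zero_ne_zero {A : Matrix (Fin (n + 1)) (Fin (n + 1)) ℝ} (hA : A ∈ posDet (n + 1)) :
    A.col 0 ≠ 0 := by
  intro h
  have : A.det = 0 := det_eq_zero_of_column_eq_zero 0 fun i => congrFun h i
  simp [posDet, this] at hA

lemma posDet_eq_union : posDet (n + 1) =
    posDetCol n (slitSet n) ∪ posDetCol n (slitSetNeg n) := by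
  ext A
  refine ⟨fun hA => ?_, fun h => h.elim And.left And.left⟩
  have := euclNorm_pos (col_zero_ne_zero hA)
  by_cases h : 0 < euclNorm (A.col 0) + A.col 0 0
  · exact Or.inl ⟨hA, h⟩
  · refine Or.inr ⟨hA, ?_⟩
    simp only [slitSetNeg, Set.mem_ofPred]
    linarith

lemma mem_slitSet_inter {v : Fin (n + 1) → ℝ} :
    v ∈ slitSet n ∩ slitSetNeg n ↔ ∃ i : Fin n, v i.succ ≠ 0 := by
  have key : euclNorm v * euclNorm v = v 0 * v 0 + ∑ i : Fin n, v i.succ * v i.succ := by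
    rw [euclNorm_mul_self, dotProduct, Fin.sum_univ_succ]
  have h0 := euclNorm_nonneg v
  have hnn : 0 ≤ ∑ i : Fin n, v i.succ * v i.succ :=
    Finset.sum_nonneg fun i _ => mul_self_nonneg _
  have hiff : 0 < ∑ i : Fin n, v i.succ * v i.succ ↔ ∃ i : Fin n, v i.succ ≠ 0 := by
    rw [Finset.sum_pos_iff_of_nonneg fun i _ => mul_self_nonneg _]
    simp
  rw [← hiff]
  simp only [slitSet, slitSetNeg, Set.mem_inter_iff, Set.mem_ofPred]
  constructor
  · rintro ⟨h1, h2⟩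
    have := mul_pos h1 h2
    nlinarith
  · intro h
    have : |v 0| < euclNorm v := abs_lt_of_sq_lt_sq (by nlinarith) h0
    constructor <;> linarith [abs_lt.1 this]

/-- The matrices of positive determinant are connected, by induction on the size: the first column
avoids one of two opposite rays, and with the first column outside a ray the matrices deform to
smaller ones. -/
lemma isPreconnected_posDet : ∀ d : ℕ, IsPreconnected (posDet d)
  | 0 => by
    have : Subsingleton (Matrix (Fin 0) (Fin 0) ℝ) := inferInstance
    exact Set.Subsingleton.isPreconnected (Set.subsingleton_of_subsingleton)
  | 1 => by
    refine Convex.isPreconnected fun x hx y hy a b ha hb hab => ?_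
    simp only [posDet, Set.mem_ofPred, det_unique] at *
    simp only [Matrix.add_apply, Matrix.smul_apply, smul_eq_mul]
    rcases ha.lt_or_eq with h | h
    · have := mul_pos h hx
      have := mul_nonneg hb hy.le
      linarith
    · have : b = 1 := by linarith
      rw [← h, this]; simpa using hy
  | n + 2 => by
    have h1 := isPreconnected_posDetCol subset_rfl isPreconnected_slitSet
      (isPreconnected_posDet (n + 1))
    have himg : posDetCol (n + 1) (slitSetNeg _) =
        (fun A => reflTwo n * A) '' posDetCol (n + 1) (slitSet _) := by
      ext A
      constructor
      · intro hA
        refine ⟨reflTwo n * A, ⟨reflTwo_mul_mem hA.1, reflTwo_mem_slitSet.2 hA.2⟩, ?_⟩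
        simp only [← mul_assoc, reflTwo_mul_self, one_mul]
      · rintro ⟨B, hB, rfl⟩
        refine ⟨reflTwo_mul_mem hB.1, ?_⟩
        rw [← reflTwo_mem_slitSet, ← mul_assoc, reflTwo_mul_self, one_mul]
        exact hB.2
    have h2 : IsPreconnected (posDetCol (n + 1) (slitSetNeg _)) := by
      rw [himg]
      exact h1.image _ (by fun_prop)
    rw [posDet_eq_union]
    -- a transvection has its first column off the axis
    let T : Matrix (Fin (n + 2)) (Fin (n + 2)) ℝ := transvection 1 0 1
    have hT : T ∈ posDet (n + 2) := by simp [posDet, T, det_transvection_of_ne]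
    have hc : T.col 0 ∈ slitSet (n + 1) ∩ slitSetNeg (n + 1) :=
      mem_slitSet_inter.2 ⟨0, by simp [T, transvection, Matrix.col]⟩
    exact h1.union T ⟨hT, hc.1⟩ ⟨hT, hc.2⟩ h2

lemma isPathConnected_posDet (d : ℕ) : IsPathConnected (posDet d) := by
  have : LocallyPathConnectedSpace (Matrix (Fin d) (Fin d) ℝ) :=
    inferInstanceAs (LocallyPathConnectedSpace (Fin d → Fin d → ℝ))
  exact (IsOpen.isConnected_iff_isPathConnected (isOpen_posDet d)).1
    ⟨⟨1, one_mem_posDet d⟩, isPreconnected_posDet d⟩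

end Columns

/-! ### Lifting maps from the matrices of positive determinant -/

section Lifts

variable {P X Z Z' : Type*} [TopologicalSpace P] [TopologicalSpace Z] [TopologicalSpace Z']
  {p : P → X}

/-- The map `f` lifts through `p` over the set `S`, with any prescribed value at one point. -/
def HasLiftsOn (p : P → X) (f : Z → X) (S : Set Z) : Prop :=
  ∀ z₀ ∈ S, ∀ q₀, p q₀ = f z₀ →
    ∃ F : Z → P, ContinuousOn F S ∧ (∀ z ∈ S, p (F z) = f z) ∧ F z₀ = q₀

/-- If `f` is homotopic to a map which factors through `f'`, then `f` lifts as soon as `f'` does: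
lift the homotopy, starting from the composed lift. The starting value is transported along the
homotopy. -/
lemma HasLiftsOn.of_homotopy [TopologicalSpace X] (hp : IsCoveringMap p) {f : Z → X} {f' : Z' → X} {S : Set Z}
    {S' : Set Z'} (r : Z → Z') (hr : ContinuousOn r S) (hrS : Set.MapsTo r S S')
    (h : ℝ × Z → X) (hh : ContinuousOn h (Set.Icc 0 1 ×ˢ S))
    (h0 : ∀ z ∈ S, h (0, z) = f' (r z)) (h1 : ∀ z ∈ S, h (1, z) = f z)
    (hf' : HasLiftsOn p f' S') : HasLiftsOn p f S := by
  classical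
  intro z₀ hz₀ q₀ hq₀
  let H : C(I × S, X) := ⟨fun x => h (x.1, x.2), by
    refine hh.comp_continuous (by fun_prop) fun x => ⟨x.1.2, x.2.2⟩⟩
  let γ : C(I, X) := ⟨fun t => H (σ t, ⟨z₀, hz₀⟩), by fun_prop⟩
  have hγ0 : γ 0 = p q₀ := by simp [γ, H, hq₀, h1 z₀ hz₀]
  let Γ := hp.liftPath γ q₀ hγ0
  have hΓ : ∀ t, p (Γ t) = γ t := fun t => congrFun (hp.liftPath_lifts γ q₀ hγ0) t
  have hΓ1 : p (Γ 1) = f' (r z₀) := by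
    rw [hΓ]; simp [γ, H, h0 z₀ hz₀]
  obtain ⟨F', hF'c, hF'l, hF'0⟩ := hf' (r z₀) (hrS hz₀) (Γ 1) hΓ1
  let F₀ : C(S, P) := ⟨fun z => F' (r z), by
    refine (hF'c.comp hr hrS).comp_continuous continuous_subtype_val fun z => z.2⟩
  have hH0 : ∀ a, H (0, a) = p (F₀ a) := fun a => by
    simp [H, F₀, h0 a a.2, hF'l _ (hrS a.2)]
  let G := hp.liftHomotopy H F₀ hH0
  have hG : ∀ x, p (G x) = H x := fun x => congrFun (hp.liftHomotopy_lifts H F₀ hH0) x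
  have hG0 : ∀ a, G (0, a) = F₀ a := hp.liftHomotopy_zero H F₀ hH0
  refine ⟨fun z => if hz : z ∈ S then G (1, ⟨z, hz⟩) else q₀, ?_, fun z hz => ?_, ?_⟩
  · rw [continuousOn_iff_continuous_domRestrict]
    have : S.domRestrict (fun z => if hz : z ∈ S then G (1, ⟨z, hz⟩) else q₀) = fun z => G (1, z) := by
      ext z; simp [Set.domRestrict]
    rw [this]; fun_prop
  · simp [hz, hG, H, h1 z hz]
  · have := hp.eq_of_comp_eq (g₁ := fun t => G (σ t, ⟨z₀, hz₀⟩)) (g₂ := Γ) (by fun_prop)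
      (by fun_prop) (by ext t; simp [hG, hΓ, γ]) 1 (by simp [hG0, F₀, hF'0])
    have := congrFun this 0
    simp only [hz₀, dite_true]
    simpa [Γ, hp.liftPath_zero] using this

/-- Lifts pull back along a map `e` with a left inverse `e'`. -/
lemma HasLiftsOn.comp_homeo {f : Z → X} {S : Set Z} {S' : Set Z'} (e : Z → Z') (e' : Z' → Z)
    (he : ContinuousOn e S) (heS : Set.MapsTo e S S') (hee : ∀ z ∈ S, e' (e z) = z)
    (hf : HasLiftsOn p (f ∘ e') S') : HasLiftsOn p f S := by
  intro z₀ hz₀ q₀ hq₀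
  obtain ⟨F, hFc, hFl, hF0⟩ := hf (e z₀) (heS hz₀) q₀ (by simpa [hee z₀ hz₀] using hq₀)
  refine ⟨F ∘ e, hFc.comp he heS, fun z hz => ?_, hF0⟩
  simp [hFl _ (heS hz), hee z hz]

/-- Lifts over two open sets glue if lifts which agree at one point agree on the intersection. -/
lemma HasLiftsOn.union {f : Z → X} {U V : Set Z} (hU : IsOpen U) (hV : IsOpen V)
    (hUV : (U ∩ V).Nonempty) (hfU : HasLiftsOn p f U) (hfV : HasLiftsOn p f V)
    (h : ∀ F G : Z → P, ContinuousOn F U → ContinuousOn G V → (∀ z ∈ U, p (F z) = f z) →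
      (∀ z ∈ V, p (G z) = f z) → (∃ z ∈ U ∩ V, F z = G z) → Set.EqOn F G (U ∩ V)) :
    HasLiftsOn p f (U ∪ V) := by
  classical
  obtain ⟨z₁, hz₁⟩ := hUV
  intro z₀ hz₀ q₀ hq₀
  obtain ⟨F, G, hFc, hGc, hFl, hGl, hFG, h0⟩ : ∃ F G : Z → P, ContinuousOn F U ∧ ContinuousOn G V ∧
      (∀ z ∈ U, p (F z) = f z) ∧ (∀ z ∈ V, p (G z) = f z) ∧ (∃ z ∈ U ∩ V, F z = G z) ∧
      ((z₀ ∈ U ∧ F z₀ = q₀) ∨ (z₀ ∈ V ∧ G z₀ = q₀)) := by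
    rcases hz₀ with hz | hz
    · obtain ⟨F, hF, hFl, hF0⟩ := hfU z₀ hz q₀ hq₀
      obtain ⟨G, hG, hGl, hG0⟩ := hfV z₁ hz₁.2 (F z₁) (hFl _ hz₁.1)
      exact ⟨F, G, hF, hG, hFl, hGl, ⟨z₁, hz₁, hG0.symm⟩, Or.inl ⟨hz, hF0⟩⟩
    · obtain ⟨G, hG, hGl, hG0⟩ := hfV z₀ hz q₀ hq₀
      obtain ⟨F, hF, hFl, hF0⟩ := hfU z₁ hz₁.1 (G z₁) (hGl _ hz₁.2)
      exact ⟨F, G, hF, hG, hFl, hGl, ⟨z₁, hz₁, hF0⟩, Or.inr ⟨hz, hG0⟩⟩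
  have heq := h F G hFc hGc hFl hGl hFG
  have hV' : Set.EqOn (fun z => if z ∈ U then F z else G z) G V := by
    intro z hz
    by_cases hzU : z ∈ U
    · simp [hzU, heq ⟨hzU, hz⟩]
    · simp [hzU]
  have hU' : Set.EqOn (fun z => if z ∈ U then F z else G z) F U := fun z hz => if_pos hz
  refine ⟨fun z => if z ∈ U then F z else G z, ?_, ?_, ?_⟩
  · exact (hFc.congr hU').union_of_isOpen (hGc.congr hV') hU hV
  · rintro z (hz | hz)
    · rw [hU' hz, hFl z hz]
    · rw [hV' hz, hGl z hz]
  · rcases h0 with ⟨hz, h0⟩ | ⟨hz, h0⟩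
    · rw [hU' hz, h0]
    · rw [hV' hz, h0]

lemma hasLiftsOn_posDet_zero {f : Matrix (Fin 0) (Fin 0) ℝ → X} : HasLiftsOn p f (posDet 0) := by
  intro z₀ _ q₀ hq₀
  refine ⟨fun _ => q₀, continuousOn_const, fun z _ => ?_, rfl⟩
  rw [hq₀]; exact congrArg f (Subsingleton.elim _ _)

end Lifts

section PosDetLifts

variable {P X : Type*} [TopologicalSpace P] [TopologicalSpace X] {p : P → X}

/-- The rotation by the angle `θ` in the plane of the last two coordinates. -/
noncomputable def lastRot : (n : ℕ) → ℝ → Matrix (Fin (n + 2)) (Fin (n + 2)) ℝ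
  | 0, θ => !![Real.cos θ, -Real.sin θ; Real.sin θ, Real.cos θ]
  | n + 1, θ => oneBlock (lastRot n θ)

lemma continuous_lastRot : ∀ n : ℕ, Continuous (lastRot n)
  | 0 => by
    refine continuous_matrix fun i k => ?_
    fin_cases i <;> fin_cases k <;> simp [lastRot] <;> fun_prop
  | n + 1 => continuous_oneBlock.comp (continuous_lastRot n)

lemma det_lastRot : ∀ (n : ℕ) (θ : ℝ), (lastRot n θ).det = 1
  | 0, θ => by
    have : (!![Real.cos θ, -Real.sin θ; Real.sin θ, Real.cos θ] : Matrix (Fin 2) (Fin 2) ℝ).det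
        = 1 := by
      rw [det_fin_two_of]
      nlinarith [Real.sin_sq_add_cos_sq θ]
    exact this
  | n + 1, θ => by rw [lastRot, det_oneBlock, det_lastRot n θ]

/-- With the first column outside a ray, the matrices deform to matrices of smaller size. -/
lemma hasLiftsOn_posDetCol_slitSet (hp : IsCoveringMap p) {n : ℕ}
    {f : Matrix (Fin (n + 1)) (Fin (n + 1)) ℝ → X} (hf : ContinuousOn f (posDet (n + 1)))
    (h : HasLiftsOn p (f ∘ oneBlock) (posDet n)) :
    HasLiftsOn p f (posDetCol n (slitSet n)) := by
  refine h.of_homotopy hp lowerBlock continuousOn_lowerBlock (fun A hA => lowerBlock_mem hA)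
    (fun x => f (deform x.1 x.2)) ?_ ?_ ?_
  · exact hf.comp continuousOn_deform fun x hx => deform_mem_posDet hx.2 hx.1
  · intro A hA; simp [deform_zero hA.2]
  · intro A hA; simp [deform_one hA.2]

lemma posDetCol_inter (n : ℕ) (V W : Set (Fin (n + 1) → ℝ)) :
    posDetCol n V ∩ posDetCol n W = posDetCol n (V ∩ W) := by
  ext A; simp only [posDetCol, Set.mem_inter_iff, Set.mem_ofPred]; tauto

lemma hasLiftsOn_posDet_one (hp : IsCoveringMap p) {f : Matrix (Fin 1) (Fin 1) ℝ → X}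
    (hf : ContinuousOn f (posDet 1)) : HasLiftsOn p f (posDet 1) := by
  have h := hasLiftsOn_posDetCol_slitSet hp hf hasLiftsOn_posDet_zero
  have : posDet 1 = posDetCol 0 (slitSet 0) := by
    ext A
    refine ⟨fun hA => ⟨hA, ?_⟩, And.left⟩
    have h1 : 0 < A 0 0 := by simpa [posDet] using hA
    have h2 := euclNorm_nonneg (A.col 0)
    simp only [slitSet, Set.mem_ofPred, Matrix.col]
    exact add_pos_of_nonneg_of_pos h2 h1
  rwa [this]

/-- Off the axis, the possible first columns of matrices of size at least `3` are connected. -/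
lemma isPreconnected_slitSet_inter (n : ℕ) :
    IsPreconnected (slitSet (n + 2) ∩ slitSetNeg (n + 2)) := by
  have h : IsPreconnected ({0}ᶜ : Set (Fin (n + 2) → ℝ)) :=
    (isConnected_compl_singleton_of_one_lt_rank (by
      rw [rank_fin_fun]; exact_mod_cast (by omega : 1 < n + 2)) 0).isPreconnected
  have himg : slitSet (n + 2) ∩ slitSetNeg (n + 2) =
      (fun x : ℝ × (Fin (n + 2) → ℝ) => (Fin.cons x.1 x.2 : Fin (n + 3) → ℝ)) ''
        (Set.univ ×ˢ {0}ᶜ) := by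
    ext v
    rw [mem_slitSet_inter]
    constructor
    · rintro ⟨i, hi⟩
      refine ⟨(v 0, fun k => v k.succ), ⟨trivial, fun h => hi (congrFun h i)⟩, ?_⟩
      exact Fin.cons_self_tail v
    · rintro ⟨⟨a, w⟩, ⟨-, hw⟩, rfl⟩
      by_contra! hc
      exact hw (funext fun i => by simpa using hc i)
  rw [himg]
  exact (isPreconnected_univ.prod h).image _ (by fun_prop)

lemma isPreconnected_halfPlane (s : ℝ) :
    IsPreconnected {v : Fin 2 → ℝ | 0 < s * v 1} := by
  refine Convex.isPreconnected fun x hx y hy a b ha hb hab => ?_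
  simp only [Set.mem_ofPred] at *
  simp only [Pi.add_apply, Pi.smul_apply, smul_eq_mul]
  rcases ha.lt_or_eq with h | h
  · have := mul_pos h hx
    have := mul_nonneg hb hy.le
    nlinarith
  · have : b = 1 := by linarith
    rw [← h, this]; simpa using hy

lemma halfPlane_subset {s : ℝ} : {v : Fin 2 → ℝ | 0 < s * v 1} ⊆ slitSet 1 ∩ slitSetNeg 1 := by
  intro v hv
  refine mem_slitSet_inter.2 ⟨0, fun h => ?_⟩
  simp only [Set.mem_ofPred] at hv
  rw [show (1 : Fin 2) = Fin.succ 0 from rfl, h] at hv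
  simp at hv

/-- Two lifts over the slit regions of the matrices of size `2` which agree somewhere agree
everywhere: the intersection has two components, which are connected by the rotation loop. -/
lemma eqOn_of_lastRot (hp : IsCoveringMap p) {f : Matrix (Fin 2) (Fin 2) ℝ → X}
    (hf : ContinuousOn f (posDet 2))
    (hrot : ∀ A ∈ posDet 2, ∀ γ : C(I, P),
      (∀ t : I, p (γ t) = f (A * lastRot 0 (2 * Real.pi * t))) → γ 0 = γ 1)
    {F G : Matrix (Fin 2) (Fin 2) ℝ → P} (hF : ContinuousOn F (posDetCol 1 (slitSet 1)))
    (hG : ContinuousOn G (posDetCol 1 (slitSetNeg 1)))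
    (hFl : ∀ z ∈ posDetCol 1 (slitSet 1), p (F z) = f z)
    (hGl : ∀ z ∈ posDetCol 1 (slitSetNeg 1), p (G z) = f z)
    {A : Matrix (Fin 2) (Fin 2) ℝ} (hA : A ∈ posDetCol 1 (slitSet 1) ∩ posDetCol 1 (slitSetNeg 1))
    (hAFG : F A = G A) :
    Set.EqOn F G (posDetCol 1 (slitSet 1) ∩ posDetCol 1 (slitSetNeg 1)) := by
  -- each of the two components of the intersection is connected
  have hhalf : ∀ (s : ℝ) (B C : Matrix (Fin 2) (Fin 2) ℝ), B ∈ posDet 2 → C ∈ posDet 2 →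
      0 < s * B 1 0 → 0 < s * C 1 0 → F B = G B → F C = G C := by
    intro s B C hB hC hBs hCs hFG
    have hsub : posDetCol 1 {v : Fin 2 → ℝ | 0 < s * v 1} ⊆
        posDetCol 1 (slitSet 1) ∩ posDetCol 1 (slitSetNeg 1) := by
      rw [posDetCol_inter]
      exact fun A hA => ⟨hA.1, halfPlane_subset hA.2⟩
    refine hp.eqOn_of_comp_eqOn (isPreconnected_posDetCol
      (halfPlane_subset.trans Set.inter_subset_left) (isPreconnected_halfPlane s)
      (isPreconnected_posDet 1)) (hF.mono (hsub.trans Set.inter_subset_left))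
      (hG.mono (hsub.trans Set.inter_subset_right)) ?_
      (show B ∈ posDetCol 1 {v : Fin 2 → ℝ | 0 < s * v 1} from ⟨hB, hBs⟩) hFG ⟨hC, hCs⟩
    intro D hD
    simp [hFl D (hsub hD).1, hGl D (hsub hD).2]
  -- the rotation loop stays in one slit region for `t ≠ 1 / 2`, and in the other for `0 < t < 1`
  let R : I → Matrix (Fin 2) (Fin 2) ℝ := fun t => lastRot 0 (2 * Real.pi * t)
  have hRc : Continuous R := (continuous_lastRot 0).comp (by fun_prop)
  have hRp : ∀ t, R t ∈ posDet 2 := fun t => by simp [posDet, R, det_lastRot]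
  have hR10 : ∀ t : I, R t 1 0 = Real.sin (2 * Real.pi * t) := fun t => by simp [R, lastRot]
  have hR00 : ∀ t : I, R t 0 0 = Real.cos (2 * Real.pi * t) := fun t => by simp [R, lastRot]
  have hpi := Real.pi_pos
  have hlow : ∀ t : I, (t : ℝ) < 1 / 2 ∨ 1 / 2 < (t : ℝ) → R t ∈ posDetCol 1 (slitSet 1) := by
    intro t ht
    refine ⟨hRp t, ?_⟩
    by_cases h0 : R t 1 0 = 0
    · have h1 : 0 < R t 0 0 := by
        rw [hR10] at h0; rw [hR00]
        obtain ⟨k, hk⟩ := Real.sin_eq_zero_iff.1 h0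
        have hk' : (k : ℝ) = 2 * t := by
          have : (k : ℝ) * Real.pi = (2 * t) * Real.pi := by linarith
          exact mul_right_cancel₀ hpi.ne' this
        have hb := t.2
        have hk0 : k ≠ 1 := by
          rintro rfl
          push_cast at hk'
          rcases ht with ht | ht <;> linarith
        have hk1 : k = 0 ∨ k = 2 := by
          have h1 : (k : ℝ) ≤ 2 := by linarith [hb.2]
          have h2 : (0 : ℝ) ≤ k := by linarith [hb.1]
          have h1' : k ≤ 2 := by exact_mod_cast h1
          have h2' : 0 ≤ k := by exact_mod_cast h2
          omega
        rw [← hk]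
        rcases hk1 with rfl | rfl <;> simp
      exact add_pos_of_nonneg_of_pos (euclNorm_nonneg _) h1
    · exact (mem_slitSet_inter.2 ⟨0, h0⟩).1
  have hmid : ∀ t : I, t ∈ Set.Ioo (0 : I) 1 → R t ∈ posDetCol 1 (slitSetNeg 1) := by
    intro t ht
    refine ⟨hRp t, ?_⟩
    by_cases h0 : R t 1 0 = 0
    · have h1 : R t 0 0 < 0 := by
        rw [hR10] at h0; rw [hR00]
        obtain ⟨k, hk⟩ := Real.sin_eq_zero_iff.1 h0
        have hk' : (k : ℝ) = 2 * t := by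
          have : (k : ℝ) * Real.pi = (2 * t) * Real.pi := by linarith
          exact mul_right_cancel₀ hpi.ne' this
        have hb0 : (0 : ℝ) < t := ht.1
        have hb1 : (t : ℝ) < 1 := ht.2
        have hk1 : k = 1 := by
          have h1 : (k : ℝ) < 2 := by linarith
          have h2 : (0 : ℝ) < k := by linarith
          have h1' : k < 2 := by exact_mod_cast h1
          have h2' : 0 < k := by exact_mod_cast h2
          omega
        rw [← hk, hk1]
        simp
      have := euclNorm_nonneg ((R t).col 0)
      simp only [slitSetNeg, Set.mem_ofPred]
      have e : (R t).col 0 0 = R t 0 0 := rfl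
      linarith
    · exact (mem_slitSet_inter.2 ⟨0, h0⟩).2
  obtain ⟨γ, hγ, hγ0⟩ : ∃ γ : C(I, P), (∀ t, p (γ t) = f (R t)) ∧ γ 0 = F (R 0) := by
    have h0 : (⟨fun t => f (R t), hf.comp_continuous hRc hRp⟩ : C(I, X)) 0 = p (F (R 0)) := by
      rw [hFl _ (hlow 0 (by left; norm_num))]; rfl
    exact ⟨hp.liftPath _ _ h0, fun t => congrFun (hp.liftPath_lifts _ _ h0) t,
      hp.liftPath_zero _ _ h0⟩
  have hγ1 : γ 1 = F (R 1) := by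
    have h01 : R 0 = R 1 := by simp [R, lastRot]
    rw [← h01, ← hγ0]
    exact (hrot 1 (one_mem_posDet 2) γ fun t => by rw [hγ, one_mul]).symm
  -- the lift `γ` of the rotation loop agrees with `F` on both sides of `t = 1 / 2`, since it is
  -- closed
  have hγF : ∀ t : I, (t : ℝ) < 1 / 2 ∨ 1 / 2 < (t : ℝ) → γ t = F (R t) := by
    intro t ht
    rcases ht with ht | ht
    · refine hp.eqOn_of_comp_eqOn (s := {t : I | (t : ℝ) < 1 / 2}) (g₁ := γ) (g₂ := F ∘ R)
        ?_ γ.continuous.continuousOn (hF.comp hRc.continuousOn fun t ht => hlow t (Or.inl ht))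
        (fun t ht => ?_) (a := 0) (by simp) hγ0 ht
      · have : {t : I | (t : ℝ) < 1 / 2} = Set.Iio ⟨1 / 2, by norm_num, by norm_num⟩ := by
          ext; simp [← Subtype.coe_lt_coe]
        rw [this]; exact isPreconnected_Iio
      · simp [hγ, hFl _ (hlow t (Or.inl ht))]
    · refine hp.eqOn_of_comp_eqOn (s := {t : I | 1 / 2 < (t : ℝ)}) (g₁ := γ) (g₂ := F ∘ R)
        ?_ γ.continuous.continuousOn (hF.comp hRc.continuousOn fun t ht => hlow t (Or.inr ht))
        (fun t ht => ?_) (a := 1) (by norm_num) hγ1 ht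
      · have : {t : I | 1 / 2 < (t : ℝ)} = Set.Ioi ⟨1 / 2, by norm_num, by norm_num⟩ := by
          ext; simp [← Subtype.coe_lt_coe]
        rw [this]; exact isPreconnected_Ioi
      · simp [hγ, hFl _ (hlow t (Or.inr ht))]
  -- hence, if `F` and `G` agree at a quarter of the loop, they agree at three quarters
  have hγG : ∀ a ∈ Set.Ioo (0 : I) 1, ∀ b ∈ Set.Ioo (0 : I) 1, γ a = G (R a) → γ b = G (R b) := by
    intro a ha b hb hab
    refine hp.eqOn_of_comp_eqOn (g₁ := γ) (g₂ := G ∘ R) isPreconnected_Ioo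
      γ.continuous.continuousOn (hG.comp hRc.continuousOn fun t ht => hmid t ht)
      (fun t ht => ?_) ha hab hb
    simp [hγ, hGl _ (hmid t ht)]
  -- the two quarter points represent the two components of the intersection
  let t₁ : I := ⟨1 / 4, by norm_num, by norm_num⟩
  let t₃ : I := ⟨3 / 4, by norm_num, by norm_num⟩
  have ht₁ : t₁ ∈ Set.Ioo (0 : I) 1 := by constructor <;> simp [t₁, ← Subtype.coe_lt_coe]; norm_num
  have ht₃ : t₃ ∈ Set.Ioo (0 : I) 1 := by constructor <;> simp [t₃, ← Subtype.coe_lt_coe]; norm_num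
  have hs₁ : R t₁ 1 0 = 1 := by
    rw [hR10]; simp only [t₁]
    rw [show 2 * Real.pi * (1 / 4) = Real.pi / 2 by ring, Real.sin_pi_div_two]
  have hs₃ : R t₃ 1 0 = -1 := by
    rw [hR10]; simp only [t₃]
    rw [show 2 * Real.pi * (3 / 4) = Real.pi / 2 + Real.pi by ring, Real.sin_add_pi,
      Real.sin_pi_div_two]
  have h13 : F (R t₁) = G (R t₁) ↔ F (R t₃) = G (R t₃) := by
    rw [← hγF t₁ (by left; norm_num [t₁]), ← hγF t₃ (by right; norm_num [t₃])]
    exact ⟨hγG _ ht₁ _ ht₃, hγG _ ht₃ _ ht₁⟩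
  -- transport the agreement to the point `R t₁`
  have hne : ∀ B ∈ posDetCol 1 (slitSet 1) ∩ posDetCol 1 (slitSetNeg 1), B 1 0 ≠ 0 := by
    intro B hB h0
    rw [posDetCol_inter] at hB
    obtain ⟨i, hi⟩ := mem_slitSet_inter.1 hB.2
    rw [Subsingleton.elim i 0] at hi
    exact hi h0
  have key : ∀ B ∈ posDetCol 1 (slitSet 1) ∩ posDetCol 1 (slitSetNeg 1),
      F B = G B ↔ F (R t₁) = G (R t₁) := by
    intro B hB
    rcases lt_or_gt_of_ne (hne B hB) with h | h
    · rw [h13]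
      constructor <;> refine hhalf (-1) _ _ ?_ ?_ ?_ ?_
      · exact hB.1.1
      · exact hRp _
      · linarith
      · rw [hs₃]; norm_num
      · exact hRp _
      · exact hB.1.1
      · rw [hs₃]; norm_num
      · linarith
    · constructor <;> refine hhalf 1 _ _ ?_ ?_ ?_ ?_
      · exact hB.1.1
      · exact hRp _
      · linarith
      · rw [hs₁]; norm_num
      · exact hRp _
      · exact hB.1.1
      · rw [hs₁]; norm_num
      · linarith
  exact fun B hB => (key B hB).2 ((key A hA).1 hAFG)

/-- A map from the matrices of positive determinant lifts through a covering if the loops of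
rotations in the plane of the last two coordinates lift to loops. -/
theorem hasLiftsOn_posDet (hp : IsCoveringMap p) : ∀ (n : ℕ)
    (f : Matrix (Fin (n + 2)) (Fin (n + 2)) ℝ → X), ContinuousOn f (posDet (n + 2)) →
    (∀ A ∈ posDet (n + 2), ∀ γ : C(I, P),
      (∀ t : I, p (γ t) = f (A * lastRot n (2 * Real.pi * t))) → γ 0 = γ 1) →
    HasLiftsOn p f (posDet (n + 2))
  | n, f, hf, hrot => by
    -- lifts over the two slit regions
    have hmain : ∀ f : Matrix (Fin (n + 2)) (Fin (n + 2)) ℝ → X, ContinuousOn f (posDet (n + 2)) →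
        (∀ A ∈ posDet (n + 2), ∀ γ : C(I, P),
          (∀ t : I, p (γ t) = f (A * lastRot n (2 * Real.pi * t))) → γ 0 = γ 1) →
        HasLiftsOn p f (posDetCol (n + 1) (slitSet (n + 1))) := by
      intro f hf hrot
      refine hasLiftsOn_posDetCol_slitSet hp hf ?_
      have hfc : ContinuousOn (f ∘ oneBlock) (posDet (n + 1)) :=
        hf.comp continuous_oneBlock.continuousOn fun B hB => oneBlock_mem_posDet hB
      match n, f, hf, hrot, hfc with
      | 0, f, hf, hrot, hfc => exact hasLiftsOn_posDet_one hp hfc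
      | n + 1, f, hf, hrot, hfc =>
        refine hasLiftsOn_posDet hp n _ hfc fun B hB γ hγ => ?_
        refine hrot (oneBlock B) (oneBlock_mem_posDet hB) γ fun t => ?_
        simp [hγ, lastRot, oneBlock_mul]
    have h1 := hmain f hf hrot
    have h2 : HasLiftsOn p f (posDetCol (n + 1) (slitSetNeg (n + 1))) := by
      refine HasLiftsOn.comp_homeo (S' := posDetCol (n + 1) (slitSet (n + 1)))
        (fun A => reflTwo n * A) (fun A => reflTwo n * A) (by fun_prop) ?_ ?_ (hmain _ ?_ ?_)
      · exact fun A hA => ⟨reflTwo_mul_mem hA.1, reflTwo_mem_slitSet.2 hA.2⟩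
      · intro A _; simp only [← mul_assoc, reflTwo_mul_self, one_mul]
      · exact hf.comp (by fun_prop) fun A hA => reflTwo_mul_mem hA
      · intro A hA γ hγ
        refine hrot (reflTwo n * A) (reflTwo_mul_mem hA) γ fun t => ?_
        rw [hγ, Function.comp_apply, Matrix.mul_assoc]
    -- a transvection has its first column off the axis
    have hT : (transvection 1 0 1 : Matrix (Fin (n + 2)) (Fin (n + 2)) ℝ) ∈ posDet (n + 2) := by
      simp [posDet, det_transvection_of_ne]
    have hc : (transvection 1 0 1 : Matrix (Fin (n + 2)) (Fin (n + 2)) ℝ).col 0 ∈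
        slitSet (n + 1) ∩ slitSetNeg (n + 1) :=
      mem_slitSet_inter.2 ⟨0, by simp [transvection, Matrix.col]⟩
    rw [posDet_eq_union]
    refine h1.union (isOpen_posDetCol isOpen_slitSet) (isOpen_posDetCol isOpen_slitSetNeg)
      ⟨_, ⟨hT, hc.1⟩, ⟨hT, hc.2⟩⟩ h2 ?_
    intro F G hF hG hFl hGl ⟨A, hA, hAFG⟩
    cases n with
    | zero => exact eqOn_of_lastRot hp hf hrot hF hG hFl hGl hA hAFG
    | succ n =>
      have hcon : IsPreconnected (posDetCol (n + 2) (slitSet (n + 2)) ∩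
          posDetCol (n + 2) (slitSetNeg (n + 2))) := by
        rw [posDetCol_inter]
        exact isPreconnected_posDetCol Set.inter_subset_left (isPreconnected_slitSet_inter n)
          (isPreconnected_posDet _)
      refine hp.eqOn_of_comp_eqOn hcon (hF.mono Set.inter_subset_left)
        (hG.mono Set.inter_subset_right) ?_ hA hAFG
      intro B hB
      simp [hFl B hB.1, hGl B hB.2]

end PosDetLifts

/-! ### The monodromy of a spin covering -/

section GeneralLinear

variable {d : ℕ}

lemma continuous_GL_iff {Z : Type*} [TopologicalSpace Z] {f : Z → GL (Fin d) ℝ} :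
    Continuous f ↔ Continuous fun z => (f z : Matrix (Fin d) (Fin d) ℝ) := by
  refine ⟨fun h => Units.continuous_val.comp h, fun h => Units.continuous_iff.2 ⟨h, ?_⟩⟩
  have : (fun z => ((f z)⁻¹ : GL (Fin d) ℝ).val) = fun z =>
      ((f z : Matrix (Fin d) (Fin d) ℝ).det)⁻¹ • (f z : Matrix (Fin d) (Fin d) ℝ).adjugate := by
    ext1 z
    rw [Matrix.coe_units_inv, Matrix.inv_def, Ring.inverse_eq_inv]
  rw [this]
  refine (h.matrix_det.inv₀ fun z => ?_).smul h.matrix_adjugate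
  exact (Matrix.isUnit_iff_isUnit_det _).1 (f z).isUnit |>.ne_zero

lemma GL_det_ne_zero (g : GL (Fin d) ℝ) : (g : Matrix (Fin d) (Fin d) ℝ).det ≠ 0 :=
  ((Matrix.isUnit_iff_isUnit_det _).1 g.isUnit).ne_zero

/-- An invertible matrix as an element of the general linear group (and `1` for the others). -/
noncomputable def toGL (A : Matrix (Fin d) (Fin d) ℝ) : GL (Fin d) ℝ :=
  open Classical in
  if h : A.det ≠ 0 then Matrix.GeneralLinearGroup.mkOfDetNeZero A h else 1

lemma coe_toGL {A : Matrix (Fin d) (Fin d) ℝ} (h : A.det ≠ 0) : (toGL A : Matrix (Fin d) (Fin d) ℝ) = A := by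
  rw [toGL, dif_pos h]; rfl

lemma toGL_coe (g : GL (Fin d) ℝ) : toGL (g : Matrix (Fin d) (Fin d) ℝ) = g :=
  Units.ext (coe_toGL (GL_det_ne_zero g))

lemma toGL_one : toGL (1 : Matrix (Fin d) (Fin d) ℝ) = 1 := toGL_coe 1

lemma toGL_mul {A B : Matrix (Fin d) (Fin d) ℝ} (hA : A.det ≠ 0) (hB : B.det ≠ 0) :
    toGL (A * B) = toGL A * toGL B := by
  refine Units.ext ?_
  rw [coe_toGL (by rw [det_mul]; exact mul_ne_zero hA hB), Units.val_mul, coe_toGL hA, coe_toGL hB]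

lemma continuousOn_toGL : ContinuousOn (toGL (d := d)) {A | A.det ≠ 0} := by
  rw [continuousOn_iff_continuous_domRestrict, continuous_GL_iff]
  refine continuous_subtype_val.congr fun A => ?_
  exact (coe_toGL A.2).symm

/-- The matrices of positive determinant can be joined by paths of such matrices. -/
lemma exists_path_GL {g h : GL (Fin d) ℝ} (hgh : 0 < (g : Matrix (Fin d) (Fin d) ℝ).det *
      (h : Matrix (Fin d) (Fin d) ℝ).det) :
    ∃ k : C(I, GL (Fin d) ℝ), k 0 = g ∧ k 1 = h := by
  have hp : ((g⁻¹ * h : GL (Fin d) ℝ) : Matrix (Fin d) (Fin d) ℝ) ∈ posDet d := by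
    have e : (g : Matrix (Fin d) (Fin d) ℝ).det * ((g⁻¹ * h : GL (Fin d) ℝ) : Matrix (Fin d) (Fin d) ℝ).det
        = (h : Matrix (Fin d) (Fin d) ℝ).det := by
      rw [← det_mul, ← Units.val_mul, mul_inv_cancel_left]
    rw [← e, ← mul_assoc] at hgh
    exact (pos_iff_pos_of_mul_pos hgh).1 (mul_self_pos.2 (GL_det_ne_zero g))
  obtain ⟨γ, hγ⟩ := (isPathConnected_posDet d).joinedIn _ (one_mem_posDet d) _ hp
  have hne : ∀ t, (γ t).det ≠ 0 := fun t => (show (0:ℝ) < _ from hγ t).ne'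
  refine ⟨⟨fun t => g * toGL (γ t), continuous_const.mul
    (continuousOn_toGL.comp_continuous γ.continuous hne)⟩, ?_, ?_⟩
  · simp [toGL_one]
  · show g * toGL (γ 1) = h
    rw [γ.target, toGL_coe, mul_inv_cancel_left]

end GeneralLinear

/-- A double covering of the positive part of a space `X` on which the general linear group acts
from the right, where a matrix preserves the positive part if and only if its determinant is
positive; orbits are embedded copies of the group, and the covering is connected over the positive
part of every orbit. (The main example is a spin structure on the frame bundle.) -/
structure SpinCover (d : ℕ) (X P : Type*) [TopologicalSpace X] [TopologicalSpace P]
    [MulAction (GL (Fin d) ℝ)ᵐᵒᵖ X] where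
  /-- the positive part of `X` -/
  S : Set X
  /-- the covering map -/
  π : P → S
  isClopen : IsClopen S
  op_smul_mem : ∀ (x : X) (g : GL (Fin d) ℝ), x ∈ S →
    (op g • x ∈ S ↔ 0 < (g : Matrix (Fin d) (Fin d) ℝ).det)
  op_smul_mem_of_neg : ∀ (x : X) (g : GL (Fin d) ℝ), x ∉ S →
    (g : Matrix (Fin d) (Fin d) ℝ).det < 0 → op g • x ∈ S
  isCoveringMap : IsCoveringMap π
  card_fiber : ∀ x, Nat.card (π ⁻¹' {x}) = 2
  isPreconnected : ∀ x ∈ S, IsPreconnected {q : P | ∃ g : GL (Fin d) ℝ, (π q : X) = op g • x}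
  exists_coord : ∀ x, ∃ φ : X → GL (Fin d) ℝ,
    ContinuousOn φ {y | ∃ g : GL (Fin d) ℝ, y = op g • x} ∧ ∀ g : GL (Fin d) ℝ, φ (op g • x) = g

lemma exists_det_neg (d : ℕ) :
    ∃ g : GL (Fin (d + 1)) ℝ, (g : Matrix (Fin (d + 1)) (Fin (d + 1)) ℝ).det < 0 := by
  have h : (reflZero d).det ≠ 0 := by rw [det_reflZero]; norm_num
  exact ⟨toGL (reflZero d), by rw [coe_toGL h, det_reflZero]; norm_num⟩

namespace SpinCover

variable {d : ℕ} {X P : Type*} [TopologicalSpace X] [TopologicalSpace P]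
  [MulAction (GL (Fin d) ℝ)ᵐᵒᵖ X] (C : SpinCover d X P)

/-- `γ` is a lift of the path `c`, after moving `c` by the constant matrix `g`. -/
def IsLift (g : GL (Fin d) ℝ) (γ : C(I, P)) (c : C(I, X)) : Prop :=
  ∀ t, (C.π (γ t) : X) = op g • c t

/-- The monodromy of the double covering along a loop: `0` if and only if the loop lifts to a
loop, after moving it to the positive part by some matrix. -/
noncomputable def mon (c : C(I, X)) : ZMod 2 :=
  open Classical in if ∃ g γ, C.IsLift g γ c ∧ γ 0 = γ 1 then 0 else 1

variable {C}

lemma exists_op_smul_mem (hd : 0 < d) (x : X) : ∃ g : GL (Fin d) ℝ, op g • x ∈ C.S := by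
  by_cases hx : x ∈ C.S
  · exact ⟨1, by simpa using hx⟩
  · obtain ⟨d, rfl⟩ : ∃ e, d = e + 1 := ⟨d - 1, by omega⟩
    obtain ⟨g, hg⟩ := exists_det_neg d
    exact ⟨g, C.op_smul_mem_of_neg x g hx hg⟩

lemma exists_preimage (x : X) (hx : x ∈ C.S) : ∃ q, C.π q = ⟨x, hx⟩ := by
  have : 0 < Nat.card (C.π ⁻¹' {⟨x, hx⟩}) := by rw [C.card_fiber]; norm_num
  obtain ⟨q, hq⟩ := (Nat.card_pos_iff.1 this).1
  exact ⟨q, hq⟩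

/-- Of three points in a fibre, two agree. -/
lemma eq_of_ne_of_ne {a b c : P} (hab : C.π a = C.π b) (hbc : C.π b = C.π c) (h1 : a ≠ b)
    (h2 : b ≠ c) : a = c := by
  have h := Nat.card_eq_two_iff' (⟨b, rfl⟩ : C.π ⁻¹' {C.π b}) |>.1 (C.card_fiber _)
  have := h.unique (y₁ := ⟨a, hab⟩) (y₂ := ⟨c, hbc.symm⟩) (fun h => h1 (congrArg Subtype.val h))
    (fun h => h2 (congrArg Subtype.val h).symm)
  exact congrArg Subtype.val this

/-- Lifts of the same map from a connected space which agree somewhere agree. -/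
lemma eq_of_isLift {A : Type*} [TopologicalSpace A] [PreconnectedSpace A] {α β : A → P}
    (hα : Continuous α) (hβ : Continuous β) (h : ∀ a, (C.π (α a) : X) = C.π (β a)) (a b : A)
    (hab : α a = β a) : α b = β b :=
  congrFun (C.isCoveringMap.eq_of_comp_eq hα hβ (funext fun a => Subtype.ext (h a)) a hab) b

/-- Whether a lift of a loop is closed does not change under a homotopy of loops. -/
lemma closed_iff_of_square (K : C(I × I, P)) (h : ∀ s, (C.π (K (s, 0)) : X) = C.π (K (s, 1))) :
    K (0, 0) = K (0, 1) ↔ K (1, 0) = K (1, 1) :=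
  ⟨eq_of_isLift (α := fun s => K (s, 0)) (β := fun s => K (s, 1)) (by fun_prop) (by fun_prop) h 0 1,
    eq_of_isLift (α := fun s => K (s, 0)) (β := fun s => K (s, 1)) (by fun_prop) (by fun_prop) h 1 0⟩

/-- Two lifts of a loop, moved by the same matrix, are both closed or both not closed. -/
lemma closed_of_closed_aux {c : C(I, X)} (hc : c 0 = c 1) {g : GL (Fin d) ℝ} {γ γ' : C(I, P)}
    (h : C.IsLift g γ c) (h' : C.IsLift g γ' c) (h0 : γ 0 = γ 1) : γ' 0 = γ' 1 := by
  by_contra hne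
  have e01 : C.π (γ' 0) = C.π (γ' 1) := Subtype.ext (by rw [h' 0, h' 1, hc])
  have e : ∀ t, C.π (γ t) = C.π (γ' t) := fun t => Subtype.ext (by rw [h t, h' t])
  have key : ∀ a b, γ a = γ' a → γ b = γ' b := eq_of_isLift γ.continuous γ'.continuous
    fun t => by rw [e t]
  by_cases h00 : γ 0 = γ' 0
  · exact hne (by rw [← h00, h0, key 0 1 h00])
  · -- the third point in the fibre would be `γ' 1`
    have h3 := eq_of_ne_of_ne (e 0) e01 h00 hne
    exact h00 (key 1 0 (h0 ▸ h3))

variable [ContinuousSMul (GL (Fin d) ℝ)ᵐᵒᵖ X]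

/-- Squares lift to the double covering. -/
lemma exists_square_lift (H : C(I × I, X)) (g : GL (Fin d) ℝ) (q : P)
    (hq : (C.π q : X) = op g • H (0, 0)) :
    ∃ K : C(I × I, P), (∀ x, (C.π (K x) : X) = op g • H x) ∧ K (0, 0) = q := by
  have hmem : ∀ x, op g • H x ∈ C.S := by
    have hc : Continuous fun x => op g • H x := by fun_prop
    have := (C.isClopen.preimage hc).eq_univ ⟨(0, 0), by rw [Set.mem_preimage, ← hq]; exact (C.π q).2⟩
    exact fun x => (this.symm.subset (Set.mem_univ x) : _)
  let H' : C(I × I, C.S) := ⟨fun x => ⟨op g • H x, hmem x⟩, by fun_prop⟩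
  let γ : C(I, C.S) := ⟨fun t => H' (0, t), by fun_prop⟩
  have hγ : γ 0 = C.π q := Subtype.ext hq.symm
  let Γ := C.isCoveringMap.liftPath γ q hγ
  have hΓ : ∀ t, H' (0, t) = C.π (Γ t) := fun t =>
    (congrFun (C.isCoveringMap.liftPath_lifts γ q hγ) t).symm
  refine ⟨C.isCoveringMap.liftHomotopy H' Γ hΓ, fun x => ?_, ?_⟩
  · have := congrFun (C.isCoveringMap.liftHomotopy_lifts H' Γ hΓ) x
    exact congrArg Subtype.val this
  · rw [C.isCoveringMap.liftHomotopy_zero]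
    exact C.isCoveringMap.liftPath_zero γ q hγ

lemma exists_lift (c : C(I, X)) (g : GL (Fin d) ℝ) (q : P) (hq : (C.π q : X) = op g • c 0) :
    ∃ γ, C.IsLift g γ c ∧ γ 0 = q := by
  obtain ⟨K, hK, hK0⟩ := exists_square_lift (c.comp ⟨Prod.snd, continuous_snd⟩ : C(I × I, X)) g q hq
  exact ⟨K.comp ⟨fun t => (0, t), by fun_prop⟩, fun t => hK (0, t), hK0⟩

lemma exists_isLift (hd : 0 < d) (c : C(I, X)) : ∃ g γ, C.IsLift g γ c := by
  obtain ⟨g, hg⟩ := exists_op_smul_mem (C := C) hd (c 0)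
  obtain ⟨q, hq⟩ := exists_preimage _ hg
  obtain ⟨γ, hγ, -⟩ := exists_lift c g q (by rw [hq])
  exact ⟨g, γ, hγ⟩

/-- Whether the lifts of a loop are closed does not depend on the matrix moving the loop to the
positive part: two such matrices are joined by a path. -/
lemma closed_of_closed {c : C(I, X)} (hc : c 0 = c 1) {g g' : GL (Fin d) ℝ} {γ γ' : C(I, P)}
    (h : C.IsLift g γ c) (h' : C.IsLift g' γ' c) (h0 : γ 0 = γ 1) : γ' 0 = γ' 1 := by
  have hdet : 0 < (g : Matrix (Fin d) (Fin d) ℝ).det * (g' : Matrix (Fin d) (Fin d) ℝ).det := by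
    have h1 : op g • c 0 ∈ C.S := h 0 ▸ (C.π (γ 0)).2
    have h2 : op (g⁻¹ * g') • op g • c 0 ∈ C.S := by
      rw [smul_smul, ← op_mul, mul_inv_cancel_left, ← h' 0]; exact (C.π (γ' 0)).2
    have h3 := (C.op_smul_mem _ _ h1).1 h2
    have e : (g : Matrix (Fin d) (Fin d) ℝ).det * ((g⁻¹ * g' : GL (Fin d) ℝ) : Matrix (Fin d) (Fin d) ℝ).det
        = (g' : Matrix (Fin d) (Fin d) ℝ).det := by
      rw [← det_mul, ← Units.val_mul, mul_inv_cancel_left]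
    rw [← e, ← mul_assoc]
    exact mul_pos (mul_self_pos.2 (GL_det_ne_zero g)) h3
  obtain ⟨k, hk0, hk1⟩ := exists_path_GL hdet
  let H : C(I × I, X) := ⟨fun x => op (k x.1) • c x.2,
    (continuous_op.comp (k.continuous.comp continuous_fst)).smul (c.continuous.comp continuous_snd)⟩
  obtain ⟨K, hK, hK0⟩ := exists_square_lift H 1 (γ 0) (by rw [h 0]; simp [H, hk0])
  have hH : ∀ x, (C.π (K x) : X) = op (k x.1) • c x.2 := fun x => by rw [hK]; simp [H]
  have hγ : ∀ t, K (0, t) = γ t := fun t =>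
    eq_of_isLift (α := fun t => K (0, t)) (by fun_prop) γ.continuous
      (fun t => by rw [hH, h t, hk0]) 0 t hK0
  have h1 := (closed_iff_of_square K fun s => by rw [hH, hH, hc]).1 (by rw [hγ, hγ, h0])
  exact closed_of_closed_aux hc (γ := K.comp ⟨fun t => (1, t), by fun_prop⟩)
    (fun t => by simp [hH, hk1]) h' h1

lemma mon_eq_zero_iff {c : C(I, X)} (hc : c 0 = c 1) {g : GL (Fin d) ℝ} {γ : C(I, P)}
    (h : C.IsLift g γ c) : C.mon c = 0 ↔ γ 0 = γ 1 := by
  rw [mon]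
  split_ifs with h1
  · obtain ⟨g', γ', h', h0⟩ := h1
    exact iff_of_true rfl (closed_of_closed hc h' h h0)
  · exact iff_of_false one_ne_zero fun h0 => h1 ⟨g, γ, h, h0⟩

lemma eq_iff_eq_zero_iff (a b : ZMod 2) : a = b ↔ (a = 0 ↔ b = 0) := by
  revert a b; decide

/-- The monodromy is invariant under homotopies of loops. -/
lemma mon_homotopy (hd : 0 < d) (H : C(I × I, X)) (h : ∀ s, H (s, 0) = H (s, 1)) :
    C.mon (H.comp ⟨fun t => (0, t), by fun_prop⟩) = C.mon (H.comp ⟨fun t => (1, t), by fun_prop⟩) := by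
  obtain ⟨g, hg⟩ := exists_op_smul_mem (C := C) hd (H (0, 0))
  obtain ⟨q, hq⟩ := exists_preimage _ hg
  obtain ⟨K, hK, hK0⟩ := exists_square_lift H g q (by rw [hq])
  rw [eq_iff_eq_zero_iff,
    mon_eq_zero_iff (h 0) (γ := K.comp ⟨fun t => (0, t), by fun_prop⟩) (fun t => hK (0, t)),
    mon_eq_zero_iff (h 1) (γ := K.comp ⟨fun t => (1, t), by fun_prop⟩) (fun t => hK (1, t))]
  exact closed_iff_of_square K fun s => by rw [hK, hK, h]

/-- The path `c` moved by a path `w` of matrices. -/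
def mulPath (c : C(I, X)) (w : C(I, GL (Fin d) ℝ)) : C(I, X) :=
  ⟨fun t => op (w t) • c t, (continuous_op.comp w.continuous).smul c.continuous⟩

@[simp] lemma mulPath_apply (c : C(I, X)) (w : C(I, GL (Fin d) ℝ)) (t : I) :
    mulPath c w t = op (w t) • c t := rfl

lemma mon_mulPath_const (hd : 0 < d) {c : C(I, X)} (hc : c 0 = c 1) (g : GL (Fin d) ℝ) :
    C.mon (mulPath c (.const I g)) = C.mon c := by
  obtain ⟨g', γ, hγ⟩ := exists_isLift (C := C) hd c
  rw [eq_iff_eq_zero_iff, mon_eq_zero_iff hc hγ, mon_eq_zero_iff (by simp [hc])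
    (g := g⁻¹ * g') (γ := γ) fun t => ?_]
  rw [hγ t, mulPath_apply, smul_smul, ← op_mul, ContinuousMap.const_apply, mul_inv_cancel_left]

lemma mon_const (hd : 0 < d) (x : X) : C.mon (.const I x) = 0 := by
  obtain ⟨g, hg⟩ := exists_op_smul_mem (C := C) hd x
  obtain ⟨q, hq⟩ := exists_preimage _ hg
  rw [mon_eq_zero_iff rfl (g := g) (γ := .const I q) fun t => by simp [hq]]
  rfl

/-- Moving a loop by a loop of matrices adds the monodromies. -/
lemma mon_mulPath (hd : 0 < d) {c : C(I, X)} (hc : c 0 = c 1) {w : C(I, GL (Fin d) ℝ)}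
    (hw0 : w 0 = 1) (hw1 : w 1 = 1) :
    C.mon (mulPath c w) = C.mon c + C.mon (mulPath (.const I (c 0)) w) := by
  obtain ⟨g, hg⟩ := exists_op_smul_mem (C := C) hd (c 0)
  obtain ⟨q, hq⟩ := exists_preimage _ hg
  -- the sides of the square are `c` and the loop of `w` at `c 0`, and the diagonal is their product
  let H : C(I × I, X) := ⟨fun x => op (w x.2) • c x.1,
    (continuous_op.comp (w.continuous.comp continuous_snd)).smul (c.continuous.comp continuous_fst)⟩
  obtain ⟨K, hK, hK0⟩ := exists_square_lift H g q (by rw [hq]; simp [H, hw0])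
  have hH : ∀ x, (C.π (K x) : X) = op g • op (w x.2) • c x.1 := hK
  have e1 := mon_eq_zero_iff (C := C) hc (γ := K.comp ⟨fun t => (t, 0), by fun_prop⟩) (g := g)
    fun t => by simp [hH, hw0]
  have e2 := mon_eq_zero_iff (C := C) (c := mulPath (.const I (c 0)) w) (by simp [hw0, hw1])
    (γ := K.comp ⟨fun t => (1, t), by fun_prop⟩) (g := g) fun t => by simp [hH, hc]
  have e3 := mon_eq_zero_iff (C := C) (c := mulPath c w) (by simp [hw0, hw1, hc])
    (γ := K.comp ⟨fun t => (t, t), by fun_prop⟩) (g := g) fun t => by simp [hH]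
  simp only [ContinuousMap.comp_apply, ContinuousMap.coe_mk] at e1 e2 e3
  have f1 : C.π (K (0, 0)) = C.π (K (1, 0)) := Subtype.ext (by rw [hH, hH, hc])
  have f2 : C.π (K (1, 0)) = C.π (K (1, 1)) := Subtype.ext (by rw [hH, hH, hw0, hw1])
  have key : K (0, 0) = K (1, 1) ↔ (K (0, 0) = K (1, 0) ↔ K (1, 0) = K (1, 1)) := by
    constructor
    · intro h; rw [h]; exact eq_comm
    · intro h
      by_cases h1 : K (0, 0) = K (1, 0)
      · rw [h1, h.1 h1]
      · exact eq_of_ne_of_ne f1 f2 h1 fun h2 => h1 (h.2 h2)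
  rw [← e1, ← e2, ← e3] at key
  generalize C.mon (mulPath c w) = a at key ⊢
  generalize C.mon c = b at key ⊢
  generalize C.mon (mulPath (.const I (c 0)) w) = c at key ⊢
  revert a b c; decide

end SpinCover

/-! ### The monodromy of a full turn in one plane -/

namespace SpinCover

variable {X P : Type*} [TopologicalSpace X] [TopologicalSpace P]

/-- The loop of rotations in the plane of the last two coordinates. -/
noncomputable def lastRotLoop (n : ℕ) : C(I, GL (Fin (n + 2)) ℝ) :=
  ⟨fun t => toGL (lastRot n (2 * Real.pi * t)), continuousOn_toGL.comp_continuous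
    ((continuous_lastRot n).comp (by fun_prop)) fun t => by simp [det_lastRot]⟩

lemma coe_lastRotLoop (n : ℕ) (t : I) :
    (lastRotLoop n t : Matrix _ _ ℝ) = lastRot n (2 * Real.pi * t) :=
  coe_toGL (by simp [det_lastRot])

lemma lastRot_zero : ∀ n : ℕ, lastRot n 0 = 1
  | 0 => by ext i k; fin_cases i <;> fin_cases k <;> simp [lastRot]
  | n + 1 => by
    rw [lastRot, lastRot_zero n]
    ext i k
    refine Fin.cases ?_ (fun i => ?_) i <;> refine Fin.cases ?_ (fun k => ?_) k <;>
      simp [one_apply, Fin.succ_ne_zero, eq_comm]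

lemma lastRot_two_pi : ∀ n : ℕ, lastRot n (2 * Real.pi) = 1
  | 0 => by ext i k; fin_cases i <;> fin_cases k <;> simp [lastRot]
  | n + 1 => by
    rw [lastRot, lastRot_two_pi n]
    ext i k
    refine Fin.cases ?_ (fun i => ?_) i <;> refine Fin.cases ?_ (fun k => ?_) k <;>
      simp [one_apply, Fin.succ_ne_zero, eq_comm]

lemma lastRotLoop_zero (n : ℕ) : lastRotLoop n 0 = 1 :=
  Units.ext (by rw [coe_lastRotLoop]; simp [lastRot_zero])

lemma lastRotLoop_one (n : ℕ) : lastRotLoop n 1 = 1 :=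
  Units.ext (by rw [coe_lastRotLoop]; simp [lastRot_two_pi])

/-- A reflection of the last coordinate inverts the rotations. -/
lemma exists_reflect_lastRot : ∀ n : ℕ, ∃ A : Matrix (Fin (n + 2)) (Fin (n + 2)) ℝ, A.det = -1 ∧
    ∀ θ, A * lastRot n θ * A * lastRot n θ = 1
  | 0 => by
    refine ⟨!![1, 0; 0, -1], ?_, fun θ => ?_⟩
    · have : (!![1, 0; 0, -1] : Matrix (Fin 2) (Fin 2) ℝ).det = -1 := by
        rw [det_fin_two_of]; norm_num
      exact this
    · have h : (!![1, 0; 0, -1] * !![Real.cos θ, -Real.sin θ; Real.sin θ, Real.cos θ] *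
          !![1, 0; 0, -1] * !![Real.cos θ, -Real.sin θ; Real.sin θ, Real.cos θ] :
          Matrix (Fin 2) (Fin 2) ℝ) = 1 := by
        have := Real.sin_sq_add_cos_sq θ
        ext i k
        fin_cases i <;> fin_cases k <;>
          simp [Matrix.mul_apply, Fin.sum_univ_two] <;> nlinarith
      exact h
  | n + 1 => by
    obtain ⟨A, hA, hAR⟩ := exists_reflect_lastRot n
    refine ⟨oneBlock A, by rw [det_oneBlock, hA], fun θ => ?_⟩
    rw [lastRot, ← oneBlock_mul, ← oneBlock_mul, ← oneBlock_mul, hAR]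
    ext i k
    refine Fin.cases ?_ (fun i => ?_) i <;> refine Fin.cases ?_ (fun k => ?_) k <;>
      simp [one_apply, Fin.succ_ne_zero, eq_comm]

variable {n : ℕ} [MulAction (GL (Fin (n + 2)) ℝ)ᵐᵒᵖ X] [ContinuousSMul (GL (Fin (n + 2)) ℝ)ᵐᵒᵖ X]
  (C : SpinCover (n + 2) X P)

/-- Over the positive part, the rotation loop has nontrivial monodromy: otherwise the covering
would have a section over the orbit, contradicting connectedness. -/
lemma mon_lastRotLoop_of_mem {x : X} (hx : x ∈ C.S) :
    C.mon (mulPath (.const I x) (lastRotLoop n)) = 1 := by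
  by_contra hne
  have h0 : C.mon (mulPath (.const I x) (lastRotLoop n)) = 0 := by
    revert hne; generalize C.mon (mulPath (.const I x) (lastRotLoop n)) = a; revert a; decide
  -- the orbit map of `x`, on the matrices of positive determinant
  have hmem : ∀ A ∈ posDet (n + 2), op (toGL A) • x ∈ C.S := fun A hA =>
    (C.op_smul_mem x _ hx).2 (by rw [coe_toGL (det_ne_zero_of_mem hA)]; exact hA)
  obtain ⟨f, hf⟩ : ∃ f : Matrix (Fin (n + 2)) (Fin (n + 2)) ℝ → C.S,
      ∀ A, A ∈ posDet (n + 2) → (f A : X) = op (toGL A) • x := by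
    have : ∀ A, ∃ y : C.S, A ∈ posDet (n + 2) → (y : X) = op (toGL A) • x := fun A => by
      by_cases hA : A ∈ posDet (n + 2)
      · exact ⟨⟨_, hmem A hA⟩, fun _ => rfl⟩
      · exact ⟨⟨x, hx⟩, fun h => absurd h hA⟩
    choose f hf using this
    exact ⟨f, hf⟩
  have hfc : ContinuousOn f (posDet (n + 2)) := by
    rw [continuousOn_iff_continuous_domRestrict, continuous_induced_rng]
    have h1 : Continuous fun A : posDet (n + 2) =>
        toGL (A : Matrix (Fin (n + 2)) (Fin (n + 2)) ℝ) :=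
      continuousOn_toGL.comp_continuous continuous_subtype_val fun A => det_ne_zero_of_mem A.2
    have : Continuous fun A : posDet (n + 2) =>
        op (toGL (A : Matrix (Fin (n + 2)) (Fin (n + 2)) ℝ)) • x :=
      (continuous_op.comp h1).smul continuous_const
    exact this.congr fun A => (hf A A.2).symm
  -- the rotation loop at another point of the orbit is homotopic to the one at `x`
  have hrot : ∀ A ∈ posDet (n + 2), ∀ γ : C(I, P),
      (∀ t : I, C.π (γ t) = f (A * lastRot n (2 * Real.pi * t))) → γ 0 = γ 1 := by
    intro A hA γ hγ
    have hγ' : ∀ t, (C.π (γ t) : X) = op (lastRotLoop n t) • op (toGL A) • x := by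
      intro t
      rw [hγ, hf _ (mul_mem_posDet hA (by simp [posDet, det_lastRot])), smul_smul, ← op_mul,
        toGL_mul (det_ne_zero_of_mem hA) (by simp [det_lastRot])]
      rfl
    obtain ⟨k, hk0, hk1⟩ := exists_path_GL (g := 1) (h := toGL A)
      (by rw [coe_toGL (det_ne_zero_of_mem hA)]; simpa [posDet] using hA)
    let H : C(I × I, X) := ⟨fun y => op (lastRotLoop n y.2) • op (k y.1) • x,
      (continuous_op.comp ((lastRotLoop n).continuous.comp continuous_snd)).smul
        ((continuous_op.comp (k.continuous.comp continuous_fst)).smul continuous_const)⟩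
    have hH := mon_homotopy (C := C) (by omega) H fun s => by
      simp [H, lastRotLoop_zero, lastRotLoop_one]
    have e0 : H.comp ⟨fun t => (0, t), by fun_prop⟩ = mulPath (.const I x) (lastRotLoop n) := by
      ext t; simp [H, hk0]
    rw [e0, h0] at hH
    refine (mon_eq_zero_iff (C := C) (c := H.comp ⟨fun t => (1, t), by fun_prop⟩) ?_ (g := 1)
      fun t => ?_).1 hH.symm
    · simp [H, lastRotLoop_zero, lastRotLoop_one]
    · simp [H, hk1, hγ']
  obtain ⟨q₀, hq₀⟩ := exists_preimage (C := C) x hx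
  have hf1 : C.π q₀ = f 1 := by
    rw [hq₀]; exact Subtype.ext (by rw [hf 1 (one_mem_posDet _), toGL_one, op_one, one_smul])
  -- the lift `F` of the orbit map gives a section of the covering over the orbit
  obtain ⟨F, hFc, hFl, hF0⟩ := hasLiftsOn_posDet C.isCoveringMap n f hfc hrot 1 (one_mem_posDet _)
    q₀ hf1
  obtain ⟨φ, hφc, hφ⟩ := C.exists_coord x
  have hφmem : ∀ q, (∃ g : GL (Fin (n + 2)) ℝ, (C.π q : X) = op g • x) →
      ((φ (C.π q) : GL (Fin (n + 2)) ℝ) : Matrix _ _ ℝ) ∈ posDet (n + 2) := by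
    rintro q ⟨g, hg⟩
    rw [hg, hφ]
    exact (C.op_smul_mem x g hx).1 (hg ▸ (C.π q).2)
  have hcont : ContinuousOn (fun q => F (φ (C.π q) : GL (Fin (n + 2)) ℝ))
      {q : P | ∃ g : GL (Fin (n + 2)) ℝ, (C.π q : X) = op g • x} := by
    refine hFc.comp (Units.continuous_val.comp_continuousOn (hφc.comp ?_ ?_)) fun q hq => hφmem q hq
    · exact (continuous_subtype_val.comp C.isCoveringMap.continuous).continuousOn
    · exact fun q hq => hq
  have hq₀m : q₀ ∈ {q : P | ∃ g : GL (Fin (n + 2)) ℝ, (C.π q : X) = op g • x} :=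
    ⟨1, by simp [hq₀]⟩
  have hF1 : F (φ x : GL (Fin (n + 2)) ℝ) = q₀ := by
    have := hφ 1
    rw [op_one, one_smul] at this
    rw [this]; exact hF0
  -- since the covering is connected over the orbit, the section composed with the projection is the
  -- identity
  have hEq := C.isCoveringMap.eqOn_of_comp_eqOn (C.isPreconnected x hx) hcont continuousOn_id
    (fun q hq => by
      obtain ⟨g, hg⟩ := hq
      have hm := hφmem q ⟨g, hg⟩
      refine Subtype.ext ?_
      rw [Function.comp_apply, hFl _ hm, hf _ hm, toGL_coe, hg, hφ, Function.comp_apply, id, hg])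
    hq₀m (by simp [hq₀, hF1])
  -- hence the fibre over `x` is a single point
  obtain ⟨q₁, hq₁, -⟩ := (Nat.card_eq_two_iff' (⟨q₀, hq₀⟩ : C.π ⁻¹' {⟨x, hx⟩})).1 (C.card_fiber _)
  refine hq₁ (Subtype.ext ?_)
  have h1 : (C.π q₁.1 : X) = x := congrArg Subtype.val q₁.2
  have := hEq (show q₁.1 ∈ _ from ⟨1, by simp [h1]⟩)
  simp only [h1, id] at this
  rw [← this, hF1]

/-- The rotation loop has nontrivial monodromy at every point. -/
lemma mon_lastRotLoop (x : X) : C.mon (mulPath (.const I x) (lastRotLoop n)) = 1 := by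
  by_cases hx : x ∈ C.S
  · exact C.mon_lastRotLoop_of_mem hx
  -- a reflection moves `x` to the positive part, and conjugates the loop to its inverse
  · obtain ⟨g, hg, hgR⟩ : ∃ g : GL (Fin (n + 2)) ℝ, (g : Matrix (Fin (n + 2)) (Fin (n + 2)) ℝ).det < 0 ∧
        ∀ t, g * lastRotLoop n t * g = (lastRotLoop n t)⁻¹ := by
      obtain ⟨A, hA, hAR⟩ := exists_reflect_lastRot n
      refine ⟨toGL A, by rw [coe_toGL (by rw [hA]; norm_num), hA]; norm_num, fun t => ?_⟩
      refine eq_inv_of_mul_eq_one_left (Units.ext ?_)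
      simp only [Units.val_mul, coe_toGL (show A.det ≠ 0 by rw [hA]; norm_num), coe_lastRotLoop,
        Units.val_one]
      exact hAR _
    have hgg : g * g = 1 := by simpa [lastRotLoop_zero] using hgR 0
    have h1 := C.mon_lastRotLoop_of_mem (C.op_smul_mem_of_neg x g hx hg)
    have h2 := mon_mulPath_const (C := C) (by omega) (c := mulPath (.const I x) (lastRotLoop n))
      (by simp [lastRotLoop_zero, lastRotLoop_one]) g
    let R' : C(I, GL (Fin (n + 2)) ℝ) := ⟨fun t => (lastRotLoop n t)⁻¹, by fun_prop⟩
    have h3 : mulPath (mulPath (.const I x) (lastRotLoop n)) (.const I g) =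
        mulPath (.const I (op g • x)) R' := by
      ext t
      simp only [mulPath_apply, ContinuousMap.const_apply, smul_smul, ← op_mul]
      congr 2
      show lastRotLoop n t * g = g * (lastRotLoop n t)⁻¹
      rw [← hgR, ← mul_assoc, ← mul_assoc, hgg, one_mul]
    have h4 := mon_mulPath (C := C) (by omega) (c := mulPath (.const I (op g • x)) R')
      (by simp [R', lastRotLoop_zero, lastRotLoop_one]) (w := lastRotLoop n)
      (lastRotLoop_zero n) (lastRotLoop_one n)
    have h5 : mulPath (mulPath (.const I (op g • x)) R') (lastRotLoop n) =
        .const I (op g • x) := by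
      ext t
      simp [smul_smul, R']
    have h6 : mulPath (.const I (op g • x)) R' 0 = op g • x := by simp [R', lastRotLoop_zero]
    rw [h5, h6, h1, mon_const (C := C) (by omega)] at h4
    rw [h3] at h2
    rw [← h2]
    revert h4
    generalize C.mon (mulPath (.const I (op g • x)) R') = a
    revert a; decide

end SpinCover

/-! ### Rotations of the coordinate planes -/

section RotMat

variable {m : ℕ}

/-- Numbering of the coordinates of `m` planes: the `j`-th plane has coordinates `2 j`, `2 j + 1`.
-/
def pairEquiv (m : ℕ) : Fin 2 × Fin m ≃ Fin (2 * m) where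
  toFun p := ⟨2 * p.2 + p.1, by omega⟩
  invFun i := (⟨i % 2, by omega⟩, ⟨i / 2, by omega⟩)
  left_inv p := by ext <;> simp <;> omega
  right_inv i := by ext; simp; omega

/-- The rotation of the `j`-th coordinate plane by the angle `θ j`, for all `j`. -/
noncomputable def rotMat (θ : Fin m → ℝ) : Matrix (Fin (2 * m)) (Fin (2 * m)) ℝ :=
  reindex (pairEquiv m) (pairEquiv m) (blockDiagonal fun j =>
    !![Real.cos (θ j), -Real.sin (θ j); Real.sin (θ j), Real.cos (θ j)])

lemma rotMat_apply (θ : Fin m → ℝ) (a b : Fin 2) (i j : Fin m) :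
    rotMat θ (pairEquiv m (a, i)) (pairEquiv m (b, j)) = if i = j then
      !![Real.cos (θ i), -Real.sin (θ i); Real.sin (θ i), Real.cos (θ i)] a b else 0 := by
  simp [rotMat, blockDiagonal_apply]

lemma rotMat_add (θ η : Fin m → ℝ) : rotMat (θ + η) = rotMat θ * rotMat η := by
  rw [rotMat, rotMat, rotMat, reindex_apply, reindex_apply, reindex_apply, submatrix_mul_equiv,
    ← blockDiagonal_mul]
  congr 2
  ext1 j
  ext a b
  fin_cases a <;> fin_cases b <;>
    simp [Matrix.mul_apply, Fin.sum_univ_two, Real.cos_add, Real.sin_add] <;> ring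

lemma rotMat_zero : rotMat (0 : Fin m → ℝ) = 1 := by
  have : (fun j : Fin m => !![Real.cos ((0 : Fin m → ℝ) j), -Real.sin ((0 : Fin m → ℝ) j);
      Real.sin ((0 : Fin m → ℝ) j), Real.cos ((0 : Fin m → ℝ) j)]) = 1 := by
    ext j a b
    fin_cases a <;> fin_cases b <;> simp
  rw [rotMat, this, blockDiagonal_one]
  simp

lemma det_rotMat (θ : Fin m → ℝ) : (rotMat θ).det = 1 := by
  rw [rotMat, det_reindex_self, det_blockDiagonal]
  refine Finset.prod_eq_one fun j _ => ?_
  rw [det_fin_two_of]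
  nlinarith [Real.sin_sq_add_cos_sq (θ j)]

lemma continuous_rotMat : Continuous (rotMat (m := m)) := by
  refine continuous_matrix fun i k => ?_
  obtain ⟨⟨a, i⟩, rfl⟩ := (pairEquiv m).surjective i
  obtain ⟨⟨b, k⟩, rfl⟩ := (pairEquiv m).surjective k
  simp only [rotMat_apply]
  split_ifs
  · fin_cases a <;> fin_cases b <;> simp <;> fun_prop
  · fun_prop

/-- `rotMat` as an element of the general linear group. -/
noncomputable def rotGL (θ : Fin m → ℝ) : GL (Fin (2 * m)) ℝ := toGL (rotMat θ)

lemma coe_rotGL (θ : Fin m → ℝ) : (rotGL θ : Matrix (Fin (2 * m)) (Fin (2 * m)) ℝ) = rotMat θ :=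
  coe_toGL (by simp [det_rotMat])

lemma rotGL_add (θ η : Fin m → ℝ) : rotGL (θ + η) = rotGL θ * rotGL η :=
  Units.ext (by rw [Units.val_mul, coe_rotGL, coe_rotGL, coe_rotGL, rotMat_add])

lemma rotGL_zero : rotGL (0 : Fin m → ℝ) = 1 :=
  Units.ext (by rw [coe_rotGL, rotMat_zero, Units.val_one])

lemma rotGL_neg (θ : Fin m → ℝ) : rotGL (-θ) = (rotGL θ)⁻¹ := by
  rw [eq_inv_iff_mul_eq_one, ← rotGL_add, neg_add_cancel, rotGL_zero]

lemma continuous_rotGL : Continuous (rotGL (m := m)) :=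
  continuous_GL_iff.2 (continuous_rotMat.congr fun θ => (coe_rotGL θ).symm)

/-- The effect of a permutation of the planes. -/
lemma rotMat_comp_perm (θ : Fin m → ℝ) (ρ : Equiv.Perm (Fin m)) :
    rotMat (θ ∘ ρ) = (rotMat θ).submatrix ((pairEquiv m).permCongr (.prodCongr (.refl _) ρ))
      ((pairEquiv m).permCongr (.prodCongr (.refl _) ρ)) := by
  ext i k
  obtain ⟨⟨a, i⟩, rfl⟩ := (pairEquiv m).surjective i
  obtain ⟨⟨b, k⟩, rfl⟩ := (pairEquiv m).surjective k
  simp [rotMat_apply, Equiv.permCongr_apply]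

/-- The loop of rotations which winds `l j` times in the `j`-th plane. -/
noncomputable def intLoop (l : Fin m → ℤ) : C(I, GL (Fin (2 * m)) ℝ) :=
  ⟨fun t => rotGL fun j => 2 * Real.pi * t * l j, continuous_rotGL.comp (by fun_prop)⟩

lemma intLoop_apply (l : Fin m → ℤ) (t : I) :
    intLoop l t = rotGL fun j => 2 * Real.pi * t * l j := rfl

lemma rotMat_two_pi (l : Fin m → ℤ) : rotMat (fun j => 2 * Real.pi * l j) = 1 := by
  rw [← rotMat_zero, rotMat, rotMat]
  congr 3
  ext1 j
  rw [mul_comm, Real.cos_int_mul_two_pi, ← sub_zero ((l j : ℝ) * (2 * Real.pi)),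
    ← zero_sub, ← zero_sub, Real.sin_sub, Real.cos_int_mul_two_pi]
  have : Real.sin ((l j : ℝ) * (2 * Real.pi)) = 0 := by
    have := Real.sin_int_mul_pi (l j * 2)
    push_cast at this
    rw [← this]; ring_nf
  simp [this]

lemma rotGL_two_pi (l : Fin m → ℤ) : rotGL (fun j => 2 * Real.pi * l j) = 1 :=
  Units.ext (by rw [coe_rotGL, rotMat_two_pi, Units.val_one])

lemma intLoop_zero (l : Fin m → ℤ) : intLoop l 0 = 1 := by
  rw [intLoop_apply, ← rotGL_zero]; congr 1; ext; simp

lemma intLoop_one (l : Fin m → ℤ) : intLoop l 1 = 1 := by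
  rw [intLoop_apply, ← rotGL_two_pi l]; simp

lemma lastRot_apply (θ : ℝ) : ∀ (n : ℕ) (i k : Fin (n + 2)), lastRot n θ i k =
    if (i : ℕ) = n then (if (k : ℕ) = n then Real.cos θ else if (k : ℕ) = n + 1 then -Real.sin θ else 0)
    else if (i : ℕ) = n + 1 then
      (if (k : ℕ) = n then Real.sin θ else if (k : ℕ) = n + 1 then Real.cos θ else 0)
    else if (i : ℕ) = k then 1 else 0
  | 0, i, k => by fin_cases i <;> fin_cases k <;> simp [lastRot]
  | n + 1, i, k => by
    rw [lastRot]
    refine Fin.cases ?_ (fun i => ?_) i <;> refine Fin.cases ?_ (fun k => ?_) k <;>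
      simp [lastRot_apply θ n]

/-- The rotation of the last plane only. -/
lemma rotMat_single_last (θ : ℝ) :
    rotMat (Pi.single (Fin.last m) θ) = lastRot (2 * m) θ := by
  refine Matrix.ext fun i k => ?_
  obtain ⟨⟨a, i⟩, rfl⟩ := (pairEquiv (m + 1)).surjective i
  obtain ⟨⟨b, k⟩, rfl⟩ := (pairEquiv (m + 1)).surjective k
  rw [rotMat_apply]
  refine Eq.trans ?_ (lastRot_apply θ (2 * m) _ _).symm
  have hv : ∀ (a : Fin 2) (i : Fin (m + 1)), ((pairEquiv (m + 1) (a, i) : Fin (2 * (m + 1))) : ℕ) =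
      2 * i + a := fun _ _ => rfl
  have hi : ∀ i : Fin (m + 1), i ≠ Fin.last m → (i : ℕ) < m := fun i h =>
    lt_of_le_of_ne (Nat.lt_succ_iff.1 i.2) fun h' => h (Fin.ext h')
  rw [hv, hv]
  by_cases h : i = Fin.last m
  · subst h
    by_cases h' : k = Fin.last m
    · subst h'
      fin_cases a <;> fin_cases b <;> simp
    · have := hi k h'
      rw [if_neg (Ne.symm h'), Fin.val_last]
      split_ifs <;> first | rfl | (exfalso; omega)
  · have := hi i h
    have ha := a.2
    rw [if_neg (show ¬ 2 * (i : ℕ) + a = 2 * m by omega),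
      if_neg (show ¬ 2 * (i : ℕ) + a = 2 * m + 1 by omega)]
    by_cases hik : i = k
    · subst hik
      rw [if_pos rfl, Pi.single_eq_of_ne h]
      fin_cases a <;> fin_cases b <;> simp
    · have hb := b.2
      rw [if_neg hik, if_neg (fun h => hik (Fin.ext (by omega)))]

/-- The permutation matrix which permutes the planes by `ρ`. Its determinant is `1`, since it
permutes both the first and the second vectors of the planes by `ρ`. -/
lemma exists_permGL (ρ : Equiv.Perm (Fin m)) : ∃ g : GL (Fin (2 * m)) ℝ,
    (g : Matrix (Fin (2 * m)) (Fin (2 * m)) ℝ).det = 1 ∧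
    (∀ (i : Fin (2 * m)) (c : Fin 2) (j : Fin m), (g : Matrix (Fin (2 * m)) (Fin (2 * m)) ℝ) i
      (pairEquiv m (c, j)) = if i = pairEquiv m (c, ρ j) then 1 else 0) ∧
    ∀ θ, g * rotGL (θ ∘ ρ) = rotGL θ * g := by
  set τ : Equiv.Perm (Fin (2 * m)) := (pairEquiv m).permCongr (.prodCongr (.refl _) ρ)
  have hdet : (τ⁻¹.permMatrix ℝ).det = 1 := by
    rw [det_permutation, Equiv.Perm.sign_inv, Equiv.Perm.sign_permCongr]
    have : (Equiv.prodCongr (.refl (Fin 2)) ρ) = Equiv.prodCongrRight fun _ => ρ := rfl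
    rw [this, Equiv.Perm.sign_prodCongrRight, Fin.prod_univ_two, Int.units_mul_self]
    simp
  have hg := coe_toGL (A := τ⁻¹.permMatrix ℝ) (by rw [hdet]; exact one_ne_zero)
  refine ⟨toGL (τ⁻¹.permMatrix ℝ), by rw [hg, hdet], fun i c j => ?_, fun θ => Units.ext ?_⟩
  · rw [hg, Equiv.Perm.permMatrix, PEquiv.toMatrix_apply]
    have : τ (pairEquiv m (c, j)) = pairEquiv m (c, ρ j) := by simp [τ, Equiv.permCongr_apply]
    rw [← this]
    simp [Equiv.toPEquiv_apply, Equiv.symm_apply_eq]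
  · rw [Units.val_mul, Units.val_mul, hg, coe_rotGL, coe_rotGL, rotMat_comp_perm,
      Equiv.Perm.permMatrix, PEquiv.toMatrix_toPEquiv_mul, PEquiv.mul_toMatrix_toPEquiv]
    ext i k
    rw [Matrix.submatrix_apply, Matrix.submatrix_apply, Matrix.submatrix_apply,
      Equiv.Perm.inv_def, Equiv.symm_symm, Equiv.apply_symm_apply]
    rfl

end RotMat

namespace SpinCover

variable {m : ℕ} {X P : Type*} [TopologicalSpace X] [TopologicalSpace P]
  [MulAction (GL (Fin (2 * m)) ℝ)ᵐᵒᵖ X] [ContinuousSMul (GL (Fin (2 * m)) ℝ)ᵐᵒᵖ X]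
  (C : SpinCover (2 * m) X P)

/-- A full turn in one plane has nontrivial monodromy: a permutation of the planes conjugates it to
the full turn in the last plane. -/
lemma mon_intLoop_single (j : Fin m) (x : X) :
    C.mon (mulPath (.const I x) (intLoop (Pi.single j 1))) = 1 := by
  obtain ⟨m, rfl⟩ : ∃ m', m = m' + 1 := ⟨m - 1, by have := j.2; omega⟩
  obtain ⟨g, hg⟩ : ∃ g : GL (Fin (2 * (m + 1))) ℝ, ∀ θ : Fin (m + 1) → ℝ,
      rotGL (θ ∘ Equiv.swap j (Fin.last m)) = g * rotGL θ * g⁻¹ := by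
    obtain ⟨g, -, -, hg⟩ := exists_permGL (Equiv.swap j (Fin.last m))
    exact ⟨g⁻¹, fun θ => by rw [inv_inv, mul_assoc, ← hg, inv_mul_cancel_left]⟩
  have h1 : C.mon (mulPath (.const I (op g • x)) (intLoop (Pi.single (Fin.last m) 1))) = 1 := by
    have e : intLoop (Pi.single (Fin.last m) 1) = lastRotLoop (2 * m) := by
      refine ContinuousMap.ext fun t => Units.ext ?_
      rw [intLoop_apply, coe_rotGL]
      refine Eq.trans ?_ (coe_lastRotLoop (2 * m) t).symm
      rw [← rotMat_single_last]
      congr 1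
      ext i
      by_cases h : i = Fin.last m
      · subst h; simp
      · simp [h]
    rw [e]
    exact C.mon_lastRotLoop (n := 2 * m) _
  have h2 := mon_mulPath_const (C := C) (by omega)
    (c := mulPath (.const I x) (intLoop (Pi.single j 1)))
    (by simp [intLoop_zero, intLoop_one]) g
  rw [← h2, ← h1]
  congr 1
  ext t
  simp only [mulPath_apply, ContinuousMap.const_apply, smul_smul, ← op_mul]
  congr 2
  rw [← eq_mul_inv_iff_mul_eq, intLoop_apply, intLoop_apply, ← hg]
  congr 1
  ext i
  simp only [Function.comp]
  congr 1
  by_cases h : i = j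
  · subst h; simp
  · have : Equiv.swap j (Fin.last m) i ≠ Fin.last m := fun h' => h (by
      rw [Equiv.swap_apply_eq_iff, Equiv.swap_apply_right] at h'; exact h')
    simp [h, this]

/-- The monodromy along a loop of rotations is the parity of the sum of the winding numbers. -/
lemma mon_intLoop (hm : 0 < m) (x : X) (l : Fin m → ℤ) :
    C.mon (mulPath (.const I x) (intLoop l)) = ((∑ j, l j : ℤ) : ZMod 2) := by
  have hadd : ∀ l l' : Fin m → ℤ, C.mon (mulPath (.const I x) (intLoop (l + l'))) =
      C.mon (mulPath (.const I x) (intLoop l)) + C.mon (mulPath (.const I x) (intLoop l')) := by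
    intro l l'
    have h := mon_mulPath (C := C) (by omega) (c := mulPath (.const I x) (intLoop l))
      (by simp [intLoop_zero, intLoop_one]) (w := intLoop l') (intLoop_zero _) (intLoop_one _)
    have h0 : mulPath (.const I x) (intLoop l) 0 = x := by simp [intLoop_zero]
    rw [h0] at h
    rw [← h]
    congr 1
    ext t
    simp only [mulPath_apply, ContinuousMap.const_apply, smul_smul, ← op_mul]
    congr 2
    rw [intLoop_apply, intLoop_apply, intLoop_apply, ← rotGL_add]
    congr 1
    ext j
    simp [mul_add]
  -- both sides are additive in `l`
  let φ : (Fin m → ℤ) →+ ZMod 2 :=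
    AddMonoidHom.mk' (fun l => C.mon (mulPath (.const I x) (intLoop l))) hadd
  let ψ : (Fin m → ℤ) →+ ZMod 2 := AddMonoidHom.mk' (fun l => ((∑ j, l j : ℤ) : ZMod 2))
    fun l l' => by simp [Finset.sum_add_distrib]
  suffices φ = ψ from DFunLike.congr_fun this l
  refine AddMonoidHom.functions_ext' _ _ _ fun j => AddMonoidHom.ext_int ?_
  simp only [AddMonoidHom.comp_apply, AddMonoidHom.single_apply]
  show C.mon (mulPath (.const I x) (intLoop (Pi.single j 1))) = ((∑ i, (Pi.single j 1 : Fin m → ℤ) i : ℤ) : ZMod 2)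
  rw [C.mon_intLoop_single, Finset.sum_pi_single']
  simp

end SpinCover

/-! ### Matrices commuting with a rotation -/

section Cut

variable {ι : Type*} [DecidableEq ι] (p : ι → Prop) [DecidablePred p]

/-- The matrix which agrees with `A` on the coordinates satisfying `p`, and is the identity on the
others. -/
def cut (A : Matrix ι ι ℝ) : Matrix ι ι ℝ :=
  of fun i k => if p i ∧ p k then A i k else if i = k then 1 else 0

lemma cut_apply (A : Matrix ι ι ℝ) (i k : ι) :
    cut p A i k = if p i ∧ p k then A i k else if i = k then 1 else 0 := rfl

lemma continuous_cut : Continuous (cut p) := by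
  refine continuous_matrix fun i k => ?_
  simp only [cut_apply]
  split_ifs <;> fun_prop

variable [Fintype ι]

lemma det_cut (A : Matrix ι ι ℝ) : (cut p A).det = (A.toSquareBlockProp p).det := by
  rw [twoBlockTriangular_det _ p]
  · have h1 : (cut p A).toSquareBlockProp p = A.toSquareBlockProp p := by
      ext i k; simp [toSquareBlockProp, cut_apply, i.2, k.2]
    have h2 : (cut p A).toSquareBlockProp (fun i => ¬ p i) = 1 := by
      ext i k; simp [toSquareBlockProp, cut_apply, i.2, one_apply, Subtype.ext_iff]
    rw [h1, h2, det_one, mul_one]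
  · intro i hi k hk
    have : i ≠ k := fun h => hi (h ▸ hk)
    simp [cut_apply, hi, this]

/-- A block diagonal matrix is the product of its blocks. -/
lemma cut_mul_cut_not {A : Matrix ι ι ℝ} (hA : ∀ i k, (p i ↔ p k) ∨ A i k = 0) :
    cut p A * cut (fun i => ¬ p i) A = A := by
  ext i k
  rw [mul_apply]
  by_cases hi : p i
  · rw [Finset.sum_eq_single k]
    · by_cases hk : p k
      · simp [cut_apply, hi, hk]
      · have : i ≠ k := fun h => hk (h ▸ hi)
        rcases hA i k with h | h
        · exact absurd (h.1 hi) hk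
        · simp [cut_apply, hk, this, h]
    · intro l _ hl
      by_cases hpl : p l
      · simp [cut_apply, hpl, hl]
      · have : i ≠ l := fun h => hpl (h ▸ hi)
        simp [cut_apply, hpl, this]
    · simp
  · rw [Finset.sum_eq_single i]
    · by_cases hk : p k
      · have : i ≠ k := fun h => hi (h ▸ hk)
        rcases hA i k with h | h
        · exact absurd (h.2 hk) hi
        · simp [cut_apply, hi, hk, this, h]
      · simp [cut_apply, hi, hk]
    · intro l _ hl
      simp [cut_apply, hi, hl.symm]
    · simp

/-- Two blocks with determinants of equal sign can be joined by a path of invertible blocks. -/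
lemma exists_path_cut {A B : Matrix ι ι ℝ} (h : 0 < (cut p A).det * (cut p B).det) :
    ∃ K : I → Matrix ι ι ℝ, Continuous K ∧ cut p (K 0) = cut p A ∧ cut p (K 1) = cut p B ∧
      ∀ t, (cut p (K t)).det ≠ 0 := by
  let e := Fintype.equivFin {i // p i}
  let f : Matrix ι ι ℝ → Matrix (Fin _) (Fin _) ℝ := fun M => (M.toSquareBlockProp p).submatrix e.symm e.symm
  have hf : ∀ M, (f M).det = (cut p M).det := fun M => by
    rw [det_cut, det_submatrix_equiv_self]
  have hne := fun M (h : (cut p M).det ≠ 0) => (hf M).symm ▸ h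
  have hA : (cut p A).det ≠ 0 := left_ne_zero_of_mul h.ne'
  have hB : (cut p B).det ≠ 0 := right_ne_zero_of_mul h.ne'
  obtain ⟨k, hk0, hk1⟩ := exists_path_GL (g := toGL (f A)) (h := toGL (f B)) (by
    rwa [coe_toGL (hne A hA), coe_toGL (hne B hB), hf, hf])
  let K : I → Matrix ι ι ℝ := fun t => of fun i j =>
    if h : p i ∧ p j then (k t : Matrix (Fin _) (Fin _) ℝ) (e ⟨i, h.1⟩) (e ⟨j, h.2⟩) else 0
  have hfK : ∀ t, f (K t) = k t := fun t => by
    ext i j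
    have h1 := (e.symm i).2
    have h2 := (e.symm j).2
    simp [f, K, toSquareBlockProp, h1, h2]
  have hcut : ∀ M M' : Matrix ι ι ℝ, f M = f M' → cut p M = cut p M' := fun M M' h => by
    ext i j
    rw [cut_apply, cut_apply]
    split_ifs with hij
    · simpa [f, toSquareBlockProp] using congrFun (congrFun h (e ⟨i, hij.1⟩)) (e ⟨j, hij.2⟩)
    all_goals rfl
  refine ⟨K, continuous_matrix fun i j => ?_, hcut _ _ ?_, hcut _ _ ?_, fun t => ?_⟩
  · by_cases h : p i ∧ p j
    · simp only [K, of_apply, dif_pos h]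
      exact (Units.continuous_val.comp k.continuous).matrix_elem _ _
    · simp only [K, of_apply, dif_neg h]
      exact continuous_const
  · rw [hfK, hk0, coe_toGL (hne A hA)]
  · rw [hfK, hk1, coe_toGL (hne B hB)]
  · rw [← hf, hfK]; exact GL_det_ne_zero _

end Cut

section Commute

variable {m : ℕ}

/-- A function on the planes, as a function on the coordinates. -/
def onCoord {α : Type*} (θ : Fin m → α) (i : Fin (2 * m)) : α := θ ((pairEquiv m).symm i).2

@[simp] lemma onCoord_pairEquiv {α : Type*} (θ : Fin m → α) (a : Fin 2) (i : Fin m) :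
    onCoord θ (pairEquiv m (a, i)) = θ i := by simp [onCoord]

/-- The complex structure: rotation by a right angle in every plane. -/
noncomputable def cplxJ (m : ℕ) : Matrix (Fin (2 * m)) (Fin (2 * m)) ℝ := rotMat fun _ => Real.pi / 2

lemma rotMat_eq (θ : Fin m → ℝ) : rotMat θ = diagonal (fun i => Real.cos (onCoord θ i)) +
    diagonal (fun i => Real.sin (onCoord θ i)) * cplxJ m := by
  ext i k
  obtain ⟨⟨a, i⟩, rfl⟩ := (pairEquiv m).surjective i
  obtain ⟨⟨b, k⟩, rfl⟩ := (pairEquiv m).surjective k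
  rw [cplxJ, Matrix.add_apply, diagonal_mul, rotMat_apply, rotMat_apply, diagonal_apply]
  by_cases h : i = k
  · subst h
    fin_cases a <;> fin_cases b <;> simp
  · simp [h]

lemma diagonal_mul_cplxJ (f : Fin m → ℝ) :
    diagonal (onCoord f) * cplxJ m = cplxJ m * diagonal (onCoord f) := by
  ext i k
  obtain ⟨⟨a, i⟩, rfl⟩ := (pairEquiv m).surjective i
  obtain ⟨⟨b, k⟩, rfl⟩ := (pairEquiv m).surjective k
  rw [cplxJ, diagonal_mul, mul_diagonal, rotMat_apply]
  by_cases h : i = k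
  · subst h; simp [mul_comm]
  · simp [h]

/-- The sum of a rotation and its inverse is diagonal, with twice the cosines of the angles. -/
lemma rotMat_add_rotMat_neg (θ : Fin m → ℝ) :
    rotMat θ + rotMat (-θ) = diagonal fun i => 2 * Real.cos (onCoord θ i) := by
  ext i k
  obtain ⟨⟨a, i⟩, rfl⟩ := (pairEquiv m).surjective i
  obtain ⟨⟨b, k⟩, rfl⟩ := (pairEquiv m).surjective k
  rw [Matrix.add_apply, rotMat_apply, rotMat_apply, diagonal_apply, onCoord_pairEquiv]
  simp only [(pairEquiv m).injective.eq_iff, Prod.mk.injEq]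
  by_cases h : i = k
  · subst h
    fin_cases a <;> fin_cases b <;> simp [two_mul]
  · simp [h]

variable {θ : Fin m → ℝ} {h : Matrix (Fin (2 * m)) (Fin (2 * m)) ℝ}

lemma commute_rotMat_neg (hc : Commute h (rotMat θ)) : Commute h (rotMat (-θ)) := by
  have h1 : rotMat θ * rotMat (-θ) = 1 := by rw [← rotMat_add, add_neg_cancel, rotMat_zero]
  have h2 : rotMat (-θ) * rotMat θ = 1 := by rw [← rotMat_add, neg_add_cancel, rotMat_zero]
  calc h * rotMat (-θ) = rotMat (-θ) * (rotMat θ * h) * rotMat (-θ) := by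
        rw [← Matrix.mul_assoc (rotMat (-θ)), h2, Matrix.one_mul]
    _ = rotMat (-θ) * h := by
        rw [← hc.eq, Matrix.mul_assoc, Matrix.mul_assoc, h1, Matrix.mul_one]

/-- A matrix commuting with a rotation respects the angles. -/
lemma eq_or_eq_zero_of_commute (hθ : ∀ j, θ j ∈ Set.Icc 0 Real.pi) (hc : Commute h (rotMat θ))
    (i k : Fin (2 * m)) : onCoord θ i = onCoord θ k ∨ h i k = 0 := by
  have hd : Commute h (diagonal fun i => Real.cos (onCoord θ i)) := by
    have h2 : (2 : ℝ) • diagonal (fun i => Real.cos (onCoord θ i)) = rotMat θ + rotMat (-θ) := by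
      rw [rotMat_add_rotMat_neg, ← diagonal_smul]
      rfl
    have h3 := hc.add_right (commute_rotMat_neg hc)
    rw [← h2] at h3
    have := h3.smul_right (2⁻¹ : ℝ)
    rwa [smul_smul, inv_mul_cancel₀ two_ne_zero, one_smul] at this
  have := congrFun (congrFun hd.eq i) k
  rw [mul_diagonal, diagonal_mul] at this
  by_cases h0 : h i k = 0
  · exact .inr h0
  · left
    refine Real.injOn_cos (hθ _) (hθ _) (mul_right_cancel₀ h0 ?_)
    exact this.symm.trans (mul_comm _ _)

lemma commute_diagonal (hb : ∀ i k, onCoord θ i = onCoord θ k ∨ h i k = 0) (f : ℝ → ℝ) :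
    Commute h (diagonal fun i => f (onCoord θ i)) := by
  ext i k
  rw [mul_diagonal, diagonal_mul]
  rcases hb i k with h' | h'
  · rw [h', mul_comm]
  · simp [h']

/-- A matrix commuting with a rotation commutes with the complex structure of the planes on which
the rotation is not real: there, the complex structure is the imaginary part of the rotation divided
by the sine. -/
lemma commute_diagonal_mul_cplxJ (hθ : ∀ j, θ j ∈ Set.Icc 0 Real.pi) (hc : Commute h (rotMat θ))
    (f : ℝ → ℝ) (hf : ∀ v, Real.sin v = 0 → f v = 0) :
    Commute h (diagonal (fun i => f (onCoord θ i)) * cplxJ m) := by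
  have hb := eq_or_eq_zero_of_commute hθ hc
  have h1 : Commute h (diagonal (fun i => Real.sin (onCoord θ i)) * cplxJ m) := by
    have := hc.sub_right (commute_diagonal hb Real.cos)
    rwa [rotMat_eq, add_sub_cancel_left] at this
  have h2 := (commute_diagonal hb fun v => f v / Real.sin v).mul_right h1
  have e : (fun i => f (onCoord θ i) / Real.sin (onCoord θ i) * Real.sin (onCoord θ i)) =
      fun i => f (onCoord θ i) := by
    ext i
    by_cases h0 : Real.sin (onCoord θ i) = 0
    · simp [h0, hf _ h0]
    · field_simp
  rwa [← Matrix.mul_assoc, diagonal_mul_diagonal, e] at h2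

/-- A matrix commuting with the rotation by the angles `θ` commutes with the rotation by angles
which are functions of `θ`, as long as no new non-real rotation appears. -/
lemma commute_rotMat_comp (hθ : ∀ j, θ j ∈ Set.Icc 0 Real.pi) (hc : Commute h (rotMat θ))
    (f : ℝ → ℝ) (hf : ∀ v, Real.sin v = 0 → Real.sin (f v) = 0) :
    Commute h (rotMat (f ∘ θ)) := by
  rw [rotMat_eq]
  exact (commute_diagonal (eq_or_eq_zero_of_commute hθ hc) fun v => Real.cos (f v)).add_right
    (commute_diagonal_mul_cplxJ hθ hc (fun v => Real.sin (f v)) hf)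

/-- The identification of `ℂ^m` with `ℝ^(2m)`. -/
noncomputable def cplxEquiv (m : ℕ) : (Fin m → ℂ) ≃ₗ[ℝ] (Fin (2 * m) → ℝ) where
  toFun v i := ![(v ((pairEquiv m).symm i).2).re, (v ((pairEquiv m).symm i).2).im]
    ((pairEquiv m).symm i).1
  invFun w j := ⟨w (pairEquiv m (0, j)), w (pairEquiv m (1, j))⟩
  map_add' v w := by
    ext i
    obtain ⟨⟨a, i⟩, rfl⟩ := (pairEquiv m).surjective i
    fin_cases a <;> simp
  map_smul' c v := by
    ext i
    obtain ⟨⟨a, i⟩, rfl⟩ := (pairEquiv m).surjective i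
    fin_cases a <;> simp
  left_inv v := by ext j; simp
  right_inv w := by
    ext i
    obtain ⟨⟨a, i⟩, rfl⟩ := (pairEquiv m).surjective i
    fin_cases a <;> simp

lemma cplxEquiv_I_smul (v : Fin m → ℂ) : cplxEquiv m (Complex.I • v) = cplxJ m *ᵥ cplxEquiv m v := by
  ext i
  obtain ⟨⟨a, i⟩, rfl⟩ := (pairEquiv m).surjective i
  rw [mulVec, dotProduct, ← (pairEquiv m).sum_comp, Fintype.sum_prod_type, Fin.sum_univ_two]
  simp only [cplxJ, rotMat_apply]
  fin_cases a <;> simp [cplxEquiv]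

/-- An invertible complex matrix, viewed as a real one, has positive determinant. -/
lemma det_pos_of_commute_cplxJ (hc : Commute h (cplxJ m)) (h0 : h.det ≠ 0) : 0 < h.det := by
  let f : (Fin m → ℂ) →ₗ[ℝ] (Fin m → ℂ) :=
    (cplxEquiv m).symm.toLinearMap ∘ₗ toLin' h ∘ₗ (cplxEquiv m).toLinearMap
  have hI : ∀ v, f (Complex.I • v) = Complex.I • f v := fun v => by
    apply (cplxEquiv m).injective
    rw [cplxEquiv_I_smul]
    simp only [f, LinearMap.comp_apply, LinearEquiv.coe_coe, LinearEquiv.apply_symm_apply,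
      cplxEquiv_I_smul, toLin'_apply, mulVec_mulVec, hc.eq]
  let F : (Fin m → ℂ) →ₗ[ℂ] (Fin m → ℂ) :=
    { toFun := f
      map_add' := f.map_add
      map_smul' := fun c v => by
        have : ∀ w : Fin m → ℂ, c • w = c.re • w + c.im • Complex.I • w := fun w => by
          ext j
          simp only [Pi.add_apply, Pi.smul_apply, smul_eq_mul, Complex.real_smul]
          linear_combination -(w j) * Complex.re_add_im c
        rw [this v, map_add, map_smul, map_smul, hI, RingHom.id_apply, this] }
  have h1 : LinearMap.det (F.restrictScalars ℝ) = h.det := by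
    have : F.restrictScalars ℝ = f := rfl
    rw [this]
    have := LinearMap.det_conj (toLin' h) (cplxEquiv m).symm
    rw [LinearMap.det_toLin'] at this
    exact this
  rw [LinearMap.det_restrictScalars, Algebra.norm_complex_apply] at h1
  rw [← h1] at h0 ⊢
  exact lt_of_le_of_ne (Complex.normSq_nonneg _) h0.symm

end Commute

section Twist

variable {m : ℕ} {θ : Fin m → ℝ}

/-- Matrices which differ from the identity only in the complement of `p`, and only in `p`,
respectively, commute. -/
lemma commute_of_disjoint {ι : Type*} [Fintype ι] [DecidableEq ι] (p : ι → Prop)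
    {A B : Matrix ι ι ℝ} (hA : ∀ i k, p i ∨ p k → A i k = (1 : Matrix ι ι ℝ) i k)
    (hB : ∀ i k, ¬ p i ∨ ¬ p k → B i k = (1 : Matrix ι ι ℝ) i k) : Commute A B := by
  have h1 : (A - 1) * (B - 1) = 0 := by
    ext i k
    rw [mul_apply]
    refine Finset.sum_eq_zero fun l _ => ?_
    by_cases hl : p l
    · simp [hA i l (.inr hl)]
    · simp [hB l k (.inl hl)]
  have h2 : (B - 1) * (A - 1) = 0 := by
    ext i k
    rw [mul_apply]
    refine Finset.sum_eq_zero fun l _ => ?_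
    by_cases hl : p l
    · simp [hA l k (.inl hl)]
    · simp [hB i l (.inr hl)]
  rw [sub_mul, mul_sub, mul_sub] at h1 h2
  simp only [Matrix.mul_one, Matrix.one_mul] at h1 h2
  show A * B = B * A
  calc A * B = (A * B - A - (B - 1)) + A + B - 1 := by abel
    _ = (B * A - B - (A - 1)) + A + B - 1 := by rw [h1, h2]
    _ = B * A := by abel

/-- The planes which are rotated by the angle `π`. -/
noncomputable def halfTurn (θ : Fin m → ℝ) (j : Fin m) : ℝ :=
  if θ j = Real.pi then Real.pi else 0

lemma onCoord_smul_halfTurn (t : ℝ) (i : Fin (2 * m)) : onCoord (t • halfTurn θ) i =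
    if onCoord θ i = Real.pi then t * Real.pi else 0 := by
  obtain ⟨⟨a, i⟩, rfl⟩ := (pairEquiv m).surjective i
  simp only [onCoord_pairEquiv, halfTurn, Pi.smul_apply, smul_eq_mul]
  split_ifs <;> simp

/-- Away from the coordinates rotated by `π`, a matrix commutes with the partial half turns of these
coordinates. -/
lemma commute_cut_halfTurn (A : Matrix (Fin (2 * m)) (Fin (2 * m)) ℝ) (t : ℝ) :
    Commute (cut (fun i => ¬ onCoord θ i = Real.pi) A) (rotMat (t • halfTurn θ)) := by
  refine commute_of_disjoint (fun i => onCoord θ i = Real.pi) (fun i k h => ?_) fun i k h => ?_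
  · rw [cut_apply, if_neg (by tauto), one_apply]
  · rw [rotMat_eq, Matrix.add_apply, diagonal_mul, diagonal_apply, one_apply]
    simp only [onCoord_smul_halfTurn]
    by_cases hi : onCoord θ i = Real.pi
    · have hk : ¬ onCoord θ k = Real.pi := by tauto
      have hik : i ≠ k := fun e => hk (e ▸ hi)
      have : cplxJ m i k = 0 := by
        obtain ⟨⟨a, i⟩, rfl⟩ := (pairEquiv m).surjective i
        obtain ⟨⟨b, k⟩, rfl⟩ := (pairEquiv m).surjective k
        rw [cplxJ, rotMat_apply, if_neg]
        rintro rfl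
        simp only [onCoord_pairEquiv] at hi hk
        exact hk hi
      simp [hik, this]
    · simp [hi]

lemma commute_cut_rotMat_halfTurn (A : Matrix (Fin (2 * m)) (Fin (2 * m)) ℝ) :
    Commute (cut (fun i => onCoord θ i = Real.pi) A) (rotMat (halfTurn θ)) := by
  have h := onCoord_smul_halfTurn (θ := θ) 1
  simp only [one_smul, one_mul] at h
  rw [rotMat_eq]
  have hs : (fun i => Real.sin (onCoord (halfTurn θ) i)) = 0 := by
    ext i
    rw [h]
    split_ifs <;> simp
  rw [hs, show diagonal (0 : Fin (2 * m) → ℝ) = 0 from diagonal_zero, Matrix.zero_mul, add_zero]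
  refine commute_diagonal (fun i k => ?_) Real.cos
  rw [h, h, cut_apply]
  by_cases hi : onCoord θ i = Real.pi <;> by_cases hk : onCoord θ k = Real.pi
  · simp [hi, hk]
  · right; rw [if_neg (by tauto), if_neg]; rintro rfl; exact hk hi
  · right; rw [if_neg (by tauto), if_neg]; rintro rfl; exact hi hk
  · simp [hi, hk]

/-- The commutators of `h` with the rotations by fractions of the angles `θ`. -/
noncomputable def twistLoop (θ : Fin m → ℝ) (h : GL (Fin (2 * m)) ℝ) : C(I, GL (Fin (2 * m)) ℝ) :=
  ⟨fun t => rotGL ((t : ℝ) • θ) * h * (rotGL ((t : ℝ) • θ))⁻¹ * h⁻¹, by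
    have : Continuous fun t : I => rotGL ((t : ℝ) • θ) := continuous_rotGL.comp (by fun_prop)
    fun_prop⟩

lemma twistLoop_apply (h : GL (Fin (2 * m)) ℝ) (t : I) : twistLoop θ h t =
    rotGL ((t : ℝ) • θ) * h * (rotGL ((t : ℝ) • θ))⁻¹ * h⁻¹ := rfl

lemma twistLoop_zero (h : GL (Fin (2 * m)) ℝ) : twistLoop θ h 0 = 1 := by
  simp [twistLoop_apply, rotGL_zero]

lemma commute_rotGL {h : GL (Fin (2 * m)) ℝ}
    (hc : Commute (h : Matrix (Fin (2 * m)) (Fin (2 * m)) ℝ) (rotMat θ)) : Commute h (rotGL θ) :=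
  Units.ext (by simpa [coe_rotGL] using hc.eq)

lemma twistLoop_one {h : GL (Fin (2 * m)) ℝ}
    (hc : Commute (h : Matrix (Fin (2 * m)) (Fin (2 * m)) ℝ) (rotMat θ)) : twistLoop θ h 1 = 1 := by
  have := commute_rotGL hc
  simp [twistLoop_apply, ← this.eq]

/-- Only the coordinates rotated by the angle `π` matter for the commutators. -/
lemma twistLoop_eq_halfTurn (hθ : ∀ j, θ j ∈ Set.Icc 0 Real.pi) {h : GL (Fin (2 * m)) ℝ}
    (hc : Commute (h : Matrix (Fin (2 * m)) (Fin (2 * m)) ℝ) (rotMat θ))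
    (hdet : (cut (fun i => onCoord θ i = Real.pi)
      (h : Matrix (Fin (2 * m)) (Fin (2 * m)) ℝ)).det ≠ 0) :
    twistLoop θ h = twistLoop (halfTurn θ) (toGL (cut (fun i => onCoord θ i = Real.pi)
      (h : Matrix (Fin (2 * m)) (Fin (2 * m)) ℝ))) := by
  have hb := eq_or_eq_zero_of_commute hθ hc
  ext1 t
  rw [twistLoop_apply, twistLoop_apply]
  set g := toGL (cut (fun i => onCoord θ i = Real.pi) (h : Matrix (Fin (2 * m)) (Fin (2 * m)) ℝ))
  set f : ℝ → ℝ := fun v => if Real.sin v = 0 then 0 else t * v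
  -- split the rotation into the part on the planes with the angle `π` and the part on the other
  -- planes, which commutes with `h`
  have h1 : (t : ℝ) • θ = (t : ℝ) • halfTurn θ + f ∘ θ := by
    ext j
    simp only [Pi.smul_apply, Pi.add_apply, smul_eq_mul, Function.comp_apply, f, halfTurn]
    by_cases hπ : θ j = Real.pi
    · simp [hπ]
    · by_cases h0 : Real.sin (θ j) = 0
      · have : θ j = 0 := by
          by_contra hne
          exact (Real.sin_pos_of_pos_of_lt_pi (lt_of_le_of_ne (hθ j).1 (Ne.symm hne))
            (lt_of_le_of_ne (hθ j).2 hπ)).ne' h0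
        rw [if_neg hπ, if_pos h0, this]; simp
      · simp [hπ, h0]
  have h2 : Commute h (rotGL (f ∘ θ)) := commute_rotGL <| commute_rotMat_comp hθ hc f fun v hv => by
    simp [f, hv]
  -- the part of `h` on the other planes commutes with the half turns
  have h3 : Commute (g⁻¹ * h) (rotGL ((t : ℝ) • halfTurn θ)) := by
    refine commute_rotGL ?_
    have e : ((g⁻¹ * h : GL (Fin (2 * m)) ℝ) : Matrix (Fin (2 * m)) (Fin (2 * m)) ℝ) =
        cut (fun i => ¬ onCoord θ i = Real.pi) (h : Matrix (Fin (2 * m)) (Fin (2 * m)) ℝ) := by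
      have hh : (h : Matrix (Fin (2 * m)) (Fin (2 * m)) ℝ) = (g : Matrix (Fin (2 * m)) (Fin (2 * m)) ℝ) *
          cut (fun i => ¬ onCoord θ i = Real.pi) (h : Matrix (Fin (2 * m)) (Fin (2 * m)) ℝ) := by
        rw [coe_toGL hdet, cut_mul_cut_not]
        intro i k
        rcases hb i k with h' | h'
        · exact .inl (by rw [h'])
        · exact .inr h'
      rw [Units.val_mul]
      conv_lhs => rw [hh]
      rw [← Matrix.mul_assoc, ← Units.val_mul, inv_mul_cancel, Units.val_one, Matrix.one_mul]
    rw [e]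
    exact commute_cut_halfTurn _ _
  rw [h1, rotGL_add]
  generalize rotGL (f ∘ θ) = q at h2
  generalize rotGL ((t : ℝ) • halfTurn θ) = r at h3
  have e1 : q * h * q⁻¹ = h := by rw [← h2.eq, mul_inv_cancel_right]
  have e2 : r * (g⁻¹ * h) * r⁻¹ = g⁻¹ * h := by rw [← h3.eq, mul_inv_cancel_right]
  calc r * q * h * (r * q)⁻¹ * h⁻¹ = r * (q * h * q⁻¹) * r⁻¹ * h⁻¹ := by group
    _ = r * g * r⁻¹ * (r * (g⁻¹ * h) * r⁻¹) * h⁻¹ := by rw [e1]; group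
    _ = r * g * r⁻¹ * g⁻¹ := by rw [e2]; group

/-- The reflection of the second coordinate of the `j`-th plane. -/
noncomputable def planeRefl (j : Fin m) : Matrix (Fin (2 * m)) (Fin (2 * m)) ℝ :=
  diagonal fun i => if i = pairEquiv m (1, j) then -1 else 1

lemma det_planeRefl (j : Fin m) : (planeRefl j).det = -1 := by
  rw [planeRefl, det_diagonal, Finset.prod_ite_eq' Finset.univ _ (fun _ => (-1 : ℝ))]
  simp

lemma planeRefl_mul_rotMat (j : Fin m) (θ : Fin m → ℝ) : planeRefl j * rotMat θ =
    rotMat (Function.update θ j (-θ j)) * planeRefl j := by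
  ext i k
  obtain ⟨⟨a, i⟩, rfl⟩ := (pairEquiv m).surjective i
  obtain ⟨⟨b, k⟩, rfl⟩ := (pairEquiv m).surjective k
  rw [planeRefl, diagonal_mul, mul_diagonal, rotMat_apply, rotMat_apply]
  by_cases h : i = k
  · subst h
    by_cases hj : i = j
    · subst hj
      fin_cases a <;> fin_cases b <;> simp
    · fin_cases a <;> fin_cases b <;> simp [hj]
  · simp [h]

end Twist

/-! ### The monodromy of commutators with rotations -/

section SignLemma

variable {m : ℕ} {θ : Fin m → ℝ}

lemma det_submatrix_eq_det_cut {d k : ℕ} (hk : k ≤ d) (p : Fin d → Prop) [DecidablePred p]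
    (hp : ∀ i, p i ↔ (i : ℕ) < k) (A : Matrix (Fin d) (Fin d) ℝ) :
    (A.submatrix (Fin.castLE hk) (Fin.castLE hk)).det = (cut p A).det := by
  rw [det_cut]
  let e : Fin k ≃ {i // p i} :=
    { toFun := fun i => ⟨Fin.castLE hk i, (hp _).2 i.2⟩
      invFun := fun i => ⟨i.1, (hp _).1 i.2⟩
      left_inv := fun i => rfl
      right_inv := fun i => rfl }
  rw [← det_submatrix_equiv_self e]
  rfl

/-- The sign of the determinant of a matrix commuting with a rotation only depends on the blocks
with the angles `0` and `π`, since the remaining block is complex linear. -/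
lemma sign_det_of_commute (hθ : ∀ j, θ j ∈ Set.Icc 0 Real.pi)
    {h : Matrix (Fin (2 * m)) (Fin (2 * m)) ℝ} (hc : Commute h (rotMat θ)) (hdet : h.det ≠ 0) :
    0 < h.det * (cut (fun i => onCoord θ i = 0) h).det ↔
      0 < (cut (fun i => onCoord θ i = Real.pi) h).det := by
  have hb := eq_or_eq_zero_of_commute hθ hc
  -- `h` is a product of its blocks for the angles `π`, `0`, and those in between
  set h₁ := cut (fun i => ¬ onCoord θ i = Real.pi) h with h₁_def
  have e1 : h.det = (cut (fun i => onCoord θ i = Real.pi) h).det * h₁.det := by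
    rw [← det_mul, cut_mul_cut_not]
    intro i k
    rcases hb i k with h' | h'
    · exact .inl (by rw [h'])
    · exact .inr h'
  have hb₁ : ∀ i k, onCoord θ i = onCoord θ k ∨ h₁ i k = 0 := fun i k => by
    rcases hb i k with h' | h'
    · exact .inl h'
    · by_cases hik : i = k
      · subst hik; exact .inl rfl
      · right; rw [h₁_def, cut_apply, h']; simp [hik]
  set h₂ := cut (fun i => ¬ onCoord θ i = 0) h₁ with h₂_def
  have e2 : h₁.det = (cut (fun i => onCoord θ i = 0) h).det * h₂.det := by
    have : cut (fun i => onCoord θ i = 0) h = cut (fun i => onCoord θ i = 0) h₁ := by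
      ext i k
      rw [cut_apply, cut_apply]
      split_ifs with hik
      · have h0 : ∀ i, onCoord θ i = 0 → ¬ onCoord θ i = Real.pi := fun i h => by
          rw [h]; exact Real.pi_pos.ne
        rw [h₁_def, cut_apply, if_pos ⟨h0 _ hik.1, h0 _ hik.2⟩]
      all_goals rfl
    rw [this, ← det_mul, cut_mul_cut_not]
    intro i k
    rcases hb₁ i k with h' | h'
    · exact .inl (by rw [h'])
    · exact .inr h'
  have hne2 : h₂.det ≠ 0 := fun h0 => hdet (by rw [e1, e2, h0]; simp)
  have hpos : 0 < h₂.det := by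
    refine det_pos_of_commute_cplxJ ?_ hne2
    -- `h₂` is `h` on the planes with angles in `(0, π)`, and the identity elsewhere
    set f : ℝ → ℝ := fun v => if Real.sin v = 0 then 0 else 1
    have hs : ∀ i, Real.sin (onCoord θ i) = 0 ↔ onCoord θ i = 0 ∨ onCoord θ i = Real.pi := by
      intro i
      obtain ⟨⟨a, i⟩, rfl⟩ := (pairEquiv m).surjective i
      simp only [onCoord_pairEquiv]
      constructor
      · intro h0
        by_contra! hne
        exact (Real.sin_pos_of_pos_of_lt_pi (lt_of_le_of_ne (hθ i).1 (Ne.symm hne.1))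
            (lt_of_le_of_ne (hθ i).2 hne.2)).ne' h0
      · rintro (h | h) <;> simp [h]
    have e3 : h₂ = diagonal (fun i => f (onCoord θ i)) * h +
        diagonal (fun i => 1 - f (onCoord θ i)) := by
      ext i k
      rw [Matrix.add_apply, diagonal_mul, diagonal_apply, h₂_def, cut_apply, h₁_def, cut_apply]
      simp only [f, hs]
      rcases hb i k with h' | h'
      · rw [← h']
        by_cases h0 : onCoord θ i = 0
        · simp [h0]
        · by_cases hπ : onCoord θ i = Real.pi
          · simp [hπ]
          · simp [h0, hπ]
      · rw [h']
        by_cases hik : i = k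
        · subst hik
          by_cases h0 : onCoord θ i = 0
          · simp [h0]
          · by_cases hπ : onCoord θ i = Real.pi
            · simp [hπ]
            · simp [h0, hπ]
        · simp [hik]
    have c1 := commute_diagonal_mul_cplxJ hθ hc f fun v hv => by simp [f, hv]
    have c2 := diagonal_mul_cplxJ (fun j => f (θ j))
    have c3 := diagonal_mul_cplxJ (fun j => 1 - f (θ j))
    have c4 := commute_diagonal hb f
    change diagonal (fun i => f (onCoord θ i)) * _ = _ * diagonal (fun i => f (onCoord θ i)) at c2
    change diagonal (fun i => 1 - f (onCoord θ i)) * _ =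
      _ * diagonal (fun i => 1 - f (onCoord θ i)) at c3
    rw [e3]
    refine Commute.add_left ?_ c3
    calc diagonal (fun i => f (onCoord θ i)) * h * cplxJ m
        = h * (diagonal (fun i => f (onCoord θ i)) * cplxJ m) := by
          rw [← c4.eq, Matrix.mul_assoc]
      _ = cplxJ m * (diagonal (fun i => f (onCoord θ i)) * h) := by
          rw [c1.eq, c2, Matrix.mul_assoc]
  have h0 : (cut (fun i => onCoord θ i = 0) h).det ≠ 0 := fun h0 => hdet (by rw [e1, e2, h0]; simp)
  rw [e1, e2]
  have : (cut (fun i => onCoord θ i = Real.pi) h).det *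
      ((cut (fun i => onCoord θ i = 0) h).det * h₂.det) * (cut (fun i => onCoord θ i = 0) h).det =
      (cut (fun i => onCoord θ i = Real.pi) h).det *
      (h₂.det * (cut (fun i => onCoord θ i = 0) h).det ^ 2) := by ring
  rw [this]
  exact mul_pos_iff_of_pos_right (by positivity)

end SignLemma

namespace SpinCover

variable {m : ℕ} {X P : Type*} [TopologicalSpace X] [TopologicalSpace P]
  [MulAction (GL (Fin (2 * m)) ℝ)ᵐᵒᵖ X] [ContinuousSMul (GL (Fin (2 * m)) ℝ)ᵐᵒᵖ X]
  (C : SpinCover (2 * m) X P) {θ : Fin m → ℝ}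

/-- The monodromy of the commutators depends only on the component of the block with the angle `π`
in the general linear group, by homotopy invariance. -/
lemma mon_twistLoop_cut (hm : 0 < m) {A B : Matrix (Fin (2 * m)) (Fin (2 * m)) ℝ}
    (h : 0 < (cut (fun i => onCoord θ i = Real.pi) A).det *
      (cut (fun i => onCoord θ i = Real.pi) B).det) (x : X) :
    C.mon (mulPath (.const I x)
      (twistLoop (halfTurn θ) (toGL (cut (fun i => onCoord θ i = Real.pi) A)))) =
    C.mon (mulPath (.const I x)
      (twistLoop (halfTurn θ) (toGL (cut (fun i => onCoord θ i = Real.pi) B)))) := by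
  obtain ⟨K, hK, hK0, hK1, hKdet⟩ := exists_path_cut _ h
  set g : I → GL (Fin (2 * m)) ℝ := fun s => toGL (cut (fun i => onCoord θ i = Real.pi) (K s))
  have hg : Continuous g := continuousOn_toGL.comp_continuous ((continuous_cut _).comp hK) hKdet
  have hr : Continuous fun y : I × I => rotGL ((y.2 : ℝ) • halfTurn θ) :=
    continuous_rotGL.comp (by fun_prop)
  have hw : Continuous fun y : I × I => twistLoop (halfTurn θ) (g y.1) y.2 := by
    simp only [twistLoop_apply]
    fun_prop
  let H : C(I × I, X) := ⟨fun y => op (twistLoop (halfTurn θ) (g y.1) y.2) • x,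
    (continuous_op.comp hw).smul continuous_const⟩
  have hH := mon_homotopy (C := C) (by omega) H fun s => by
    have : twistLoop (halfTurn θ) (g s) 1 = 1 := twistLoop_one (by
      rw [coe_toGL (hKdet s)]
      exact commute_cut_rotMat_halfTurn _)
    simp [H, twistLoop_zero, this]
  convert hH using 2
  · ext t; simp [H, g, hK0]
  · ext t; simp [H, g, hK1]

/-- The monodromy along the commutators of `h` with fractions of a rotation commuting with `h`
measures whether `h` preserves the orientation of the space rotated by the angle `π`. -/
lemma mon_twistLoop (hm : 0 < m) (hθ : ∀ j, θ j ∈ Set.Icc 0 Real.pi) {k : ℕ} (hk : k ≤ 2 * m)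
    (hk' : ∀ i, onCoord θ i = 0 ↔ (i : ℕ) < k) {h : GL (Fin (2 * m)) ℝ}
    (hc : Commute (h : Matrix (Fin (2 * m)) (Fin (2 * m)) ℝ) (rotMat θ)) (x : X) :
    C.mon (mulPath (.const I x) (twistLoop θ h)) = 0 ↔
      0 < (h : Matrix (Fin (2 * m)) (Fin (2 * m)) ℝ).det *
        ((h : Matrix (Fin (2 * m)) (Fin (2 * m)) ℝ).submatrix (Fin.castLE hk) (Fin.castLE hk)).det := by
  set A := (h : Matrix (Fin (2 * m)) (Fin (2 * m)) ℝ)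
  set p : Fin (2 * m) → Prop := fun i => onCoord θ i = Real.pi
  have hb := eq_or_eq_zero_of_commute hθ hc
  have hne : (cut p A).det ≠ 0 := by
    intro h0
    have : A.det = (cut p A).det * (cut (fun i => ¬ p i) A).det := by
      rw [← det_mul, cut_mul_cut_not]
      intro i k
      rcases hb i k with h' | h'
      · exact .inl (by simp only [p]; rw [h'])
      · exact .inr h'
    exact GL_det_ne_zero h (by rw [this, h0, zero_mul])
  rw [det_submatrix_eq_det_cut hk _ hk', sign_det_of_commute hθ hc (GL_det_ne_zero h),
    twistLoop_eq_halfTurn hθ hc hne]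
  -- if the block with the angle `π` has negative determinant, it deforms to the reflection of a
  -- line, whose commutators with the fractions of a half turn form a full turn; otherwise it
  -- deforms to the identity
  rcases hne.lt_or_gt with hneg | hpos
  · refine iff_of_false ?_ hneg.not_gt
    obtain ⟨j, hj⟩ : ∃ j, θ j = Real.pi := by
      by_contra! hno
      have : cut p A = 1 := by
        ext i k
        have : ¬ p i := hno _
        simp [cut_apply, this, one_apply]
      rw [this, det_one] at hneg
      linarith
    have hcut : cut p (planeRefl j) = planeRefl j := by
      ext i k
      rw [cut_apply, planeRefl, diagonal_apply]
      by_cases hik : i = k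
      · subst hik
        by_cases hi : p i
        · simp [hi]
        · have : i ≠ pairEquiv m (1, j) := by
            rintro rfl
            exact hi (by simp [p, hj])
          simp [hi, this]
      · simp [hik]
    rw [C.mon_twistLoop_cut hm (B := planeRefl j)
      (by change 0 < (cut p A).det * (cut p _).det; rw [hcut, det_planeRefl]; linarith) x]
    change ¬ C.mon (mulPath (.const I x) (twistLoop (halfTurn θ) (toGL (cut p (planeRefl j))))) = 0
    rw [hcut]
    have hloop : twistLoop (halfTurn θ) (toGL (planeRefl j)) = intLoop (Pi.single j 1) := by
      ext1 t
      rw [twistLoop_apply, mul_assoc, mul_assoc, ← rotGL_neg, ← mul_assoc (toGL _)]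
      have hd : (planeRefl j).det ≠ 0 := by rw [det_planeRefl]; norm_num
      have : toGL (planeRefl j) * rotGL (-((t : ℝ) • halfTurn θ)) =
          rotGL (Function.update (-((t : ℝ) • halfTurn θ)) j (t * Real.pi)) *
            toGL (planeRefl j) := by
        refine Units.ext ?_
        rw [Units.val_mul, Units.val_mul, coe_toGL hd, coe_rotGL, coe_rotGL, planeRefl_mul_rotMat]
        congr 3
        simp [halfTurn, hj]
      rw [this, mul_inv_cancel_right, ← rotGL_add, intLoop_apply]
      congr 1
      ext i
      by_cases hi : i = j
      · subst hi
        simp [halfTurn, hj]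
        ring
      · simp [hi]
    rw [hloop, C.mon_intLoop_single]
    decide
  · refine iff_of_true ?_ hpos
    have h1 : cut p 1 = 1 := by
      ext i k
      rw [cut_apply, one_apply]
      simp
    rw [C.mon_twistLoop_cut hm (B := 1)
      (by change 0 < (cut p A).det * (cut p 1).det; rwa [h1, det_one, mul_one]) x]
    change C.mon (mulPath (.const I x) (twistLoop (halfTurn θ) (toGL (cut p 1)))) = 0
    rw [h1, toGL_one]
    have : mulPath (.const I x) (twistLoop (halfTurn θ) 1) = .const I x := by
      ext t; simp [twistLoop_apply]
    rw [this, mon_const (C := C) (by omega)]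

end SpinCover

open SpinCover

/-! ### The action of matrices on the frame bundle -/

namespace Module.Basis

variable {d : ℕ} {V W : Type*} [AddCommGroup V] [Module ℝ V] [AddCommGroup W] [Module ℝ W]

/-- The right action of invertible matrices on bases: `(b · g) i = ∑ k, g k i • b k`. -/
noncomputable def rightMul (b : Basis (Fin d) ℝ V) (g : GL (Fin d) ℝ) : Basis (Fin d) ℝ V :=
  .ofEquivFun (b.equivFun.trans (toLin'OfInv
    (M' := (g : Matrix (Fin d) (Fin d) ℝ)) (M := ((g⁻¹ : GL (Fin d) ℝ) : Matrix (Fin d) (Fin d) ℝ)) (by simp [-coe_units_inv, ← Units.val_mul])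
      (by simp [-coe_units_inv, ← Units.val_mul])).symm)

lemma rightMul_equivFun_symm (b : Basis (Fin d) ℝ V) (g : GL (Fin d) ℝ) (v : Fin d → ℝ) :
    (b.rightMul g).equivFun.symm v = b.equivFun.symm ((g : Matrix (Fin d) (Fin d) ℝ) *ᵥ v) := by
  simp [rightMul]

lemma equivFun_symm_single (b : Basis (Fin d) ℝ V) (i : Fin d) :
    b.equivFun.symm (Pi.single i 1) = b i := by
  simp [equivFun_symm_apply, Pi.single_apply]

lemma rightMul_apply (b : Basis (Fin d) ℝ V) (g : GL (Fin d) ℝ) (i : Fin d) :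
    b.rightMul g i = ∑ k, (g : Matrix (Fin d) (Fin d) ℝ) k i • b k := by
  rw [← equivFun_symm_single, rightMul_equivFun_symm, equivFun_symm_apply]
  simp

lemma rightMul_one (b : Basis (Fin d) ℝ V) : b.rightMul 1 = b := by
  refine Basis.eq_of_apply_eq fun i => ?_
  simp [rightMul_apply, one_apply]

lemma rightMul_mul (b : Basis (Fin d) ℝ V) (g h : GL (Fin d) ℝ) :
    b.rightMul (g * h) = (b.rightMul g).rightMul h := by
  refine Basis.eq_of_apply_eq fun i => ?_
  rw [← equivFun_symm_single, ← equivFun_symm_single, rightMul_equivFun_symm,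
    rightMul_equivFun_symm, rightMul_equivFun_symm, mulVec_mulVec, Units.val_mul]

lemma map_rightMul (b : Basis (Fin d) ℝ V) (g : GL (Fin d) ℝ) (T : V ≃ₗ[ℝ] W) :
    (b.rightMul g).map T = (b.map T).rightMul g := by
  refine Basis.eq_of_apply_eq fun i => ?_
  simp [rightMul_apply]

lemma exists_rightMul (b b' : Basis (Fin d) ℝ V) : ∃ g, b.rightMul g = b' := by
  have hdet : (b.toMatrix b').det ≠ 0 := by
    rw [← b.det_apply]; exact (b.isUnit_det b').ne_zero
  refine ⟨toGL (b.toMatrix b'), Basis.eq_of_apply_eq fun i => ?_⟩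
  rw [rightMul_apply, coe_toGL hdet, sum_toMatrix_smul_self]

lemma rightMul_injective (b : Basis (Fin d) ℝ V) : Function.Injective b.rightMul := by
  intro g h hgh
  refine Units.ext (Matrix.ext_of_mulVec_single fun i => ?_)
  apply b.equivFun.symm.injective
  rw [← rightMul_equivFun_symm, hgh, rightMul_equivFun_symm]

lemma det_rightMul (b : Basis (Fin d) ℝ V) (g : GL (Fin d) ℝ) :
    b.det (b.rightMul g) = (g : Matrix (Fin d) (Fin d) ℝ).det := by
  rw [b.det_apply]
  congr 1
  ext i k
  rw [toMatrix_apply, rightMul_apply]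
  simp [Finsupp.single_apply]

lemma orientation_rightMul_eq_iff (b : Basis (Fin d) ℝ V) (g : GL (Fin d) ℝ) :
    (b.rightMul g).orientation = b.orientation ↔ 0 < (g : Matrix (Fin d) (Fin d) ℝ).det := by
  rw [eq_comm, orientation_eq_iff_det_pos, det_rightMul]

/-- A matrix preserves or reverses the orientation of bases according to the sign of its
determinant. -/
lemma orientation_rightMul (b : Basis (Fin d) ℝ V) (g : GL (Fin d) ℝ) (o : Orientation ℝ V (Fin d)) :
    (b.rightMul g).orientation = o ↔
      (b.orientation = o ↔ 0 < (g : Matrix (Fin d) (Fin d) ℝ).det) := by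
  have h1 := b.orientation_rightMul_eq_iff g
  by_cases hb : b.orientation = o
  · simp [← hb, h1]
  · have ho := (b.orientation_ne_iff_eq_neg o).1 (Ne.symm hb)
    simp only [hb, false_iff]
    rw [← h1]
    constructor
    · rintro h h'
      exact hb (h'.symm.trans h)
    · intro h
      rw [ho]
      exact (b.orientation_ne_iff_eq_neg _).1 h

end Module.Basis

section FrameBundle

variable {d : ℕ} {N : Type*} [TopologicalSpace N] [ChartedSpace (EuclideanSpace ℝ (Fin d)) N]

/-- The right action of matrices on frames: the vectors of `op g • f` are the linear combinations of
those of `f` given by the columns of `g`. -/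
noncomputable instance FrameBundle.instMulAction : MulAction (GL (Fin d) ℝ)ᵐᵒᵖ (FrameBundle d N) where
  smul g f := ⟨f.1, f.2.rightMul g.unop⟩
  one_smul f := by
    show (⟨f.1, f.2.rightMul 1⟩ : FrameBundle d N) = f
    rw [Module.Basis.rightMul_one]
    rfl
  mul_smul g h f := by
    show (⟨f.1, f.2.rightMul (h.unop * g.unop)⟩ : FrameBundle d N) =
      ⟨f.1, (f.2.rightMul h.unop).rightMul g.unop⟩
    rw [Module.Basis.rightMul_mul]

lemma FrameBundle.exists_op_smul {f f' : FrameBundle d N} (h : f'.1 = f.1) :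
    ∃ g : GL (Fin d) ℝ, f' = op g • f := by
  obtain ⟨x, b⟩ := f
  obtain ⟨x', b'⟩ := f'
  obtain rfl : x' = x := h
  obtain ⟨g, hg⟩ := b.exists_rightMul b'
  exact ⟨g, congrArg (Sigma.mk x') hg.symm⟩

lemma FrameBundle.op_smul_injective (f : FrameBundle d N) :
    Function.Injective fun g : GL (Fin d) ℝ => op g • f := by
  intro g h hgh
  obtain ⟨x, b⟩ := f
  exact b.rightMul_injective (eq_of_heq (Sigma.mk.inj hgh).2)

section Topology

variable [IsManifold (𝓡 d) ∞ N]

lemma FrameBundle.continuous_iff {Z : Type*} [TopologicalSpace Z] {φ : Z → FrameBundle d N} :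
    Continuous φ ↔ Continuous (fun z => (φ z).1) ∧
      ∀ i, Continuous fun z => (⟨(φ z).1, (φ z).2 i⟩ : TangentBundle (𝓡 d) N) := by
  rw [continuous_induced_rng]
  refine ⟨fun h => ⟨h.fst, fun i => (continuous_apply i).comp h.snd⟩, fun h => ?_⟩
  exact h.1.prodMk (continuous_pi h.2)

lemma FrameBundle.continuous_base : Continuous fun f : FrameBundle d N => f.1 :=
  (continuous_iff.1 continuous_id).1

lemma FrameBundle.continuous_vector (i : Fin d) :
    Continuous fun f : FrameBundle d N => (⟨f.1, f.2 i⟩ : TangentBundle (𝓡 d) N) :=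
  (continuous_iff.1 continuous_id).2 i

/-- Linear combinations of vectors in the tangent bundle, over a common base point. -/
lemma continuous_tangent_sum {Z : Type*} [TopologicalSpace Z] {ι : Type*} [Fintype ι] {x : Z → N}
    {c : ι → Z → ℝ} {v : ∀ (_ : ι) (z : Z), TangentSpace (𝓡 d) (x z)} (hx : Continuous x)
    (hc : ∀ i, Continuous (c i))
    (hv : ∀ i, Continuous fun z => (⟨x z, v i z⟩ : TangentBundle (𝓡 d) N)) :
    Continuous fun z => (⟨x z, ∑ i, c i z • v i z⟩ : TangentBundle (𝓡 d) N) := by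
  rw [continuous_iff_continuousAt]
  intro z₀
  rw [FiberBundle.continuousAt_totalSpace]
  refine ⟨hx.continuousAt, ?_⟩
  set e := trivializationAt (EuclideanSpace ℝ (Fin d)) (TangentSpace (𝓡 d)) (x z₀)
  have hv' : ∀ i, ContinuousAt (fun z => (e ⟨x z, v i z⟩).2) z₀ := fun i =>
    ((FiberBundle.continuousAt_totalSpace _ _).1 (hv i).continuousAt).2
  have : ContinuousAt (fun z => ∑ i, c i z • (e ⟨x z, v i z⟩).2) z₀ :=
    tendsto_finsetSum _ fun i _ => (hc i).continuousAt.smul (hv' i)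
  refine this.congr ?_
  have hU : ∀ᶠ z in 𝓝 z₀, x z ∈ e.baseSet := hx.continuousAt.eventually
    (e.open_baseSet.mem_nhds (FiberBundle.mem_baseSet_trivializationAt' (x z₀)))
  filter_upwards [hU] with z hz
  have hlin : ∀ w : TangentSpace (𝓡 d) (x z), (e ⟨x z, w⟩).2 =
      e.continuousLinearEquivAt ℝ (x z) hz w := fun w => rfl
  simp only [hlin, map_sum, map_smul]

instance FrameBundle.instContinuousSMul :
    ContinuousSMul (GL (Fin d) ℝ)ᵐᵒᵖ (FrameBundle d N) where
  continuous_smul := by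
    rw [continuous_iff]
    refine ⟨show Continuous fun z : (GL (Fin d) ℝ)ᵐᵒᵖ × FrameBundle d N => z.2.1 from
      continuous_base.comp continuous_snd, fun i => ?_⟩
    have := continuous_tangent_sum (Z := (GL (Fin d) ℝ)ᵐᵒᵖ × FrameBundle d N)
      (x := fun z => z.2.1) (c := fun k z => (z.1.unop : Matrix (Fin d) (Fin d) ℝ) k i)
      (v := fun k z => z.2.2 k) (continuous_base.comp continuous_snd)
      (fun k => (Units.continuous_val.comp (continuous_unop.comp continuous_fst)).matrix_elem k i)
      (fun k => (continuous_vector k).comp continuous_snd)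
    refine this.congr fun z => ?_
    exact congrArg (Bundle.TotalSpace.mk z.2.1) (z.2.2.rightMul_apply z.1.unop i).symm

/-- On the frames over a trivializing open set, there are continuous matrix coordinates which are
equivariant for the right action. -/
lemma FrameBundle.exists_coord (x₀ : N) : ∃ (U : Set N) (φ : FrameBundle d N → GL (Fin d) ℝ),
    IsOpen U ∧ x₀ ∈ U ∧ ContinuousOn φ {f | f.1 ∈ U} ∧
      ∀ f : FrameBundle d N, f.1 ∈ U → ∀ g : GL (Fin d) ℝ, φ (op g • f) = φ f * g := by
  set e := trivializationAt (EuclideanSpace ℝ (Fin d)) (TangentSpace (𝓡 d)) x₀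
  let A : FrameBundle d N → Matrix (Fin d) (Fin d) ℝ := fun f => of fun i k =>
    (e ⟨f.1, f.2 k⟩).2 i
  have hlin : ∀ x ∈ e.baseSet, ∀ w : TangentSpace (𝓡 d) x,
      (e ⟨x, w⟩).2 = e.linearMapAt ℝ x w := fun x hx w => by
    rw [e.linearMapAt_apply, if_pos hx]
  have hA : ∀ f : FrameBundle d N, f.1 ∈ e.baseSet → (A f).det ≠ 0 := by
    intro f hf
    let b' := (f.2.map (e.continuousLinearEquivAt ℝ f.1 hf).toLinearEquiv)
    have : A f = (EuclideanSpace.basisFun (Fin d) ℝ).toBasis.toMatrix b' := by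
      ext i k
      rfl
    rw [this, ← Module.Basis.det_apply]
    exact (Module.Basis.isUnit_det _ b').ne_zero
  refine ⟨e.baseSet, fun f => toGL (A f), e.open_baseSet,
    FiberBundle.mem_baseSet_trivializationAt' x₀, ?_, fun f hf g => ?_⟩
  · refine continuousOn_toGL.comp ?_ hA
    refine continuousOn_pi.2 fun i => continuousOn_pi.2 fun k => ?_
    have h1 : ContinuousOn (fun f : FrameBundle d N => (e ⟨f.1, f.2 k⟩).2) {f | f.1 ∈ e.baseSet} :=
      continuous_snd.comp_continuousOn (e.continuousOn.comp (continuous_vector k).continuousOn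
        fun f hf => e.mem_source.2 hf)
    exact (EuclideanSpace.proj (𝕜 := ℝ) i).continuous.comp_continuousOn h1
  · rw [← toGL_coe g, ← toGL_mul (hA f hf) (GL_det_ne_zero _), toGL_coe]
    refine congrArg toGL (Matrix.ext fun i k => ?_)
    rw [mul_apply]
    simp only [A, of_apply]
    have h1 : (op g • f).2 k = ∑ j, (g : Matrix (Fin d) (Fin d) ℝ) j k • f.2 j :=
      f.2.rightMul_apply g k
    have h2 : (e ⟨f.1, (op g • f).2 k⟩).2 =
        ∑ j, (g : Matrix (Fin d) (Fin d) ℝ) j k • (e ⟨f.1, f.2 j⟩).2 := by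
      rw [h1]
      simp only [hlin f.1 hf, map_sum, map_smul]
    refine (congrArg (fun v : EuclideanSpace ℝ (Fin d) => v i) h2).trans ?_
    simp [mul_comm]

/-- A spin structure is a spin covering of the frame bundle. -/
lemma IsSpinManifold.exists_spinCover {d : ℕ} {N : Type u} [TopologicalSpace N]
    [ChartedSpace (EuclideanSpace ℝ (Fin d)) N] [IsManifold (𝓡 d) ∞ N] (hd : 2 ≤ d)
    (h : IsSpinManifold d N) :
    ∃ (P : Type u) (_ : TopologicalSpace P), Nonempty (SpinCover d (FrameBundle d N) P) := by
  obtain ⟨o, P, tP, π, hπ, hcard, hconn⟩ := h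
  refine ⟨P, tP, ⟨⟨{f | f.2.orientation = o.at' f.1}, π, o.continuous', fun f g hf => ?_,
    fun f g hf hg => ?_, hπ, hcard, fun f hf => ?_, fun f => ?_⟩⟩⟩
  · exact (f.2.orientation_rightMul g _).trans ⟨fun h => h.1 hf, fun h => iff_of_true hf h⟩
  · exact (f.2.orientation_rightMul g _).2 (iff_of_false hf hg.not_gt)
  · convert (hconn hd f.1).isPreconnected using 1
    ext q
    constructor
    · rintro ⟨g, hg⟩
      exact (congrArg Sigma.fst hg :)
    · intro hq
      exact FrameBundle.exists_op_smul hq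
  · obtain ⟨U, φ, -, hx, hφ, hφg⟩ := FrameBundle.exists_coord (d := d) f.1
    refine ⟨fun f' => (φ f)⁻¹ * φ f', ?_, fun g => ?_⟩
    · refine continuousOn_const.mul (hφ.mono ?_)
      rintro _ ⟨g, rfl⟩
      exact hx
    · show (φ f)⁻¹ * φ (op g • f) = g
      rw [hφg f hx, inv_mul_cancel_left]

end Topology

end FrameBundle

/-! ### Frames under local diffeomorphisms and under the circle -/

section FrameMap

variable {d : ℕ} {N M : Type*} [TopologicalSpace N] [ChartedSpace (EuclideanSpace ℝ (Fin d)) N]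
  [TopologicalSpace M] [ChartedSpace (EuclideanSpace ℝ (Fin d)) M]

lemma FrameBundle.ext {f f' : FrameBundle d N} (h1 : f.1 = f'.1)
    (h2 : ∀ i, (⟨f.1, f.2 i⟩ : TangentBundle (𝓡 d) N) = ⟨f'.1, f'.2 i⟩) : f = f' := by
  obtain ⟨x, b⟩ := f
  obtain ⟨x', b'⟩ := f'
  obtain rfl : x = x' := h1
  refine congrArg (Sigma.mk x) (Module.Basis.eq_of_apply_eq fun i => ?_)
  simpa using h2 i

/-- The map on frames induced by a local diffeomorphism. -/
noncomputable def frameMap {φ : N → M} (hφ : IsLocalDiffeomorph (𝓡 d) (𝓡 d) ∞ φ)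
    (f : FrameBundle d N) : FrameBundle d M :=
  ⟨φ f.1, f.2.map (hφ.mfderivToContinuousLinearEquiv (by simp) f.1).toLinearEquiv⟩

variable {φ : N → M} (hφ : IsLocalDiffeomorph (𝓡 d) (𝓡 d) ∞ φ)

lemma frameMap_vector (f : FrameBundle d N) (i : Fin d) :
    (⟨(frameMap hφ f).1, (frameMap hφ f).2 i⟩ : TangentBundle (𝓡 d) M) =
      tangentMap (𝓡 d) (𝓡 d) φ ⟨f.1, f.2 i⟩ := rfl

lemma frameMap_op_smul (g : GL (Fin d) ℝ) (f : FrameBundle d N) :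
    frameMap hφ (op g • f) = op g • frameMap hφ f :=
  congrArg (Sigma.mk (φ f.1)) (Module.Basis.map_rightMul _ _ _)

/-- Frames can be pulled back along a local diffeomorphism. -/
lemma exists_frameMap_eq {x : N} {f : FrameBundle d M} (h : φ x = f.1) :
    ∃ f' : FrameBundle d N, f'.1 = x ∧ frameMap hφ f' = f := by
  obtain ⟨y, b⟩ := f
  obtain rfl : φ x = y := h
  refine ⟨⟨x, b.map (hφ.mfderivToContinuousLinearEquiv (by simp) x).toLinearEquiv.symm⟩, rfl,
    congrArg (Sigma.mk (φ x)) (Module.Basis.eq_of_apply_eq fun i => ?_)⟩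
  simp

lemma frameMap_injective {f f' : FrameBundle d N} (h1 : f.1 = f'.1)
    (h2 : frameMap hφ f = frameMap hφ f') : f = f' := by
  obtain ⟨g, rfl⟩ := FrameBundle.exists_op_smul h1.symm
  rw [frameMap_op_smul] at h2
  have h3 : op (1 : GL (Fin d) ℝ) • frameMap hφ f = op g • frameMap hφ f := by
    rwa [op_one, one_smul]
  rw [← (frameMap hφ f).op_smul_injective h3, op_one, one_smul]

variable [IsManifold (𝓡 d) ∞ N] [IsManifold (𝓡 d) ∞ M]

/-- Near a given point, the differential of a local diffeomorphism has a continuous left inverse. -/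
lemma exists_tangent_inverse {φ : N → M} (hφ : IsLocalDiffeomorph (𝓡 d) (𝓡 d) ∞ φ) (x₀ : N) : ∃ (U : Set N) (V : Set M)
    (T : TangentBundle (𝓡 d) M → TangentBundle (𝓡 d) N), IsOpen U ∧ x₀ ∈ U ∧ IsOpen V ∧
      ContinuousOn T (Bundle.TotalSpace.proj ⁻¹' V) ∧ ∀ v : TangentBundle (𝓡 d) N, v.1 ∈ U →
        φ v.1 ∈ V ∧ T (tangentMap (𝓡 d) (𝓡 d) φ v) = v := by
  set τ := (hφ x₀).localInverse
  have hτs : ∀ x ∈ τ.target, φ x ∈ τ.source := fun x hx => by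
    have e : φ x = τ.toPartialEquiv.symm x := by
      rw [← (hφ x₀).localInverse_right_inv (τ.toPartialEquiv.map_target hx)]
      congr 1
      exact (τ.toPartialEquiv.right_inv hx).symm
    rw [e]
    exact τ.toPartialEquiv.map_target hx
  refine ⟨τ.target, τ.source, tangentMapWithin (𝓡 d) (𝓡 d) τ τ.source, τ.open_target,
    (hφ x₀).localInverse_mem_target, τ.open_source,
    τ.contMDiffOn.continuousOn_tangentMapWithin (by simp) τ.open_source.uniqueMDiffOn,
    fun v hv => ⟨hτs _ hv, ?_⟩⟩
  have hu : UniqueMDiffWithinAt (𝓡 d) τ.target v.1 := τ.open_target.uniqueMDiffWithinAt hv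
  have hφd : MDifferentiableAt (𝓡 d) (𝓡 d) φ v.1 := hφ.contMDiff.mdifferentiableAt (by simp)
  rw [← tangentMapWithin_eq_tangentMap (s := τ.target) hu hφd,
    ← tangentMapWithin_comp_at _ (τ.contMDiffOn.mdifferentiableOn (by simp) _ (hτs _ hv))
      hφd.mdifferentiableWithinAt hτs hu,
    tangentMapWithin_congr (f := τ ∘ φ) (f₁ := id) (fun x hx =>
      (hφ x₀).localInverse_left_inv hx) _ hv, tangentMapWithin_id hu]

/-- A family of frames is continuous if its base points and its images under a local diffeomorphism
are. -/
lemma continuous_of_frameMap {Z : Type*} [TopologicalSpace Z] {ψ : Z → FrameBundle d N}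
    (h1 : Continuous fun z => (ψ z).1) (h2 : Continuous fun z => frameMap hφ (ψ z)) :
    Continuous ψ := by
  refine FrameBundle.continuous_iff.2 ⟨h1, fun i => continuous_iff_continuousAt.2 fun z₀ => ?_⟩
  obtain ⟨U, V, T, hU, hxU, hV, hT, h⟩ := exists_tangent_inverse hφ (ψ z₀).1
  have hz : ∀ᶠ z in 𝓝 z₀, (ψ z).1 ∈ U := h1.continuousAt.eventually (hU.mem_nhds hxU)
  have hv : Continuous fun z => tangentMap (𝓡 d) (𝓡 d) φ ⟨(ψ z).1, (ψ z).2 i⟩ :=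
    (FrameBundle.continuous_vector i).comp h2
  have hV' : IsOpen (Bundle.TotalSpace.proj ⁻¹' V : Set (TangentBundle (𝓡 d) M)) :=
    hV.preimage (FiberBundle.continuous_proj _ _)
  have hTat := hT.continuousAt (hV'.mem_nhds (show tangentMap (𝓡 d) (𝓡 d) φ ⟨(ψ z₀).1, (ψ z₀).2 i⟩ ∈ _
    from (h ⟨(ψ z₀).1, (ψ z₀).2 i⟩ hxU).1))
  refine (hTat.comp (f := fun z => tangentMap (𝓡 d) (𝓡 d) φ ⟨(ψ z).1, (ψ z).2 i⟩)
    hv.continuousAt).congr ?_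
  filter_upwards [hz] with z hz
  exact (h ⟨(ψ z).1, (ψ z).2 i⟩ hz).2

end FrameMap

section CircleAction

variable {d : ℕ} {M : Type*} [TopologicalSpace M] [ChartedSpace (EuclideanSpace ℝ (Fin d)) M]
  [MulAction Circle M] [ContMDiffSMul (𝓡 1) (𝓡 d) ∞ Circle M]

lemma isLocalDiffeomorph_smul (z : Circle) :
    IsLocalDiffeomorph (𝓡 d) (𝓡 d) ∞ fun y : M => z • y :=
  (Diffeomorph.smul (𝓡 1) (𝓡 d) ∞ z).isLocalDiffeomorph

/-- The action of the circle on frames by differentials. -/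
noncomputable instance FrameBundle.instSMulCircle : MulAction Circle (FrameBundle d M) where
  smul z f := frameMap (isLocalDiffeomorph_smul z) f
  one_smul f := by
    refine FrameBundle.ext (one_smul Circle f.1) fun i => ?_
    refine (frameMap_vector _ f i).trans ?_
    have : (fun y : M => (1 : Circle) • y) = id := funext fun y => one_smul _ y
    rw [this, tangentMap_id, id]
  mul_smul z w f := by
    refine FrameBundle.ext (mul_smul z w f.1) fun i => ?_
    refine (frameMap_vector _ f i).trans ?_
    refine Eq.trans ?_ (frameMap_vector (isLocalDiffeomorph_smul z)
      (frameMap (isLocalDiffeomorph_smul w) f) i).symm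
    rw [frameMap_vector]
    have : (fun y : M => (z * w) • y) = (fun y : M => z • y) ∘ fun y => w • y :=
      funext fun y => mul_smul _ _ y
    rw [this, tangentMap_comp ((isLocalDiffeomorph_smul z).mdifferentiable (by simp))
      ((isLocalDiffeomorph_smul w).mdifferentiable (by simp)), Function.comp]

lemma FrameBundle.circle_smul_vector (z : Circle) (f : FrameBundle d M) (i : Fin d) :
    (⟨(z • f).1, (z • f).2 i⟩ : TangentBundle (𝓡 d) M) =
      tangentMap (𝓡 d) (𝓡 d) (fun y : M => z • y) ⟨f.1, f.2 i⟩ := rfl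

lemma FrameBundle.circle_smul_op_smul (z : Circle) (g : GL (Fin d) ℝ) (f : FrameBundle d M) :
    z • op g • f = op g • z • f := frameMap_op_smul _ g f

variable [IsManifold (𝓡 d) ∞ M]

lemma continuous_tangentMap_smul : Continuous fun y : Circle × TangentBundle (𝓡 d) M =>
    tangentMap (𝓡 d) (𝓡 d) (fun x : M => y.1 • x) y.2 := by
  have h1 : ContMDiff ((𝓡 1).prod (𝓡 d)) (𝓡 d) ∞ fun y : Circle × M => y.1 • y.2 := contMDiff_smul
  have h2 : Continuous fun y : Circle × TangentBundle (𝓡 d) M =>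
      (equivTangentBundleProd (𝓡 1) Circle (𝓡 d) M).symm (⟨y.1, 0⟩, y.2) := by
    refine (contMDiff_equivTangentBundleProd_symm (n := 0)).continuous.comp (Continuous.prodMk ?_ continuous_snd)
    exact (Bundle.contMDiff_zeroSection ℝ (n := 0) (IB := 𝓡 1) (F := EuclideanSpace ℝ (Fin 1))
      (TangentSpace (𝓡 1) (M := Circle))).continuous.comp continuous_fst
  refine ((h1.continuous_tangentMap (by simp)).comp h2).congr fun y => ?_
  have h3 : (equivTangentBundleProd (𝓡 1) Circle (𝓡 d) M).symm (⟨y.1, 0⟩, y.2) =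
      tangentMap (𝓡 d) ((𝓡 1).prod (𝓡 d)) (fun x : M => (y.1, x)) y.2 := by
    rw [tangentMap_prod_right]
    rfl
  rw [Function.comp_apply, h3, ← tangentMap_comp_at _ (h1.mdifferentiableAt (by simp))
    (f := fun x : M => (y.1, x)) (mdifferentiableAt_const.prodMk mdifferentiableAt_id)]
  rfl

instance FrameBundle.instContinuousSMulCircle : ContinuousSMul Circle (FrameBundle d M) where
  continuous_smul := by
    have : ContinuousSMul Circle M := @ContMDiffSMul.continuousSMul _ _ _ _ _ _ _ (𝓡 1) _ _ _ _ _ (𝓡 d) _ _ _ _ _ _ _ ∞ _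
    refine FrameBundle.continuous_iff.2 ⟨?_, fun i => ?_⟩
    · exact (continuous_fst.smul (FrameBundle.continuous_base.comp continuous_snd) :
        Continuous fun y : Circle × FrameBundle d M => y.1 • y.2.1)
    · have h1 : Continuous fun y : Circle × FrameBundle d M =>
          (⟨y.2.1, y.2.2 i⟩ : TangentBundle (𝓡 d) M) :=
        (FrameBundle.continuous_vector i).comp continuous_snd
      exact continuous_tangentMap_smul.comp (continuous_fst.prodMk h1)

end CircleAction

/-! ### The monodromy of adapted frames -/

section Monodromy

variable {m : ℕ} {M : Type*} [TopologicalSpace M] [ChartedSpace (EuclideanSpace ℝ (Fin (2 * m))) M]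
  [IsManifold (𝓡 (2 * m)) ∞ M] [MulAction Circle M] [ContMDiffSMul (𝓡 1) (𝓡 (2 * m)) ∞ Circle M]

/-- A frame `f` is moved by the elements `exp (2π i t / n)`, `0 ≤ t ≤ 1`, of the circle, and rotated
back by the angles `t θ`. If `exp (2π i / n)` acts on `f` as the rotation by the angles `θ`, then
this is a loop. -/
noncomputable def frameLoop (n : ℕ) (θ : Fin m → ℝ) (f : FrameBundle (2 * m) M) :
    C(I, FrameBundle (2 * m) M) :=
  ⟨fun t => op (rotGL ((t : ℝ) • θ))⁻¹ • Circle.exp (2 * Real.pi / n * t) • f, by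
    have h1 : Continuous fun t : I => rotGL ((t : ℝ) • θ) := continuous_rotGL.comp (by fun_prop)
    have h2 : Continuous fun t : I => Circle.exp (2 * Real.pi / n * t) := by fun_prop
    exact (continuous_op.comp h1.inv).smul (h2.smul continuous_const)⟩

lemma frameLoop_apply (n : ℕ) (θ : Fin m → ℝ) (f : FrameBundle (2 * m) M) (t : I) :
    frameLoop n θ f t = op (rotGL ((t : ℝ) • θ))⁻¹ • Circle.exp (2 * Real.pi / n * t) • f := rfl

/-- The frames on which the generator of the group of order `n` acts as the rotation by `θ`. -/
def adaptedFrames (M : Type*) [TopologicalSpace M] [ChartedSpace (EuclideanSpace ℝ (Fin (2 * m))) M]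
    [IsManifold (𝓡 (2 * m)) ∞ M] [MulAction Circle M]
    [ContMDiffSMul (𝓡 1) (𝓡 (2 * m)) ∞ Circle M] (n : ℕ) (θ : Fin m → ℝ) :
    Set (FrameBundle (2 * m) M) :=
  {f | Circle.exp (2 * Real.pi / n) • f = op (rotGL θ) • f}

variable {n : ℕ} {θ : Fin m → ℝ}

lemma frameLoop_zero (f : FrameBundle (2 * m) M) : frameLoop n θ f 0 = f := by
  simp [frameLoop_apply, rotGL_zero]

lemma frameLoop_one {f : FrameBundle (2 * m) M} (hf : f ∈ adaptedFrames M n θ) :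
    frameLoop n θ f 1 = f := by
  have h : Circle.exp (2 * Real.pi / n) • f = op (rotGL θ) • f := hf
  simp [frameLoop_apply, h, smul_smul]

/-- If `h` commutes with the rotation, `h` acts on the adapted frames. -/
lemma op_smul_mem_adaptedFrames {f : FrameBundle (2 * m) M} (hf : f ∈ adaptedFrames M n θ)
    {h : GL (Fin (2 * m)) ℝ} : op h • f ∈ adaptedFrames M n θ ↔
      Commute (h : Matrix (Fin (2 * m)) (Fin (2 * m)) ℝ) (rotMat θ) := by
  have hf' : Circle.exp (2 * Real.pi / n) • f = op (rotGL θ) • f := hf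
  have e : op h • f ∈ adaptedFrames M n θ ↔ h * rotGL θ = rotGL θ * h := by
    show Circle.exp (2 * Real.pi / n) • op h • f = op (rotGL θ) • op h • f ↔ _
    rw [FrameBundle.circle_smul_op_smul, hf', smul_smul, smul_smul, ← op_mul, ← op_mul,
      f.op_smul_injective.eq_iff, eq_comm]
  rw [e, Units.ext_iff, Units.val_mul, Units.val_mul, coe_rotGL]
  rfl

variable {N P : Type*} [TopologicalSpace N] [ChartedSpace (EuclideanSpace ℝ (Fin (2 * m))) N]
  [IsManifold (𝓡 (2 * m)) ∞ N] [TopologicalSpace P] {p : N → M}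

/-- The loop of an adapted frame has a lift to a loop of frames of `N`, with monodromy `ε`. -/
def HasMon (hp : IsLocalDiffeomorph (𝓡 (2 * m)) (𝓡 (2 * m)) ∞ p)
    (C : SpinCover (2 * m) (FrameBundle (2 * m) N) P) (n : ℕ) (θ : Fin m → ℝ)
    (f : FrameBundle (2 * m) M) (ε : ZMod 2) : Prop :=
  ∃ c : C(I, FrameBundle (2 * m) N), (∀ t, frameMap hp (c t) = frameLoop n θ f t) ∧ c 0 = c 1 ∧
    C.mon c = ε

variable {hp : IsLocalDiffeomorph (𝓡 (2 * m)) (𝓡 (2 * m)) ∞ p}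
  {C : SpinCover (2 * m) (FrameBundle (2 * m) N) P}

/-- The monodromy is constant along paths of adapted frames. -/
lemma HasMon.of_path (hm : 0 < m) (hcov : IsCoveringMap p) {β : C(I, FrameBundle (2 * m) M)}
    (hβ : ∀ s, β s ∈ adaptedFrames M n θ) {ε : ZMod 2} (h : HasMon hp C n θ (β 0) ε) :
    HasMon hp C n θ (β 1) ε := by
  obtain ⟨c, hc, hc01, hmon⟩ := h
  have h1 : Continuous fun y : I × I => rotGL ((y.2 : ℝ) • θ) := continuous_rotGL.comp (by fun_prop)
  have h2 : Continuous fun y : I × I => Circle.exp (2 * Real.pi / n * y.2) := by fun_prop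
  have hL : Continuous fun y : I × I => frameLoop n θ (β y.1) y.2 :=
    (continuous_op.comp h1.inv).smul (h2.smul (β.continuous.comp continuous_fst))
  let H : C(I × I, M) := ⟨fun y => (frameLoop n θ (β y.1) y.2).1, FrameBundle.continuous_base.comp hL⟩
  let f : C(I, N) := ⟨fun t => (c t).1, FrameBundle.continuous_base.comp c.continuous⟩
  have hf : ∀ t, H (0, t) = p (f t) := fun t => (congrArg Sigma.fst (hc t) :).symm
  -- lift the base points of the loops to `N`, and then the frames, which are determined by their
  -- base points and their images
  set K := hcov.liftHomotopy H f hf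
  have hK : ∀ y, p (K y) = H y := fun y => congrFun (hcov.liftHomotopy_lifts H f hf) y
  choose Ψ hΨ1 hΨ2 using fun y => exists_frameMap_eq hp (x := K y) (f := frameLoop n θ (β y.1) y.2)
    (hK y)
  have hΨ : Continuous Ψ := continuous_of_frameMap hp (K.continuous.congr fun y => (hΨ1 y).symm)
    (hL.congr fun y => (hΨ2 y).symm)
  have hΨ0 : ∀ t, Ψ (0, t) = c t := fun t => by
    refine frameMap_injective hp ?_ ((hΨ2 _).trans (hc t).symm)
    rw [hΨ1]
    exact hcov.liftHomotopy_zero H f hf t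
  have hend : ∀ s, frameLoop n θ (β s) 0 = frameLoop n θ (β s) 1 := fun s => by
    rw [frameLoop_zero, frameLoop_one (hβ s)]
  -- the lifted loops stay closed
  have hK01 : ∀ s, K (s, 0) = K (s, 1) := by
    have := hcov.eq_of_comp_eq (A := I) (g₁ := fun s => K (s, 0)) (g₂ := fun s => K (s, 1))
      (by fun_prop) (by fun_prop) (funext fun s => by
        show p (K (s, 0)) = p (K (s, 1))
        rw [hK, hK]
        exact (congrArg Sigma.fst (hend s) :)) 0 (by
        rw [← hΨ1, ← hΨ1, hΨ0, hΨ0, hc01])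
    exact congrFun this
  have hΨ01 : ∀ s, Ψ (s, 0) = Ψ (s, 1) := fun s =>
    frameMap_injective hp (by rw [hΨ1, hΨ1, hK01]) (by rw [hΨ2, hΨ2]; exact hend s)
  refine ⟨⟨fun t => Ψ (1, t), by fun_prop⟩, fun t => hΨ2 (1, t), hΨ01 1, ?_⟩
  have := SpinCover.mon_homotopy (C := C) (by omega) ⟨Ψ, hΨ⟩ hΨ01
  rw [← hmon]
  refine Eq.trans this.symm (congrArg C.mon (ContinuousMap.ext fun t => hΨ0 t))

/-- The effect of changing the frame by a matrix commuting with the rotation on the monodromy: the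
loop of `op h • f` is the loop of `f`, moved by the loop of commutators of `h` and then by the
constant `h`. -/
lemma HasMon.op_smul (hm : 0 < m) (hθ : ∀ j, θ j ∈ Set.Icc 0 Real.pi) {k : ℕ} (hk : k ≤ 2 * m)
    (hk' : ∀ i, onCoord θ i = 0 ↔ (i : ℕ) < k) {f : FrameBundle (2 * m) M}
    {h : GL (Fin (2 * m)) ℝ}
    (hc : Commute (h : Matrix (Fin (2 * m)) (Fin (2 * m)) ℝ) (rotMat θ)) {ε : ZMod 2}
    (hf : HasMon hp C n θ f ε) : HasMon hp C n θ (op h • f) (ε +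
      if 0 < (h : Matrix (Fin (2 * m)) (Fin (2 * m)) ℝ).det * ((h : Matrix (Fin (2 * m)) (Fin (2 * m)) ℝ).submatrix
        (Fin.castLE hk) (Fin.castLE hk)).det then 0 else 1) := by
  obtain ⟨c, hc', hc01, hmon⟩ := hf
  have hw := C.mon_twistLoop hm hθ hk hk' hc (c 0)
  have hw' : C.mon (mulPath (.const I (c 0)) (twistLoop θ h)) =
      if 0 < (h : Matrix (Fin (2 * m)) (Fin (2 * m)) ℝ).det * ((h : Matrix (Fin (2 * m)) (Fin (2 * m)) ℝ).submatrix
        (Fin.castLE hk) (Fin.castLE hk)).det then 0 else 1 := by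
    split_ifs with h'
    · exact hw.2 h'
    · have := mt hw.1 h'
      revert this
      generalize C.mon (mulPath (.const I (c 0)) (twistLoop θ h)) = a
      revert a; decide
  have h1 := SpinCover.mon_mulPath (C := C) (by omega) (c := c) hc01 (twistLoop_zero h)
    (twistLoop_one hc)
  have hloop : mulPath c (twistLoop θ h) 0 = mulPath c (twistLoop θ h) 1 := by
    simp [twistLoop_zero, twistLoop_one hc, hc01]
  -- with `R` the rotation by `t θ`, this is the identity `R⁻¹ (R h R⁻¹ h⁻¹) h = h R⁻¹`
  refine ⟨mulPath (mulPath c (twistLoop θ h)) (.const I h), fun t => ?_, by simp [twistLoop_zero, twistLoop_one hc, hc01], ?_⟩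
  · simp only [mulPath_apply, ContinuousMap.const_apply, frameMap_op_smul, hc', frameLoop_apply,
      FrameBundle.circle_smul_op_smul, smul_smul, ← op_mul]
    congr 2
    rw [twistLoop_apply]
    group
  · rw [SpinCover.mon_mulPath_const (C := C) (by omega) hloop, h1, hmon, hw']

/-- At a point fixed by the circle the loop of a rotated frame stays in the fibre, where it is the
loop of rotations with the winding numbers `l`. -/
lemma hasMon_iff_of_fixed (hm : 0 < m) (hcov : IsCoveringMap p) (hn : n ≠ 0)
    {f : FrameBundle (2 * m) M} (hfib : ∃ x, p x = f.1) {a l r : Fin m → ℤ}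
    (ha : ∀ j, a j = n * l j + r j) (hθ : ∀ j, θ j = 2 * Real.pi * r j / n)
    (hf : ∀ t : ℝ, Circle.exp t • f = op (rotGL fun j => t * a j) • f) {ε : ZMod 2} :
    HasMon hp C n θ f ε ↔ ε = ((∑ j, l j : ℤ) : ZMod 2) := by
  have hloop : ∀ t : I, frameLoop n θ f t = op (intLoop l t) • f := fun t => by
    rw [frameLoop_apply, hf, smul_smul, ← op_mul, ← rotGL_neg, ← rotGL_add, intLoop_apply]
    congr 3
    ext j
    have : (n : ℝ) ≠ 0 := by exact_mod_cast hn
    simp only [Pi.add_apply, Pi.neg_apply, Pi.smul_apply, smul_eq_mul, hθ, ha]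
    push_cast
    field_simp
    ring
  have hval : ∀ f' : FrameBundle (2 * m) N, C.mon (mulPath (.const I f') (intLoop l)) =
      ((∑ j, l j : ℤ) : ZMod 2) := fun f' => C.mon_intLoop hm f' l
  constructor
  · rintro ⟨c, hc, hc01, rfl⟩
    rw [← hval (c 0)]
    congr 1
    ext1 t
    have hbase : ∀ t, (c t).1 = (c 0).1 := fun t => by
      have hconst : ∀ t, p (c t).1 = f.1 := fun t =>
        (congrArg Sigma.fst ((hc t).trans (hloop t)) :)
      exact congrFun (hcov.eq_of_comp_eq (A := I) (g₁ := fun t => (c t).1) (g₂ := fun _ => (c 0).1)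
        (FrameBundle.continuous_base.comp c.continuous) continuous_const
        (funext fun t => (hconst t).trans (hconst 0).symm) 0 rfl) t
    refine frameMap_injective hp (hbase t) ?_
    rw [hc, hloop, mulPath_apply, frameMap_op_smul, ContinuousMap.const_apply, hc, frameLoop_zero]
  · rintro rfl
    obtain ⟨x, hx⟩ := hfib
    obtain ⟨f', hf'1, hf'⟩ := exists_frameMap_eq hp hx
    refine ⟨mulPath (.const I f') (intLoop l), fun t => ?_, by simp [intLoop_zero, intLoop_one],
      hval f'⟩
    rw [hloop, mulPath_apply, frameMap_op_smul, ContinuousMap.const_apply, hf']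

end Monodromy

/-! ### Linearisation of maps of finite order -/

section Linearisation

variable {E : Type*} [NormedAddCommGroup E] [NormedSpace ℝ E]

lemma eventually_contDiffAt_iterate {G : E → E} {w₀ : E} (hG : ∀ᶠ w in 𝓝 w₀, ContDiffAt ℝ ∞ G w)
    (h0 : G w₀ = w₀) : ∀ i, ∀ᶠ w in 𝓝 w₀, ContDiffAt ℝ ∞ G^[i] w
  | 0 => .of_forall fun _ => contDiffAt_id
  | i + 1 => by
    have ht : Filter.Tendsto G (𝓝 w₀) (𝓝 w₀) := by
      have := hG.self_of_nhds.continuousAt.tendsto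
      rwa [h0] at this
    filter_upwards [hG, ht.eventually (eventually_contDiffAt_iterate hG h0 i)] with w h1 h2
    rw [Function.iterate_succ]
    exact h2.comp w h1

variable [CompleteSpace E]

/-- A smooth map of finite order near a fixed point is conjugate to its differential there: average
a linear coordinate over the finite cyclic group. -/
lemma exists_linearisation {G : E → E} {w₀ : E} (hG : ∀ᶠ w in 𝓝 w₀, ContDiffAt ℝ ∞ G w)
    (h0 : G w₀ = w₀) {n : ℕ} (hn : n ≠ 0) (hGn : ∀ᶠ w in 𝓝 w₀, G^[n] w = w) (A : E ≃L[ℝ] E)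
    (R : E →L[ℝ] E) (hR : ∀ v, A (fderiv ℝ G w₀ v) = R (A v)) {T : Set E} (hT : T ∈ 𝓝 w₀) :
    ∃ φ : OpenPartialHomeomorph E E, w₀ ∈ φ.source ∧ φ w₀ = 0 ∧ φ.source ⊆ T ∧
      ContDiffOn ℝ ∞ φ φ.source ∧ ContDiffOn ℝ ∞ φ.symm φ.target ∧
      ∀ w ∈ φ.source, φ (G w) = R (φ w) := by
  set L := fderiv ℝ G w₀
  have hL : HasFDerivAt G L w₀ := (hG.self_of_nhds.differentiableAt (by simp)).hasFDerivAt
  have hRL : ∀ i v, A ((L ^ i) v) = (R ^ i) (A v) := fun i => by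
    induction i with
    | zero => simp
    | succ i ih => intro v; rw [pow_succ, pow_succ, mul_apply_eq_comp,
        mul_apply_eq_comp, ih, hR]
  have hLn : L ^ n = 1 := by
    have h1 : HasFDerivAt G^[n] (L ^ n) w₀ := hL.iterate h0 n
    have h2 : HasFDerivAt G^[n] (1 : E →L[ℝ] E) w₀ :=
      (hasFDerivAt_id w₀).congr_of_eventuallyEq hGn
    exact h1.unique h2
  have hRn : R ^ n = 1 := by
    ext v
    rw [← A.apply_symm_apply v, ← hRL, hLn]
    rfl
  -- the average of `R⁻ⁱ A Gⁱ` over the group, where `R⁻ⁱ` is written as `R ^ (n - i)`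
  let f : E → E := fun w => (n : ℝ)⁻¹ • ∑ i ∈ Finset.range n, (R ^ (n - i)) (A (G^[i] w - w₀))
  have hfsm : ∀ᶠ w in 𝓝 w₀, ContDiffAt ℝ ∞ f w := by
    have : ∀ᶠ w in 𝓝 w₀, ∀ i ∈ Finset.range n, ContDiffAt ℝ ∞ G^[i] w :=
      (Filter.eventually_all_finset _).2 fun i _ => eventually_contDiffAt_iterate hG h0 i
    filter_upwards [this] with w hw
    refine contDiffAt_const.smul (ContDiffAt.sum fun i hi => ?_)
    exact (R ^ (n - i)).contDiff.contDiffAt.comp w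
      (A.contDiff.contDiffAt.comp w ((hw i hi).sub contDiffAt_const))
  -- every summand has the derivative `A`
  have hf' : HasFDerivAt f (A : E →L[ℝ] E) w₀ := by
    have h1 : HasFDerivAt f ((n : ℝ)⁻¹ • ∑ i ∈ Finset.range n,
        (R ^ (n - i)) ∘L (A : E →L[ℝ] E) ∘L (L ^ i)) w₀ := by
      refine (HasFDerivAt.fun_sum fun i _ => ?_).const_smul _
      exact (R ^ (n - i)).hasFDerivAt.comp w₀ ((A : E →L[ℝ] E).hasFDerivAt.comp w₀
        ((hL.iterate h0 i).sub_const w₀))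
    convert h1 using 1
    have h2 : ∀ i ∈ Finset.range n, (R ^ (n - i)) ∘L (A : E →L[ℝ] E) ∘L (L ^ i) = A := by
      intro i hi
      ext v
      have : n - i + i = n := Nat.sub_add_cancel (Finset.mem_range.1 hi).le
      simp only [ContinuousLinearMap.comp_apply, ContinuousLinearEquiv.coe_coe, hRL]
      rw [← mul_apply_eq_comp, ← pow_add, this, hRn]
      rfl
    rw [Finset.sum_congr rfl h2, Finset.sum_const, Finset.card_range, ← Nat.cast_smul_eq_nsmul ℝ,
      smul_smul, inv_mul_cancel₀ (by exact_mod_cast hn), one_smul]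
  -- applying `G` permutes the summands cyclically, up to the factor `R`
  have hfG : ∀ w, G^[n] w = w → f (G w) = R (f w) := by
    intro w hw
    simp only [f, map_smul, map_sum]
    congr 1
    obtain ⟨k, rfl⟩ : ∃ k, n = k + 1 := ⟨n - 1, by omega⟩
    rw [Finset.sum_range_succ, Finset.sum_range_succ' (fun i => R ((R ^ (k + 1 - i)) _))]
    congr 1
    · refine Finset.sum_congr rfl fun i hi => ?_
      have : k + 1 - i = k + 1 - (i + 1) + 1 := by have := Finset.mem_range.1 hi; omega
      rw [← mul_apply_eq_comp, ← pow_succ', ← this, Function.iterate_succ_apply]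
    · rw [← mul_apply_eq_comp, ← pow_succ', ← Function.iterate_succ_apply, hw, Nat.sub_zero,
        pow_succ R (k + 1), hRn]
      simp
  have hinv : ∀ᶠ w in 𝓝 w₀, ∃ f' : E ≃L[ℝ] E, HasFDerivAt f (f' : E →L[ℝ] E) w := by
    have h1 : ContinuousAt (fderiv ℝ f) w₀ :=
      (hfsm.self_of_nhds.fderiv_right (m := 0) (by simp)).continuousAt
    have h2 := h1.eventually (f := fderiv ℝ f) (hf'.fderiv.symm ▸ A.nhds)
    filter_upwards [h2, hfsm] with w ⟨f', hf'w⟩ hw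
    exact ⟨f', hf'w ▸ (hw.differentiableAt (by simp)).hasFDerivAt⟩
  obtain ⟨O, hO, hOo, hwO⟩ := mem_nhds_iff.1 (hfsm.and (hinv.and (hGn.and hT)))
  set φ₀ := hfsm.self_of_nhds.toOpenPartialHomeomorph f hf' (by simp)
  have hφ₀ : ∀ w, φ₀ w = f w := fun w => rfl
  refine ⟨φ₀.restrOpen O hOo, ⟨hfsm.self_of_nhds.mem_toOpenPartialHomeomorph_source hf' (by simp),
    hwO⟩, ?_, fun w hw => (hO hw.2).2.2.2, fun w hw => (hO hw.2).1.contDiffWithinAt, ?_, ?_⟩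
  · show f w₀ = 0
    have : ∀ i, G^[i] w₀ = w₀ := fun i => Function.iterate_fixed h0 i
    simp [f, this]
  · intro v hv
    have hv' := (φ₀.restrOpen O hOo).map_target hv
    obtain ⟨f', hf'⟩ := (hO hv'.2).2.1
    exact ((φ₀.restrOpen O hOo).contDiffAt_symm hv hf' (hO hv'.2).1).contDiffWithinAt
  · exact fun w hw => hfG w (hO hw.2).2.2.1

end Linearisation

/-! ### Coordinate frames and linearising charts -/

section ChartFrame

variable {d : ℕ} {M : Type*} [TopologicalSpace M] [ChartedSpace (EuclideanSpace ℝ (Fin d)) M]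
  {χ : OpenPartialHomeomorph M (EuclideanSpace ℝ (Fin d))}

lemma mdifferentiable_of_mem_maximalAtlas (hχ : χ ∈ IsManifold.maximalAtlas (𝓡 d) ∞ M) :
    χ.MDifferentiable (𝓡 d) (𝓡 d) :=
  ⟨(contMDiffOn_of_mem_maximalAtlas hχ).mdifferentiableOn (by simp),
    (contMDiffOn_symm_of_mem_maximalAtlas hχ).mdifferentiableOn (by simp)⟩

lemma TangentBundle.mk_eq_mk {x y : M} (h : x = y) {v : TangentSpace (𝓡 d) x}
    {w : TangentSpace (𝓡 d) y} (hv : (v : EuclideanSpace ℝ (Fin d)) = w) :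
    (⟨x, v⟩ : TangentBundle (𝓡 d) M) = ⟨y, w⟩ := by
  subst h
  exact congrArg _ hv

lemma TangentBundle.mk_eq_mk_iff {x y : M} {v : TangentSpace (𝓡 d) x}
    {w : TangentSpace (𝓡 d) y} : (⟨x, v⟩ : TangentBundle (𝓡 d) M) = ⟨y, w⟩ ↔
      x = y ∧ (v : EuclideanSpace ℝ (Fin d)) = w := by
  refine ⟨fun h => ⟨congrArg Bundle.TotalSpace.proj h, ?_⟩, fun h => TangentBundle.mk_eq_mk h.1 h.2⟩
  cases h
  rfl

lemma fderiv_chartAt_conj {γ : M → M} {x : M} (hγ : MDifferentiableAt (𝓡 d) (𝓡 d) γ x)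
    (hx : γ x = x) : fderiv ℝ (chartAt (EuclideanSpace ℝ (Fin d)) x ∘ γ ∘
      (chartAt (EuclideanSpace ℝ (Fin d)) x).symm) (chartAt (EuclideanSpace ℝ (Fin d)) x x) =
      (mfderiv (𝓡 d) (𝓡 d) γ x : EuclideanSpace ℝ (Fin d) →L[ℝ] EuclideanSpace ℝ (Fin d)) := by
  refine Eq.trans ?_ hγ.mfderiv.symm
  simp only [writtenInExtChartAt, extChartAt, hx, mfld_simps]
  rw [fderivWithin_univ]

lemma toEuclideanCLM_single (R : Matrix (Fin d) (Fin d) ℝ) (i : Fin d) :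
    toEuclideanCLM (𝕜 := ℝ) R (EuclideanSpace.single i (1 : ℝ)) =
      ∑ k, R k i • EuclideanSpace.single k (1 : ℝ) := by
  ext k
  simp [Pi.single_apply]

open Classical in
/-- The coordinate frames of a chart; outside the domain of the chart the value is irrelevant. -/
noncomputable def chartFrame (hχ : χ ∈ IsManifold.maximalAtlas (𝓡 d) ∞ M) (z : M) :
    FrameBundle d M :=
  ⟨z, if hz : z ∈ χ.source then (EuclideanSpace.basisFun (Fin d) ℝ).toBasis.map
    ((mdifferentiable_of_mem_maximalAtlas hχ).mfderiv hz).symm.toLinearEquiv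
    else (EuclideanSpace.basisFun (Fin d) ℝ).toBasis⟩

variable (hχ : χ ∈ IsManifold.maximalAtlas (𝓡 d) ∞ M)

lemma chartFrame_vector {z : M} (hz : z ∈ χ.source) (i : Fin d) : (chartFrame hχ z).2 i =
    ((mdifferentiable_of_mem_maximalAtlas hχ).mfderiv hz).symm (EuclideanSpace.single i (1 : ℝ)) := by
  have h : (chartFrame hχ z).2 = (EuclideanSpace.basisFun (Fin d) ℝ).toBasis.map
    ((mdifferentiable_of_mem_maximalAtlas hχ).mfderiv hz).symm.toLinearEquiv := dif_pos hz
  refine (congrArg (fun b : Module.Basis (Fin d) ℝ (TangentSpace (𝓡 d) z) => b i) h).trans ?_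
  exact congrArg ((mdifferentiable_of_mem_maximalAtlas hχ).mfderiv hz).symm
    (by simp : (EuclideanSpace.basisFun (Fin d) ℝ).toBasis i = EuclideanSpace.single i (1 : ℝ))

lemma mfderiv_chartFrame {z : M} (hz : z ∈ χ.source) (i : Fin d) :
    mfderiv (𝓡 d) (𝓡 d) χ z ((chartFrame hχ z).2 i) = EuclideanSpace.single i (1 : ℝ) := by
  rw [chartFrame_vector hχ hz]
  exact ((mdifferentiable_of_mem_maximalAtlas hχ).mfderiv hz).apply_symm_apply _

/-- The coordinate frame of a chart is continuous: it is the image of a constant frame under the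
inverse chart. -/
lemma continuousOn_chartFrame [IsManifold (𝓡 d) ∞ M] : ContinuousOn (chartFrame hχ) χ.source := by
  rw [continuousOn_iff_continuous_domRestrict]
  refine FrameBundle.continuous_iff.2 ⟨continuous_subtype_val, fun i => ?_⟩
  have hs := contMDiffOn_symm_of_mem_maximalAtlas hχ
  have h1 : ContinuousOn (tangentMapWithin (𝓡 d) (𝓡 d) χ.symm χ.target)
      (Bundle.TotalSpace.proj ⁻¹' χ.target) :=
    hs.continuousOn_tangentMapWithin (by simp) χ.open_target.uniqueMDiffOn
  have h2 : Continuous fun w : EuclideanSpace ℝ (Fin d) =>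
      (⟨w, EuclideanSpace.single i (1 : ℝ)⟩ : TangentBundle (𝓡 d) (EuclideanSpace ℝ (Fin d))) :=
    (tangentBundleModelSpaceHomeomorph (𝓡 d)).symm.continuous.comp
      (continuous_id.prodMk continuous_const)
  have h3 : Continuous fun z : χ.source => (⟨χ z, EuclideanSpace.single i (1 : ℝ)⟩ :
      TangentBundle (𝓡 d) (EuclideanSpace ℝ (Fin d))) :=
    h2.comp (continuousOn_iff_continuous_domRestrict.1 χ.continuousOn)
  refine (h1.comp_continuous h3 fun z => χ.map_source z.2).congr fun z => ?_
  refine (tangentMapWithin_eq_tangentMap (χ.open_target.uniqueMDiffWithinAt (χ.map_source z.2))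
    ((hs.mdifferentiableOn (by simp) _ (χ.map_source z.2)).mdifferentiableAt
      (χ.open_target.mem_nhds (χ.map_source z.2)))).trans ?_
  show tangentMap _ _ _ _ = (⟨z, (chartFrame hχ z).2 i⟩ : TangentBundle (𝓡 d) M)
  rw [chartFrame_vector hχ z.2]
  exact TangentBundle.mk_eq_mk (χ.left_inv z.2) rfl

/-- If a map is linear in a chart, so is its differential at a fixed point, with the same matrix. -/
lemma mfderiv_eq_toEuclideanCLM_of_eqOn (hχ : χ ∈ IsManifold.maximalAtlas (𝓡 d) ∞ M) {γ : M → M} (hγ : MDifferentiable (𝓡 d) (𝓡 d) γ)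
    {R : Matrix (Fin d) (Fin d) ℝ} (hR : ∀ z ∈ χ.source, χ (γ z) = toEuclideanCLM (𝕜 := ℝ) R (χ z))
    {z : M} (hz : z ∈ χ.source) (hfix : γ z = z) (v : TangentSpace (𝓡 d) z) :
    (mfderiv (𝓡 d) (𝓡 d) χ z (mfderiv (𝓡 d) (𝓡 d) γ z v) : EuclideanSpace ℝ (Fin d)) =
      toEuclideanCLM (𝕜 := ℝ) R (mfderiv (𝓡 d) (𝓡 d) χ z v) := by
  have hd : MDifferentiableAt (𝓡 d) (𝓡 d) χ z :=
    (mdifferentiable_of_mem_maximalAtlas hχ).mdifferentiableAt hz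
  have hL : MDifferentiableAt (𝓡 d) (𝓡 d) (toEuclideanCLM (𝕜 := ℝ) R) (χ z) :=
    (toEuclideanCLM (𝕜 := ℝ) R).differentiableAt.mdifferentiableAt
  have h1 : χ ∘ γ =ᶠ[𝓝 z] toEuclideanCLM (𝕜 := ℝ) R ∘ χ := by
    filter_upwards [χ.open_source.mem_nhds hz] with y hy using hR y hy
  have hd' : MDifferentiableAt (𝓡 d) (𝓡 d) χ (γ z) := by rwa [hfix]
  have h2 : (mfderiv (𝓡 d) (𝓡 d) χ (γ z) : EuclideanSpace ℝ (Fin d) →L[ℝ] EuclideanSpace ℝ (Fin d))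
      ∘L mfderiv (𝓡 d) (𝓡 d) γ z = mfderiv (𝓡 d) (𝓡 d) (toEuclideanCLM (𝕜 := ℝ) R) (χ z) ∘L
        mfderiv (𝓡 d) (𝓡 d) χ z := by
    refine (mfderiv_comp z hd' (hγ z)).symm.trans (Eq.trans ?_ (mfderiv_comp z hL hd))
    exact h1.mfderiv_eq
  have h4 : (mfderiv (𝓡 d) (𝓡 d) χ (γ z) : EuclideanSpace ℝ (Fin d) →L[ℝ] EuclideanSpace ℝ (Fin d))
      = mfderiv (𝓡 d) (𝓡 d) χ z := by
    rw [hfix]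
  have h5 : mfderiv (𝓡 d) (𝓡 d) (toEuclideanCLM (𝕜 := ℝ) R) (χ z) = toEuclideanCLM (𝕜 := ℝ) R :=
    (toEuclideanCLM (𝕜 := ℝ) R).hasFDerivAt.hasMFDerivAt.mfderiv
  rw [h4, h5] at h2
  exact DFunLike.congr_fun h2 v

variable [MulAction Circle M] [ContMDiffSMul (𝓡 1) (𝓡 d) ∞ Circle M]

/-- If an element of the circle acts linearly in a chart, its matrix is that of the action on the
coordinate frames at the fixed points. -/
lemma smul_chartFrame {g : Circle} {R : GL (Fin d) ℝ}
    (hR : ∀ z ∈ χ.source, χ (g • z) =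
      toEuclideanCLM (𝕜 := ℝ) (R : Matrix (Fin d) (Fin d) ℝ) (χ z))
    {z : M} (hz : z ∈ χ.source) (hfix : g • z = z) :
    g • chartFrame hχ z = op R • chartFrame hχ z := by
  refine FrameBundle.ext hfix fun i => TangentBundle.mk_eq_mk hfix ?_
  refine ((mdifferentiable_of_mem_maximalAtlas hχ).mfderiv hz).injective ?_
  refine (mfderiv_eq_toEuclideanCLM_of_eqOn hχ
    ((isLocalDiffeomorph_smul (d := d) (M := M) g).mdifferentiable (by simp)) hR hz hfix
    ((chartFrame hχ z).2 i)).trans ?_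
  rw [mfderiv_chartFrame hχ hz]
  refine Eq.trans ?_ (congrArg ((mdifferentiable_of_mem_maximalAtlas hχ).mfderiv hz)
    (Module.Basis.rightMul_apply _ R i)).symm
  rw [map_sum]
  have h : ∀ k, ((mdifferentiable_of_mem_maximalAtlas hχ).mfderiv hz)
      ((R : Matrix (Fin d) (Fin d) ℝ) k i • (chartFrame hχ z).2 k) =
      (R : Matrix (Fin d) (Fin d) ℝ) k i • EuclideanSpace.single k (1 : ℝ) := fun k =>
    (map_smul _ _ _).trans (congrArg _ (mfderiv_chartFrame hχ hz k))
  exact (toEuclideanCLM_single _ i).trans (Finset.sum_congr rfl fun k _ => h k).symm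

end ChartFrame

section LinearisingChart

variable {d : ℕ} {M : Type*} [TopologicalSpace M] [ChartedSpace (EuclideanSpace ℝ (Fin d)) M]
  [IsManifold (𝓡 d) ∞ M] [MulAction Circle M] [ContMDiffSMul (𝓡 1) (𝓡 d) ∞ Circle M]

/-- A finite order element of the circle acts linearly in a suitable chart around a fixed point.
The domain of the chart corresponds to a ball. -/
lemma exists_linearising_chart {g : Circle} {n : ℕ} (hn : n ≠ 0) (hgn : g ^ n = 1)
    {f : FrameBundle d M} {R : GL (Fin d) ℝ} (hf : g • f = op R • f) :
    ∃ χ ∈ IsManifold.maximalAtlas (𝓡 d) ∞ M, f.1 ∈ χ.source ∧ χ f.1 = 0 ∧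
      (∃ ρ > 0, χ.target = Metric.ball 0 ρ) ∧
      (∀ z ∈ χ.source, χ (g • z) = toEuclideanCLM (𝕜 := ℝ) (R : Matrix (Fin d) (Fin d) ℝ) (χ z)) ∧
      ∀ z ∈ χ.source, toEuclideanCLM (𝕜 := ℝ) (R : Matrix (Fin d) (Fin d) ℝ) (χ z) = χ z →
        g • z = z := by
  set x₀ := f.1
  set γ : M → M := fun y => g • y
  have hfix : γ x₀ = x₀ := (congrArg Sigma.fst hf :)
  have hγs : ContMDiff (𝓡 d) (𝓡 d) ∞ γ := (isLocalDiffeomorph_smul (d := d) (M := M) g).contMDiff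
  have hγc : Continuous γ := hγs.continuous
  have hγi : ∀ i y, γ^[i] y = g ^ i • y := fun i y => smul_iterate_apply g i y
  set e := chartAt (EuclideanSpace ℝ (Fin d)) x₀
  have hxe : x₀ ∈ e.source := mem_chart_source _ _
  have he : e ∈ IsManifold.maximalAtlas (𝓡 d) ∞ M := IsManifold.chart_mem_maximalAtlas x₀
  have he1 := contMDiffOn_of_mem_maximalAtlas he
  have he2 := contMDiffOn_symm_of_mem_maximalAtlas he
  set w₀ := e x₀
  have hw₀ : e.symm w₀ = x₀ := e.left_inv hxe
  -- the action of `g` in a chart, which is defined near `w₀` only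
  set G := e ∘ γ ∘ e.symm
  have hset : ∀ i, ∀ᶠ w in 𝓝 w₀, w ∈ e.target ∧ γ^[i] (e.symm w) ∈ e.source := fun i => by
    refine (e.open_target.eventually_mem (e.map_source hxe)).and ?_
    have h1 : ContinuousAt (fun w => γ^[i] (e.symm w)) w₀ :=
      (hγc.iterate i).continuousAt.comp (e.symm.continuousAt (e.map_source hxe))
    refine h1.eventually_mem (e.open_source.mem_nhds ?_)
    rwa [hw₀, Function.iterate_fixed hfix]
  have hG : ∀ᶠ w in 𝓝 w₀, ContDiffAt ℝ ∞ G w := by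
    filter_upwards [(hset 1).eventually_nhds] with w hw
    have h1 : ContMDiffAt (𝓡 d) (𝓡 d) ∞ e.symm w :=
      he2.contMDiffAt (e.open_target.mem_nhds hw.self_of_nhds.1)
    have h2 : ContMDiffAt (𝓡 d) (𝓡 d) ∞ e (γ (e.symm w)) :=
      he1.contMDiffAt (e.open_source.mem_nhds hw.self_of_nhds.2)
    exact (h2.comp w (hγs.contMDiffAt.comp w h1)).contDiffAt
  have hG0 : G w₀ = w₀ := by simp only [G, Function.comp_apply, hw₀, hfix]; rfl
  have hGi : ∀ i, ∀ᶠ w in 𝓝 w₀, G^[i] w = e (γ^[i] (e.symm w)) := fun i => by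
    induction i with
    | zero => filter_upwards [hset 0] with w hw using (e.right_inv hw.1).symm
    | succ i ih =>
      filter_upwards [ih, hset i] with w hw hw'
      rw [Function.iterate_succ_apply', hw, Function.iterate_succ_apply']
      simp only [G, Function.comp_apply]
      rw [e.left_inv hw'.2]
  have hGn : ∀ᶠ w in 𝓝 w₀, G^[n] w = w := by
    filter_upwards [hGi n, hset 0] with w hw hw'
    rw [hw, hγi, hgn, one_smul, e.right_inv hw'.1]
  -- in the linear coordinates given by the frame, the differential of `G` is the matrix `R`
  let b : Module.Basis (Fin d) ℝ (EuclideanSpace ℝ (Fin d)) := f.2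
  let A : EuclideanSpace ℝ (Fin d) ≃L[ℝ] EuclideanSpace ℝ (Fin d) :=
    (b.equivFun.trans (WithLp.linearEquiv 2 ℝ (Fin d → ℝ)).symm).toContinuousLinearEquiv
  have hA : ∀ i, A (b i) = EuclideanSpace.single i (1 : ℝ) := fun i => by
    ext k
    simp [A, b.equivFun_apply, Finsupp.single_apply, eq_comm]
  have hR : ∀ v, A (fderiv ℝ G w₀ v) =
      toEuclideanCLM (𝕜 := ℝ) (R : Matrix (Fin d) (Fin d) ℝ) (A v) := fun v => by
    rw [fderiv_chartAt_conj (hγs.mdifferentiableAt (by simp)) hfix]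
    let D : EuclideanSpace ℝ (Fin d) →L[ℝ] EuclideanSpace ℝ (Fin d) := mfderiv (𝓡 d) (𝓡 d) γ x₀
    have hL : ∀ i, D (b i) = (b.rightMul R) i := fun i =>
      (TangentBundle.mk_eq_mk_iff.1 (congrFun (congrArg (fun f => (FrameBundle.toTangent d M f).2) hf) i)).2
    have : (A : EuclideanSpace ℝ (Fin d) →ₗ[ℝ] EuclideanSpace ℝ (Fin d)) ∘ₗ
        (D : EuclideanSpace ℝ (Fin d) →ₗ[ℝ] EuclideanSpace ℝ (Fin d)) =
        (toEuclideanCLM (𝕜 := ℝ) (R : Matrix (Fin d) (Fin d) ℝ) :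
          EuclideanSpace ℝ (Fin d) →L[ℝ] EuclideanSpace ℝ (Fin d)) ∘ₗ (A : EuclideanSpace ℝ (Fin d) →ₗ[ℝ] EuclideanSpace ℝ (Fin d)) := by
      refine b.ext fun i => ?_
      show A (D (b i)) =
        toEuclideanCLM (𝕜 := ℝ) (R : Matrix (Fin d) (Fin d) ℝ) (A (b i))
      rw [hL, Module.Basis.rightMul_apply, map_sum, hA, toEuclideanCLM_single]
      exact Finset.sum_congr rfl fun k _ => by rw [map_smul, hA]
    exact LinearMap.congr_fun this v
  obtain ⟨φ, hφ0, hφ1, hφT, hφs, hφs', hφR⟩ := exists_linearisation hG hG0 hn hGn A _ hR (hset 1)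
  set χ₁ := e.trans φ
  have hχ₁ : ∀ z ∈ χ₁.source, z ∈ e.source ∧ e z ∈ φ.source := fun z hz => by
    simpa [χ₁] using hz
  have hχR : ∀ z ∈ χ₁.source, χ₁ (g • z) =
      toEuclideanCLM (𝕜 := ℝ) (R : Matrix (Fin d) (Fin d) ℝ) (χ₁ z) := fun z hz => by
    have h := hφR _ (hχ₁ z hz).2
    simp only [G, Function.comp_apply] at h
    rw [e.left_inv (hχ₁ z hz).1] at h
    exact h
  -- shrink the domain, so that it is mapped to the domain of `χ₁` by `g`, and then to a ball
  set χ₂ := χ₁.restrOpen (γ ⁻¹' χ₁.source) (χ₁.open_source.preimage hγc)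
  have hx₁ : x₀ ∈ χ₁.source := by simpa [χ₁] using ⟨hxe, hφ0⟩
  have hx₂ : x₀ ∈ χ₂.source := ⟨hx₁, by rwa [Set.mem_preimage, hfix]⟩
  have hχ₂0 : χ₂ x₀ = 0 := hφ1
  obtain ⟨ρ, hρ, hρt⟩ := Metric.isOpen_iff.1 χ₂.open_target _ (χ₂.map_source hx₂)
  rw [hχ₂0] at hρt
  set χ := (χ₂.symm.restrOpen (Metric.ball 0 ρ) Metric.isOpen_ball).symm
  have hsrc : ∀ z ∈ χ.source, z ∈ χ₂.source ∧ χ₂ z ∈ Metric.ball 0 ρ := fun z hz => hz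
  refine ⟨χ, ?_, ⟨hx₂, (congrArg (· ∈ Metric.ball 0 ρ) hχ₂0).mpr (Metric.mem_ball_self hρ)⟩, hφ1, ⟨ρ, hρ, ?_⟩,
    fun z hz => hχR z (hsrc z hz).1.1, fun z hz h => ?_⟩
  · refine χ.mem_maximalAtlas_of_contMDiffOn ?_ ?_
    · exact hφs.contMDiffOn.comp (he1.mono fun z hz => (hχ₁ z (hsrc z hz).1.1).1)
        fun z hz => (hχ₁ z (hsrc z hz).1.1).2
    · have ht : ∀ w ∈ χ.target, w ∈ φ.target ∧ φ.symm w ∈ e.target := fun w hw => by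
        have : w ∈ χ₁.target := hw.1.1
        simpa [χ₁] using this
      exact he2.comp (hφs'.contMDiffOn.mono fun w hw => (ht w hw).1) fun w hw => (ht w hw).2
  · exact Set.inter_eq_right.2 hρt
  · refine χ₁.injOn (hsrc z hz).1.2 (hsrc z hz).1.1 ?_
    exact (hχR z (hsrc z hz).1.1).trans h

end LinearisingChart

/-! ### Slice charts and embedded submanifolds -/

section Slice

variable {d k : ℕ}

/-- The inclusion of the first `k` coordinates. -/
noncomputable def coordIncl (d k : ℕ) : EuclideanSpace ℝ (Fin k) →L[ℝ] EuclideanSpace ℝ (Fin d) :=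
  LinearMap.toContinuousLinearMap
    { toFun := fun v => WithLp.toLp 2 fun i => if h : (i : ℕ) < k then v ⟨i, h⟩ else 0
      map_add' := fun v w => by ext i; by_cases h : (i : ℕ) < k <;> simp [h]
      map_smul' := fun c v => by ext i; by_cases h : (i : ℕ) < k <;> simp [h] }

/-- The projection to the first `k` coordinates. -/
noncomputable def coordProj (hk : k ≤ d) : EuclideanSpace ℝ (Fin d) →L[ℝ] EuclideanSpace ℝ (Fin k) :=
  LinearMap.toContinuousLinearMap
    { toFun := fun v => WithLp.toLp 2 fun i => v (Fin.castLE hk i)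
      map_add' := fun v w => by ext i; simp
      map_smul' := fun c v => by ext i; simp }

lemma coordIncl_apply (v : EuclideanSpace ℝ (Fin k)) (i : Fin d) :
    coordIncl d k v i = if h : (i : ℕ) < k then v ⟨i, h⟩ else 0 := rfl

lemma coordProj_apply (hk : k ≤ d) (v : EuclideanSpace ℝ (Fin d)) (i : Fin k) :
    coordProj hk v i = v (Fin.castLE hk i) := rfl

lemma coordProj_coordIncl (hk : k ≤ d) (v : EuclideanSpace ℝ (Fin k)) :
    coordProj hk (coordIncl d k v) = v := by
  ext i
  simp [coordProj_apply, coordIncl_apply]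

lemma coordIncl_coordProj (hk : k ≤ d) {w : EuclideanSpace ℝ (Fin d)}
    (hw : ∀ i : Fin d, k ≤ i → w i = 0) : coordIncl d k (coordProj hk w) = w := by
  ext i
  rw [coordIncl_apply]
  split_ifs with h
  · rfl
  · exact (hw i (not_lt.1 h)).symm

lemma coordIncl_single (hk : k ≤ d) (i : Fin k) : coordIncl d k (EuclideanSpace.single i (1 : ℝ)) =
    EuclideanSpace.single (Fin.castLE hk i) (1 : ℝ) := by
  ext j
  rw [coordIncl_apply]
  simp only [PiLp.single_apply, Fin.ext_iff, Fin.val_castLE]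
  split_ifs <;> first | rfl | omega

variable {M : Type*} [TopologicalSpace M] [ChartedSpace (EuclideanSpace ℝ (Fin d)) M]

/-- A chart in which `F` is given by the vanishing of all coordinates but the first `k`. -/
structure IsSliceChart (k : ℕ) (F : Set M)
    (χ : OpenPartialHomeomorph M (EuclideanSpace ℝ (Fin d))) : Prop where
  mem_maximalAtlas : χ ∈ IsManifold.maximalAtlas (𝓡 d) ∞ M
  mem_iff : ∀ z ∈ χ.source, z ∈ F ↔ ∀ i : Fin d, k ≤ i → χ z i = 0

variable {F : Set M} {χ : OpenPartialHomeomorph M (EuclideanSpace ℝ (Fin d))}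

open Classical in
/-- The chart of `F` given by the first `k` coordinates of a slice chart. The point `x₀` is the
value of the inverse outside the range of the chart. -/
noncomputable def sliceChart (hk : k ≤ d) (h : IsSliceChart k F χ) (x₀ : F) :
    OpenPartialHomeomorph F (EuclideanSpace ℝ (Fin k)) where
  toFun z := coordProj hk (χ z)
  invFun v := if hv : χ.symm (coordIncl d k v) ∈ F then ⟨_, hv⟩ else x₀
  source := Subtype.val ⁻¹' χ.source
  target := coordIncl d k ⁻¹' χ.target
  map_source' z hz := by
    show coordIncl d k (coordProj hk (χ z)) ∈ χ.target
    rw [coordIncl_coordProj hk ((h.mem_iff z hz).1 z.2)]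
    exact χ.map_source hz
  map_target' v hv := by
    have h1 : χ.symm (coordIncl d k v) ∈ F := by
      refine (h.mem_iff _ (χ.map_target hv)).2 fun i hi => ?_
      rw [χ.right_inv hv, coordIncl_apply, dif_neg (not_lt.2 hi)]
    rw [dif_pos h1]
    exact χ.map_target hv
  left_inv' z hz := by
    have h1 : χ.symm (coordIncl d k (coordProj hk (χ z))) = z := by
      rw [coordIncl_coordProj hk ((h.mem_iff z hz).1 z.2)]
      exact χ.left_inv hz
    have h2 : χ.symm (coordIncl d k (coordProj hk (χ z))) ∈ F := by rw [h1]; exact z.2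
    rw [dif_pos h2]
    exact Subtype.ext h1
  right_inv' v hv := by
    have h1 : χ.symm (coordIncl d k v) ∈ F := by
      refine (h.mem_iff _ (χ.map_target hv)).2 fun i hi => ?_
      rw [χ.right_inv hv, coordIncl_apply, dif_neg (not_lt.2 hi)]
    rw [dif_pos h1, χ.right_inv hv, coordProj_coordIncl]
  open_source := χ.open_source.preimage continuous_subtype_val
  open_target := χ.open_target.preimage (coordIncl d k).continuous
  continuousOn_toFun := (coordProj hk).continuous.comp_continuousOn
    (χ.continuousOn.comp continuous_subtype_val.continuousOn fun _ hz => hz)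
  continuousOn_invFun := by
    rw [Topology.IsEmbedding.subtypeVal.isInducing.continuousOn_iff]
    refine (χ.symm.continuousOn.comp (coordIncl d k).continuous.continuousOn
      fun _ hv => hv).congr fun v hv => ?_
    have h1 : χ.symm (coordIncl d k v) ∈ F := by
      refine (h.mem_iff _ (χ.map_target hv)).2 fun i hi => ?_
      rw [χ.right_inv hv, coordIncl_apply, dif_neg (not_lt.2 hi)]
    simp only [Function.comp_apply, dif_pos h1]

variable (hk : k ≤ d) (h : IsSliceChart k F χ) (x₀ : F)

lemma sliceChart_apply (z : F) : sliceChart hk h x₀ z = coordProj hk (χ z) := rfl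

lemma coordIncl_sliceChart {z : F} (hz : (z : M) ∈ χ.source) :
    coordIncl d k (sliceChart hk h x₀ z) = χ z :=
  coordIncl_coordProj hk ((h.mem_iff z hz).1 z.2)

lemma sliceChart_symm_val {v : EuclideanSpace ℝ (Fin k)} (hv : coordIncl d k v ∈ χ.target) :
    ((sliceChart hk h x₀).symm v : M) = χ.symm (coordIncl d k v) := by
  have h1 := (sliceChart hk h x₀).map_target hv
  rw [← χ.left_inv h1, ← coordIncl_sliceChart hk h x₀ h1, (sliceChart hk h x₀).right_inv hv]

/-- A subset of a manifold with slice charts is an embedded submanifold, in such a way that the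
slice charts restrict to charts. -/
lemma exists_isSmoothEmbedding_of_isSliceChart
    (hF : ∀ x ∈ F, ∃ χ : OpenPartialHomeomorph M (EuclideanSpace ℝ (Fin d)), x ∈ χ.source ∧
      IsSliceChart k F χ) :
    ∃ (_ : ChartedSpace (EuclideanSpace ℝ (Fin k)) F) (_ : IsManifold (𝓡 k) ∞ F),
      Manifold.IsSmoothEmbedding (𝓡 k) (𝓡 d) ∞ (Subtype.val : F → M) ∧
      ∀ (χ : OpenPartialHomeomorph M (EuclideanSpace ℝ (Fin d))) (h : IsSliceChart k F χ) (x₀ : F),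
        sliceChart hk h x₀ ∈ IsManifold.maximalAtlas (𝓡 k) ∞ F := by
  choose χ hχ hs using hF
  -- all restrictions of slice charts are taken as charts
  let cs : ChartedSpace (EuclideanSpace ℝ (Fin k)) F :=
    { atlas := {ψ | ∃ (χ : OpenPartialHomeomorph M (EuclideanSpace ℝ (Fin d)))
        (h : IsSliceChart k F χ) (x₀ : F), ψ = sliceChart hk h x₀}
      chartAt := fun x => sliceChart hk (hs x x.2) x
      mem_chart_source := fun x => hχ x x.2
      chart_mem_atlas := fun x => ⟨_, _, _, rfl⟩ }
  have hM : IsManifold (𝓡 k) ∞ F := by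
    refine isManifold_of_contDiffOn (𝓡 k) ∞ F ?_
    rintro _ _ ⟨χ, h, x, rfl⟩ ⟨χ', h', x', rfl⟩
    simp only [mfld_simps]
    have h1 := (contMDiffOn_of_mem_maximalAtlas h'.mem_maximalAtlas).comp'
      (contMDiffOn_symm_of_mem_maximalAtlas h.mem_maximalAtlas)
    rw [contMDiffOn_iff_contDiffOn] at h1
    refine ((coordProj hk).contDiff.comp_contDiffOn
      (h1.comp (coordIncl d k).contDiff.contDiffOn ?_)).congr ?_
    · rintro v ⟨hv, hv'⟩
      refine ⟨hv, ?_⟩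
      have : ((sliceChart hk h x).symm v : M) ∈ χ'.source := hv'
      rwa [sliceChart_symm_val hk h x hv] at this
    · rintro v ⟨hv, hv'⟩
      simp only [Function.comp_apply, sliceChart_apply, sliceChart_symm_val hk h x hv]
  have hatlas : ∀ (χ : OpenPartialHomeomorph M (EuclideanSpace ℝ (Fin d))) (h : IsSliceChart k F χ)
      (x₀ : F), sliceChart hk h x₀ ∈ IsManifold.maximalAtlas (𝓡 k) ∞ F := fun χ h x₀ =>
    IsManifold.subset_maximalAtlas ⟨χ, h, x₀, rfl⟩
  refine ⟨cs, hM, ⟨?_, .subtypeVal⟩, hatlas⟩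
  let eq := ContinuousLinearEquiv.equivOfRightInverse (coordProj hk) (coordIncl d k)
    (coordProj_coordIncl hk)
  refine Manifold.IsImmersionOfComplement.isImmersion (F := (coordProj hk).ker) fun x => ?_
  refine .mk_of_charts eq.symm (sliceChart hk (hs x x.2) x) (χ x x.2) (hχ x x.2) (hχ x x.2)
    (hatlas _ _ _) (hs x x.2).mem_maximalAtlas (fun z hz => hz) fun v hv => ?_
  have hv' : coordIncl d k v ∈ (χ x x.2).target := by
    have : v ∈ (sliceChart hk (hs x x.2) x).target := by simpa using hv
    exact this
  simp only [mfld_simps]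
  rw [sliceChart_symm_val hk _ _ hv', (χ x x.2).right_inv hv',
    ContinuousLinearEquiv.equivOfRightInverse_symm_apply]
  simp

/-- The coordinate frame of a slice chart consists of the first vectors of the coordinate frame of
the ambient chart. -/
lemma mfderiv_val_chartFrame [ChartedSpace (EuclideanSpace ℝ (Fin k)) F]
    (hF : MDifferentiable (𝓡 k) (𝓡 d) (Subtype.val : F → M))
    (hψ : sliceChart hk h x₀ ∈ IsManifold.maximalAtlas (𝓡 k) ∞ F) {z : F} (hz : (z : M) ∈ χ.source)
    (i : Fin k) : mfderiv (𝓡 k) (𝓡 d) (Subtype.val : F → M) z ((chartFrame hψ z).2 i) =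
      (chartFrame h.mem_maximalAtlas (z : M)).2 (Fin.castLE hk i) := by
  set ψ := sliceChart hk h x₀
  have hz' : z ∈ ψ.source := hz
  have hd := (mdifferentiable_of_mem_maximalAtlas h.mem_maximalAtlas).mdifferentiableAt hz
  have hd' := (mdifferentiable_of_mem_maximalAtlas hψ).mdifferentiableAt hz'
  have hL : MDifferentiableAt (𝓡 k) (𝓡 d) (coordIncl d k) (ψ z) :=
    (coordIncl d k).differentiableAt.mdifferentiableAt
  have h1 : χ ∘ Subtype.val =ᶠ[𝓝 z] coordIncl d k ∘ ψ := by
    filter_upwards [ψ.open_source.mem_nhds hz'] with y hy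
      using (coordIncl_sliceChart hk h x₀ hy).symm
  have h2 : (mfderiv (𝓡 d) (𝓡 d) χ z : EuclideanSpace ℝ (Fin d) →L[ℝ] EuclideanSpace ℝ (Fin d))
      ∘L mfderiv (𝓡 k) (𝓡 d) (Subtype.val : F → M) z =
      mfderiv (𝓡 k) (𝓡 d) (coordIncl d k) (ψ z) ∘L mfderiv (𝓡 k) (𝓡 k) ψ z :=
    (mfderiv_comp z hd (hF z)).symm.trans (h1.mfderiv_eq.trans (mfderiv_comp z hL hd'))
  have h5 : mfderiv (𝓡 k) (𝓡 d) (coordIncl d k) (ψ z) = coordIncl d k :=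
    (coordIncl d k).hasFDerivAt.hasMFDerivAt.mfderiv
  rw [h5] at h2
  refine ((mdifferentiable_of_mem_maximalAtlas h.mem_maximalAtlas).mfderiv hz).injective ?_
  refine (DFunLike.congr_fun h2 ((chartFrame hψ z).2 i)).trans ?_
  refine Eq.trans ?_ (mfderiv_chartFrame h.mem_maximalAtlas hz _).symm
  refine (congrArg (coordIncl d k) (mfderiv_chartFrame hψ hz' i)).trans ?_
  exact coordIncl_single hk i

end Slice

/-! ### The components of the fixed set -/

section FixedVectors

variable {m : ℕ}

lemma rotMat_mulVec_apply (θ : Fin m → ℝ) (w : Fin (2 * m) → ℝ) (a : Fin 2) (j : Fin m) :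
    (rotMat θ *ᵥ w) (pairEquiv m (a, j)) =
      ∑ b, !![Real.cos (θ j), -Real.sin (θ j); Real.sin (θ j), Real.cos (θ j)] a b *
        w (pairEquiv m (b, j)) := by
  rw [mulVec, dotProduct, ← (pairEquiv m).sum_comp, Fintype.sum_prod_type]
  refine Finset.sum_congr rfl fun b _ => ?_
  simp only [rotMat_apply, ite_mul, zero_mul]
  rw [Finset.sum_ite_eq]
  simp

/-- The vectors fixed by a rotation. -/
lemma rotMat_mulVec_eq_iff {θ : Fin m → ℝ} (hθ : ∀ j, Real.cos (θ j) = 1 → θ j = 0)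
    {w : Fin (2 * m) → ℝ} : rotMat θ *ᵥ w = w ↔ ∀ i, onCoord θ i ≠ 0 → w i = 0 := by
  constructor
  · intro h i hi
    obtain ⟨⟨a, j⟩, rfl⟩ := (pairEquiv m).surjective i
    rw [onCoord_pairEquiv] at hi
    have h0 := congrFun h (pairEquiv m (0, j))
    have h1 := congrFun h (pairEquiv m (1, j))
    rw [rotMat_mulVec_apply, Fin.sum_univ_two] at h0 h1
    simp only [of_apply, cons_val', cons_val_zero, cons_val_one, cons_val_fin_one] at h0 h1
    have hc : 2 - 2 * Real.cos (θ j) ≠ 0 := fun h => hi (hθ j (by linarith))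
    have hs := Real.sin_sq_add_cos_sq (θ j)
    have h2 : (2 - 2 * Real.cos (θ j)) * w (pairEquiv m (0, j)) = 0 := by
      linear_combination (Real.cos (θ j) - 1) * h0 + Real.sin (θ j) * h1 -
        w (pairEquiv m (0, j)) * hs
    have h3 : (2 - 2 * Real.cos (θ j)) * w (pairEquiv m (1, j)) = 0 := by
      linear_combination (Real.cos (θ j) - 1) * h1 - Real.sin (θ j) * h0 -
        w (pairEquiv m (1, j)) * hs
    fin_cases a
    · exact (mul_eq_zero.1 h2).resolve_left hc
    · exact (mul_eq_zero.1 h3).resolve_left hc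
  · intro h
    ext i
    obtain ⟨⟨a, j⟩, rfl⟩ := (pairEquiv m).surjective i
    rw [rotMat_mulVec_apply, Fin.sum_univ_two]
    by_cases hj : θ j = 0
    · rw [hj]
      fin_cases a <;> simp
    · have hb : ∀ b, w (pairEquiv m (b, j)) = 0 := fun b => h _ (by rwa [onCoord_pairEquiv])
      simp [hb]

lemma toEuclideanCLM_rotGL_eq_iff {θ : Fin m → ℝ} (hθ : ∀ j, Real.cos (θ j) = 1 → θ j = 0) {k : ℕ}
    (hk' : ∀ i, onCoord θ i = 0 ↔ (i : ℕ) < k) {w : EuclideanSpace ℝ (Fin (2 * m))} :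
    toEuclideanCLM (𝕜 := ℝ) (rotGL θ : Matrix (Fin (2 * m)) (Fin (2 * m)) ℝ) w = w ↔
      ∀ i : Fin (2 * m), k ≤ i → w i = 0 := by
  have h1 : toEuclideanCLM (𝕜 := ℝ) (rotGL θ : Matrix (Fin (2 * m)) (Fin (2 * m)) ℝ) w = w ↔
      rotMat θ *ᵥ w.ofLp = w.ofLp := by
    rw [← (WithLp.ofLp_injective 2).eq_iff, ofLp_toEuclideanCLM, coe_rotGL]
  rw [h1, rotMat_mulVec_eq_iff hθ]
  refine forall_congr' fun i => ?_
  rw [Ne, hk' i, not_lt]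

end FixedVectors

lemma IsPreconnected.iff_of_eventually {X : Type*} [TopologicalSpace X] {F : Set X}
    (hF : IsPreconnected F) {P : X → Prop} (h : ∀ y ∈ F, ∀ᶠ z in 𝓝[F] y, P y ↔ P z) {x y : X}
    (hx : x ∈ F) (hy : y ∈ F) : P x ↔ P y :=
  hF.induction₂ (fun x y => P x ↔ P y) h (fun _ _ _ _ _ _ h1 h2 => h1.trans h2)
    (fun _ _ _ _ h => h.symm) hx hy

section Component

variable {d : ℕ} {M : Type*} [TopologicalSpace M] [ChartedSpace (EuclideanSpace ℝ (Fin d)) M]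
  [IsManifold (𝓡 d) ∞ M] [MulAction Circle M] [ContMDiffSMul (𝓡 1) (𝓡 d) ∞ Circle M]

/-- The conjugacy class of the differential is constant along a connected set of fixed points. -/
lemma exists_frame_of_isPreconnected {g : Circle} {n : ℕ} (hn : n ≠ 0) (hgn : g ^ n = 1) {F : Set M}
    (hF : IsPreconnected F) (hFg : ∀ y ∈ F, g • y = y) {f : FrameBundle d M} {R : GL (Fin d) ℝ}
    (hf : g • f = op R • f) (hfF : f.1 ∈ F) {y : M} (hy : y ∈ F) :
    ∃ f' : FrameBundle d M, f'.1 = y ∧ g • f' = op R • f' := by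
  refine (hF.iff_of_eventually (P := fun y => ∃ f' : FrameBundle d M, f'.1 = y ∧
    g • f' = op R • f') ?_ hfF hy).1 ⟨f, rfl, hf⟩
  intro x hx
  obtain ⟨f₀, hf₀⟩ : ∃ f₀ : FrameBundle d M, f₀.1 = x :=
    ⟨⟨x, (EuclideanSpace.basisFun (Fin d) ℝ).toBasis⟩, rfl⟩
  obtain ⟨R₀, hR₀⟩ := FrameBundle.exists_op_smul (f := f₀) (f' := g • f₀)
    (show g • f₀.1 = f₀.1 by rw [hf₀]; exact hFg x hx)
  -- in a linearising chart, the differential has the matrix `R₀` at all nearby fixed points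
  obtain ⟨χ, hχ, hx', -, -, h1, -⟩ := exists_linearising_chart hn hgn (f := f₀) (R := R₀) hR₀
  rw [hf₀] at hx'
  have hconj : ∀ {f f' : FrameBundle d M}, f.1 = f'.1 → g • f = op R • f → g • f' = op R₀ • f' →
      ∃ h : GL (Fin d) ℝ, R₀ = h⁻¹ * R * h := fun {f f'} e hf hf' => by
    obtain ⟨h, rfl⟩ := FrameBundle.exists_op_smul e.symm
    refine ⟨h, ?_⟩
    rw [FrameBundle.circle_smul_op_smul, hf, smul_smul, smul_smul, ← op_mul, ← op_mul] at hf'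
    have := f.op_smul_injective hf'
    rw [mul_assoc, this, inv_mul_cancel_left]
  have hback : ∀ {f : FrameBundle d M} {h : GL (Fin d) ℝ}, g • f = op R₀ • f → R₀ = h⁻¹ * R * h →
      g • op h⁻¹ • f = op R • op h⁻¹ • f := fun {f h} hf e => by
    rw [FrameBundle.circle_smul_op_smul, hf, smul_smul, smul_smul, ← op_mul, ← op_mul, e]
    congr 2
    group
  have key : ∀ z ∈ F, z ∈ χ.source → ((∃ f' : FrameBundle d M, f'.1 = z ∧ g • f' = op R • f') ↔
      ∃ h : GL (Fin d) ℝ, R₀ = h⁻¹ * R * h) := fun z hz hzs => by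
    have hB := smul_chartFrame hχ h1 hzs (hFg z hz)
    constructor
    · rintro ⟨f', rfl, hf'⟩
      exact hconj (f := f') (f' := chartFrame hχ f'.1) rfl hf' hB
    · rintro ⟨h, hh⟩
      exact ⟨_, rfl, hback hB hh⟩
  filter_upwards [mem_nhdsWithin_of_mem_nhds (χ.open_source.mem_nhds hx'), self_mem_nhdsWithin]
    with z hzs hz
  rw [key x hx hx', key z hz hzs]

end Component

section AdaptedComponent

variable {m : ℕ} {M : Type*} [TopologicalSpace M] [ChartedSpace (EuclideanSpace ℝ (Fin (2 * m))) M]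
  [IsManifold (𝓡 (2 * m)) ∞ M] [MulAction Circle M] [ContMDiffSMul (𝓡 1) (𝓡 (2 * m)) ∞ Circle M]
  {n : ℕ} {θ : Fin m → ℝ} {k : ℕ} {x₀ : M}

lemma exp_two_pi_div_pow (hn : n ≠ 0) : Circle.exp (2 * Real.pi / n) ^ n = 1 := by
  rw [← Circle.exp_nsmul, nsmul_eq_mul, mul_div_cancel₀ _ (by exact_mod_cast hn)]
  simp

/-- The component of `x₀` in the fixed point set of the elements of order dividing `n`. -/
def fixedComponent (n : ℕ) (x₀ : M) : Set M :=
  connectedComponentIn {y | Circle.exp (2 * Real.pi / n) • y = y} x₀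

lemma smul_eq_of_mem_fixedComponent {y : M} (hy : y ∈ fixedComponent n x₀) :
    Circle.exp (2 * Real.pi / n) • y = y :=
  connectedComponentIn_subset {y : M | Circle.exp (2 * Real.pi / n) • y = y} x₀ hy

/-- A slice chart of the component, in which the generator acts as the rotation by `θ`. -/
structure IsAdaptedChart (n : ℕ) (θ : Fin m → ℝ) (k : ℕ) (F : Set M)
    (χ : OpenPartialHomeomorph M (EuclideanSpace ℝ (Fin (2 * m)))) : Prop extends
    IsSliceChart k F χ where
  target_eq_ball : ∃ ρ > 0, χ.target = Metric.ball 0 ρ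
  smul_eq : ∀ z ∈ χ.source, χ (Circle.exp (2 * Real.pi / n) • z) =
    toEuclideanCLM (𝕜 := ℝ) (rotGL θ : Matrix (Fin (2 * m)) (Fin (2 * m)) ℝ) (χ z)

/-- Around every point of the component there is an adapted chart: the conjugacy class of the
differential of the generator does not depend on the point, and the action is linear in suitable
coordinates. -/
lemma exists_isAdaptedChart (hn : n ≠ 0) (hθ : ∀ j, Real.cos (θ j) = 1 → θ j = 0)
    (hk' : ∀ i, onCoord θ i = 0 ↔ (i : ℕ) < k) {f : FrameBundle (2 * m) M}
    (hf : f ∈ adaptedFrames M n θ) (hfF : f.1 ∈ fixedComponent n x₀) {y : M}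
    (hy : y ∈ fixedComponent n x₀) :
    ∃ χ : OpenPartialHomeomorph M (EuclideanSpace ℝ (Fin (2 * m))), y ∈ χ.source ∧ χ y = 0 ∧
      IsAdaptedChart n θ k (fixedComponent n x₀) χ := by
  obtain ⟨f', rfl, hf'⟩ := exists_frame_of_isPreconnected hn (exp_two_pi_div_pow hn)
    isPreconnected_connectedComponentIn (fun y hy => smul_eq_of_mem_fixedComponent hy) hf hfF hy
  obtain ⟨χ, hχ, hx, h0, ⟨ρ, hρ, ht⟩, h1, h2⟩ :=
    exists_linearising_chart hn (exp_two_pi_div_pow hn) hf'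
  refine ⟨χ, hx, h0, ⟨hχ, fun z hz => ?_⟩, ⟨ρ, hρ, ht⟩, h1⟩
  have hfix : ∀ z ∈ χ.source, Circle.exp (2 * Real.pi / n) • z = z ↔
      ∀ i : Fin (2 * m), k ≤ i → χ z i = 0 := fun z hz => by
    rw [← toEuclideanCLM_rotGL_eq_iff hθ hk']
    exact ⟨fun h => by rw [← h1 z hz, h], h2 z hz⟩
  rw [← hfix z hz]
  refine ⟨smul_eq_of_mem_fixedComponent, fun hgz => ?_⟩
  -- the fixed points in the domain of the chart form a linear slice of a ball
  set S : Set (EuclideanSpace ℝ (Fin (2 * m))) := {w | ∀ i : Fin (2 * m), k ≤ i → w i = 0} ∩ χ.target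
  have hS : Convex ℝ S := by
    refine Convex.inter ?_ (ht ▸ convex_ball _ _)
    intro v hv w hw a b _ _ _ i hi
    simp [hv i hi, hw i hi]
  have hpre : IsPreconnected (χ.symm '' S) :=
    hS.isPreconnected.image _ (χ.continuousOn_symm.mono Set.inter_subset_right)
  have hsub : χ.symm '' S ⊆ {y | Circle.exp (2 * Real.pi / n) • y = y} := by
    rintro _ ⟨w, ⟨hw, hwt⟩, rfl⟩
    exact (hfix _ (χ.map_target hwt)).2 (by rwa [χ.right_inv hwt])
  have hmem : ∀ z ∈ χ.source, Circle.exp (2 * Real.pi / n) • z = z → z ∈ χ.symm '' S :=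
    fun z hz h => ⟨χ z, ⟨(hfix z hz).1 h, χ.map_source hz⟩, χ.left_inv hz⟩
  have := hpre.subset_connectedComponentIn (hmem _ hx (smul_eq_of_mem_fixedComponent hy)) hsub
  rw [fixedComponent, connectedComponentIn_eq hy]
  exact this (hmem z hz hgz)

namespace IsAdaptedChart

variable {χ : OpenPartialHomeomorph M (EuclideanSpace ℝ (Fin (2 * m)))}

lemma chartFrame_mem (h : IsAdaptedChart n θ k (fixedComponent n x₀) χ) {z : M} (hz : z ∈ χ.source)
    (hzF : z ∈ fixedComponent n x₀) : chartFrame h.mem_maximalAtlas z ∈ adaptedFrames M n θ :=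
  smul_chartFrame h.mem_maximalAtlas h.smul_eq hz (smul_eq_of_mem_fixedComponent hzF)

/-- The coordinate frames of an adapted chart are joined by a path of adapted frames. -/
lemma exists_path (h : IsAdaptedChart n θ k (fixedComponent n x₀) χ) {y z : M} (hy : y ∈ χ.source)
    (hyF : y ∈ fixedComponent n x₀) (hz : z ∈ χ.source) (hzF : z ∈ fixedComponent n x₀) :
    ∃ β : C(I, FrameBundle (2 * m) M), β 0 = chartFrame h.mem_maximalAtlas y ∧
      β 1 = chartFrame h.mem_maximalAtlas z ∧
      ∀ s, β s ∈ adaptedFrames M n θ ∧ (β s).1 ∈ fixedComponent n x₀ := by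
  obtain ⟨ρ, hρ, ht⟩ := h.target_eq_ball
  let w : I → EuclideanSpace ℝ (Fin (2 * m)) := fun s => AffineMap.lineMap (χ y) (χ z) (s : ℝ)
  have hw : Continuous w := AffineMap.lineMap_continuous.comp continuous_subtype_val
  have hwt : ∀ s, w s ∈ χ.target := fun s => by
    rw [ht]
    exact (convex_ball _ _).lineMap_mem (ht ▸ χ.map_source hy) (ht ▸ χ.map_source hz) s.2
  have hF : ∀ s, χ.symm (w s) ∈ fixedComponent n x₀ := fun s => by
    refine (h.mem_iff _ (χ.map_target (hwt s))).2 fun i hi => ?_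
    rw [χ.right_inv (hwt s)]
    simp [w, AffineMap.lineMap_apply, (h.mem_iff _ hy).1 hyF i hi, (h.mem_iff _ hz).1 hzF i hi]
  refine ⟨⟨fun s => chartFrame h.mem_maximalAtlas (χ.symm (w s)), ?_⟩, ?_, ?_, fun s =>
    ⟨h.chartFrame_mem (χ.map_target (hwt s)) (hF s), hF s⟩⟩
  · exact (continuousOn_chartFrame h.mem_maximalAtlas).comp_continuous
      (χ.continuousOn_symm.comp_continuous hw hwt) fun s => χ.map_target (hwt s)
  · simp [w, χ.left_inv hy]
  · simp [w, χ.left_inv hz]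

end IsAdaptedChart

end AdaptedComponent

/-! ### Representations of the circle -/

section CircleRepresentation

variable {V : Type*} [NormedAddCommGroup V] [NormedSpace ℝ V]

/-- The one-parameter group `u` rotates the plane of `x` and `y` with weight `a`. -/
def IsRotated (u : ℝ → V →L[ℝ] V) (a : ℤ) (x y : V) : Prop :=
  ∀ t, u t x = Real.cos (a * t) • x + Real.sin (a * t) • y ∧
    u t y = -Real.sin (a * t) • x + Real.cos (a * t) • y

lemma IsRotated.neg {u : ℝ → V →L[ℝ] V} {a : ℤ} {x y : V} (h : IsRotated u a x y) :
    IsRotated u (-a) x (-y) := fun t => by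
  rw [map_neg, (h t).1, (h t).2]
  push_cast
  rw [neg_mul, Real.cos_neg, Real.sin_neg]
  constructor <;> module

lemma IsRotated.swap {u : ℝ → V →L[ℝ] V} {a : ℤ} {x y : V} (h : IsRotated u a x y) :
    IsRotated u a y (-x) := fun t => by
  rw [map_neg, (h t).1, (h t).2]
  constructor <;> module

variable [CompleteSpace V] {u : ℝ → V →L[ℝ] V}

/-- The Fourier coefficients of an orbit span a rotated plane. -/
lemma isRotated_fourier (hu : ∀ v, Continuous fun t => u t v) (hadd : ∀ s t v, u (s + t) v = u s (u t v))
    (hper : ∀ v, u (2 * Real.pi) v = v) (a : ℤ) (v : V) :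
    IsRotated u a (∫ t in 0..2 * Real.pi, Real.cos (a * t) • u t v)
      (∫ t in 0..2 * Real.pi, Real.sin (a * t) • u t v) := by
  -- substitution in the integral, by periodicity
  have hshift : ∀ (f : ℝ → ℝ), Continuous f → (∀ t, f (t + 2 * Real.pi) = f t) → ∀ s,
      u s (∫ t in 0..2 * Real.pi, f t • u t v) = ∫ t in 0..2 * Real.pi, f (t - s) • u t v := by
    intro f hf hfp s
    have h1 : Function.Periodic (fun t => f (t - s) • u t v) (2 * Real.pi) := fun t => by
      simp only
      rw [hadd, hper, show t + 2 * Real.pi - s = t - s + 2 * Real.pi by ring, hfp]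
    have hI : IntervalIntegrable (fun t => f t • u t v) MeasureTheory.volume 0 (2 * Real.pi) :=
      (hf.smul (hu v)).intervalIntegrable _ _
    rw [← ContinuousLinearMap.intervalIntegral_comp_comm _ hI]
    have h2 := h1.intervalIntegral_add_eq s 0
    rw [zero_add] at h2
    rw [← h2, add_comm s, ← zero_add (s : ℝ)]
    have h3 := intervalIntegral.integral_comp_add_right (a := 0) (b := 2 * Real.pi)
      (fun t => f (t - s) • u t v) s
    simp only [zero_add] at h3 ⊢
    rw [← h3]
    refine intervalIntegral.integral_congr fun t _ => ?_
    simp only [map_smul, add_sub_cancel_right]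
    rw [← hadd, add_comm]
  have hI : ∀ f : ℝ → ℝ, Continuous f → IntervalIntegrable (fun t => f t • u t v)
      MeasureTheory.volume 0 (2 * Real.pi) := fun f hf => (hf.smul (hu v)).intervalIntegrable _ _
  have hc : Continuous fun t : ℝ => Real.cos (a * t) := by fun_prop
  have hs : Continuous fun t : ℝ => Real.sin (a * t) := by fun_prop
  intro s
  constructor
  · rw [hshift (fun t => Real.cos (a * t)) hc (fun t => by
      rw [mul_add]; exact Real.cos_add_int_mul_two_pi _ _), ← intervalIntegral.integral_smul,
      ← intervalIntegral.integral_smul, ← intervalIntegral.integral_add]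
    · refine intervalIntegral.integral_congr fun t _ => ?_
      simp only [mul_sub, Real.cos_sub]
      module
    · exact (hI _ hc).smul _
    · exact (hI _ hs).smul _
  · rw [hshift (fun t => Real.sin (a * t)) hs (fun t => by
      rw [mul_add]; exact Real.sin_add_int_mul_two_pi _ _), ← intervalIntegral.integral_smul,
      ← intervalIntegral.integral_smul, ← intervalIntegral.integral_add]
    · refine intervalIntegral.integral_congr fun t _ => ?_
      simp only [mul_sub, Real.sin_sub]
      module
    · exact (hI _ hc).smul _
    · exact (hI _ hs).smul _

/-- A continuous periodic function whose Fourier coefficients vanish is zero. -/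
lemma eq_zero_of_fourier {f : ℝ → ℝ} (hf : Continuous f) (hper : ∀ t, f (t + 2 * Real.pi) = f t)
    (hc : ∀ a : ℤ, ∫ t in 0..2 * Real.pi, Real.cos (a * t) * f t = 0)
    (hs : ∀ a : ℤ, ∫ t in 0..2 * Real.pi, Real.sin (a * t) * f t = 0) (t : ℝ) : f t = 0 := by
  have : Fact (0 < 2 * Real.pi) := ⟨Real.two_pi_pos⟩
  have hp : Function.Periodic (fun t => (f t : ℂ)) (2 * Real.pi) := fun t => by simp [hper]
  let F : C(AddCircle (2 * Real.pi), ℂ) := ⟨hp.lift, by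
    refine (continuous_quot_lift _ ?_)
    exact Complex.continuous_ofReal.comp hf⟩
  have hF : ∀ t : ℝ, F t = f t := fun t => hp.lift_coe t
  have hcoef : fourierCoeff (F : AddCircle (2 * Real.pi) → ℂ) = 0 := by
    ext a
    rw [fourierCoeff_eq_intervalIntegral _ _ 0, zero_add]
    have h1 : ∀ t : ℝ, (fourier (-a) (t : AddCircle (2 * Real.pi))) • F t =
        ((Real.cos (a * t) * f t : ℝ) : ℂ) - Complex.I * ((Real.sin (a * t) * f t : ℝ) : ℂ) := by
      intro t
      rw [hF, fourier_coe_apply]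
      have : 2 * (Real.pi : ℂ) * Complex.I * ((-a : ℤ) : ℂ) * t / ((2 * Real.pi : ℝ) : ℂ) =
          ((-(a * t) : ℝ) : ℂ) * Complex.I := by
        have : (Real.pi : ℂ) ≠ 0 := by exact_mod_cast Real.pi_ne_zero
        push_cast
        field_simp
      rw [this, Complex.exp_mul_I, ← Complex.ofReal_cos, ← Complex.ofReal_sin, Real.cos_neg,
        Real.sin_neg, smul_eq_mul]
      push_cast
      ring
    simp only [h1]
    rw [intervalIntegral.integral_sub, intervalIntegral.integral_const_mul,
      intervalIntegral.integral_ofReal, intervalIntegral.integral_ofReal, hc, hs]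
    · simp
    · exact (by fun_prop : Continuous _).intervalIntegrable _ _
    · exact (by fun_prop : Continuous _).intervalIntegrable _ _
  have hsum : HasSum (fun i => fourierCoeff (F : AddCircle (2 * Real.pi) → ℂ) i • fourier i) F :=
    hasSum_fourier_series_of_summable (by rw [hcoef]; exact summable_zero)
  have h0 : F = 0 := hsum.unique (by simp only [hcoef, Pi.zero_apply, zero_smul]; exact hasSum_zero)
  have := hF t
  rw [h0] at this
  exact Complex.ofReal_eq_zero.1 this.symm

variable [FiniteDimensional ℝ V]

/-- The rotated planes generate the representation: a linear form which vanishes on the Fourier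
coefficients of an orbit vanishes on the orbit. -/
lemma exists_isRotated_notMem (hu : ∀ v, Continuous fun t => u t v)
    (hadd : ∀ s t v, u (s + t) v = u s (u t v)) (hper : ∀ v, u (2 * Real.pi) v = v)
    (h0 : ∀ v, u 0 v = v)
    {S : Submodule ℝ V} (hS : S < ⊤) : ∃ a x y, IsRotated u a x y ∧ x ∉ S := by
  obtain ⟨ℓ, hℓ, hSℓ⟩ := S.exists_le_ker_of_lt_top hS
  obtain ⟨v, hv⟩ : ∃ v, ℓ v ≠ 0 := by
    by_contra! h
    exact hℓ (LinearMap.ext h)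
  by_contra! hall
  let L : V →L[ℝ] ℝ := LinearMap.toContinuousLinearMap ℓ
  have hcs := fun a : ℤ => isRotated_fourier hu hadd hper a v
  have hzero : ∀ f : ℝ → ℝ, Continuous f → (∫ t in 0..2 * Real.pi, f t • u t v) ∈ S →
      ∫ t in 0..2 * Real.pi, f t * L (u t v) = 0 := fun f hf h => by
    have h1 : L (∫ t in 0..2 * Real.pi, f t • u t v) = 0 := hSℓ h
    have hI : IntervalIntegrable (fun t => f t • u t v) MeasureTheory.volume 0 (2 * Real.pi) :=
      (hf.smul (hu v)).intervalIntegrable _ _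
    rw [← ContinuousLinearMap.intervalIntegral_comp_comm _ hI] at h1
    simpa using h1
  refine hv ?_
  have := eq_zero_of_fourier (f := fun t => L (u t v)) (L.continuous.comp (hu v))
    (fun t => by rw [hadd, hper])
    (fun a => hzero _ (by fun_prop) (hall _ _ _ (hcs a)))
    (fun a => hzero _ (by fun_prop) (hall _ _ _ (hcs a).swap)) 0
  exact (by simpa [h0] using this : L v = 0)

/-- A representation of the circle on a space of even dimension is a sum of rotated planes; the
signs of the weights can be chosen. -/
lemma exists_isRotated_family (hu : ∀ v, Continuous fun t => u t v)
    (hadd : ∀ s t v, u (s + t) v = u s (u t v)) (hper : ∀ v, u (2 * Real.pi) v = v)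
    (h0 : ∀ v, u 0 v = v) {Q : ℤ → Prop} (hQ : ∀ a, Q a ∨ Q (-a)) {m : ℕ}
    (hm : Module.finrank ℝ V = 2 * m) : ∀ r ≤ m, ∃ (b : Fin r × Fin 2 → V) (a : Fin r → ℤ),
      LinearIndependent ℝ b ∧ ∀ j, Q (a j) ∧ IsRotated u (a j) (b (j, 0)) (b (j, 1)) := by
  intro r
  induction r with
  | zero => exact fun _ => ⟨fun p => p.1.elim0, fun j => j.elim0, linearIndependent_empty_type, fun j => j.elim0⟩
  | succ r ih =>
    intro hr
    obtain ⟨b, a, hb, hba⟩ := ih (by omega)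
    set S := Submodule.span ℝ (Set.range b)
    have hSr : Module.finrank ℝ S = r * 2 := by
      rw [finrank_span_eq_card hb]; simp
    have hSinv : ∀ t, ∀ v ∈ S, u t v ∈ S := fun t => by
      have : S ≤ S.comap (u t : V →ₗ[ℝ] V) := by
        refine Submodule.span_le.2 ?_
        rintro _ ⟨⟨j, i⟩, rfl⟩
        have h1 : b (j, 0) ∈ S := Submodule.subset_span ⟨_, rfl⟩
        have h2 : b (j, 1) ∈ S := Submodule.subset_span ⟨_, rfl⟩
        show u t (b (j, i)) ∈ S
        fin_cases i
        · exact ((hba j).2 t).1 ▸ S.add_mem (S.smul_mem _ h1) (S.smul_mem _ h2)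
        · exact ((hba j).2 t).2 ▸ S.add_mem (S.smul_mem _ h1) (S.smul_mem _ h2)
      exact this
    -- a rotated plane complementary to the planes found so far
    obtain ⟨c, x, y, hxy, hind⟩ : ∃ c x y, IsRotated u c x y ∧
        ∀ α β : ℝ, α • x + β • y ∈ S → α = 0 ∧ β = 0 := by
      have hlt : S < ⊤ := lt_top_iff_ne_top.2 fun h => by
        rw [h, finrank_top] at hSr; omega
      -- if the weight is nonzero, a quarter turn shows that the plane meets `S` trivially; if all
      -- further weights are zero, the plane is spanned by two fixed vectors, which exist since the
      -- dimension is even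
      by_cases hex : ∃ c x y, IsRotated u c x y ∧ x ∉ S ∧ c ≠ 0
      · obtain ⟨c, x, y, hxy, hx, hc⟩ := hex
        refine ⟨c, x, y, hxy, fun α β h => ?_⟩
        have h1 := hSinv (Real.pi / 2 / c) _ h
        have hc' : (c : ℝ) ≠ 0 := by exact_mod_cast hc
        rw [map_add, map_smul, map_smul, (hxy _).1, (hxy _).2, mul_div_cancel₀ _ hc',
          Real.cos_pi_div_two, Real.sin_pi_div_two] at h1
        have h2 : (α ^ 2 + β ^ 2) • x ∈ S := by
          have := S.sub_mem (S.smul_mem α h) (S.smul_mem β h1)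
          convert this using 1
          module
        have h3 : α ^ 2 + β ^ 2 = 0 := by
          by_contra h3
          exact hx ((S.smul_mem_iff h3).1 h2)
        constructor <;> nlinarith [sq_nonneg α, sq_nonneg β]
      · push Not at hex
        have hfix : ∀ {S' : Submodule ℝ V}, S ≤ S' → S' < ⊤ → ∃ x, (∀ t, u t x = x) ∧ x ∉ S' := by
          intro S' hle hlt
          obtain ⟨c, x, y, hxy, hx⟩ := exists_isRotated_notMem hu hadd hper h0 hlt
          have hc := hex c x y hxy fun h => hx (hle h)
          subst hc
          exact ⟨x, fun t => by simpa using (hxy t).1, hx⟩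
        obtain ⟨x, hx, hxS⟩ := hfix le_rfl hlt
        have hlt' : S ⊔ Submodule.span ℝ {x} < ⊤ := lt_top_iff_ne_top.2 fun h => by
          have h1 := Submodule.finrank_add_le_finrank_add_finrank S (Submodule.span ℝ {x})
          have h2 := finrank_span_le_card (R := ℝ) ({x} : Set V)
          rw [h, finrank_top] at h1
          simp at h2
          omega
        obtain ⟨y, hy, hyS⟩ := hfix le_sup_left hlt'
        refine ⟨0, x, y, fun t => by simp [hx, hy], fun α β h => ?_⟩
        have hβ : β = 0 := by
          by_contra hβ
          refine hyS ((Submodule.smul_mem_iff _ hβ).1 ?_)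
          have : β • y = (α • x + β • y) + -α • x := by module
          rw [this]
          exact Submodule.add_mem _ (Submodule.mem_sup_left h) (Submodule.mem_sup_right
            (Submodule.smul_mem _ _ (Submodule.mem_span_singleton_self x)))
        refine ⟨?_, hβ⟩
        by_contra hα
        rw [hβ, zero_smul, add_zero] at h
        exact hxS ((S.smul_mem_iff hα).1 h)
    obtain ⟨c, x, y, hxy, hind, hQc⟩ : ∃ c x y, IsRotated u c x y ∧
        (∀ α β : ℝ, α • x + β • y ∈ S → α = 0 ∧ β = 0) ∧ Q c := by
      rcases hQ c with h | h
      · exact ⟨c, x, y, hxy, hind, h⟩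
      · refine ⟨-c, x, -y, hxy.neg, fun α β h' => ?_, h⟩
        have := hind α (-β) (by rwa [neg_smul, ← smul_neg])
        exact ⟨this.1, neg_eq_zero.1 this.2⟩
    let b' : Fin (r + 1) × Fin 2 → V := fun p =>
      Fin.snoc (α := fun _ => Fin 2 → V) (fun j i => b (j, i)) ![x, y] p.1 p.2
    have hb'1 : ∀ j i, b' (Fin.castSucc j, i) = b (j, i) := fun j i => by simp [b']
    have hb'2 : ∀ i, b' (Fin.last r, i) = ![x, y] i := fun i => by simp [b']
    refine ⟨b', Fin.snoc a c, ?_, fun j => ?_⟩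
    · rw [Fintype.linearIndependent_iff] at hb ⊢
      intro g hg
      rw [Fintype.sum_prod_type, Fin.sum_univ_castSucc] at hg
      simp only [hb'1, hb'2, Fin.sum_univ_two (fun i => g (Fin.last r, i) • ![x, y] i),
        cons_val_zero, cons_val_one] at hg
      have hmem : ∑ j : Fin r, ∑ i, g (Fin.castSucc j, i) • b (j, i) ∈ S :=
        S.sum_mem fun j _ => S.sum_mem fun i _ => S.smul_mem _ (Submodule.subset_span ⟨_, rfl⟩)
      obtain ⟨h1, h2⟩ := hind (g (Fin.last r, 0)) (g (Fin.last r, 1)) (by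
        rw [eq_neg_of_add_eq_zero_right hg]
        exact S.neg_mem hmem)
      rw [h1, h2, zero_smul, zero_smul, add_zero, add_zero] at hg
      have h3 := hb (fun p => g (Fin.castSucc p.1, p.2)) (by rwa [Fintype.sum_prod_type])
      rintro ⟨j, i⟩
      refine Fin.lastCases ?_ (fun j => h3 (j, i)) j
      fin_cases i
      · exact h1
      · exact h2
    · refine Fin.lastCases ?_ (fun j => ?_) j
      · rw [hb'2, hb'2, Fin.snoc_last]
        exact ⟨hQc, hxy⟩
      · rw [hb'1, hb'1, Fin.snoc_castSucc]
        exact hba j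

end CircleRepresentation

/-! ### Rotated frames at the fixed points of the circle -/

section WeightSplitting

variable {m : ℕ}

lemma mul_rotMat_apply {ι : Type*} (B : Matrix ι (Fin (2 * m)) ℝ) (θ : Fin m → ℝ) (i : ι) (a : Fin 2)
    (j : Fin m) : (B * rotMat θ) i (pairEquiv m (a, j)) =
      ∑ b, B i (pairEquiv m (b, j)) *
        !![Real.cos (θ j), -Real.sin (θ j); Real.sin (θ j), Real.cos (θ j)] b a := by
  rw [Matrix.mul_apply, ← (pairEquiv m).sum_comp, Fintype.sum_prod_type]
  refine Finset.sum_congr rfl fun b _ => ?_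
  simp only [rotMat_apply, mul_ite, mul_zero]
  rw [Finset.sum_ite_eq']
  simp

/-- Up to the sign, an integer has a residue between `0` and `n / 2` modulo `n`. -/
lemma exists_eq_mul_add_or_neg (n : ℕ) (a : ℤ) :
    (∃ l r : ℤ, a = n * l + r ∧ 0 ≤ r ∧ (n ≠ 0 → 2 * r ≤ n) ∧ (n = 0 → l = 0)) ∨
      ∃ l r : ℤ, -a = n * l + r ∧ 0 ≤ r ∧ (n ≠ 0 → 2 * r ≤ n) ∧ (n = 0 → l = 0) := by
  rcases eq_or_ne n 0 with rfl | hn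
  · rcases le_total 0 a with h | h
    · exact .inl ⟨0, a, by simp, h, by simp, by simp⟩
    · exact .inr ⟨0, -a, by simp, by omega, by simp, by simp⟩
  have hn' : (0 : ℤ) < n := by exact_mod_cast Nat.pos_of_ne_zero hn
  have h1 := Int.mul_ediv_add_emod a n
  have h2 := Int.emod_nonneg a hn'.ne'
  have h3 := Int.emod_lt_of_pos a hn'
  by_cases h : 2 * (a % n) ≤ n
  · exact .inl ⟨a / n, a % n, h1.symm, h2, fun _ => h, fun h => absurd h hn⟩
  · refine .inr ⟨-(a / n) - 1, n - a % n, ?_, by omega, by omega, fun h => absurd h hn⟩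
    linear_combination h1

/-- If the residues increase, the coordinates with residue zero are the first `k` ones. -/
lemma exists_eq_zero_iff_lt_of_monotone {r : Fin m → ℤ} (hr : Monotone r) (h0 : ∀ j, 0 ≤ r j) :
    ∃ k ≤ 2 * m, ∀ i, onCoord r i = 0 ↔ (i : ℕ) < k := by
  obtain ⟨c, hc, h⟩ : ∃ c ≤ m, ∀ j : Fin m, r j = 0 ↔ (j : ℕ) < c := by
    by_cases hex : ∃ c, ∃ h : c < m, r ⟨c, h⟩ ≠ 0
    · classical
      obtain ⟨hlt, hne⟩ := Nat.find_spec hex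
      refine ⟨Nat.find hex, hlt.le, fun j => ⟨fun h => ?_, fun h => ?_⟩⟩
      · by_contra hle
        have := hr (show (⟨Nat.find hex, hlt⟩ : Fin m) ≤ j from not_lt.1 hle)
        exact hne (le_antisymm (this.trans h.le) (h0 _))
      · have := Nat.find_min hex h
        by_contra hne
        exact this ⟨j.2, hne⟩
    · push Not at hex
      exact ⟨m, le_rfl, fun j => ⟨fun _ => j.2, fun _ => hex j j.2⟩⟩
  refine ⟨2 * c, by omega, fun i => ?_⟩
  obtain ⟨⟨a, j⟩, rfl⟩ := (pairEquiv m).surjective i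
  rw [onCoord_pairEquiv, h]
  show _ ↔ 2 * (j : ℕ) + (a : ℕ) < 2 * c
  have := a.2
  omega

variable {M : Type*} [TopologicalSpace M] [ChartedSpace (EuclideanSpace ℝ (Fin (2 * m))) M]
  [IsManifold (𝓡 (2 * m)) ∞ M] [MulAction Circle M] [ContMDiffSMul (𝓡 1) (𝓡 (2 * m)) ∞ Circle M]

/-- At a fixed point of the circle there is a frame on which the circle acts by rotations of the
coordinate planes. The planes can be oriented and ordered such that the residues `r j` of the
weights are at most `n / 2` and increase with `j`. -/
lemma exists_rotated_frame (n : ℕ) {x : M} (hx : ∀ z : Circle, z • x = x) :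
    ∃ (f : FrameBundle (2 * m) M) (a l r : Fin m → ℤ), f.1 = x ∧ Monotone r ∧
      (∀ j, a j = n * l j + r j ∧ 0 ≤ r j ∧ (n ≠ 0 → 2 * r j ≤ n) ∧ (n = 0 → l j = 0)) ∧
      ∀ t : ℝ, Circle.exp t • f = op (rotGL fun j => t * a j) • f := by
  obtain ⟨f₀, hf₀⟩ : ∃ f₀ : FrameBundle (2 * m) M, f₀.1 = x :=
    ⟨⟨x, (EuclideanSpace.basisFun (Fin (2 * m)) ℝ).toBasis⟩, rfl⟩
  obtain ⟨U, φ, hU, hxU, hφ, hφg⟩ := FrameBundle.exists_coord (d := 2 * m) x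
  have hfst : ∀ t : ℝ, (Circle.exp t • f₀).1 = f₀.1 := fun t => by
    show Circle.exp t • f₀.1 = f₀.1
    rw [hf₀, hx]
  -- the matrices `h t` of the action in a fixed frame form a one-parameter group
  choose h hh using fun t : ℝ => FrameBundle.exists_op_smul (hfst t)
  have hhφ : ∀ t, h t = (φ f₀)⁻¹ * φ (Circle.exp t • f₀) := fun t => by
    rw [hh t, hφg f₀ (hf₀ ▸ hxU), inv_mul_cancel_left]
  have hhc : Continuous h := by
    refine Continuous.congr ?_ fun t => (hhφ t).symm
    refine continuous_const.mul (hφ.comp_continuous ?_ fun t => ?_)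
    · exact (Circle.exp.continuous).smul continuous_const
    · show (Circle.exp t • f₀).1 ∈ U
      rw [hfst, hf₀]
      exact hxU
  have hadd : ∀ s t, h (s + t) = h s * h t := fun s t => by
    refine f₀.op_smul_injective ?_
    show op (h (s + t)) • f₀ = op (h s * h t) • f₀
    rw [← hh, Circle.exp_add, mul_smul, hh t, FrameBundle.circle_smul_op_smul, hh s, smul_smul,
      op_mul]
  have h0 : h 0 = 1 := by
    have := hadd 0 0
    rwa [add_zero, left_eq_mul] at this
  have hper : h (2 * Real.pi) = 1 := by
    refine f₀.op_smul_injective ?_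
    show op (h (2 * Real.pi)) • f₀ = op 1 • f₀
    rw [← hh, Circle.exp_two_pi, one_smul, op_one, one_smul]
  let u : ℝ → EuclideanSpace ℝ (Fin (2 * m)) →L[ℝ] EuclideanSpace ℝ (Fin (2 * m)) := fun t =>
    toEuclideanCLM (𝕜 := ℝ) (h t : Matrix (Fin (2 * m)) (Fin (2 * m)) ℝ)
  have hu1 : ∀ t v i, u t v i = ((h t : Matrix (Fin (2 * m)) (Fin (2 * m)) ℝ) *ᵥ v.ofLp) i :=
    fun t v i => by rw [← ofLp_toEuclideanCLM]
  obtain ⟨b, a, hb, hba⟩ := exists_isRotated_family (u := u) (m := m)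
    (Q := fun a => ∃ l r : ℤ, a = n * l + r ∧ 0 ≤ r ∧ (n ≠ 0 → 2 * r ≤ n) ∧ (n = 0 → l = 0))
    (fun v => by
      exact (PiLp.continuous_toLp 2 _).comp
        ((Units.continuous_val.comp hhc).matrix_mulVec continuous_const))
    (fun s t v => by simp [u, hadd])
    (fun v => by simp [u, hper]) (fun v => by simp [u, h0]) (exists_eq_mul_add_or_neg n) (by simp)
    m le_rfl
  choose hQ hrot using hba
  choose l r hlr using hQ
  -- sort the planes by the residues of their weights
  set ρ := Tuple.sort r
  let B : Matrix (Fin (2 * m)) (Fin (2 * m)) ℝ := of fun i k =>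
    b (ρ ((pairEquiv m).symm k).2, ((pairEquiv m).symm k).1) i
  have hB : ∀ i c j, B i (pairEquiv m (c, j)) = b (ρ j, c) i := fun i c j => by simp [B]
  have hBdet : B.det ≠ 0 := by
    have h1 : LinearIndependent ℝ B.col := by
      have h2 := (hb.comp (fun k : Fin (2 * m) => (ρ ((pairEquiv m).symm k).2, ((pairEquiv m).symm k).1))
        (fun k k' hkk => by
          have h3 := Prod.ext_iff.1 hkk
          exact (pairEquiv m).symm.injective (Prod.ext h3.2 (ρ.injective h3.1)))).map'
        (WithLp.linearEquiv 2 ℝ (Fin (2 * m) → ℝ)).toLinearMap (LinearEquiv.ker _)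
      exact h2
    exact (isUnit_iff_isUnit_det _).1 (linearIndependent_cols_iff_isUnit.1 h1) |>.ne_zero
  refine ⟨op (toGL B) • f₀, a ∘ ρ, l ∘ ρ, r ∘ ρ, hf₀, Tuple.monotone_sort r, fun j => hlr _,
    fun t => ?_⟩
  rw [FrameBundle.circle_smul_op_smul, hh, smul_smul, smul_smul, ← op_mul, ← op_mul]
  congr 2
  refine Units.ext ?_
  rw [Units.val_mul, Units.val_mul, coe_toGL hBdet, coe_rotGL]
  ext i k
  obtain ⟨⟨c, j⟩, rfl⟩ := (pairEquiv m).surjective k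
  rw [mul_rotMat_apply, Fin.sum_univ_two, hB, hB]
  have h1 : ((h t : Matrix (Fin (2 * m)) (Fin (2 * m)) ℝ) * B) i (pairEquiv m (c, j)) =
      u t (b (ρ j, c)) i := by
    rw [hu1, Matrix.mul_apply, mulVec, dotProduct]
    simp only [hB]
  rw [h1]
  fin_cases c
  · simp only [Fin.zero_eta, (hrot (ρ j) t).1]
    simp [mul_comm]
  · simp only [Fin.mk_one, (hrot (ρ j) t).2]
    simp [mul_comm]

end WeightSplitting

/-! ### The orientation defined by a frame invariant -/

section TangentPair

variable {d k : ℕ} {M : Type*} [TopologicalSpace M] [ChartedSpace (EuclideanSpace ℝ (Fin d)) M]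
  {F : Set M} [ChartedSpace (EuclideanSpace ℝ (Fin k)) F]

/-- The frame `s` of the submanifold `F` consists of the first vectors of the frame `b` of `M`. -/
structure TangentPair (hk : k ≤ d) (b : FrameBundle d M) (s : FrameBundle k F) : Prop where
  base : b.1 = s.1
  vector : ∀ i : Fin k, (mfderiv (𝓡 k) (𝓡 d) (Subtype.val : F → M) s.1 (s.2 i) :
    EuclideanSpace ℝ (Fin d)) = b.2 (Fin.castLE hk i)

variable {hk : k ≤ d}

/-- The change of the tangent frames is the upper left block of the change of the frames. -/
lemma TangentPair.exists_op_smul {b b' : FrameBundle d M} {s s' : FrameBundle k F}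
    (h : TangentPair hk b s) (h' : TangentPair hk b' s') (hs : s'.1 = s.1) :
    ∃ (g : GL (Fin d) ℝ) (g₀ : GL (Fin k) ℝ), b' = op g • b ∧ s' = op g₀ • s ∧
      (g₀ : Matrix (Fin k) (Fin k) ℝ) =
        (g : Matrix (Fin d) (Fin d) ℝ).submatrix (Fin.castLE hk) (Fin.castLE hk) ∧
      ∀ (l : Fin d) (i : Fin k), k ≤ l →
        (g : Matrix (Fin d) (Fin d) ℝ) l (Fin.castLE hk i) = 0 := by
  obtain ⟨g₀, rfl⟩ := FrameBundle.exists_op_smul hs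
  obtain ⟨g, rfl⟩ := FrameBundle.exists_op_smul (f := b) (f' := b')
    (by rw [h.base, h'.base, hs])
  let D : EuclideanSpace ℝ (Fin k) →L[ℝ] EuclideanSpace ℝ (Fin d) :=
    mfderiv (𝓡 k) (𝓡 d) (Subtype.val : F → M) s.1
  let B : Module.Basis (Fin d) ℝ (EuclideanSpace ℝ (Fin d)) := b.2
  let S : Module.Basis (Fin k) ℝ (EuclideanSpace ℝ (Fin k)) := s.2
  have h1 : ∀ i, D (S i) = B (Fin.castLE hk i) := h.vector
  have h2 : ∀ i, D (S.rightMul g₀ i) = B.rightMul g (Fin.castLE hk i) := h'.vector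
  have h3 : ∀ (l : Fin d) (i : Fin k), ∑ y : Fin k, (g₀ : Matrix (Fin k) (Fin k) ℝ) y i *
      (if Fin.castLE hk y = l then 1 else 0) =
        (g : Matrix (Fin d) (Fin d) ℝ) l (Fin.castLE hk i) := fun l i => by
    have h3 := congrArg (fun v => B.repr v l) (h2 i)
    rw [Module.Basis.rightMul_apply, Module.Basis.rightMul_apply, map_sum] at h3
    simpa [h1, Finsupp.single_apply] using h3
  refine ⟨g, g₀, rfl, rfl, ?_, fun l i hl => ?_⟩
  · ext l i
    rw [Matrix.submatrix_apply, ← h3]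
    simp [(Fin.castLE_injective hk).eq_iff]
  · rw [← h3]
    refine Finset.sum_eq_zero fun y _ => ?_
    rw [if_neg, mul_zero]
    rintro rfl
    exact absurd y.2 (not_lt.2 hl)

end TangentPair

section Orientation

lemma isClopen_of_eventually {X : Type*} [TopologicalSpace X] {S : Set X}
    (h : ∀ x, ∀ᶠ y in 𝓝 x, y ∈ S ↔ x ∈ S) : IsClopen S := by
  refine ⟨isOpen_compl_iff.1 (isOpen_iff_mem_nhds.2 fun x hx => ?_),
    isOpen_iff_mem_nhds.2 fun x hx => ?_⟩
  · filter_upwards [h x] with y hy using fun h' => hx (hy.1 h')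
  · filter_upwards [h x] with y hy using hy.2 hx

lemma IsClopen.apply_zero_mem_iff {X : Type*} [TopologicalSpace X] {S : Set X} (hS : IsClopen S)
    (β : C(I, X)) : β 0 ∈ S ↔ β 1 ∈ S := by
  rcases isClopen_iff.1 (hS.preimage β.continuous) with h | h
  · have h' : ∀ t, β t ∉ S := fun t ht => (Set.ext_iff.1 h t).1 ht
    exact iff_of_false (h' 0) (h' 1)
  · have h' : ∀ t, β t ∈ S := fun t => (Set.ext_iff.1 h t).2 trivial
    exact iff_of_true (h' 0) (h' 1)

lemma ContinuousAt.eventually_pos_iff {X : Type*} [TopologicalSpace X] {f : X → ℝ} {x : X}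
    (hf : ContinuousAt f x) (h0 : f x ≠ 0) : ∀ᶠ y in 𝓝 x, 0 < f y ↔ 0 < f x := by
  rcases lt_or_gt_of_ne h0 with h | h
  · filter_upwards [hf.eventually_lt_const h] with y hy
    exact ⟨fun h' => absurd h' hy.not_gt, fun h' => absurd h' h.not_gt⟩
  · filter_upwards [hf.eventually_const_lt h] with y hy using ⟨fun _ => h, fun _ => hy⟩

variable {m : ℕ} {M : Type*} [TopologicalSpace M] [ChartedSpace (EuclideanSpace ℝ (Fin (2 * m))) M]
  [IsManifold (𝓡 (2 * m)) ∞ M] [MulAction Circle M] [ContMDiffSMul (𝓡 1) (𝓡 (2 * m)) ∞ Circle M]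
  {n : ℕ} {θ : Fin m → ℝ} {k : ℕ} {x₀ : M}

/-- A mod 2 invariant of the adapted frames over `F`, invariant under deformation, which depends on
the frame through the orientations of the tangent space and of the normal space. -/
structure FrameInvariant (hk : k ≤ 2 * m) (n : ℕ) (θ : Fin m → ℝ) (F : Set M)
    (e : FrameBundle (2 * m) M → ZMod 2) : Prop where
  path : ∀ β : C(I, FrameBundle (2 * m) M), (∀ s, β s ∈ adaptedFrames M n θ ∧ (β s).1 ∈ F) →
    e (β 0) = e (β 1)
  op_smul : ∀ b ∈ adaptedFrames M n θ, b.1 ∈ F → ∀ h : GL (Fin (2 * m)) ℝ,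
    Commute (h : Matrix (Fin (2 * m)) (Fin (2 * m)) ℝ) (rotMat θ) →
    e (op h • b) = e b + if 0 < (h : Matrix (Fin (2 * m)) (Fin (2 * m)) ℝ).det *
      ((h : Matrix (Fin (2 * m)) (Fin (2 * m)) ℝ).submatrix (Fin.castLE hk) (Fin.castLE hk)).det
        then 0 else 1

lemma add_ite_eq_iff (a c : ZMod 2) (P : Prop) [Decidable P] :
    (a + if P then 0 else 1) = c ↔ (a = c ↔ P) := by
  by_cases h : P <;> simp only [h, if_true, if_false] <;> revert a c <;> decide

lemma mul_pos_iff_pos_iff_pos {a b : ℝ} (ha : a ≠ 0) (hb : b ≠ 0) : 0 < a * b ↔ (0 < a ↔ 0 < b) := by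
  rcases lt_or_gt_of_ne ha with h | h <;> rcases lt_or_gt_of_ne hb with h' | h' <;>
    simp [h, h', h.not_gt, h'.not_gt, mul_pos_iff]

lemma iff_iff_iff_iff (A B E p q : Prop) :
    ((A ↔ q) ↔ ((B ↔ p) ↔ (E ↔ (p ↔ q)))) ↔ (A ↔ (B ↔ E)) := by
  by_cases hA : A <;> by_cases hB : B <;> by_cases hp : p <;> by_cases hq : q <;>
    simp [hA, hB, hp, hq]

variable {hk : k ≤ 2 * m} {F : Set M} [ChartedSpace (EuclideanSpace ℝ (Fin k)) F]
  {e : FrameBundle (2 * m) M → ZMod 2} {oM : ManifoldOrientation (2 * m) M}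

/-- The comparison of orientations by means of a frame invariant does not depend on the frames. -/
lemma FrameInvariant.orientation_iff_iff (he : FrameInvariant hk n θ F e)
    {b b' : FrameBundle (2 * m) M} {s s' : FrameBundle k F} (h : TangentPair hk b s)
    (h' : TangentPair hk b' s') (hs : s'.1 = s.1) (hb : b ∈ adaptedFrames M n θ)
    (hb' : b' ∈ adaptedFrames M n θ) (oF : ∀ x : F, Orientation ℝ (TangentSpace (𝓡 k) x) (Fin k))
    (c : ZMod 2) :
    (s'.2.orientation = oF s'.1 ↔ (b'.2.orientation = oM.at' b'.1 ↔ e b' = c)) ↔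
      (s.2.orientation = oF s.1 ↔ (b.2.orientation = oM.at' b.1 ↔ e b = c)) := by
  obtain ⟨g, g₀, rfl, rfl, hg, -⟩ := h.exists_op_smul h' hs
  have h1 : (op g • b).2.orientation = oM.at' (op g • b).1 ↔
      (b.2.orientation = oM.at' b.1 ↔ 0 < (g : Matrix (Fin (2 * m)) (Fin (2 * m)) ℝ).det) :=
    b.2.orientation_rightMul g _
  have h2 : (op g₀ • s).2.orientation = oF (op g₀ • s).1 ↔
      (s.2.orientation = oF s.1 ↔ 0 < (g₀ : Matrix (Fin k) (Fin k) ℝ).det) :=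
    s.2.orientation_rightMul g₀ _
  have h3 := he.op_smul b hb (by rw [h.base]; exact s.1.2) g ((op_smul_mem_adaptedFrames hb).1 hb')
  rw [← hg] at h3
  rw [h1, h2, h3, add_ite_eq_iff, mul_pos_iff_pos_iff_pos (GL_det_ne_zero g) (GL_det_ne_zero g₀)]
  exact iff_iff_iff_iff _ _ _ _ _

end Orientation

section ComponentOrientation

variable {m : ℕ} {M : Type*} [TopologicalSpace M] [ChartedSpace (EuclideanSpace ℝ (Fin (2 * m))) M]
  [IsManifold (𝓡 (2 * m)) ∞ M] [MulAction Circle M] [ContMDiffSMul (𝓡 1) (𝓡 (2 * m)) ∞ Circle M]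
  {n : ℕ} {θ : Fin m → ℝ} {k : ℕ} {x₀ : M} {hk : k ≤ 2 * m}
  [ChartedSpace (EuclideanSpace ℝ (Fin k)) ↥(fixedComponent n x₀)]
  [IsManifold (𝓡 k) ∞ ↥(fixedComponent n x₀)]
  {e : FrameBundle (2 * m) M → ZMod 2} {oM : ManifoldOrientation (2 * m) M}
  {χ : OpenPartialHomeomorph M (EuclideanSpace ℝ (Fin (2 * m)))}

/-- The component can be oriented such that the orientations of `F` and `M` are related by the frame
invariant: this relation is independent of the frames, and it holds along adapted charts, on which
all the quantities involved are locally constant, so that the orientation is continuous. -/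
lemma FrameInvariant.exists_orientation (he : FrameInvariant hk n θ (fixedComponent n x₀) e)
    (hval : MDifferentiable (𝓡 k) (𝓡 (2 * m)) (Subtype.val : ↥(fixedComponent n x₀) → M))
    (hatlas : ∀ (χ : OpenPartialHomeomorph M (EuclideanSpace ℝ (Fin (2 * m))))
      (h : IsSliceChart k (fixedComponent n x₀) χ) (y : ↥(fixedComponent n x₀)),
      sliceChart hk h y ∈ IsManifold.maximalAtlas (𝓡 k) ∞ ↥(fixedComponent n x₀))
    (hchart : ∀ y ∈ fixedComponent n x₀,
      ∃ χ : OpenPartialHomeomorph M (EuclideanSpace ℝ (Fin (2 * m))), y ∈ χ.source ∧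
        IsAdaptedChart n θ k (fixedComponent n x₀) χ) (c : ZMod 2) :
    ∃ oF : ManifoldOrientation k ↥(fixedComponent n x₀),
      ∀ (b : FrameBundle (2 * m) M) (s : FrameBundle k ↥(fixedComponent n x₀)),
        TangentPair hk b s → b ∈ adaptedFrames M n θ →
        (s.2.orientation = oF.at' s.1 ↔ (b.2.orientation = oM.at' b.1 ↔ e b = c)) := by
  classical
  choose χ hχs hχ using hchart
  let B (y z : ↥(fixedComponent n x₀)) : FrameBundle (2 * m) M :=
    chartFrame (hχ y y.2).mem_maximalAtlas z
  let S (y z : ↥(fixedComponent n x₀)) : FrameBundle k ↥(fixedComponent n x₀) :=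
    chartFrame (hatlas (χ y y.2) (hχ y y.2).toIsSliceChart y) z
  have hpair : ∀ y z : ↥(fixedComponent n x₀), (z : M) ∈ (χ y y.2).source →
      TangentPair hk (B y z) (S y z) := fun y z hz =>
    ⟨rfl, mfderiv_val_chartFrame hk (hχ y y.2).toIsSliceChart y hval (hatlas _ _ _) hz⟩
  have hB : ∀ y z : ↥(fixedComponent n x₀), (z : M) ∈ (χ y y.2).source →
      B y z ∈ adaptedFrames M n θ := fun y z hz => (hχ y y.2).chartFrame_mem hz z.2
  let o (y : ↥(fixedComponent n x₀)) : Orientation ℝ (TangentSpace (𝓡 k) y) (Fin k) :=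
    if (B y y).2.orientation = oM.at' y ↔ e (B y y) = c then (S y y).2.orientation
      else -(S y y).2.orientation
  have ho : ∀ y, (S y y).2.orientation = o y ↔
      ((B y y).2.orientation = oM.at' (B y y).1 ↔ e (B y y) = c) := fun y => by
    show _ = ite _ _ _ ↔ ((B y y).2.orientation = oM.at' y ↔ e (B y y) = c)
    split_ifs with h
    · exact iff_of_true rfl h
    · exact iff_of_false (Module.Ray.ne_neg_self _) h
  have key : ∀ (b : FrameBundle (2 * m) M) (s : FrameBundle k ↥(fixedComponent n x₀)),
        TangentPair hk b s → b ∈ adaptedFrames M n θ →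
        (s.2.orientation = o s.1 ↔ (b.2.orientation = oM.at' b.1 ↔ e b = c)) := fun b s h hb =>
    (he.orientation_iff_iff (hpair s.1 s.1 (hχs _ _)) h rfl (hB _ _ (hχs _ _)) hb o c).2 (ho s.1)
  refine ⟨⟨o, isClopen_of_eventually fun f₀ => ?_⟩, key⟩
  obtain ⟨V, φ, hV, hyV, hφ, hφg⟩ := FrameBundle.exists_coord (d := k) f₀.1
  set y₀ := f₀.1 with hy₀
  set U : Set (FrameBundle k ↥(fixedComponent n x₀)) :=
    (fun f => f.1) ⁻¹' (V ∩ Subtype.val ⁻¹' (χ y₀ y₀.2).source)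
  have hU : IsOpen U := (hV.inter ((χ y₀ y₀.2).open_source.preimage continuous_subtype_val)).preimage
    FrameBundle.continuous_base
  have hf₀U : f₀ ∈ U := ⟨hyV, hχs _ _⟩
  -- the coordinate frame of a chart has constant orientation
  have hconst : ∀ f ∈ U, (S y₀ f.1).2.orientation = o f.1 ↔ (S y₀ y₀).2.orientation = o y₀ := by
    intro f hf
    refine (key _ (S y₀ f.1) (hpair y₀ f.1 hf.2) (hB y₀ f.1 hf.2)).trans (Iff.trans ?_ (ho y₀).symm)
    obtain ⟨β, hβ0, hβ1, hβ⟩ := (hχ y₀ y₀.2).exists_path hf.2 f.1.2 (hχs y₀ y₀.2) y₀.2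
    have h1 : e (B y₀ f.1) = e (B y₀ y₀) := by
      have := he.path β hβ
      rwa [hβ0, hβ1] at this
    have h2 : (B y₀ f.1).2.orientation = oM.at' (B y₀ f.1).1 ↔
        (B y₀ y₀).2.orientation = oM.at' (B y₀ y₀).1 := by
      have h3 := oM.continuous'.apply_zero_mem_iff β
      rw [hβ0, hβ1] at h3
      exact h3
    exact iff_congr h2 (by rw [h1])
  let h (f : FrameBundle k ↥(fixedComponent n x₀)) : GL (Fin k) ℝ := (φ (S y₀ f.1))⁻¹ * φ f
  have hh : ∀ f ∈ U, f = op (h f) • S y₀ f.1 := fun f hf => by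
    obtain ⟨g, hg⟩ := FrameBundle.exists_op_smul (f := S y₀ f.1) (f' := f) rfl
    have : φ f = φ (S y₀ f.1) * g := by
      rw [← hφg (S y₀ f.1) hf.1, ← hg]
    simp only [h]
    rw [this, inv_mul_cancel_left]
    exact hg
  have hhc : ContinuousOn h U := by
    refine ContinuousOn.mul (ContinuousOn.inv (hφ.comp ?_ fun f hf => hf.1)) (hφ.mono fun f hf => hf.1)
    exact (continuousOn_chartFrame (hatlas (χ y₀ y₀.2) (hχ y₀ y₀.2).toIsSliceChart y₀)).comp
      FrameBundle.continuous_base.continuousOn fun f hf => hf.2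
  have hor : ∀ f ∈ U, f.2.orientation = o f.1 ↔ ((S y₀ y₀).2.orientation = o y₀ ↔
      0 < (h f : Matrix (Fin k) (Fin k) ℝ).det) := fun f hf => by
    rw [← hconst f hf]
    have := (S y₀ f.1).2.orientation_rightMul (h f) (o f.1)
    rw [← this]
    have h1 : ∀ f' : FrameBundle k ↥(fixedComponent n x₀), f = f' →
        (f.2.orientation = o f.1 ↔ f'.2.orientation = o f'.1) := by rintro _ rfl; rfl
    exact h1 _ (hh f hf)
  have hdet : ContinuousAt (fun f => (h f : Matrix (Fin k) (Fin k) ℝ).det) f₀ :=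
    ((continuous_id.matrix_det.comp Units.continuous_val).continuousAt.comp
      (hhc.continuousAt (hU.mem_nhds hf₀U)))
  filter_upwards [hU.mem_nhds hf₀U, hdet.eventually_pos_iff (GL_det_ne_zero _)] with f hf hpos
  show f.2.orientation = o f.1 ↔ f₀.2.orientation = o f₀.1
  rw [hor f hf, hor f₀ hf₀U, hpos]

end ComponentOrientation

/-! ### Conjugate rotations -/

section RotationAngles

variable {m : ℕ} {θ θ' : Fin m → ℝ}

lemma card_onCoord_eq (θ : Fin m → ℝ) (c : ℝ) :
    Fintype.card {i // onCoord θ i = c} = 2 * Fintype.card {j // θ j = c} := by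
  have h2 : 2 * Fintype.card {j // θ j = c} = Fintype.card (Fin 2 × {j // θ j = c}) := by simp
  refine Eq.trans (Fintype.card_congr (((pairEquiv m).subtypeEquiv (p := fun y => θ y.2 = c)
    fun y => by rw [← onCoord_pairEquiv θ y.1 y.2]).symm.trans ⟨fun y => (y.1.1, ⟨y.1.2, y.2⟩),
    fun y => ⟨(y.1, y.2.1), y.2.2⟩, fun y => rfl, fun y => rfl⟩)) h2.symm

/-- The cosines of the angles of a rotation are, up to the order, determined by its conjugacy class:
the sum of a rotation and its inverse is diagonal, with characteristic polynomial given by the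
cosines. -/
lemma exists_perm_cos_of_mul_rotGL {h : GL (Fin (2 * m)) ℝ} (hc : h * rotGL θ' = rotGL θ * h) :
    ∃ ρ : Equiv.Perm (Fin m), ∀ j, Real.cos (θ' (ρ j)) = Real.cos (θ j) := by
  have h1 : h * rotGL (-θ') = rotGL (-θ) * h := by
    rw [rotGL_neg, rotGL_neg, eq_inv_mul_iff_mul_eq, ← mul_assoc, ← hc, mul_assoc, mul_inv_cancel,
      mul_one]
  have h2 : (h : Matrix (Fin (2 * m)) (Fin (2 * m)) ℝ) * (rotMat θ' + rotMat (-θ')) * (h⁻¹ : GL _ ℝ) =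
      rotMat θ + rotMat (-θ) := by
    have h3 := congrArg Units.val hc
    have h4 := congrArg Units.val h1
    rw [Units.val_mul, Units.val_mul, coe_rotGL, coe_rotGL] at h3 h4
    rw [mul_add, h3, h4, ← add_mul, Matrix.mul_assoc, ← Units.val_mul, mul_inv_cancel, Units.val_one,
      Matrix.mul_one]
  have h5 := congrArg Matrix.charpoly h2
  rw [Matrix.coe_units_inv, charpoly_units_conj, rotMat_add_rotMat_neg, rotMat_add_rotMat_neg,
    charpoly_diagonal, charpoly_diagonal] at h5
  have hroots : ∀ f : Fin (2 * m) → ℝ,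
      (∏ i, (Polynomial.X - Polynomial.C (f i))).roots = Finset.univ.val.map f := fun f => by
    rw [← Polynomial.roots_multiset_prod_X_sub_C (Finset.univ.val.map f), Multiset.map_map]
    rfl
  have h6 := congrArg Polynomial.roots h5
  rw [hroots, hroots] at h6
  have hcard : ∀ c, Fintype.card {j // Real.cos (θ j) = c} = Fintype.card {j // Real.cos (θ' j) = c} := by
    intro c
    have h7 := congrArg (Multiset.count (2 * c)) h6
    rw [Multiset.count_map, Multiset.count_map] at h7
    have h8 : ∀ η : Fin m → ℝ,
        (Multiset.filter (fun i => 2 * c = 2 * Real.cos (onCoord η i)) Finset.univ.val).card =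
          Fintype.card {i // onCoord (fun j => Real.cos (η j)) i = c} := fun η => by
      rw [Fintype.card_subtype]
      simp only [mul_right_inj' (two_ne_zero (α := ℝ)), eq_comm (a := c)]
      rfl
    rw [h8, h8, card_onCoord_eq, card_onCoord_eq] at h7
    omega
  exact ⟨Equiv.ofFiberEquiv fun c => Fintype.equivOfCardEq (hcard c), fun j =>
    Equiv.ofFiberEquiv_map (f := fun j => Real.cos (θ j)) (g := fun j => Real.cos (θ' j)) _ j⟩

lemma exists_perm_of_mul_rotGL (hθ : ∀ j, θ j ∈ Set.Icc 0 Real.pi)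
    (hθ' : ∀ j, θ' j ∈ Set.Icc 0 Real.pi) {h : GL (Fin (2 * m)) ℝ}
    (hc : h * rotGL θ' = rotGL θ * h) : ∃ ρ : Equiv.Perm (Fin m), θ' ∘ ρ = θ := by
  obtain ⟨ρ, hρ⟩ := exists_perm_cos_of_mul_rotGL hc
  exact ⟨ρ, funext fun j => Real.injOn_cos (hθ' _) (hθ _) (hρ j)⟩

/-- The permutation of the planes in `exists_perm_of_mul_rotGL` can be chosen to fix the planes
which are not rotated, if these are not rotated by the other rotation either. -/
lemma exists_perm_of_mul_rotGL_of_fixed (hθ : ∀ j, θ j ∈ Set.Icc 0 Real.pi)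
    (hθ' : ∀ j, θ' j ∈ Set.Icc 0 Real.pi) {h : GL (Fin (2 * m)) ℝ}
    (hc : h * rotGL θ' = rotGL θ * h) (h0 : ∀ j, θ j = 0 → θ' j = 0) :
    ∃ ρ : Equiv.Perm (Fin m), θ' ∘ ρ = θ ∧ ∀ j, θ j = 0 → ρ j = j := by
  obtain ⟨ρ, hρ⟩ := exists_perm_of_mul_rotGL hθ hθ' hc
  have hρ' : ∀ j, θ' (ρ j) = θ j := congrFun hρ
  have h1 : ∀ j, θ j = 0 ↔ θ' j = 0 := by
    have h2 : Finset.univ.filter (fun j => θ j = 0) = Finset.univ.filter fun j => θ' j = 0 := by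
      refine Finset.eq_of_subset_of_card_le (fun j => by simpa using h0 j) (le_of_eq ?_)
      refine (Finset.card_bij (fun j _ => ρ j) (fun j => by simp [hρ']) (fun _ _ _ _ h => ρ.injective h)
        fun j => ?_).symm
      intro hj
      exact ⟨ρ.symm j, by simpa [← hρ'] using hj, by simp⟩
    intro j
    simpa using Finset.ext_iff.1 h2 j
  let η : Fin m → Fin m := fun j => if θ j = 0 then j else ρ j
  have hη : Function.Injective η := fun i j hij => by
    simp only [η] at hij
    split_ifs at hij with hi hj hj
    · exact hij
    · exact absurd ((hρ' j).symm.trans (hij ▸ (h1 i).1 hi)) hj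
    · exact absurd ((hρ' i).symm.trans (hij ▸ (h1 j).1 hj)) hi
    · exact ρ.injective hij
  refine ⟨Equiv.ofBijective η (Finite.injective_iff_bijective.1 hη), funext fun j => ?_, fun j hj => ?_⟩
  · show θ' (η j) = θ j
    by_cases hj : θ j = 0
    · simp [η, hj, (h1 j).1 hj]
    · simp [η, hj, hρ']
  · simp [η, hj]

end RotationAngles

/-! ### Weight frames as rotated frames -/

section RotatedFrames

variable {m : ℕ}

lemma rightMul_rotGL_apply {V : Type*} [AddCommGroup V] [Module ℝ V]
    (B : Module.Basis (Fin (2 * m)) ℝ V) (θ : Fin m → ℝ) (j : Fin m) :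
    B.rightMul (rotGL θ) ⟨2 * j, by omega⟩ = Real.cos (θ j) • B ⟨2 * j, by omega⟩ +
        Real.sin (θ j) • B ⟨2 * j + 1, by omega⟩ ∧
      B.rightMul (rotGL θ) ⟨2 * j + 1, by omega⟩ = -Real.sin (θ j) • B ⟨2 * j, by omega⟩ +
        Real.cos (θ j) • B ⟨2 * j + 1, by omega⟩ := by
  have h : ∀ a : Fin 2, B.rightMul (rotGL θ) (pairEquiv m (a, j)) = ∑ b,
      !![Real.cos (θ j), -Real.sin (θ j); Real.sin (θ j), Real.cos (θ j)] b a •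
        B (pairEquiv m (b, j)) := fun a => by
    rw [Module.Basis.rightMul_apply, ← (pairEquiv m).sum_comp, Fintype.sum_prod_type, coe_rotGL]
    refine Finset.sum_congr rfl fun b _ => ?_
    rw [Finset.sum_eq_single j]
    · rw [rotMat_apply, if_pos rfl]
    · intro i _ hij
      rw [rotMat_apply, if_neg hij, zero_smul]
    · simp
  have h0 := h 0
  have h1 := h 1
  rw [Fin.sum_univ_two] at h0 h1
  exact ⟨h0, h1⟩

lemma Circle.re_exp_zpow (t : ℝ) (a : ℤ) :
    ((Circle.exp t ^ a : Circle) : ℂ).re = Real.cos (t * a) ∧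
      ((Circle.exp t ^ a : Circle) : ℂ).im = Real.sin (t * a) := by
  have : ((Circle.exp t ^ a : Circle) : ℂ) = Complex.exp ((t * a : ℝ) * Complex.I) := by
    rw [Circle.coe_zpow, Circle.coe_exp, ← Complex.exp_int_mul]
    congr 1
    push_cast
    ring
  rw [this, Complex.exp_ofReal_mul_I_re, Complex.exp_ofReal_mul_I_im]
  exact ⟨rfl, rfl⟩

variable {M : Type*} [TopologicalSpace M] [ChartedSpace (EuclideanSpace ℝ (Fin (2 * m))) M]
  [IsManifold (𝓡 (2 * m)) ∞ M] [MulAction Circle M] [ContMDiffSMul (𝓡 1) (𝓡 (2 * m)) ∞ Circle M]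

/-- The circle acts on a frame by rotations if and only if the differential rotates the planes
spanned by its vectors. -/
lemma smul_eq_op_rotGL_smul_iff {f : FrameBundle (2 * m) M} {z : Circle} (hz : z • f.1 = f.1)
    {θ : Fin m → ℝ} : z • f = op (rotGL θ) • f ↔ ∀ j : Fin m,
      (tangentMap (𝓡 (2 * m)) (𝓡 (2 * m)) (fun y : M => z • y) ⟨f.1, f.2 ⟨2 * j, by omega⟩⟩ =
        ⟨f.1, Real.cos (θ j) • f.2 ⟨2 * j, by omega⟩ +
          Real.sin (θ j) • f.2 ⟨2 * j + 1, by omega⟩⟩) ∧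
      (tangentMap (𝓡 (2 * m)) (𝓡 (2 * m)) (fun y : M => z • y) ⟨f.1, f.2 ⟨2 * j + 1, by omega⟩⟩ =
        ⟨f.1, -Real.sin (θ j) • f.2 ⟨2 * j, by omega⟩ +
          Real.cos (θ j) • f.2 ⟨2 * j + 1, by omega⟩⟩) := by
  have hrot := rightMul_rotGL_apply f.2 θ
  constructor
  · intro h j
    have h1 : ∀ i, tangentMap (𝓡 (2 * m)) (𝓡 (2 * m)) (fun y : M => z • y) ⟨f.1, f.2 i⟩ =
        (⟨f.1, f.2.rightMul (rotGL θ) i⟩ : TangentBundle (𝓡 (2 * m)) M) := fun i => by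
      refine (FrameBundle.circle_smul_vector z f i).symm.trans ?_
      rw [h]
      rfl
    exact ⟨(h1 _).trans (congrArg _ (hrot j).1), (h1 _).trans (congrArg _ (hrot j).2)⟩
  · intro h
    refine FrameBundle.ext hz fun i => (FrameBundle.circle_smul_vector z f i).trans ?_
    obtain ⟨⟨a, j⟩, rfl⟩ := (pairEquiv m).surjective i
    fin_cases a
    · exact (h j).1.trans (congrArg _ (hrot j).1.symm)
    · exact (h j).2.trans (congrArg _ (hrot j).2.symm)

variable {n k : ℕ} {oM : ManifoldOrientation (2 * m) M} {F : Set M}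
  [ChartedSpace (EuclideanSpace ℝ (Fin k)) F] [IsManifold (𝓡 k) ∞ F] {oF : ManifoldOrientation k F}

/-- The frame of `M` in a weight frame. -/
def WeightFrame.frame {x : F} (W : WeightFrame n oM F oF x) : FrameBundle (2 * m) M := ⟨x, W.b⟩

/-- The frame of `F` in a weight frame. -/
def WeightFrame.tangentFrame {x : F} (W : WeightFrame n oM F oF x) : FrameBundle k F := ⟨x, W.f⟩

lemma WeightFrame.smul_frame {x : F} (hx : ∀ z : Circle, z • (x : M) = x)
    (W : WeightFrame n oM F oF x) (t : ℝ) :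
    Circle.exp t • W.frame = op (rotGL fun j => t * W.a j) • W.frame := by
  refine (smul_eq_op_rotGL_smul_iff (f := W.frame) (hx _)).2 fun j => ⟨?_, ?_⟩
  · refine (W.rotate_fst _ j).trans ?_
    rw [(Circle.re_exp_zpow _ _).1, (Circle.re_exp_zpow _ _).2]
    rfl
  · refine (W.rotate_snd _ j).trans ?_
    rw [(Circle.re_exp_zpow _ _).1, (Circle.re_exp_zpow _ _).2]
    rfl

lemma WeightFrame.tangentPair {x : F} (W : WeightFrame n oM F oF x) :
    TangentPair W.dim_le W.frame W.tangentFrame :=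
  ⟨rfl, W.tangent⟩

/-- A weight frame amounts to a rotated frame of `M` which extends a frame of `F`. -/
lemma nonempty_weightFrame {x : F} (hx : ∀ z : Circle, z • (x : M) = x) (hk : k ≤ 2 * m)
    {b : FrameBundle (2 * m) M} {s : FrameBundle k F} (h : TangentPair hk b s) (hs : s.1 = x)
    {a l r : Fin m → ℤ}
    (ha : ∀ j, a j = n * l j + r j ∧ 0 ≤ r j ∧ (n ≠ 0 → 2 * r j ≤ n) ∧ (n = 0 → l j = 0))
    (hrot : ∀ t : ℝ, Circle.exp t • b = op (rotGL fun j => t * a j) • b)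
    (ho : b.2.orientation = oM.at' b.1 ↔ s.2.orientation = oF.at' s.1) :
    Nonempty (WeightFrame n oM F oF x) := by
  obtain ⟨y, B⟩ := b
  obtain ⟨x', S⟩ := s
  obtain rfl : x' = x := hs
  obtain rfl : y = x' := h.base
  have hrot' : ∀ (z : Circle) (j : Fin m), _ := fun z j => by
    have h1 := (smul_eq_op_rotGL_smul_iff (hx z)).1 (by
      have := hrot (Complex.arg z)
      rwa [Circle.exp_arg] at this) j
    rw [← (Circle.re_exp_zpow _ _).1, ← (Circle.re_exp_zpow _ _).2, Circle.exp_arg] at h1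
    exact h1
  exact ⟨{ b := B, f := S, a := a, l := l, r := r
           rotate_fst := fun z j => (hrot' z j).1
           rotate_snd := fun z j => (hrot' z j).2
           weight_eq := fun j => (ha j).1
           r_nonneg := fun j => (ha j).2.1
           two_r_le := fun hn j => (ha j).2.2.1 hn
           l_eq_zero := fun hn j => (ha j).2.2.2 hn
           dim_le := hk
           tangent := h.vector
           orientation_iff := ho }⟩

end RotatedFrames

/-! ### Changes of rotated frames -/

section ChangeOfRotatedFrames

variable {m : ℕ}

/-- The generator rotates the planes by the angles given by the residues of the weights modulo `n`.
-/
lemma rotGL_residue {n : ℕ} (hn : n ≠ 0) {a l r : Fin m → ℤ} (ha : ∀ j, a j = n * l j + r j) :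
    rotGL (fun j => 2 * Real.pi / n * a j) = rotGL fun j => 2 * Real.pi * r j / n := by
  have hn' : (n : ℝ) ≠ 0 := by exact_mod_cast hn
  have h : ∀ j, 2 * Real.pi / n * a j = 2 * Real.pi * r j / n + l j * (2 * Real.pi) := fun j => by
    rw [ha]
    push_cast
    field_simp
    ring
  refine Units.ext ?_
  rw [coe_rotGL, coe_rotGL, rotMat, rotMat]
  simp only [h, Real.cos_add_int_mul_two_pi, Real.sin_add_int_mul_two_pi]

/-- The angles by which a generator of the group of order `n` rotates planes of weights `r j`. -/
noncomputable def residueAngle (n : ℕ) (r : Fin m → ℤ) : Fin m → ℝ := fun j => 2 * Real.pi * r j / n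

section

variable {n : ℕ} (hn : n ≠ 0) {r : Fin m → ℤ}

lemma residueAngle_mem_Icc (hr : ∀ j, 0 ≤ r j ∧ (n ≠ 0 → 2 * r j ≤ n)) (j : Fin m) :
    residueAngle n r j ∈ Set.Icc 0 Real.pi := by
  have h1 : (0 : ℝ) ≤ r j := by exact_mod_cast (hr j).1
  have hπ := Real.pi_pos
  refine ⟨by unfold residueAngle; positivity, ?_⟩
  rcases eq_or_ne n 0 with rfl | hn
  · simpa [residueAngle] using hπ.le
  have h2 : (2 : ℝ) * r j ≤ n := by exact_mod_cast (hr j).2 hn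
  have hn' : (0 : ℝ) < n := by exact_mod_cast Nat.pos_of_ne_zero hn
  rw [residueAngle, div_le_iff₀ hn']
  nlinarith

lemma residueAngle_eq_zero_iff (hn : n ≠ 0) (j : Fin m) : residueAngle n r j = 0 ↔ r j = 0 := by
  simp [residueAngle, hn, Real.pi_ne_zero]

lemma onCoord_residueAngle_eq_zero_iff (hn : n ≠ 0) (i : Fin (2 * m)) :
    onCoord (residueAngle n r) i = 0 ↔ onCoord r i = 0 := by
  obtain ⟨⟨a, j⟩, rfl⟩ := (pairEquiv m).surjective i
  rw [onCoord_pairEquiv, onCoord_pairEquiv, residueAngle_eq_zero_iff hn]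

lemma residueAngle_eq_pi_iff (hn : n ≠ 0) (j : Fin m) :
    residueAngle n r j = Real.pi ↔ 2 * r j = n := by
  have hn' : (n : ℝ) ≠ 0 := by exact_mod_cast hn
  rw [residueAngle, div_eq_iff hn', mul_comm 2 Real.pi, mul_assoc, mul_right_inj' Real.pi_ne_zero]
  exact_mod_cast Iff.rfl

lemma residueAngle_injective (hn : n ≠ 0) :
    Function.Injective (residueAngle n : (Fin m → ℤ) → Fin m → ℝ) := fun r r' h => by
  have hn' : (n : ℝ) ≠ 0 := by exact_mod_cast hn
  ext j
  have h1 := congrFun h j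
  rw [residueAngle, residueAngle, div_left_inj' hn', mul_right_inj' (by positivity)] at h1
  exact_mod_cast h1

end

lemma eq_zero_of_cos_eq_one {x : ℝ} (hx : x ∈ Set.Icc 0 Real.pi) (h : Real.cos x = 1) : x = 0 :=
  Real.injOn_cos hx ⟨le_rfl, Real.pi_pos.le⟩ (by rw [h, Real.cos_zero])

/-- If a conjugation between rotations preserves the span of the first `k` vectors, which are the
ones fixed by the first rotation, these vectors are also fixed by the second one. -/
lemma eq_zero_of_mul_rotGL {k : ℕ} {θ θ' : Fin m → ℝ} (hθ : ∀ j, θ j ∈ Set.Icc 0 Real.pi)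
    (hθ' : ∀ j, θ' j ∈ Set.Icc 0 Real.pi) (hk : k ≤ 2 * m)
    (hk' : ∀ i, onCoord θ i = 0 ↔ (i : ℕ) < k) {g : GL (Fin (2 * m)) ℝ}
    (hg : g * rotGL θ' = rotGL θ * g) (hz : ∀ (l : Fin (2 * m)) (i : Fin k), k ≤ l →
      (g : Matrix (Fin (2 * m)) (Fin (2 * m)) ℝ) l (Fin.castLE hk i) = 0) (j : Fin m) (hj : θ j = 0) :
    θ' j = 0 := by
  by_contra hne
  set i := pairEquiv m (0, j)
  have hi : (i : ℕ) < k := (hk' i).1 (by rw [onCoord_pairEquiv, hj])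
  have h1 : rotMat θ *ᵥ ((g : Matrix (Fin (2 * m)) (Fin (2 * m)) ℝ) *ᵥ Pi.single i 1) =
      (g : Matrix (Fin (2 * m)) (Fin (2 * m)) ℝ) *ᵥ Pi.single i 1 := by
    refine (rotMat_mulVec_eq_iff fun j => eq_zero_of_cos_eq_one (hθ j)).2 fun l hl => ?_
    rw [mulVec_single_one]
    exact hz l ⟨i, hi⟩ (not_lt.1 fun h => hl ((hk' l).2 h))
  have h2 : rotMat θ' *ᵥ Pi.single i 1 = Pi.single i (1 : ℝ) := by
    have h3 := congrArg Units.val hg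
    rw [Units.val_mul, Units.val_mul, coe_rotGL, coe_rotGL] at h3
    rw [mulVec_mulVec, ← h3, ← mulVec_mulVec] at h1
    have h4 := congrArg (fun v => (g⁻¹ : GL (Fin (2 * m)) ℝ).val *ᵥ v) h1
    simpa only [mulVec_mulVec, ← Matrix.mul_assoc, ← Units.val_mul, inv_mul_cancel, Units.val_one,
      Matrix.one_mul, one_mulVec] using h4
  have h5 := (rotMat_mulVec_eq_iff fun j => eq_zero_of_cos_eq_one (hθ' j)).1 h2 i
    (by rwa [onCoord_pairEquiv])
  simp at h5

variable {M : Type*} [TopologicalSpace M] [ChartedSpace (EuclideanSpace ℝ (Fin (2 * m))) M]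
  [IsManifold (𝓡 (2 * m)) ∞ M] [MulAction Circle M] [ContMDiffSMul (𝓡 1) (𝓡 (2 * m)) ∞ Circle M]

lemma circle_smul_op_smul_eq_iff {z : Circle} {f : FrameBundle (2 * m) M}
    {R R' g : GL (Fin (2 * m)) ℝ} (hf : z • f = op R • f) :
    z • op g • f = op R' • op g • f ↔ g * R' = R * g := by
  rw [FrameBundle.circle_smul_op_smul, hf, smul_smul, smul_smul, ← op_mul, ← op_mul,
    f.op_smul_injective.eq_iff, eq_comm]

variable {n : ℕ} (hn : n ≠ 0) {a l r : Fin m → ℤ}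

lemma mem_adaptedFrames_of_rotated (hn : n ≠ 0) (ha : ∀ j, a j = n * l j + r j)
    {f : FrameBundle (2 * m) M} (hf : ∀ t : ℝ, Circle.exp t • f = op (rotGL fun j => t * a j) • f) :
    f ∈ adaptedFrames M n (residueAngle n r) := by
  refine (hf _).trans ?_
  rw [rotGL_residue hn ha]
  rfl

/-- The planes of a rotated frame can be permuted. -/
lemma exists_permuted_frame (ρ : Equiv.Perm (Fin m)) {f : FrameBundle (2 * m) M}
    (hf : ∀ t : ℝ, Circle.exp t • f = op (rotGL fun j => t * a j) • f) :
    ∃ g : GL (Fin (2 * m)) ℝ, (g : Matrix (Fin (2 * m)) (Fin (2 * m)) ℝ).det = 1 ∧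
      (∀ (i : Fin (2 * m)) (c : Fin 2) (j : Fin m), (g : Matrix (Fin (2 * m)) (Fin (2 * m)) ℝ) i
        (pairEquiv m (c, j)) = if i = pairEquiv m (c, ρ j) then 1 else 0) ∧
      ∀ t : ℝ, Circle.exp t • op g • f = op (rotGL fun j => t * (a ∘ ρ) j) • op g • f := by
  obtain ⟨g, h1, h2, h3⟩ := exists_permGL ρ
  exact ⟨g, h1, h2, fun t => (circle_smul_op_smul_eq_iff (hf t)).2 (h3 fun j => t * a j)⟩

variable {k : ℕ} {hk : k ≤ 2 * m} {F : Set M} [ChartedSpace (EuclideanSpace ℝ (Fin k)) F]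
  {b : FrameBundle (2 * m) M} {s : FrameBundle k F}

/-- A matrix which preserves the span of the first `k` vectors moves a pair of frames of `M` and `F`
to another such pair. -/
lemma TangentPair.op_smul (h : TangentPair hk b s) {g : GL (Fin (2 * m)) ℝ} {g₀ : GL (Fin k) ℝ}
    (hg : (g₀ : Matrix (Fin k) (Fin k) ℝ) = (g : Matrix (Fin (2 * m)) (Fin (2 * m)) ℝ).submatrix
      (Fin.castLE hk) (Fin.castLE hk))
    (hz : ∀ (l : Fin (2 * m)) (i : Fin k), k ≤ l →
      (g : Matrix (Fin (2 * m)) (Fin (2 * m)) ℝ) l (Fin.castLE hk i) = 0) :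
    TangentPair hk (op g • b) (op g₀ • s) := by
  refine ⟨h.base, fun i => ?_⟩
  let D : EuclideanSpace ℝ (Fin k) →L[ℝ] EuclideanSpace ℝ (Fin (2 * m)) :=
    mfderiv (𝓡 k) (𝓡 (2 * m)) (Subtype.val : F → M) s.1
  let B : Module.Basis (Fin (2 * m)) ℝ (EuclideanSpace ℝ (Fin (2 * m))) := b.2
  let S : Module.Basis (Fin k) ℝ (EuclideanSpace ℝ (Fin k)) := s.2
  have h1 : ∀ i, D (S i) = B (Fin.castLE hk i) := h.vector
  show D (S.rightMul g₀ i) = B.rightMul g (Fin.castLE hk i)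
  rw [Module.Basis.rightMul_apply, Module.Basis.rightMul_apply, map_sum, hg]
  simp only [map_smul, h1, submatrix_apply]
  refine Fintype.sum_of_injective _ (Fin.castLE_injective hk) _ _ (fun l hl => ?_) fun _ => rfl
  rw [hz, zero_smul]
  refine not_lt.1 fun hlt => hl ⟨⟨l, hlt⟩, rfl⟩

/-- A matrix commuting with the rotation preserves the tangent space of the fixed set. -/
lemma TangentPair.exists_of_commute (h : TangentPair hk b s) {θ : Fin m → ℝ}
    (hθ : ∀ j, θ j ∈ Set.Icc 0 Real.pi) (hk' : ∀ i, onCoord θ i = 0 ↔ (i : ℕ) < k)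
    {g : GL (Fin (2 * m)) ℝ}
    (hc : Commute (g : Matrix (Fin (2 * m)) (Fin (2 * m)) ℝ) (rotMat θ)) :
    ∃ s' : FrameBundle k F, s'.1 = s.1 ∧ TangentPair hk (op g • b) s' := by
  have hb := eq_or_eq_zero_of_commute hθ hc
  have hdet : ((g : Matrix (Fin (2 * m)) (Fin (2 * m)) ℝ).submatrix
      (Fin.castLE hk) (Fin.castLE hk)).det ≠ 0 := fun h0 => by
    rw [det_submatrix_eq_det_cut hk (fun i => onCoord θ i = 0) hk'] at h0
    refine GL_det_ne_zero g ?_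
    rw [← cut_mul_cut_not (p := fun i => onCoord θ i = 0) (A := (g : Matrix _ _ ℝ)) fun i k =>
      (hb i k).imp_left fun h => by rw [h], det_mul, h0, zero_mul]
  refine ⟨op (toGL _) • s, rfl, h.op_smul (coe_toGL hdet) fun l i hl =>
    (hb l (Fin.castLE hk i)).resolve_left fun he => ?_⟩
  have h1 : onCoord θ (Fin.castLE hk i) = 0 := (hk' _).2 i.2
  exact absurd ((hk' l).1 (he.trans h1)) (not_lt.2 hl)

/-- A pair of frames of `M` and `F` is unaffected by a matrix which fixes the vectors tangent to
`F`. -/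
lemma TangentPair.op_smul_left (h : TangentPair hk b s) {g : GL (Fin (2 * m)) ℝ}
    (hg : ∀ (l : Fin (2 * m)) (i : Fin k), (g : Matrix (Fin (2 * m)) (Fin (2 * m)) ℝ) l
      (Fin.castLE hk i) = if l = Fin.castLE hk i then 1 else 0) :
    TangentPair hk (op g • b) s := by
  have h1 := h.op_smul (g := g) (g₀ := 1) (by
    ext l i
    rw [submatrix_apply, hg, Units.val_one, one_apply]
    simp [(Fin.castLE_injective hk).eq_iff]) fun l i hl => by
    rw [hg, if_neg]
    rintro rfl
    exact absurd i.2 (not_lt.2 hl)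
  rwa [op_one, one_smul] at h1

end ChangeOfRotatedFrames

/-! ### The parity of the weights in a weight frame -/

section WeightInvariant

variable {m : ℕ} {M : Type*} [TopologicalSpace M] [ChartedSpace (EuclideanSpace ℝ (Fin (2 * m))) M]
  [IsManifold (𝓡 (2 * m)) ∞ M] [MulAction Circle M] [ContMDiffSMul (𝓡 1) (𝓡 (2 * m)) ∞ Circle M]
  {n k : ℕ} {r : Fin m → ℤ} {e : FrameBundle (2 * m) M → ZMod 2}

/-- A frame invariant which, at the points fixed by the circle, is given by the weights. -/
structure WeightInvariant (hk : k ≤ 2 * m) (n : ℕ) (r : Fin m → ℤ) (F : Set M)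
    (e : FrameBundle (2 * m) M → ZMod 2) : Prop extends
    FrameInvariant hk n (residueAngle n r) F e where
  fixed : ∀ f : FrameBundle (2 * m) M, f.1 ∈ F → ∀ a l : Fin m → ℤ, (∀ j, a j = n * l j + r j) →
    (∀ t : ℝ, Circle.exp t • f = op (rotGL fun j => t * a j) • f) → e f = ((∑ j, l j : ℤ) : ZMod 2)

variable {hk : k ≤ 2 * m} {F : Set M} [ChartedSpace (EuclideanSpace ℝ (Fin k)) F]
  [IsManifold (𝓡 k) ∞ F] {oM : ManifoldOrientation (2 * m) M} {oF : ManifoldOrientation k F}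
  {b₀ : FrameBundle (2 * m) M} {s₀ : FrameBundle k F} {x : F} {c : ZMod 2}

/-- The orientations are related by the sum of the quotients of the weights in a weight frame. -/
lemma WeightInvariant.sum_eq (he : WeightInvariant hk n r F e) (hn : n ≠ 0)
    (hr : ∀ j, 0 ≤ r j ∧ (n ≠ 0 → 2 * r j ≤ n)) (hk' : ∀ i, onCoord r i = 0 ↔ (i : ℕ) < k)
    (key : ∀ (b : FrameBundle (2 * m) M) (s : FrameBundle k F), TangentPair hk b s →
      b ∈ adaptedFrames M n (residueAngle n r) →
      (s.2.orientation = oF.at' s.1 ↔ (b.2.orientation = oM.at' b.1 ↔ e b = c)))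
    (h₀ : TangentPair hk b₀ s₀) (hb₀ : b₀ ∈ adaptedFrames M n (residueAngle n r)) (hs₀ : s₀.1 = x)
    (hx : ∀ z : Circle, z • (x : M) = x) (W : WeightFrame n oM F oF x) :
    ((∑ j, W.l j : ℤ) : ZMod 2) = c := by
  have hk'' : ∀ i, onCoord (residueAngle n r) i = 0 ↔ (i : ℕ) < k := fun i =>
    (onCoord_residueAngle_eq_zero_iff hn i).trans (hk' i)
  have hθ := residueAngle_mem_Icc hr
  have hθ' := residueAngle_mem_Icc (n := n) (r := W.r) fun j => ⟨W.r_nonneg j, fun hn => W.two_r_le hn j⟩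
  -- compare with the adapted frame `b₀`: the residues of the weights agree up to a permutation
  obtain ⟨g, g₀, hg, -, -, hz⟩ := h₀.exists_op_smul (b' := W.frame) (s' := W.tangentFrame)
    W.tangentPair hs₀.symm
  have hadW := mem_adaptedFrames_of_rotated hn W.weight_eq (W.smul_frame hx)
  have hconj : g * rotGL (residueAngle n W.r) = rotGL (residueAngle n r) * g := by
    rw [hg] at hadW
    exact (circle_smul_op_smul_eq_iff hb₀).1 hadW
  obtain ⟨ρ, hρ, hρ0⟩ := exists_perm_of_mul_rotGL_of_fixed hθ hθ' hconj
    (eq_zero_of_mul_rotGL hθ hθ' hk hk'' hconj hz)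
  have hr' : W.r ∘ ρ = r := residueAngle_injective hn hρ
  -- after permuting the planes normal to `F`, the weight frame is an adapted frame
  obtain ⟨q, hq1, hq2, hq3⟩ := exists_permuted_frame ρ (W.smul_frame hx)
  have ha : ∀ j, (W.a ∘ ρ) j = n * (W.l ∘ ρ) j + r j := fun j => by
    rw [← hr']
    exact W.weight_eq _
  have hpair : TangentPair hk (op q • W.frame) W.tangentFrame := by
    refine TangentPair.op_smul_left W.tangentPair fun l i => ?_
    obtain ⟨⟨a, j⟩, hi⟩ := (pairEquiv m).surjective (Fin.castLE hk i)
    have h0 : onCoord (residueAngle n r) (Fin.castLE hk i) = 0 := (hk'' _).2 i.2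
    rw [← hi, onCoord_pairEquiv] at h0
    rw [← hi, hq2, hρ0 j h0]
  have hmem := mem_adaptedFrames_of_rotated hn ha hq3
  have h1 := key _ _ hpair hmem
  have h2 : (op q • W.frame).2.orientation = oM.at' (op q • W.frame).1 ↔
      (W.frame.2.orientation = oM.at' W.frame.1 ↔
        0 < (q : Matrix (Fin (2 * m)) (Fin (2 * m)) ℝ).det) :=
    W.frame.2.orientation_rightMul q _
  have h3 : W.frame.2.orientation = oM.at' W.frame.1 ↔
      W.tangentFrame.2.orientation = oF.at' W.tangentFrame.1 := W.orientation_iff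
  have h4 := he.fixed (op q • W.frame) x.2 _ _ ha hq3
  rw [show ∑ j, (W.l ∘ ρ) j = ∑ j, W.l j from Equiv.sum_comp ρ W.l] at h4
  rw [h2, hq1, h4, h3] at h1
  have : (0 : ℝ) < 1 := one_pos
  tauto

/-- Weight frames exist: if an adapted rotated frame has the wrong invariant, it is corrected by the
reflection of a plane on which the generator acts as `-1`. -/
lemma WeightInvariant.nonempty_weightFrame (he : WeightInvariant hk n r F e) (hn : n ≠ 0)
    (hr : ∀ j, 0 ≤ r j ∧ (n ≠ 0 → 2 * r j ≤ n)) (hk' : ∀ i, onCoord r i = 0 ↔ (i : ℕ) < k)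
    (key : ∀ (b : FrameBundle (2 * m) M) (s : FrameBundle k F), TangentPair hk b s →
      b ∈ adaptedFrames M n (residueAngle n r) →
      (s.2.orientation = oF.at' s.1 ↔ (b.2.orientation = oM.at' b.1 ↔ e b = c)))
    (h₀ : TangentPair hk b₀ s₀) (hb₀ : b₀ ∈ adaptedFrames M n (residueAngle n r)) (hs₀ : s₀.1 = x)
    (hx : ∀ z : Circle, z • (x : M) = x)
    (hconst : (∀ j, 2 * r j ≠ n) → ∀ b ∈ adaptedFrames M n (residueAngle n r), b.1 ∈ F → e b = c) :
    Nonempty (WeightFrame n oM F oF x) := by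
  have hk'' : ∀ i, onCoord (residueAngle n r) i = 0 ↔ (i : ℕ) < k := fun i =>
    (onCoord_residueAngle_eq_zero_iff hn i).trans (hk' i)
  have hθ := residueAngle_mem_Icc hr
  have main : ∀ (b : FrameBundle (2 * m) M) (s : FrameBundle k F) (a l : Fin m → ℤ),
      TangentPair hk b s → s.1 = x → (∀ j, a j = n * l j + r j) →
      (∀ t : ℝ, Circle.exp t • b = op (rotGL fun j => t * a j) • b) → e b = c →
      Nonempty (WeightFrame n oM F oF x) := by
    intro b s a l h hs ha hrot hec
    have h1 := key b s h (mem_adaptedFrames_of_rotated hn ha hrot)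
    exact _root_.nonempty_weightFrame hx hk h hs (a := a) (l := l) (r := r)
      (fun j => ⟨ha j, (hr j).1, (hr j).2, fun h => absurd h hn⟩) hrot (by tauto)
  -- a rotated frame at `x`, whose planes are permuted such that it is adapted
  obtain ⟨f, a, l, r', hfx, -, ha, hrot⟩ := exists_rotated_frame (m := m) n hx
  have hθ' := residueAngle_mem_Icc (n := n) (r := r') fun j => ⟨(ha j).2.1, (ha j).2.2.1⟩
  have hmem := mem_adaptedFrames_of_rotated hn (fun j => (ha j).1) hrot
  have hbx : b₀.1 = x := h₀.base.trans (congrArg Subtype.val hs₀)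
  obtain ⟨g, rfl⟩ := FrameBundle.exists_op_smul (f := b₀) (f' := f) (hfx.trans hbx.symm)
  obtain ⟨ρ, hρ⟩ := exists_perm_of_mul_rotGL hθ hθ' ((circle_smul_op_smul_eq_iff hb₀).1 hmem)
  have hr' : r' ∘ ρ = r := residueAngle_injective hn hρ
  obtain ⟨q, -, -, hq⟩ := exists_permuted_frame ρ hrot
  have ha' : ∀ j, (a ∘ ρ) j = n * (l ∘ ρ) j + r j := fun j => by
    rw [← hr']
    exact (ha _).1
  rw [smul_smul, ← op_mul] at hq
  have hmem' := mem_adaptedFrames_of_rotated hn ha' hq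
  obtain ⟨s, hs, hpair⟩ := h₀.exists_of_commute hθ hk'' ((op_smul_mem_adaptedFrames hb₀).1 hmem')
  rw [hs₀] at hs
  set f' := op (g * q) • b₀
  by_cases hec : e f' = c
  · exact main _ s _ _ hpair hs ha' hq hec
  have hf' : f'.1 ∈ F := by
    have : f'.1 = x := hbx
    rw [this]
    exact x.2
  obtain ⟨j₀, hj₀⟩ : ∃ j, 2 * r j = n := by
    by_contra! hno
    exact hec (hconst hno _ hmem' hf')
  -- reversing the orientation of a plane with `a = n l + n / 2` replaces `l` by `- l - 1`
  have hd : (planeRefl j₀).det ≠ 0 := by rw [det_planeRefl]; norm_num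
  set u : GL (Fin (2 * m)) ℝ := toGL (planeRefl j₀)
  have hu : ∀ t : ℝ, Circle.exp t • op u • f' = op (rotGL fun j =>
      t * (Function.update (a ∘ ρ) j₀ (-(a ∘ ρ) j₀)) j) • op u • f' := fun t => by
    refine (circle_smul_op_smul_eq_iff (hq t)).2 (Units.ext ?_)
    rw [Units.val_mul, Units.val_mul, coe_rotGL, coe_rotGL, coe_toGL hd, planeRefl_mul_rotMat]
    congr 2
    ext j
    by_cases h : j = j₀
    · subst h; simp
    · simp [h]
  have ha'' : ∀ j, Function.update (a ∘ ρ) j₀ (-(a ∘ ρ) j₀) j =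
      n * Function.update (l ∘ ρ) j₀ (-(l ∘ ρ) j₀ - 1) j + r j := fun j => by
    by_cases h : j = j₀
    · subst h
      rw [Function.update_self, Function.update_self, ha']
      linear_combination -hj₀
    · rw [Function.update_of_ne h, Function.update_of_ne h, ha']
  refine main (op u • f') s _ _ (hpair.op_smul_left fun i i' => ?_) hs ha'' hu ?_
  · rw [coe_toGL hd, planeRefl, diagonal_apply]
    by_cases h : i = Fin.castLE hk i'
    · rw [if_pos h, if_pos h, if_neg]
      rintro rfl
      have h1 := (hk' (Fin.castLE hk i')).2 i'.2
      have h2 : onCoord r (pairEquiv m (1, j₀)) = 0 := by rw [h]; exact h1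
      rw [onCoord_pairEquiv] at h2
      have : (0 : ℤ) < n := by exact_mod_cast Nat.pos_of_ne_zero hn
      omega
    · rw [if_neg h, if_neg h]
  · rw [he.fixed (op u • f') hf' _ _ ha'' hu, Finset.sum_update_of_mem (Finset.mem_univ _)]
    rw [he.fixed _ hf' _ _ ha' hq, ← Finset.add_sum_erase _ _ (Finset.mem_univ j₀)] at hec
    rw [← Finset.erase_eq]
    push_cast at hec ⊢
    have : ∀ y y' c : ZMod 2, ¬y + y' = c → -y - 1 + y' = c := by decide
    exact this _ _ _ hec

end WeightInvariant

/-! ### Fixed components with a weight invariant -/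

section ComponentTheorem

variable {m : ℕ} {M : Type*} [TopologicalSpace M] [ChartedSpace (EuclideanSpace ℝ (Fin (2 * m))) M]
  [IsManifold (𝓡 (2 * m)) ∞ M] [MulAction Circle M] [ContMDiffSMul (𝓡 1) (𝓡 (2 * m)) ∞ Circle M]
  {n k : ℕ} {r : Fin m → ℤ} {e : FrameBundle (2 * m) M → ZMod 2} {x₀ : M} {hk : k ≤ 2 * m}

/-- A matrix commuting with a rotation without the angle `π` is complex linear on the planes which
are rotated. Hence its determinant has the sign of the determinant on the fixed space. -/
lemma det_mul_det_pos_of_commute {θ : Fin m → ℝ} (hk : k ≤ 2 * m)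
    (hθ : ∀ j, θ j ∈ Set.Icc 0 Real.pi) (hk' : ∀ i, onCoord θ i = 0 ↔ (i : ℕ) < k)
    (hπ : ∀ j, θ j ≠ Real.pi) {h : GL (Fin (2 * m)) ℝ}
    (hc : Commute (h : Matrix (Fin (2 * m)) (Fin (2 * m)) ℝ) (rotMat θ)) :
    0 < (h : Matrix (Fin (2 * m)) (Fin (2 * m)) ℝ).det *
      ((h : Matrix (Fin (2 * m)) (Fin (2 * m)) ℝ).submatrix (Fin.castLE hk) (Fin.castLE hk)).det := by
  rw [det_submatrix_eq_det_cut hk (fun i => onCoord θ i = 0) hk',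
    sign_det_of_commute hθ hc (GL_det_ne_zero h)]
  have : cut (fun i => onCoord θ i = Real.pi) (h : Matrix (Fin (2 * m)) (Fin (2 * m)) ℝ) = 1 := by
    ext i l
    rw [cut_apply, one_apply, if_neg]
    rintro ⟨hi, -⟩
    obtain ⟨⟨a, j⟩, rfl⟩ := (pairEquiv m).surjective i
    exact hπ j (by rwa [onCoord_pairEquiv] at hi)
  rw [this, det_one]
  exact one_pos

/-- If the generator does not act as `-1` on any plane, the invariant of the adapted frames is
constant on the component. -/
lemma WeightInvariant.eq_of_forall_ne (he : WeightInvariant hk n r (fixedComponent n x₀) e)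
    (hn : n ≠ 0) (hr : ∀ j, 0 ≤ r j ∧ (n ≠ 0 → 2 * r j ≤ n))
    (hk' : ∀ i, onCoord r i = 0 ↔ (i : ℕ) < k) (hne : ∀ j, 2 * r j ≠ n)
    {b b' : FrameBundle (2 * m) M} (hb : b ∈ adaptedFrames M n (residueAngle n r))
    (hbF : b.1 ∈ fixedComponent n x₀) (hb' : b' ∈ adaptedFrames M n (residueAngle n r))
    (hbF' : b'.1 ∈ fixedComponent n x₀) : e b' = e b := by
  have hθ := residueAngle_mem_Icc hr
  have hk'' : ∀ i, onCoord (residueAngle n r) i = 0 ↔ (i : ℕ) < k := fun i =>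
    (onCoord_residueAngle_eq_zero_iff hn i).trans (hk' i)
  -- constant on the fibres
  have hfib : ∀ f f' : FrameBundle (2 * m) M, f ∈ adaptedFrames M n (residueAngle n r) →
      f' ∈ adaptedFrames M n (residueAngle n r) → f.1 ∈ fixedComponent n x₀ → f'.1 = f.1 →
      e f' = e f := by
    intro f f' hf hf' hfF hff'
    obtain ⟨h, rfl⟩ := FrameBundle.exists_op_smul hff'
    have hc := (op_smul_mem_adaptedFrames hf).1 hf'
    rw [he.op_smul f hf hfF h hc, if_pos (det_mul_det_pos_of_commute hk hθ hk''
      (fun j hj => hne j ((residueAngle_eq_pi_iff hn j).1 hj)) hc), add_zero]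
  -- locally constant along the component, by means of adapted charts
  refine (isPreconnected_connectedComponentIn.iff_of_eventually (P := fun y => ∀ f : FrameBundle (2 * m) M,
    f ∈ adaptedFrames M n (residueAngle n r) → f.1 = y → e f = e b) (fun y hy => ?_) hbF hbF').1
    (fun f hf hfb => hfib b f hb hf hbF hfb) b' hb' rfl
  obtain ⟨χ, hyχ, -, hχ⟩ := exists_isAdaptedChart hn (fun j => eq_zero_of_cos_eq_one (hθ j)) hk'' hb
    hbF hy
  filter_upwards [self_mem_nhdsWithin, nhdsWithin_le_nhds (χ.open_source.mem_nhds hyχ)] with z hz hzχ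
  obtain ⟨β, hβ0, hβ1, hβ⟩ := hχ.exists_path hyχ hy hzχ hz
  have h1 := he.path β hβ
  rw [hβ0, hβ1] at h1
  have hcf : ∀ w ∈ fixedComponent n x₀, w ∈ χ.source → ((∀ f : FrameBundle (2 * m) M,
      f ∈ adaptedFrames M n (residueAngle n r) → f.1 = w → e f = e b) ↔
        e (chartFrame hχ.mem_maximalAtlas w) = e b) := fun w hw hwχ =>
    ⟨fun h => h _ (hχ.chartFrame_mem hwχ hw) rfl, fun h f hf hfw =>
      (hfib _ f (hχ.chartFrame_mem hwχ hw) hf hw hfw).trans h⟩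
  rw [hcf y hy hyχ, hcf z hz hzχ, h1]

/-- A component of the fixed set of the group of order `n` with a weight invariant is an embedded
submanifold, with an orientation for which the sum of the quotients of the weights has constant
parity. -/
theorem WeightInvariant.exists_orientation_weightFrame (oM : ManifoldOrientation (2 * m) M)
    (he : WeightInvariant hk n r (fixedComponent n x₀) e)
    (hn : n ≠ 0) (hr : ∀ j, 0 ≤ r j ∧ (n ≠ 0 → 2 * r j ≤ n))
    (hk' : ∀ i, onCoord r i = 0 ↔ (i : ℕ) < k) {f₀ : FrameBundle (2 * m) M}
    (hf₀ : f₀ ∈ adaptedFrames M n (residueAngle n r)) (hf₀F : f₀.1 ∈ fixedComponent n x₀) :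
    ∃ (_ : ChartedSpace (EuclideanSpace ℝ (Fin k)) ↥(fixedComponent n x₀))
      (_ : IsManifold (𝓡 k) ∞ ↥(fixedComponent n x₀)),
      Manifold.IsSmoothEmbedding (𝓡 k) (𝓡 (2 * m)) ∞ (Subtype.val : ↥(fixedComponent n x₀) → M) ∧
      ∃ oF : ManifoldOrientation k ↥(fixedComponent n x₀), ∃ c : ZMod 2,
        ∀ x : ↥(fixedComponent n x₀), (∀ z : Circle, z • (x : M) = x) →
          Nonempty (WeightFrame n oM (fixedComponent n x₀) oF x) ∧
          ∀ W : WeightFrame n oM (fixedComponent n x₀) oF x, ((∑ j, W.l j : ℤ) : ZMod 2) = c := by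
  have hθ := residueAngle_mem_Icc hr
  have hk'' : ∀ i, onCoord (residueAngle n r) i = 0 ↔ (i : ℕ) < k := fun i =>
    (onCoord_residueAngle_eq_zero_iff hn i).trans (hk' i)
  have hchart : ∀ y ∈ fixedComponent n x₀,
      ∃ χ : OpenPartialHomeomorph M (EuclideanSpace ℝ (Fin (2 * m))), y ∈ χ.source ∧
        IsAdaptedChart n (residueAngle n r) k (fixedComponent n x₀) χ := fun y hy => by
    obtain ⟨χ, hyχ, -, hχ⟩ := exists_isAdaptedChart hn (fun j => eq_zero_of_cos_eq_one (hθ j)) hk''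
      hf₀ hf₀F hy
    exact ⟨χ, hyχ, hχ⟩
  obtain ⟨cs, hM, hemb, hatlas⟩ := exists_isSmoothEmbedding_of_isSliceChart hk
    (F := fixedComponent n x₀) fun y hy => by
      obtain ⟨χ, hyχ, hχ⟩ := hchart y hy
      exact ⟨χ, hyχ, hχ.toIsSliceChart⟩
  have hval : MDifferentiable (𝓡 k) (𝓡 (2 * m)) (Subtype.val : ↥(fixedComponent n x₀) → M) :=
    hemb.contMDiff.mdifferentiable (by simp)
  obtain ⟨oF, hoF⟩ := he.toFrameInvariant.exists_orientation (oM := oM) hval hatlas hchart (e f₀)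
  refine ⟨cs, hM, hemb, oF, e f₀, fun x hx => ?_⟩
  obtain ⟨χ, hxχ, hχ⟩ := hchart x x.2
  have hpair : TangentPair hk (chartFrame hχ.mem_maximalAtlas (x : M))
      (chartFrame (hatlas χ hχ.toIsSliceChart x) x) :=
    ⟨rfl, mfderiv_val_chartFrame hk hχ.toIsSliceChart x hval (hatlas _ _ _) hxχ⟩
  have hmem := hχ.chartFrame_mem hxχ x.2
  exact ⟨he.nonempty_weightFrame hn hr hk' hoF hpair hmem rfl hx fun hne b hb hbF =>
    he.eq_of_forall_ne hn hr hk' hne hf₀ hf₀F hb hbF, fun W =>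
      he.sum_eq hn hr hk' hoF hpair hmem rfl hx W⟩

end ComponentTheorem

/-! ### Finite groups -/

section FiniteGroup

variable {m : ℕ} {M : Type*} [TopologicalSpace M] [ChartedSpace (EuclideanSpace ℝ (Fin (2 * m))) M]
  [IsManifold (𝓡 (2 * m)) ∞ M] [MulAction Circle M] [ContMDiffSMul (𝓡 1) (𝓡 (2 * m)) ∞ Circle M]
  {n k : ℕ} {r : Fin m → ℤ} {x₀ : M}

/-- If the generator does not act as `-1` on any plane and the weights are congruent to `r` modulo
`n` only if they are equal to `r`, zero is a weight invariant. -/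
lemma weightInvariant_zero (hk : k ≤ 2 * m) (hn : n ≠ 0) (hr : ∀ j, 0 ≤ r j ∧ (n ≠ 0 → 2 * r j ≤ n))
    (hk' : ∀ i, onCoord r i = 0 ↔ (i : ℕ) < k) (hne : ∀ j, 2 * r j ≠ n) {F : Set M}
    (h : ∀ f : FrameBundle (2 * m) M, f.1 ∈ F → ∀ a l : Fin m → ℤ, (∀ j, a j = n * l j + r j) →
      (∀ t : ℝ, Circle.exp t • f = op (rotGL fun j => t * a j) • f) → ∀ j, l j = 0) :
    WeightInvariant hk n r F 0 where
  path _ _ := rfl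
  op_smul b _ _ g hc := by
    rw [if_pos]
    · simp
    exact det_mul_det_pos_of_commute hk (residueAngle_mem_Icc hr)
      (fun i => (onCoord_residueAngle_eq_zero_iff hn i).trans (hk' i))
      (fun j hj => hne j ((residueAngle_eq_pi_iff hn j).1 hj)) hc
  fixed f hf a l ha hrot := by
    rw [Finset.sum_eq_zero fun j _ => h f hf a l ha hrot j]
    simp

variable {N : Type*} [TopologicalSpace N] [ChartedSpace (EuclideanSpace ℝ (Fin (2 * m))) N]
  [IsManifold (𝓡 (2 * m)) ∞ N] {p : N → M}

/-- The universal covering meets every component, hence is onto by path lifting. -/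
lemma IsUniversalCovering.surjective (hp : IsUniversalCovering (2 * m) p) : Function.Surjective p := by
  intro x
  have := ChartedSpace.locallyPathConnectedSpace (EuclideanSpace ℝ (Fin (2 * m))) M
  have := hp.simplyConnected x
  obtain ⟨y, hy⟩ : Nonempty (p ⁻¹' connectedComponent x) := inferInstance
  rw [Set.mem_preimage, ← pathComponent_eq_connectedComponent] at hy
  obtain ⟨γ⟩ := hy.symm
  exact ⟨hp.covering.liftPath γ.toContinuousMap y γ.source 1,
    (congrFun (hp.covering.liftPath_lifts γ.toContinuousMap y γ.source) 1).trans γ.target⟩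

/-- The monodromy of the spin structure along the loops of adapted frames is a weight invariant. -/
lemma IsUniversalCovering.exists_weightInvariant (hp : IsUniversalCovering (2 * m) p)
    (hN : IsSpinManifold (2 * m) N) (hk : k ≤ 2 * m) (hn : n ≠ 0)
    (hr : ∀ j, 0 ≤ r j ∧ (n ≠ 0 → 2 * r j ≤ n)) (hk' : ∀ i, onCoord r i = 0 ↔ (i : ℕ) < k)
    {a l : Fin m → ℤ} (ha : ∀ j, a j = n * l j + r j) {f₀ : FrameBundle (2 * m) M}
    (hf₀ : ∀ t : ℝ, Circle.exp t • f₀ = op (rotGL fun j => t * a j) • f₀)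
    (hf₀F : f₀.1 ∈ fixedComponent n x₀) :
    ∃ e, WeightInvariant hk n r (fixedComponent n x₀) e := by
  -- in dimension zero there is no spin condition on the fibres, and no plane
  rcases Nat.eq_zero_or_pos m with rfl | hm
  · exact ⟨0, weightInvariant_zero hk hn hr hk' (fun j => j.elim0) fun _ _ _ _ _ _ j => j.elim0⟩
  obtain ⟨P, _, ⟨C⟩⟩ := hN.exists_spinCover (by omega)
  have hθ := residueAngle_mem_Icc hr
  have hk'' : ∀ i, onCoord (residueAngle n r) i = 0 ↔ (i : ℕ) < k := fun i =>
    (onCoord_residueAngle_eq_zero_iff hn i).trans (hk' i)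
  have hfixed : ∀ (f : FrameBundle (2 * m) M) (a l : Fin m → ℤ), (∀ j, a j = n * l j + r j) →
      (∀ t : ℝ, Circle.exp t • f = op (rotGL fun j => t * a j) • f) → ∀ ε : ZMod 2,
      HasMon hp.localDiffeo C n (residueAngle n r) f ε ↔ ε = ((∑ j, l j : ℤ) : ZMod 2) :=
    fun f a l ha hrot ε => hasMon_iff_of_fixed hm hp.covering hn (hp.surjective f.1) ha
      (fun _ => rfl) hrot
  have hpath : ∀ β : C(I, FrameBundle (2 * m) M), (∀ s, β s ∈ adaptedFrames M n (residueAngle n r)) →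
      ∀ ε, HasMon hp.localDiffeo C n (residueAngle n r) (β 0) ε ↔
        HasMon hp.localDiffeo C n (residueAngle n r) (β 1) ε := fun β hβ ε => by
    refine ⟨fun h => h.of_path hm hp.covering hβ, fun h => ?_⟩
    have h1 := HasMon.of_path hm hp.covering (β := β.comp ⟨unitInterval.symm, by fun_prop⟩)
      (hp := hp.localDiffeo) (C := C) (ε := ε) (fun s => hβ _) (by simpa using h)
    simpa using h1
  -- whether the monodromy is well defined depends on the base point only
  have hfib : ∀ f f' : FrameBundle (2 * m) M, f ∈ adaptedFrames M n (residueAngle n r) →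
      f' ∈ adaptedFrames M n (residueAngle n r) → f'.1 = f.1 →
      (∃! ε, HasMon hp.localDiffeo C n (residueAngle n r) f ε) →
      ∃! ε, HasMon hp.localDiffeo C n (residueAngle n r) f' ε := by
    rintro f f' hf hf' hff' ⟨ε, hε, huniq⟩
    obtain ⟨g, rfl⟩ := FrameBundle.exists_op_smul hff'
    have hc := (op_smul_mem_adaptedFrames hf).1 hf'
    have hback : op g⁻¹ • op g • f = f := by rw [smul_smul, ← op_mul, mul_inv_cancel, op_one, one_smul]
    have hc' := (op_smul_mem_adaptedFrames (h := g⁻¹) hf').1 (by rwa [hback])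
    refine ⟨_, hε.op_smul hm hθ hk hk'' hc, fun ε' hε' => ?_⟩
    have h1 := hε'.op_smul hm hθ hk hk'' hc'
    have h2 := (hε.op_smul hm hθ hk hk'' hc).op_smul hm hθ hk hk'' hc'
    rw [hback] at h1 h2
    exact add_right_cancel ((huniq _ h1).trans (huniq _ h2).symm)
  -- it is well defined at `f₀`, and this property is locally constant along the component
  have hex : ∀ f ∈ adaptedFrames M n (residueAngle n r), f.1 ∈ fixedComponent n x₀ →
      ∃! ε, HasMon hp.localDiffeo C n (residueAngle n r) f ε := by
    intro f' hf' hfF'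
    have hmem₀ := mem_adaptedFrames_of_rotated hn ha hf₀
    refine (isPreconnected_connectedComponentIn.iff_of_eventually (P := fun y =>
      ∀ f : FrameBundle (2 * m) M, f ∈ adaptedFrames M n (residueAngle n r) → f.1 = y →
        ∃! ε, HasMon hp.localDiffeo C n (residueAngle n r) f ε) (fun y hy => ?_) hf₀F hfF').1
      (fun f hf hff₀ => hfib f₀ f hmem₀ hf hff₀ ?_) f' hf' rfl
    · obtain ⟨χ, hyχ, -, hχ⟩ := exists_isAdaptedChart hn (fun j => eq_zero_of_cos_eq_one (hθ j)) hk''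
        hmem₀ hf₀F hy
      filter_upwards [self_mem_nhdsWithin, nhdsWithin_le_nhds (χ.open_source.mem_nhds hyχ)]
        with z hz hzχ
      obtain ⟨β, hβ0, hβ1, hβ⟩ := hχ.exists_path hyχ hy hzχ hz
      have h1 := hpath β fun s => (hβ s).1
      rw [hβ0, hβ1] at h1
      have hcf : ∀ w ∈ fixedComponent n x₀, w ∈ χ.source → ((∀ f : FrameBundle (2 * m) M,
          f ∈ adaptedFrames M n (residueAngle n r) → f.1 = w →
            ∃! ε, HasMon hp.localDiffeo C n (residueAngle n r) f ε) ↔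
            ∃! ε, HasMon hp.localDiffeo C n (residueAngle n r) (chartFrame hχ.mem_maximalAtlas w) ε) :=
        fun w hw hwχ => ⟨fun h => h _ (hχ.chartFrame_mem hwχ hw) rfl, fun h f hf hfw =>
          hfib _ f (hχ.chartFrame_mem hwχ hw) hf hfw h⟩
      rw [hcf y hy hyχ, hcf z hz hzχ]
      exact existsUnique_congr h1
    · exact ⟨_, (hfixed f₀ a l ha hf₀ _).2 rfl, fun ε hε => (hfixed f₀ a l ha hf₀ ε).1 hε⟩
  let e : FrameBundle (2 * m) M → ZMod 2 := fun f =>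
    Classical.epsilon fun ε => HasMon hp.localDiffeo C n (residueAngle n r) f ε
  have he : ∀ f ∈ adaptedFrames M n (residueAngle n r), f.1 ∈ fixedComponent n x₀ → ∀ ε,
      HasMon hp.localDiffeo C n (residueAngle n r) f ε ↔ e f = ε := fun f hf hfF ε => by
    have h1 := Classical.epsilon_spec (hex f hf hfF).exists
    exact ⟨fun h => (hex f hf hfF).unique h1 h, fun h => h ▸ h1⟩
  refine ⟨e, ⟨⟨fun β hβ => ?_, fun b hb hbF h hc => ?_⟩, fun f hfF a l ha hrot => ?_⟩⟩
  · rw [← he _ (hβ 0).1 (hβ 0).2, hpath β fun s => (hβ s).1, he _ (hβ 1).1 (hβ 1).2]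
  · rw [← he _ ((op_smul_mem_adaptedFrames hb).2 hc) hbF]
    exact ((he b hb hbF _).2 rfl).op_smul hm hθ hk hk'' hc
  · rw [← he f (mem_adaptedFrames_of_rotated hn ha hrot) hfF, hfixed f a l ha hrot]

/-- For the group of order `n`: the component of a fixed point of the circle is an oriented
submanifold, such that weight frames exist and the sum of the quotients `l` has constant parity. -/
theorem IsUniversalCovering.exists_orientation_weightFrame (hp : IsUniversalCovering (2 * m) p)
    (hN : IsSpinManifold (2 * m) N) (oM : ManifoldOrientation (2 * m) M) (hn : n ≠ 0)
    {x : M} (hxF : x ∈ fixedComponent n x₀) (hx : ∀ z : Circle, z • x = x) :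
    ∃ (k : ℕ) (_ : ChartedSpace (EuclideanSpace ℝ (Fin k)) ↥(fixedComponent n x₀))
      (_ : IsManifold (𝓡 k) ∞ ↥(fixedComponent n x₀)),
      Manifold.IsSmoothEmbedding (𝓡 k) (𝓡 (2 * m)) ∞ (Subtype.val : ↥(fixedComponent n x₀) → M) ∧
      ∃ oF : ManifoldOrientation k ↥(fixedComponent n x₀), ∃ c : ZMod 2,
        ∀ x : ↥(fixedComponent n x₀), (∀ z : Circle, z • (x : M) = x) →
          Nonempty (WeightFrame n oM (fixedComponent n x₀) oF x) ∧
          ∀ W : WeightFrame n oM (fixedComponent n x₀) oF x, ((∑ j, W.l j : ℤ) : ZMod 2) = c := by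
  obtain ⟨f, a, l, r, rfl, hmono, ha, hrot⟩ := exists_rotated_frame (m := m) n hx
  obtain ⟨k, hk, hk'⟩ := exists_eq_zero_iff_lt_of_monotone hmono fun j => (ha j).2.1
  obtain ⟨e, he⟩ := hp.exists_weightInvariant hN hk hn (fun j => ⟨(ha j).2.1, (ha j).2.2.1⟩) hk'
    (fun j => (ha j).1) hrot hxF
  exact ⟨k, he.exists_orientation_weightFrame oM hn (fun j => ⟨(ha j).2.1, (ha j).2.2.1⟩) hk'
    (mem_adaptedFrames_of_rotated hn (fun j => (ha j).1) hrot) hxF⟩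

end FiniteGroup

/-! ### Infinite groups -/

section InfiniteGroup

variable {m : ℕ} {M : Type*} [TopologicalSpace M] [ChartedSpace (EuclideanSpace ℝ (Fin (2 * m))) M]
  [IsManifold (𝓡 (2 * m)) ∞ M] [MulAction Circle M] [ContMDiffSMul (𝓡 1) (𝓡 (2 * m)) ∞ Circle M]

/-- Up to order and signs, the weights at the points of a connected set of fixed points of the
circle agree: they are determined by the action of a root of unity of large order. -/
lemma exists_perm_abs_eq {F : Set M} (hF : IsPreconnected F) (hFS : ∀ y ∈ F, ∀ z : Circle, z • y = y)
    {f f' : FrameBundle (2 * m) M} (hfF : f.1 ∈ F) (hfF' : f'.1 ∈ F) {a a' : Fin m → ℤ}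
    (hf : ∀ t : ℝ, Circle.exp t • f = op (rotGL fun j => t * a j) • f)
    (hf' : ∀ t : ℝ, Circle.exp t • f' = op (rotGL fun j => t * a' j) • f') :
    ∃ ρ : Equiv.Perm (Fin m), ∀ j, |a' (ρ j)| = |a j| := by
  -- an order such that all rotation angles lie between `-π` and `π`
  set S := ∑ j, (a j).natAbs + ∑ j, (a' j).natAbs with hS
  set n : ℕ := 2 * S + 1
  have hn : n ≠ 0 := by omega
  have ha : ∀ j, 2 * |a j| ≤ n := fun j => by
    have := Finset.single_le_sum (f := fun j => (a j).natAbs) (fun _ _ => Nat.zero_le _)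
      (Finset.mem_univ j)
    rw [Int.abs_eq_natAbs]
    omega
  have ha' : ∀ j, 2 * |a' j| ≤ n := fun j => by
    have := Finset.single_le_sum (f := fun j => (a' j).natAbs) (fun _ _ => Nat.zero_le _)
      (Finset.mem_univ j)
    rw [Int.abs_eq_natAbs]
    omega
  obtain ⟨f'', hff, hf''⟩ := exists_frame_of_isPreconnected hn (exp_two_pi_div_pow hn) hF
    (fun y hy => hFS y hy _) (hf _) hfF hfF'
  obtain ⟨g, rfl⟩ := FrameBundle.exists_op_smul hff.symm
  obtain ⟨ρ, hρ⟩ := exists_perm_cos_of_mul_rotGL ((circle_smul_op_smul_eq_iff hf'').1 (hf' _))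
  refine ⟨ρ, fun j => ?_⟩
  have hn' : (0 : ℝ) < n := by exact_mod_cast Nat.pos_of_ne_zero hn
  have hπ := Real.pi_pos
  have hmem : ∀ c : ℤ, 2 * |c| ≤ n → |2 * Real.pi / n * c| ∈ Set.Icc 0 Real.pi := fun c hc => by
    have hc' : 2 * |(c : ℝ)| ≤ n := by exact_mod_cast hc
    refine ⟨abs_nonneg _, ?_⟩
    rw [abs_mul, abs_of_pos (by positivity), div_mul_eq_mul_div, div_le_iff₀ hn']
    nlinarith
  have h1 := Real.injOn_cos (hmem _ (ha' (ρ j))) (hmem _ (ha j)) (by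
    rw [Real.cos_abs, Real.cos_abs]
    exact hρ j)
  rw [abs_mul, abs_mul, mul_right_inj' (abs_pos.2 (by positivity)).ne'] at h1
  exact_mod_cast h1

variable {n k : ℕ} {r : Fin m → ℤ}

lemma continuousSMul_circle (m : ℕ) (M : Type*) [TopologicalSpace M]
    [ChartedSpace (EuclideanSpace ℝ (Fin (2 * m))) M] [MulAction Circle M]
    [ContMDiffSMul (𝓡 1) (𝓡 (2 * m)) ∞ Circle M] : ContinuousSMul Circle M :=
  @ContMDiffSMul.continuousSMul _ _ _ _ _ _ _ (𝓡 1) _ _ _ _ _ (𝓡 (2 * m)) _ _ _ _ _ _ _ ∞ _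

/-- Components of closed sets are closed. -/
lemma isClosed_fixedComponent [T2Space M] [ContinuousSMul Circle M] (n : ℕ) {x : M}
    (hx : Circle.exp (2 * Real.pi / n) • x = x) : IsClosed (fixedComponent n x) := by
  have h : IsClosed {y : M | Circle.exp (2 * Real.pi / n) • y = y} :=
    isClosed_eq (continuous_const_smul _) continuous_id
  have hx' : x ∈ {y : M | Circle.exp (2 * Real.pi / n) • y = y} := hx
  rw [fixedComponent, connectedComponentIn_eq_image hx']
  exact h.isClosedEmbedding_subtypeVal.isClosedMap _ isClosed_connectedComponent

/-- If the weights `r` are small compared to `n`, the elements of order `n` and `n q` of the circle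
fix the same points near a fixed point of the circle. -/
lemma fixedComponent_subset_mul [T2Space M] (hn : n ≠ 0) (hr : ∀ j, 0 ≤ r j ∧ 2 * r j < n)
    (hk' : ∀ i, onCoord r i = 0 ↔ (i : ℕ) < k) {f₀ : FrameBundle (2 * m) M}
    (hx : ∀ z : Circle, z • f₀.1 = f₀.1)
    (hf₀ : ∀ t : ℝ, Circle.exp t • f₀ = op (rotGL fun j => t * r j) • f₀) {q : ℕ} (hq : q ≠ 0) :
    fixedComponent n f₀.1 ⊆ fixedComponent (n * q) f₀.1 := by
  have := continuousSMul_circle m M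
  intro w hw
  have hnq : n * q ≠ 0 := mul_ne_zero hn hq
  have hself : ∀ n : ℕ, f₀.1 ∈ fixedComponent n f₀.1 := fun n => mem_connectedComponentIn (hx _)
  have hqr : (1 : ℤ) ≤ q := by exact_mod_cast Nat.pos_of_ne_zero hq
  have hθ : ∀ n : ℕ, ∀ j, (∀ j, 2 * r j < n) → residueAngle n r j ∈ Set.Icc 0 Real.pi :=
    fun n j h => residueAngle_mem_Icc (fun j => ⟨(hr j).1, fun _ => (h j).le⟩) j
  have hle : ∀ j, 2 * r j < ((n * q : ℕ) : ℤ) := fun j => by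
    push_cast
    nlinarith [hr j]
  have hk'' : ∀ n, n ≠ 0 → ∀ i, onCoord (residueAngle n r) i = 0 ↔ (i : ℕ) < k := fun n hn i =>
    (onCoord_residueAngle_eq_zero_iff hn i).trans (hk' i)
  have hmem : f₀ ∈ adaptedFrames M (n * q) (residueAngle (n * q) r) :=
    mem_adaptedFrames_of_rotated hnq (a := r) (l := 0) (by simp) hf₀
  refine ((isPreconnected_connectedComponentIn : IsPreconnected (fixedComponent n f₀.1)).iff_of_eventually
    (P := (· ∈ fixedComponent (n * q) f₀.1)) (fun y hy => ?_) (hself n) hw).1 (hself _)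
  -- the component for `n q` is closed; near its points, the action is linear, and the rotations of
  -- orders `n q` and `n` have the same fixed vectors
  by_cases hyB : y ∈ fixedComponent (n * q) f₀.1
  · obtain ⟨χ, hyχ, -, hχ⟩ := exists_isAdaptedChart hnq
      (fun j => eq_zero_of_cos_eq_one (hθ _ j hle)) (hk'' _ hnq) hmem (hself _) hyB
    set g := Circle.exp (2 * Real.pi / (n * q : ℕ))
    have hgy : g • y = y := smul_eq_of_mem_fixedComponent hyB
    have hgi : ∀ i : ℕ, ∀ᶠ z in 𝓝 y, g ^ i • z ∈ χ.source ∧ χ (g ^ i • z) = toEuclideanCLM (𝕜 := ℝ)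
        (rotGL (fun j => i * residueAngle (n * q) r j) : Matrix (Fin (2 * m)) (Fin (2 * m)) ℝ) (χ z) := by
      intro i
      have hsrc : ∀ i : ℕ, ∀ᶠ z in 𝓝 y, g ^ i • z ∈ χ.source := fun i =>
        (continuous_const_smul (g ^ i)).continuousAt.eventually_mem
          (χ.open_source.mem_nhds (by
            have : ∀ i : ℕ, g ^ i • y = y := fun i => by
              induction i with
              | zero => simp
              | succ i ih => rw [pow_succ, mul_smul, hgy, ih]
            rwa [this]))
      induction i with
      | zero =>
        filter_upwards [hsrc 0] with z hz
        refine ⟨hz, ?_⟩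
        have : (fun j : Fin m => ((0 : ℕ) : ℝ) * residueAngle (n * q) r j) = 0 := by ext; simp
        rw [this, rotGL_zero]
        simp
      | succ i ih =>
        filter_upwards [ih, hsrc (i + 1)] with z hz hz'
        refine ⟨hz', ?_⟩
        have : (fun j : Fin m => ((i + 1 : ℕ) : ℝ) * residueAngle (n * q) r j) =
            residueAngle (n * q) r + fun j => i * residueAngle (n * q) r j := by
          ext j
          simp only [Pi.add_apply]
          push_cast
          ring
        rw [pow_succ', mul_smul, hχ.smul_eq _ hz.1, hz.2, this, rotGL_add]
        simp
    filter_upwards [self_mem_nhdsWithin, nhdsWithin_le_nhds (hgi q),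
      nhdsWithin_le_nhds (χ.open_source.mem_nhds hyχ)] with z hz hzq hzχ
    refine iff_of_true hyB ((hχ.mem_iff z hzχ).2 ?_)
    have hgq : g ^ q = Circle.exp (2 * Real.pi / n) := by
      rw [← Circle.exp_nsmul]
      congr 1
      have : (n : ℝ) ≠ 0 := by exact_mod_cast hn
      have : (q : ℝ) ≠ 0 := by exact_mod_cast hq
      push_cast
      rw [nsmul_eq_mul]
      field_simp
    have hang : (fun j : Fin m => (q : ℝ) * residueAngle (n * q) r j) = residueAngle n r := by
      ext j
      have : (n : ℝ) ≠ 0 := by exact_mod_cast hn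
      have : (q : ℝ) ≠ 0 := by exact_mod_cast hq
      simp only [residueAngle]
      push_cast
      field_simp
    have hfix := hzq.2
    rw [hgq, smul_eq_of_mem_fixedComponent hz, hang] at hfix
    exact (toEuclideanCLM_rotGL_eq_iff (fun j => eq_zero_of_cos_eq_one (hθ n j fun j => (hr j).2))
      (hk'' n hn)).1 hfix.symm
  · have hcl := isClosed_fixedComponent (n * q) (x := f₀.1) (hx _)
    filter_upwards [nhdsWithin_le_nhds (hcl.isOpen_compl.mem_nhds hyB)] with z hz
    exact iff_of_false hyB hz

/-- If the weights at a fixed point of the circle are small compared to `n`, the circle acts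
trivially on the component of the fixed set of the group of order `n`. -/
lemma smul_eq_of_mem_fixedComponent_of_lt [T2Space M] (hn : n ≠ 0)
    (hr : ∀ j, 0 ≤ r j ∧ 2 * r j < n)
    (hk' : ∀ i, onCoord r i = 0 ↔ (i : ℕ) < k) {f₀ : FrameBundle (2 * m) M}
    (hx : ∀ z : Circle, z • f₀.1 = f₀.1)
    (hf₀ : ∀ t : ℝ, Circle.exp t • f₀ = op (rotGL fun j => t * r j) • f₀) {y : M}
    (hy : y ∈ fixedComponent n f₀.1) (z : Circle) : z • y = y := by
  have := continuousSMul_circle m M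
  have hcl : IsClosed {t : ℝ | Circle.exp (2 * Real.pi * t) • y = y} :=
    isClosed_eq (by fun_prop) continuous_const
  have huniv : {t : ℝ | Circle.exp (2 * Real.pi * t) • y = y} = Set.univ := by
    -- all roots of unity fix `y`, and these are dense
    refine Set.eq_univ_of_univ_subset ?_
    rw [← (Rat.denseRange_cast (𝕜 := ℝ)).closure_range]
    refine closure_minimal ?_ hcl
    rintro _ ⟨s, rfl⟩
    have h1 : Circle.exp (2 * Real.pi / (n * s.den : ℕ)) • y = y :=
      smul_eq_of_mem_fixedComponent (fixedComponent_subset_mul hn hr hk' hx hf₀ s.den_nz hy)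
    have h2 : Circle.exp (2 * Real.pi * s) = Circle.exp (2 * Real.pi / (n * s.den : ℕ)) ^ (n * s.num) := by
      rw [← Circle.exp_zsmul]
      congr 1
      have h3 : (n : ℝ) ≠ 0 := by exact_mod_cast hn
      have h4 : (s.den : ℝ) ≠ 0 := by exact_mod_cast s.den_nz
      rw [zsmul_eq_mul, Rat.cast_def]
      push_cast
      field_simp
    show Circle.exp (2 * Real.pi * s) • y = y
    rw [h2]
    exact (MulAction.stabilizer Circle y).zpow_mem h1 _
  have h := huniv.ge (Set.mem_univ (Complex.arg z / (2 * Real.pi)))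
  rw [Set.mem_ofPred_eq, mul_div_cancel₀ _ (by positivity), Circle.exp_arg] at h
  exact h

/-- An infinite subgroup of the circle is dense, so that its fixed points are fixed by the circle.
-/
lemma smul_eq_of_infinite {M : Type*} [TopologicalSpace M] [T2Space M] [MulAction Circle M]
    [ContinuousSMul Circle M] {H : Subgroup Circle} (hH : Infinite H) {y : M}
    (hy : ∀ h ∈ H, h • y = y) (z : Circle) : z • y = y := by
  let S : AddSubgroup ℝ := AddSubgroup.comap Circle.expHom (Subgroup.toAddSubgroup H)
  have hS : ∀ t, t ∈ S ↔ Circle.exp t ∈ H := fun t => Iff.rfl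
  rcases S.dense_or_cyclic with hd | ⟨a, ha⟩
  · have hcl : IsClosed {t : ℝ | Circle.exp t • y = y} :=
      isClosed_eq (by fun_prop) continuous_const
    have h := hcl.closure_subset_iff.2 (fun t ht => hy _ ((hS t).1 ht)) (hd (Complex.arg z))
    rw [Set.mem_ofPred_eq, Circle.exp_arg] at h
    exact h
  · rw [← AddSubgroup.zmultiples_eq_closure] at ha
    have h1 : 2 * Real.pi ∈ AddSubgroup.zmultiples a := by
      rw [← ha, hS, Circle.exp_two_pi]
      exact H.one_mem
    obtain ⟨k, hk⟩ := AddSubgroup.mem_zmultiples_iff.1 h1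
    have hk0 : k ≠ 0 := by
      rintro rfl
      rw [zero_smul] at hk
      exact absurd hk.symm (by positivity)
    have h2 : IsOfFinOrder (Circle.exp a) := isOfFinOrder_iff_zpow_eq_one.2 ⟨k, hk0, by
      rw [← Circle.exp_zsmul, hk, Circle.exp_two_pi]⟩
    have h3 : (H : Set Circle) ⊆ Subgroup.zpowers (Circle.exp a) := fun h hh => by
      have : Complex.arg h ∈ S := (hS _).2 (by rwa [Circle.exp_arg])
      rw [ha] at this
      obtain ⟨j, hj⟩ := AddSubgroup.mem_zmultiples_iff.1 this
      exact ⟨j, by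
        show Circle.exp a ^ j = h
        rw [← Circle.exp_zsmul, hj, Circle.exp_arg]⟩
    exact absurd (((finite_zpowers.2 h2).subset h3).to_subtype) (not_finite_iff_infinite.2 hH)

/-- For infinite groups: the fixed component coincides with the one for a finite group of large odd
order. All quotients `l` vanish for this group, so that zero is a weight invariant, and all weights
in a weight frame are nonnegative. -/
theorem exists_orientation_weightFrame_zero [T2Space M] (oM : ManifoldOrientation (2 * m) M) {x : M}
    (hx : ∀ z : Circle, z • x = x) {F : Set M}
    (hF : F = connectedComponentIn {y : M | ∀ z : Circle, z • y = y} x) :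
    ∃ (k : ℕ) (_ : ChartedSpace (EuclideanSpace ℝ (Fin k)) F) (_ : IsManifold (𝓡 k) ∞ F),
      Manifold.IsSmoothEmbedding (𝓡 k) (𝓡 (2 * m)) ∞ (Subtype.val : F → M) ∧
      ∃ oF : ManifoldOrientation k F, ∃ c : ZMod 2,
        ∀ x : F, (∀ z : Circle, z • (x : M) = x) →
          Nonempty (WeightFrame 0 oM F oF x) ∧
          ∀ W : WeightFrame 0 oM F oF x, ((∑ j, W.l j : ℤ) : ZMod 2) = c := by
  obtain ⟨f₀, a, l, r, rfl, hmono, ha, hrot⟩ := exists_rotated_frame (m := m) 0 hx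
  obtain rfl : a = r := funext fun j => by simpa using (ha j).1
  have hr0 : ∀ j, 0 ≤ a j := fun j => (ha j).2.1
  obtain ⟨k, hk, hk'⟩ := exists_eq_zero_iff_lt_of_monotone hmono hr0
  set n : ℕ := 2 * ∑ j, (a j).natAbs + 1 with hn_def
  have hn : n ≠ 0 := by omega
  have hlt : ∀ j, 2 * a j < n := fun j => by
    have := Finset.single_le_sum (f := fun j => (a j).natAbs) (fun _ _ => Nat.zero_le _)
      (Finset.mem_univ j)
    omega
  have hFS : ∀ y ∈ fixedComponent n f₀.1, ∀ z : Circle, z • y = y := fun y hy z =>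
    smul_eq_of_mem_fixedComponent_of_lt hn (fun j => ⟨hr0 j, hlt j⟩) hk' hx hrot hy z
  obtain rfl : F = fixedComponent n f₀.1 := by
    rw [hF]
    have hsub : {y : M | ∀ z : Circle, z • y = y} ⊆ {y | Circle.exp (2 * Real.pi / n) • y = y} :=
      fun y hy => hy _
    refine (connectedComponentIn_mono _ hsub).antisymm ?_
    exact isPreconnected_connectedComponentIn.subset_connectedComponentIn
      (mem_connectedComponentIn (hx _)) hFS
  have hxF : f₀.1 ∈ fixedComponent n f₀.1 := mem_connectedComponentIn (hx _)
  have hl0 : ∀ f : FrameBundle (2 * m) M, f.1 ∈ fixedComponent n f₀.1 → ∀ a' l' r' : Fin m → ℤ,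
      (∀ j, a' j = n * l' j + r' j) → (∀ j, 0 ≤ r' j ∧ 2 * r' j ≤ n) →
      (∀ t : ℝ, Circle.exp t • f = op (rotGL fun j => t * a' j) • f) → ∀ j, l' j = 0 := by
    intro f hf a' l' r' ha' hr' hrot' j
    obtain ⟨ρ, hρ⟩ := exists_perm_abs_eq isPreconnected_connectedComponentIn hFS hf hxF hrot' hrot
    have h1 : 2 * |a' j| < n := by
      rw [← hρ, abs_of_nonneg (hr0 _)]
      exact hlt _
    have h2 := abs_lt.1 (show |a' j| < n by have := abs_nonneg (a' j); omega)
    have h3 := ha' j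
    have h4 := hr' j
    have h5 := neg_abs_le (a' j)
    have h6 := le_abs_self (a' j)
    have h7 : (n : ℤ) * l' j < n * 1 := by omega
    have h8 : (n : ℤ) * (-1) < n * l' j := by omega
    have hn0 : (0 : ℤ) < n := by omega
    have := lt_of_mul_lt_mul_left h7 hn0.le
    have := lt_of_mul_lt_mul_left h8 hn0.le
    omega
  have he := weightInvariant_zero (n := n) (r := a) (F := fixedComponent n f₀.1) hk hn
    (fun j => ⟨hr0 j, fun _ => (hlt j).le⟩) hk' (fun j => (hlt j).ne)
    fun f hf a' l' ha' hrot' => hl0 f hf a' l' a ha' (fun j => ⟨hr0 j, (hlt j).le⟩) hrot'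
  obtain ⟨cs, hM, hemb, oF, c, h⟩ := he.exists_orientation_weightFrame oM hn
    (fun j => ⟨hr0 j, fun _ => (hlt j).le⟩) hk'
    (mem_adaptedFrames_of_rotated hn (a := a) (l := 0) (by simp) hrot) hxF
  refine ⟨k, cs, hM, hemb, oF, 0, fun x hx => ⟨?_, fun W => ?_⟩⟩
  · obtain ⟨W⟩ := (h x hx).1
    have hl := hl0 W.frame x.2 W.a W.l W.r W.weight_eq (fun j => ⟨W.r_nonneg j, W.two_r_le hn j⟩)
      (W.smul_frame hx)
    refine nonempty_weightFrame hx W.dim_le W.tangentPair rfl (a := W.a) (l := 0) (r := W.a)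
      (fun j => ⟨by simp, ?_, by simp, by simp⟩) (W.smul_frame hx) W.orientation_iff
    rw [W.weight_eq, hl, mul_zero, zero_add]
    exact W.r_nonneg j
  · rw [Finset.sum_eq_zero fun j _ => W.l_eq_zero rfl j]
    simp

end InfiniteGroup

/-! ### Subgroups of the circle and the theorem -/

/-- A finite subgroup of the circle consists of all roots of unity of its order. -/
lemma Subgroup.eq_zpowers_of_finite (H : Subgroup Circle) [Finite H] :
    H = Subgroup.zpowers (Circle.exp (2 * Real.pi / Nat.card H)) := by
  set n := Nat.card H
  have hn : n ≠ 0 := Nat.card_pos.ne'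
  have hn' : (n : ℝ) ≠ 0 := by exact_mod_cast hn
  have hpow := exp_two_pi_div_pow hn
  have hle : H ≤ Subgroup.zpowers (Circle.exp (2 * Real.pi / n)) := fun z hz => by
    have h1 : z ^ n = 1 := congrArg Subtype.val (pow_card_eq_one' (x := (⟨z, hz⟩ : H)))
    rw [← Circle.exp_arg z, ← Circle.exp_nsmul, Circle.exp_eq_one] at h1
    obtain ⟨k, hk⟩ := h1
    refine ⟨k, ?_⟩
    show Circle.exp (2 * Real.pi / n) ^ k = z
    rw [← Circle.exp_arg z, ← Circle.exp_zsmul]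
    congr 1
    rw [nsmul_eq_mul] at hk
    rw [zsmul_eq_mul, mul_div_assoc', div_eq_iff hn', ← hk, mul_comm]
  have hfin : IsOfFinOrder (Circle.exp (2 * Real.pi / n)) :=
    isOfFinOrder_iff_pow_eq_one.2 ⟨n, Nat.pos_of_ne_zero hn, hpow⟩
  have : Finite (Subgroup.zpowers (Circle.exp (2 * Real.pi / n))) := finite_zpowers.2 hfin
  refine Subgroup.eq_of_le_of_card_ge hle ?_
  rw [Nat.card_zpowers]
  exact orderOf_le_of_pow_eq_one (Nat.pos_of_ne_zero hn) hpow

end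

theorem mainTheorem2 {m : ℕ} {M N : Type*}
    [TopologicalSpace M] [T2Space M] [SecondCountableTopology M]
    [ChartedSpace (EuclideanSpace ℝ (Fin (2 * m))) M] [IsManifold (𝓡 (2 * m)) ∞ M]
    [MulAction Circle M] [ContMDiffSMul (𝓡 1) (𝓡 (2 * m)) ∞ Circle M]
    (oM : ManifoldOrientation (2 * m) M)
    [TopologicalSpace N]
    [ChartedSpace (EuclideanSpace ℝ (Fin (2 * m))) N] [IsManifold (𝓡 (2 * m)) ∞ N]
    (p : N → M) (hp : IsUniversalCovering (2 * m) p) (hN : IsSpinManifold (2 * m) N)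
    (H : Subgroup Circle) (F : Set M)
    (hF : ∃ x ∈ MulAction.fixedPoints H M,
      F = connectedComponentIn (MulAction.fixedPoints H M) x)
    (hfix : (F ∩ MulAction.fixedPoints Circle M).Nonempty) :
    ∃ (k : ℕ) (_ : ChartedSpace (EuclideanSpace ℝ (Fin k)) F) (_ : IsManifold (𝓡 k) ∞ F),
      Manifold.IsSmoothEmbedding (𝓡 k) (𝓡 (2 * m)) ∞ (Subtype.val : F → M) ∧
      ∃ oF : ManifoldOrientation k F,
        ∃ c : ZMod 2, ∀ x : F, (x : M) ∈ MulAction.fixedPoints Circle M →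
          Nonempty (WeightFrame (Nat.card H) oM F oF x) ∧
          ∀ W : WeightFrame (Nat.card H) oM F oF x, ((∑ j, W.l j : ℤ) : ZMod 2) = c := by
  obtain ⟨x₀, -, hFx⟩ := hF
  obtain ⟨x, hxF, hx⟩ := hfix
  have hx' : ∀ z : Circle, z • x = x := hx
  have hFx' : F = connectedComponentIn (MulAction.fixedPoints H M) x := by
    rw [hFx]
    exact connectedComponentIn_eq (hFx ▸ hxF)
  have := continuousSMul_circle m M
  cases finite_or_infinite H with
  | inl hfin =>
    have hn : Nat.card H ≠ 0 := Nat.card_pos.ne'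
    -- a finite subgroup is generated by `exp (2π i / n)`
    have hset : MulAction.fixedPoints H M =
        {y : M | Circle.exp (2 * Real.pi / Nat.card H) • y = y} := by
      ext y
      constructor
      · intro hy
        exact hy ⟨_, (H.eq_zpowers_of_finite).ge (Subgroup.mem_zpowers _)⟩
      · rintro hy ⟨z, hz⟩
        have hz' : z ∈ Subgroup.zpowers (Circle.exp (2 * Real.pi / Nat.card H)) :=
          H.eq_zpowers_of_finite.le hz
        obtain ⟨k, rfl⟩ := hz'
        exact (MulAction.stabilizer Circle y).zpow_mem hy k
    obtain rfl : F = fixedComponent (Nat.card H) x := by rw [hFx', hset]; rfl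
    exact hp.exists_orientation_weightFrame hN oM hn (mem_connectedComponentIn (hx' _)) hx'
  | inr hinf =>
    -- an infinite subgroup has the same fixed points as the circle
    have hset : MulAction.fixedPoints H M = {y : M | ∀ z : Circle, z • y = y} := by
      ext y
      exact ⟨fun hy z => smul_eq_of_infinite hinf (fun h hh => hy ⟨h, hh⟩) z, fun hy h => hy h⟩
    rw [hset] at hFx'
    rw [Nat.card_eq_zero_of_infinite]
    exact exists_orientation_weightFrame_zero oM hx' hFx'
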